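/- **Setting.** Let $a,b,c,d,q$ be nonzero complex numbers, $|q|<1$, $\beta\in\mathbb C$, $t=q^\beta$. Fix square roots $q^{1/2}$, $t^{1/2}$, put $\sqrt{q/t}=q^{1/2}/t^{1/2}$, and fix $\alpha$ with $\alpha^2=abcd/q$. Write $\langle x;y\rangle=x+x^{-1}-y-y^{-1}$. For variables $x=(x_1,\dots,x_n)$ the Koornwinder operator is $$\mathcal D_x=\sum_{i=1}^n\sum_{\epsilon=\pm1}\frac{(1-ax_i^\epsilon)(1-bx_i^\epsilon)(1-cx_i^\epsilon)(1-dx_i^\epsilon)}{\alpha t^{n-1}(1-x_i^{2\epsilon})(1-qx_i^{2\epsilon})}\prod_{j\ne i}\frac{(1-tx_i^\epsilon x_j)(1-tx_i^\epsilon/x_j)}{(1-x_i^\epsilon x_j)(1-x_i^\epsilon/x_j)}\,(T_{q,x_i}^{\epsilon}-1),$$ where $T_{q,x_i}^{\pm1}$ replaces $x_i$ by $q^{\pm1}x_i$. For a partition $\mu$ of length $\le n$ put $d_\mu=\sum_{j=1}^n\langle\alpha t^{n-j}q^{\mu_j};\alpha t^{n-j}\rangle$. A Koornwinder polynomial $P_\mu(x)$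 is a Laurent polynomial invariant under permutations and inversions of the $x_i$, of the form $m_\mu+{}$(terms $m_\nu$ with $\nu<\mu$ in the dominance order $\nu_1+\dots+\nu_k\le\mu_1+\dots+\mu_k$ for all $k$), with $\mathcal D_xP_\mu=d_\mu P_\mu$. Let $n\ge m\ge1$, $y=(y_1,\dots,y_m)$. All series in $y$ are formal; rational functions of $y$ are expanded in the region $|y_1|\ll\dots\ll|y_m|\ll1$, and $T_{q,y_i}^{\pm1}y^\gamma=q^{\pm\gamma_i}y^\gamma$ for $\gamma\in\mathbb C^m$. Put $(z;q)_\infty=\prod_{k\ge0}(1-q^kz)$ and $$\Pi(x;y)=\prod_{k=1}^m y_k^{n\beta}\prod_{i=1}^n\prod_{j=1}^m\frac{(q^{1/2}t^{1/2}y_jx_i;q)_\infty}{(q^{1/2}t^{-1/2}y_jx_i;q)_\infty}\,\frac{(q^{1/2}t^{1/2}y_j/x_i;q)_\infty}{(q^{1/2}t^{-1/2}y_j/x_i;q)_\infty},$$ $$V(y)=\prod_{k=1}^m y_k^{-m+k-1}\prod_{i=1}^m(1-y_i^2)\prod_{1\le i<j\le m}(1-y_iy_j)(1-y_i/y_j).$$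 Let $\widehat{\mathcal D}_y$ be the Koornwinder operator in $y$ with parameters $(\sqrt{q/t}\,a,\sqrt{q/t}\,b,\sqrt{q/t}\,c,\sqrt{q/t}\,d\,|\,q,\widehat t\,)$, where $\widehat t=q/t$, and with $\alpha$ replaced by $\widehat\alpha=q\alpha/t$. **Theorem.** Let $\lambda=(\lambda_1,\dots,\lambda_m)$ be a partition of length $\le m$, and for $1\le i\le m$ put $$e_i=-\lambda_{m+1-i}+m+1-i-n\beta,\qquad s_i=\widehat t^{\,-m+i}q^{e_i}.$$ Let $\widehat f(y;s)=\prod_i y_i^{e_i}\sum_{\nu\in Q^+}\widehat c_\nu y^\nu$ be a formal series, $\widehat c_0=1$, where $Q^+$ is the set of exponents of the monomials in $y_1/y_2,\dots,y_{m-1}/y_m,y_m$, such that $$\widehat{\mathcal D}_y\widehat f(y;s)=\sum_{i=1}^m\langle\widehat\alpha s_i^{-1};\widehat\alpha\,\widehat t^{\,m-i}\rangle\,\widehat f(y;s).$$ 1. $\Pi(x;y)V(y)\widehat f(y;s)$ contains only integral powers of the $y_i$. Let $C(x)$ be its constant term in $y$, i.e. its coefficient of $y^0$. 2. $$\mathcal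 D_x\,C(x)=\sum_{i=1}^m\langle\alpha t^{n-i}q^{\lambda_i};\alpha t^{n-i}\rangle\,C(x).$$ 3. Regard $\lambda$ as a partition of length $\le n$ by adding zeros. If $d_\mu\ne d_\lambda$ for all partitions $\mu\neq\lambda$ of length $\le n$ with $|\mu|\le|\lambda|$, then there is exactly one Koornwinder polynomial $P_\lambda(x)$, and $C(x)=\kappa P_\lambda(x)$ for some $\kappa\in\mathbb C$. If moreover $q^kt^l\ne1$ for all integers $k\ge0$, $1\le l\le m$, then $\kappa\ne0$. -/

import Mathlib

noncomputable section

namespace Koornwinder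

open scoped BigOperators

/-! ### Parameters -/

/-- Parameters `(a, b, c, d | q, t)` of a Koornwinder operator together with a choice `α` of the
square root `(abcd/q)^{1/2}`. The relation `α ^ 2 = a b c d / q` is a hypothesis where needed. -/
structure Params where
  a : ℂ
  b : ℂ
  c : ℂ
  d : ℂ
  q : ℂˣ
  t : ℂ
  α : ℂ

/-- The twisted parameters `(r a, r b, r c, r d | q, q/t)` for a choice `r` of `√(q/t)`.
The corresponding square root of `(r a)(r b)(r c)(r d)/q` is `q α / t`. -/
def Params.hat (p : Params) (r : ℂ) : Params where
  a := r * p.a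
  b := r * p.b
  c := r * p.c
  d := r * p.d
  q := p.q
  t := (p.q : ℂ) / p.t
  α := (p.q : ℂ) * p.α / p.t

/-- `⟨x; y⟩ = x + x⁻¹ - y - y⁻¹`. -/
def bracket (x y : ℂ) : ℂ := x + x⁻¹ - y - y⁻¹

/-! ### The Koornwinder operator

It is defined over any field `F ⊇ ℂ` containing elements `X 0, …, X (n-1)` and with maps
`T k i`, which stand for the shifts `T_{q,x_i}^k`. It is used for `F` the field of rational
functions, and for `F` the field of formal (Hahn) series. -/

section Operator

variable {F : Type*} [Field F] [Algebra ℂ F] {n : ℕ}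

/-- The coefficient
`(1-au)(1-bu)(1-cu)(1-du) / (α t^{n-1} (1-u²)(1-qu²)) * ∏_{j≠i} (1-tuX_j)(1-tu/X_j) / ((1-uX_j)(1-u/X_j))`,
used with `u = X_i` and with `u = 1/X_i`. -/
def opCoeff (p : Params) (X : Fin n → F) (i : Fin n) (u : F) : F :=
  ((1 - p.a • u) * (1 - p.b • u) * (1 - p.c • u) * (1 - p.d • u)) /
      (algebraMap ℂ F (p.α * p.t ^ (n - 1)) * (1 - u ^ 2) * (1 - (p.q : ℂ) • u ^ 2)) *
    ∏ j ∈ Finset.univ.erase i,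
      ((1 - p.t • (u * X j)) * (1 - p.t • (u / X j))) / ((1 - u * X j) * (1 - u / X j))

/-- Koornwinder's `q`-difference operator. -/
def koornwinderOp (p : Params) (X : Fin n → F) (T : ℤ → Fin n → F → F) (f : F) : F :=
  ∑ i, opCoeff p X i (X i) * (T 1 i f - f) + ∑ i, opCoeff p X i (X i)⁻¹ * (T (-1) i f - f)

end Operator

/-! ### The variables `x`: rational functions and Laurent polynomials -/

/-- The field `ℂ(x_1, …, x_n)`. -/
abbrev RatX (n : ℕ) : Type := FractionRing (MvPolynomial (Fin n) ℂ)

/-- The variable `x_i`. -/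
def xVar {n : ℕ} (i : Fin n) : RatX n := algebraMap (MvPolynomial (Fin n) ℂ) (RatX n) (.X i)

/-- The substitution `x_i ↦ u x_i` on polynomials. -/
def scalePoly {n : ℕ} (i : Fin n) (u : ℂ) : MvPolynomial (Fin n) ℂ →ₐ[ℂ] MvPolynomial (Fin n) ℂ :=
  MvPolynomial.aeval fun j => if j = i then u • MvPolynomial.X j else MvPolynomial.X j

theorem scalePoly_comp {n : ℕ} (i : Fin n) {u v : ℂ} (h : u * v = 1) :
    (scalePoly i u).comp (scalePoly i v) = AlgHom.id ℂ (MvPolynomial (Fin n) ℂ) := by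
  apply MvPolynomial.algHom_ext
  intro j
  by_cases hj : j = i
  · simp [scalePoly, hj, smul_smul, mul_comm v u, h]
  · simp [scalePoly, hj]

/-- The substitution `x_i ↦ u x_i`, for `u ≠ 0`, as an automorphism of `ℂ(x)`. -/
def scaleX {n : ℕ} (i : Fin n) (u : ℂˣ) : RatX n ≃ₐ[ℂ] RatX n :=
  IsFractionRing.algEquivOfAlgEquiv
    (AlgEquiv.ofAlgHom (scalePoly i (u : ℂ)) (scalePoly i ((u⁻¹ : ℂˣ) : ℂ))
      (scalePoly_comp i (by simp)) (scalePoly_comp i (by simp)))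

/-- The operator `D_x` on `ℂ(x_1, …, x_n)`. -/
def opX {n : ℕ} (p : Params) (f : RatX n) : RatX n :=
  koornwinderOp p xVar (fun k i => scaleX i (p.q ^ k)) f

/-- The Laurent polynomial with finitely many coefficients `P μ`, `μ ∈ ℤ^n`, as an element
`∑ P_μ x^μ` of `ℂ(x)`. -/
def laurent {n : ℕ} (P : (Fin n → ℤ) →₀ ℂ) : RatX n :=
  P.sum fun μ z => z • ∏ i, xVar i ^ μ i

/-- The eigenvalue `d_λ = ∑_j ⟨α t^{n-j} q^{λ_j}; α t^{n-j}⟩`. -/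
def eigenvalue {n : ℕ} (p : Params) (lam : Fin n → ℕ) : ℂ :=
  ∑ j : Fin n, bracket (p.α * p.t ^ (n - 1 - (j : ℕ)) * (p.q : ℂ) ^ lam j)
    (p.α * p.t ^ (n - 1 - (j : ℕ)))

/-- The Laurent polynomial `P` is a Koornwinder polynomial `P_λ(x|a,b,c,d|q,t)`: it is invariant
under permutations and inversions of the variables, equals `m_λ` plus terms `m_μ` with `μ < λ` in
the dominance order, and is an eigenfunction of `D_x` with eigenvalue `d_λ`. -/
structure IsKoornwinderPolynomial {n : ℕ} (p : Params) (lam : Fin n → ℕ)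
    (P : (Fin n → ℤ) →₀ ℂ) : Prop where
  perm : ∀ (σ : Equiv.Perm (Fin n)) (μ : Fin n → ℤ), P (μ ∘ σ) = P μ
  inversion : ∀ (i : Fin n) (μ : Fin n → ℤ), P (Function.update μ i (-μ i)) = P μ
  leading : P (fun i => (lam i : ℤ)) = 1
  lower : ∀ μ : Fin n → ℕ, Antitone μ → P (fun i => (μ i : ℤ)) ≠ 0 →
    ∀ k : Fin n, ∑ i ∈ Finset.Iic k, μ i ≤ ∑ i ∈ Finset.Iic k, lam i
  eigen : opX p (laurent P) = eigenvalue p lam • laurent P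

/-! ### The variables `y`: formal series with complex exponents

`y^γ` with `γ ∈ ℂ^m`. The exponents are ordered lexicographically (a complex number by its real
part, then its imaginary part), so that every rational function of `y` is expanded in the
region `|y_1| ≪ |y_2| ≪ ⋯ ≪ |y_m| ≪ 1`, i.e. in powers of `y_1/y_2, …, y_{m-1}/y_m, y_m`. -/

/-- The ordered additive group of exponents, `ℂ^m` as a group. -/
abbrev Expo (m : ℕ) : Type := Lex (Fin m → (ℝ ×ₗ ℝ))

/-- A vector of complex numbers as an exponent. -/
def expo {m : ℕ} (γ : Fin m → ℂ) : Expo m := toLex fun i => toLex ((γ i).re, (γ i).im)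

/-- The `i`-th coordinate of an exponent as a complex number. -/
def expoCoord {m : ℕ} (γ : Expo m) (i : Fin m) : ℂ :=
  ⟨(ofLex (ofLex γ i)).1, (ofLex (ofLex γ i)).2⟩

/-- Formal series in `y` with complex exponents and coefficients in a field `K`. -/
abbrev SeriesY (m : ℕ) (K : Type*) [Field K] : Type _ := HahnSeries (Expo m) K

section Y

variable {m : ℕ} {K : Type*} [Field K]

/-- The monomial `z y^γ`. -/
def yMono (γ : Fin m → ℂ) (z : K) : SeriesY m K := HahnSeries.single (expo γ) z

/-- The variable `y_i`. -/
def yVar (i : Fin m) : SeriesY m K := yMono (Pi.single i 1) 1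

/-- `T_{q,y_i}^k`: multiplies `y^γ` by `q^{k γ_i}`. -/
def shiftY [Algebra ℂ K] (q : ℂ) (k : ℤ) (i : Fin m) (f : SeriesY m K) : SeriesY m K where
  coeff γ := (q ^ ((k : ℂ) * expoCoord γ i)) • f.coeff γ
  isPWO_support' := f.isPWO_support.mono fun γ hγ h => hγ (by simp [h])

/-- The operator `D_y` on formal series in `y`. -/
def opY (p : Params) (f : SeriesY m ℂ) : SeriesY m ℂ :=
  koornwinderOp p yVar (shiftY (p.q : ℂ)) f

/-- `y^ν` for the `i`-th simple root `ν`: `y_i / y_{i+1}` for `i < m`, and `y_m` for `i = m`. -/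
def simpleRoot (i : Fin m) : Fin m → ℤ := fun j =>
  if j = i then 1 else if (j : ℕ) = (i : ℕ) + 1 then -1 else 0

/-- The cone `Q^+` spanned by the simple roots over `ℤ_{≥ 0}`. -/
def QPlus (m : ℕ) : Set (Fin m → ℤ) := {ν | ∃ k : Fin m → ℕ, ν = ∑ i, k i • simpleRoot i}

/-- `f` is a `BC_m` eigenseries `f(y;s) = y^e ∑_{ν ∈ Q^+} c_ν y^ν` with `c_0 = 1` and
`D_y f = ∑_i ⟨α s_i⁻¹; α t^{m-i}⟩ f`. -/
structure IsEigenseries (p : Params) (e s : Fin m → ℂ) (f : SeriesY m ℂ) : Prop where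
  support : ∀ γ ∈ f.support, ∃ ν ∈ QPlus m, γ = expo fun i => e i + (ν i : ℂ)
  normalized : f.coeff (expo e) = 1
  eigen : opY p f = (∑ i : Fin m, bracket (p.α * (s i)⁻¹) (p.α * p.t ^ (m - 1 - (i : ℕ)))) • f

/-- The Weyl denominator
`V(y) = ∏_k y_k^{-m+k-1} ∏_i (1-y_i²) ∏_{i<j} (1-y_iy_j)(1-y_i/y_j)`. -/
def weylDenominator (m : ℕ) (K : Type*) [Field K] : SeriesY m K :=
  (∏ k : Fin m, yVar k ^ ((k : ℤ) - (m : ℤ))) * (∏ i : Fin m, (1 - yVar i ^ 2)) *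
    ∏ i : Fin m, ∏ j ∈ Finset.Ioi i, ((1 - yVar i * yVar j) * (1 - yVar i / yVar j))

end Y

/-! ### The kernel function -/

/-- `(z; q)_∞ = ∏_{k ≥ 0} (1 - q^k z)` as a formal power series in `z`: the coefficientwise limit of
the partial products. -/
def qPochhammer (q : ℂ) : PowerSeries ℂ :=
  PowerSeries.mk fun r => Filter.limUnder Filter.atTop fun N : ℕ =>
    PowerSeries.coeff r (∏ k ∈ Finset.range N, (1 - PowerSeries.C (q ^ k) * PowerSeries.X))

/-- `(w y_j; q)_∞` as a formal series in `y`, for `w ∈ K`. -/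
def qPochhammerY {m : ℕ} {K : Type*} [Field K] [Algebra ℂ K] (q : ℂ) (w : K) (j : Fin m) :
    SeriesY m K :=
  PowerSeries.heval (yMono (Pi.single j 1) w) ((qPochhammer q).map (algebraMap ℂ K))

/-- The kernel function
`Π(x;y) = ∏_k y_k^{nβ} ∏_{i,j} (q^{1/2}t^{1/2}y_jx_i;q)_∞ / (q^{1/2}t^{-1/2}y_jx_i;q)_∞ *`
`(q^{1/2}t^{1/2}y_j/x_i;q)_∞ / (q^{1/2}t^{-1/2}y_j/x_i;q)_∞`
as a formal series in `y` over `ℂ(x)`; `sq` and `st` are the chosen `q^{1/2}` and `t^{1/2}`. -/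
def kernelFunction (n m : ℕ) (q sq st β : ℂ) : SeriesY m (RatX n) :=
  yMono (fun _ => (n : ℂ) * β) 1 *
    ∏ i : Fin n, ∏ j : Fin m,
      (qPochhammerY q ((sq * st) • xVar i) j / qPochhammerY q ((sq * st⁻¹) • xVar i) j *
        (qPochhammerY q ((sq * st) • (xVar i)⁻¹) j / qPochhammerY q ((sq * st⁻¹) • (xVar i)⁻¹) j))

/-- A series in `y` over `ℂ` as a series in `y` over `ℂ(x)`. -/
def extendScalars {m : ℕ} (n : ℕ) (f : SeriesY m ℂ) : SeriesY m (RatX n) :=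
  f.map (algebraMap ℂ (RatX n))

/-! ### Partitions -/

/-- A sequence of length `m` extended by zeros to one of length `n`. -/
def extendZero {m : ℕ} (n : ℕ) (lam : Fin m → ℕ) : Fin n → ℕ := fun i =>
  if h : (i : ℕ) < m then lam ⟨i, h⟩ else 0

end Koornwinder

end

/-!
The eigenfunction property of the constant term `C(x)` comes from a kernel function identity and an
adjunction. Applied to the kernel `Π(x; y)`, the Koornwinder operator in `x` agrees, up to constants,
with the Koornwinder operator in `y` whose parameters are `√(qt)/a, √(qt)/b, √(qt)/c, √(qt)/d`
(`kernel_identity`). This is the residue theorem for a rational function of one variable `z` whose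
residues at `x_i^{±1}` are the terms of the first operator and whose residues at
`(√(qt) y_k^{±1})⁻¹` are the terms of the second one. Its numerator contains the quotients
`(∏ N_i - ∏ D_i) / δ`, for families with constant difference `δ = N_i - D_i`, in polynomial form
(`telescope`). A `q`-shift does not change the constant term in `y`; hence the operator in `y` may
be moved from the kernel to the other factors, where conjugation by the Weyl denominator `V(y)` turns
its adjoint into the operator with the parameters `√(q/t) a, …` and `q/t`, up to a further constant
(`shiftHom_coeffCore_mul_weylDenominator`, `sum_coeffCore_dual`). As `f̂` is an eigenfunction of the
latter, `C(x)` is one of `D_x`, and the constants add up to the stated eigenvalue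
(`sum_bracket_dual`, `koornwinderOp_constantTerm`, `opX_constantTerm`).

For the comparison with the Koornwinder polynomial, `C(x)` is first shown to be a Laurent polynomial
in `x`. The product of `V(y)`, `f̂` and the power of the `y_k` in the kernel has the leading term
`y^{-r}`, where `r` is the reversal of `λ`, and integral exponents; so only finitely many
coefficients of the rest of the kernel, which is a power series in `y` over the invariant Laurent
polynomials in `x`, enter the constant term (`hasLead_series`, `coeff_zero_eq_toRatX_constantTerm`).
Its degree is at most `|λ|`.

The operator `D_x` preserves the algebra of invariants generated by the coefficients of
`∏_j (z - x_j) (z - 1/x_j)`: its value is a sum of residues of a form with invariant coefficients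
(`opX_mem_coeffAlg`). Expanded at `x_i = 1/y_i`, it is triangular with eigenvalues `d_μ`, both for
the dominance order and for the lexicographic order (`HasLead.opY`). If `d_λ` is separated from the
other `d_μ`, then `D_x - d_λ` is injective, hence surjective, on the finite-dimensional space of
invariants below `λ`, which gives existence; uniqueness and the proportionality of `C(x)` to `P_λ`
follow from the lexicographically highest exponent of a difference
(`existsUnique_isKoornwinderPolynomial`, `eq_smul_of_eigen`).

Finally `κ ≠ 0` means `C(x) ≠ 0`. In top degree, the coefficients of `C(x)` are the values of a
linear functional on the products `∏ h_{μ_i}(y)` of the row polynomials, which are generated by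
`∏_j (√(qt) y_j z; q)_∞ / (√(q/t) y_j z; q)_∞` (`coeff_prod_laurentKernel_eq`). When `q^k t^l ≠ 1`,
the products of `m` of the `h_r` span the symmetric polynomials: the `q`-difference equation of the
generating function expresses `(1 - q^r) h_r` linearly in the `e_s h_{r-s}`, and a Cramer elimination
followed by induction shows that a functional which kills the products of the `h_r` also kills
their multiples by the elementary symmetric polynomials (`sum_perm_eq_zero`, `rowValue_eq_zero`,
`eq_zero_of_isSymmetric`). But the functional in question does not vanish on the symmetrization of
the monomial `y^r`, of which only the term `y^r` contributes (`comp_perm_eq_of_coeff_ne_zero`,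
`constantTerm_ne_zero`).
-/

noncomputable section

namespace Koornwinder

/-! ### Sums of residues of rational functions -/

section Residues

open Polynomial

variable {F : Type*} [Field F]

/-- The sum of the residues of `P / Q` for a polynomial `Q` with simple roots, in terms of the
cofactors `G i = Q / (X - v i)`. -/
theorem sum_eval_div_eval_cofactor {ι : Type*} [Fintype ι] (v : ι → F)
    (hv : Function.Injective v) (G : ι → F[X]) (Q : F[X]) (hQ : Q.Monic)
    (hG : ∀ i, (X - C (v i)) * G i = Q) (hdeg : Q.natDegree = Fintype.card ι)
    (P : F[X]) (hP : P.natDegree < Fintype.card ι) :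
    ∑ i, P.eval (v i) / (G i).eval (v i) = P.coeff (Fintype.card ι - 1) := by
  classical
  have hmon : ∀ i, (G i).Monic := fun i => (monic_X_sub_C (v i)).of_mul_monic_left (by rw [hG i]; exact hQ)
  have hGd : ∀ i, (G i).natDegree = Fintype.card ι - 1 := by
    intro i
    have h := congrArg natDegree (hG i)
    rw [(monic_X_sub_C (v i)).natDegree_mul (hmon i), natDegree_X_sub_C, hdeg] at h
    omega
  have hroot : ∀ i j, i ≠ j → (G i).eval (v j) = 0 := by
    intro i j hij
    have h1 : Q.eval (v j) = 0 := by rw [← hG j]; simp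
    rw [← hG i] at h1
    simp only [eval_mul, eval_sub, eval_X, eval_C, mul_eq_zero] at h1
    rcases h1 with h1 | h1
    · exact absurd (hv (sub_eq_zero.1 h1)).symm hij
    · exact h1
  have hcard : 0 < Fintype.card ι := by omega
  have hne : ∀ i, (G i).eval (v i) ≠ 0 := by
    intro i h0
    have : G i = 0 := by
      refine Polynomial.eq_zero_of_degree_lt_of_eval_index_eq_zero (s := Finset.univ) (v := v)
        (fun _ _ _ _ h => hv h) ?_ ?_
      · rw [Finset.card_univ, degree_eq_natDegree (hmon i).ne_zero, hGd]
        exact_mod_cast Nat.sub_lt hcard one_pos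
      · intro j _
        by_cases hij : i = j
        · rw [← hij, h0]
        · exact hroot i j hij
    exact (hmon i).ne_zero this
  -- Lagrange interpolation: both sides have degree below the number of nodes and agree at them.
  have key : P = ∑ i, C (P.eval (v i) / (G i).eval (v i)) * G i := by
    refine Polynomial.eq_of_degrees_lt_of_eval_index_eq (s := Finset.univ) (v := v)
        (fun _ _ _ _ h => hv h) ?_ ?_ ?_
    · rw [Finset.card_univ]
      exact lt_of_le_of_lt degree_le_natDegree (by exact_mod_cast hP)
    · rw [Finset.card_univ]
      refine lt_of_le_of_lt (degree_sum_le _ _) ?_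
      rw [Finset.sup_lt_iff (WithBot.bot_lt_coe _)]
      intro i _
      refine lt_of_le_of_lt degree_le_natDegree ?_
      exact_mod_cast (natDegree_C_mul_le _ _).trans_lt
        (by rw [hGd]; exact Nat.sub_lt hcard one_pos)
    · intro j _
      rw [eval_finsetSum, Finset.sum_eq_single j]
      · simp [div_mul_cancel₀ _ (hne j)]
      · intro i _ hij
        simp [hroot i j hij]
      · simp
  -- Compare the coefficients of top degree; the cofactors are monic.
  conv_rhs => rw [key]
  rw [finsetSum_coeff]
  refine Finset.sum_congr rfl fun i _ => ?_
  rw [coeff_C_mul, ← hGd i, (hmon i).coeff_natDegree, mul_one]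

/-- The residue theorem for `P(z) dz / (z ∏ (z - u_i) (z - w_i))`. -/
theorem sum_residues_pairs {I : Type*} [Fintype I] [DecidableEq I] (u w : I → F)
    (hu : ∀ i, u i ≠ 0) (hw : ∀ i, w i ≠ 0) (huu : Function.Injective u)
    (hww : Function.Injective w) (huw : ∀ i j, u i ≠ w j) (P : F[X])
    (hP : P.natDegree ≤ 2 * Fintype.card I) :
    P.eval 0 / ∏ i, (u i * w i) +
      ∑ i, (P.eval (u i) / (u i * (u i - w i) *
          ∏ j ∈ Finset.univ.erase i, ((u i - u j) * (u i - w j))) +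
        P.eval (w i) / (w i * (w i - u i) *
          ∏ j ∈ Finset.univ.erase i, ((w i - u j) * (w i - w j)))) =
      P.coeff (2 * Fintype.card I) := by
  let D : I → F[X] := fun i => (X - C (u i)) * (X - C (w i))
  let v : Option (I ⊕ I) → F := fun o => o.elim 0 (Sum.elim u w)
  let G : Option (I ⊕ I) → F[X] := fun o => o.elim (∏ i, D i)
    (Sum.elim (fun i => X * (X - C (w i)) * ∏ j ∈ Finset.univ.erase i, D j)
      (fun i => X * (X - C (u i)) * ∏ j ∈ Finset.univ.erase i, D j))
  have hD : ∀ i, (D i).Monic := fun i => (monic_X_sub_C _).mul (monic_X_sub_C _)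
  have hDp : (∏ i, D i).Monic := monic_prod_of_monic _ _ fun i _ => hD i
  have hDd : (∏ i, D i).natDegree = 2 * Fintype.card I := by
    rw [natDegree_prod_of_monic _ _ fun i _ => hD i]
    simp only [D, (monic_X_sub_C _).natDegree_mul (monic_X_sub_C _), natDegree_X_sub_C]
    simp [mul_comm]
  have hc : Fintype.card (Option (I ⊕ I)) = 2 * Fintype.card I + 1 := by
    simp [two_mul]
  have h := sum_eval_div_eval_cofactor v ?_ G (X * ∏ i, D i) (monic_X.mul hDp) ?_ ?_ P ?_
  · rw [hc, Nat.add_sub_cancel, Fintype.sum_option, Fintype.sum_sum_type,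
      ← Finset.sum_add_distrib] at h
    rw [← h]
    congr 1
    · simp only [v, G, D, Option.elim, eval_prod, eval_mul, eval_sub, eval_X, eval_C]
      congr 1
      exact Finset.prod_congr rfl fun i _ => by ring
    · refine Finset.sum_congr rfl fun i _ => ?_
      simp only [v, G, D, Option.elim, Sum.elim_inl, Sum.elim_inr, eval_prod, eval_mul, eval_sub,
        eval_X, eval_C]
  · rintro (_ | i | i) (_ | j | j) hij
    · rfl
    · exact absurd hij.symm (hu j)
    · exact absurd hij.symm (hw j)
    · exact absurd hij (hu i)
    · rw [huu hij]
    · exact absurd hij (huw i j)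
    · exact absurd hij (hw i)
    · exact absurd hij.symm (huw j i)
    · rw [hww hij]
  · rintro (_ | i | i)
    · simp [v, G]
    · simp only [v, G, Option.elim, Sum.elim_inl]
      rw [← Finset.mul_prod_erase _ _ (Finset.mem_univ i)]
      simp only [D]; ring
    · simp only [v, G, Option.elim, Sum.elim_inr]
      rw [← Finset.mul_prod_erase _ _ (Finset.mem_univ i)]
      simp only [D]; ring
  · rw [hc, monic_X.natDegree_mul hDp, hDd, natDegree_X, add_comm]
  · omega

/-- The telescoping quotient `(∏ N_i - ∏ D_i) / δ` for families with `N_i - D_i = δ`. -/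
def telescope {R : Type*} [CommRing R] : (n : ℕ) → (Fin n → R) → (Fin n → R) → R
  | 0, _, _ => 0
  | n + 1, N, D => ∏ i : Fin n, D i.succ + N 0 * telescope n (fun i => N i.succ) fun i => D i.succ

theorem telescope_succ {R : Type*} [CommRing R] (n : ℕ) (N D : Fin (n + 1) → R) :
    telescope (n + 1) N D =
      ∏ i : Fin n, D i.succ + N 0 * telescope n (fun i => N i.succ) fun i => D i.succ :=
  rfl

/-- The defining property of the telescoping quotient, valid without dividing by `δ`. -/
theorem mul_telescope {R : Type*} [CommRing R] (δ : R) :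
    ∀ (n : ℕ) (N D : Fin n → R), (∀ i, N i - D i = δ) →
      δ * telescope n N D = ∏ i, N i - ∏ i, D i
  | 0, _, _, _ => by simp [telescope]
  | n + 1, N, D, h => by
    have ih := mul_telescope δ n (fun i => N i.succ) (fun i => D i.succ) fun i => h i.succ
    rw [telescope, Fin.prod_univ_succ, Fin.prod_univ_succ]
    linear_combination N 0 * ih - (∏ i : Fin n, D i.succ) * h 0

/-- Modulo `D_k`, the telescoping quotient is the product of the other `N_l`. -/
theorem telescope_of_eq_zero {R : Type*} [CommRing R] (δ : R) :
    ∀ (n : ℕ) (N D : Fin n → R), (∀ i, N i - D i = δ) → ∀ k, D k = 0 →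
      telescope n N D = ∏ l ∈ Finset.univ.erase k, N l
  | 0, _, _, _, k, _ => k.elim0
  | n + 1, N, D, h, k, hk => by
    have ih := telescope_of_eq_zero δ n (fun i => N i.succ) (fun i => D i.succ) fun i => h i.succ
    have hm := mul_telescope δ n (fun i => N i.succ) (fun i => D i.succ) fun i => h i.succ
    have h0 := h 0
    rw [telescope]
    have hprod : ∀ k : Fin (n + 1), ∏ l ∈ Finset.univ.erase k, N l =
        ∏ l, if l = k then 1 else N l := by
      intro k
      rw [← Finset.mul_prod_erase _ _ (Finset.mem_univ k)]
      simp only [if_true, one_mul]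
      exact Finset.prod_congr rfl fun l hl => by rw [if_neg (Finset.ne_of_mem_erase hl)]
    rw [hprod, Fin.prod_univ_succ]
    refine Fin.cases ?_ (fun k hk => ?_) k hk
    · intro hk
      simp only [if_true, one_mul, Fin.succ_ne_zero, if_false]
      linear_combination hm + telescope n (fun i => N i.succ) (fun i => D i.succ) * h0 +
        telescope n (fun i => N i.succ) (fun i => D i.succ) * hk
    · rw [ih k hk, Finset.prod_eq_zero (Finset.mem_univ k) hk, if_neg (Fin.succ_ne_zero k).symm,
        zero_add]
      congr 1
      rw [← Finset.mul_prod_erase _ _ (Finset.mem_univ k), if_pos rfl, one_mul]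
      exact Finset.prod_congr rfl fun l hl => by
        rw [if_neg fun h => Finset.ne_of_mem_erase hl (Fin.succ_injective _ h)]

theorem map_telescope {R S : Type*} [CommRing R] [CommRing S] (φ : R →+* S) :
    ∀ (n : ℕ) (N D : Fin n → R), φ (telescope n N D) =
      telescope n (fun i => φ (N i)) fun i => φ (D i)
  | 0, _, _ => by simp [telescope]
  | n + 1, N, D => by simp [telescope, map_telescope φ n]

theorem telescope_const {R : Type*} [CommRing R] (ν d : R) :
    ∀ n : ℕ, telescope n (fun _ => ν) (fun _ => d) =
      ∑ j ∈ Finset.range n, ν ^ j * d ^ (n - 1 - j)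
  | 0 => by simp [telescope]
  | n + 1 => by
    rw [telescope, telescope_const ν d n, Finset.sum_range_succ', Finset.mul_sum, add_comm]
    congr 1
    · refine Finset.sum_congr rfl fun j hj => ?_
      rw [pow_succ', mul_assoc]
      congr 3
      omega
    · simp

theorem telescope_smul {R : Type*} [CommRing R] (r : R) :
    ∀ (n : ℕ) (N D : Fin n → R), telescope n (fun i => r * N i) (fun i => r * D i) =
      r ^ (n - 1) * telescope n N D
  | 0, _, _ => by simp [telescope]
  | 1, _, _ => by simp [telescope]
  | n + 2, N, D => by
    rw [telescope_succ, telescope_smul r (n + 1), telescope_succ _ N, Finset.prod_mul_distrib]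
    simp only [Finset.prod_const, Finset.card_univ, Fintype.card_fin, Nat.add_sub_cancel,
      Nat.reduceSubDiff]
    ring

/-- Degree and leading coefficient of the telescoping quotient of quadratic polynomials. -/
theorem natDegree_telescope_le {R : Type*} [CommRing R] (ν d : R) :
    ∀ (n : ℕ) (N D : Fin (n + 1) → R[X]), (∀ i, (N i).natDegree ≤ 2) →
      (∀ i, (D i).natDegree ≤ 2) → (∀ i, (N i).coeff 2 = ν) → (∀ i, (D i).coeff 2 = d) →
      (telescope (n + 1) N D).natDegree ≤ n * 2 ∧
      (telescope (n + 1) N D).coeff (n * 2) = telescope (n + 1) (fun _ => ν) fun _ => d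
  | 0, N, D, _, _, _, _ => by simp [telescope]
  | n + 1, N, D, hN, hD, hNc, hDc => by
    obtain ⟨h1, h2⟩ := natDegree_telescope_le ν d n (fun i => N i.succ) (fun i => D i.succ)
      (fun i => hN _) (fun i => hD _) (fun i => hNc _) fun i => hDc _
    have hp : (∏ i : Fin (n + 1), D i.succ).natDegree ≤ (n + 1) * 2 := by
      refine (natDegree_prod_le _ _).trans ((Finset.sum_le_card_nsmul _ _ 2 fun i _ => hD _).trans ?_)
      simp
    have hc : (∏ i : Fin (n + 1), D i.succ).coeff ((n + 1) * 2) = d ^ (n + 1) := by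
      have := coeff_prod_of_natDegree_le (s := Finset.univ) (fun i : Fin (n + 1) => D i.succ) 2
        fun i _ => hD _
      rw [Finset.card_univ, Fintype.card_fin] at this
      rw [this]; simp [hDc]
    constructor
    · rw [telescope_succ]
      refine natDegree_add_le_of_degree_le hp ?_
      refine natDegree_mul_le.trans ?_
      have := hN 0; omega
    · rw [telescope_succ, coeff_add, hc, telescope_succ (n + 1) (fun _ => ν), show (n + 1) * 2 = 2 + n * 2 by ring,
        coeff_mul_add_eq_of_natDegree_le (hN 0) h1, h2, hNc]
      simp

end Residues

/-! ### The kernel identity for rational functions -/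

section KernelIdentity

open Polynomial

variable {F : Type*} [Field F]

/-- The coefficient of a Koornwinder operator without the factor `1 / (α t^{n-1})`. -/
def coeffCore {n : ℕ} (a b c d q t : F) (X : Fin n → F) (i : Fin n) (u : F) : F :=
  ((1 - a * u) * (1 - b * u) * (1 - c * u) * (1 - d * u)) / ((1 - u ^ 2) * (1 - q * u ^ 2)) *
    ∏ j ∈ Finset.univ.erase i,
      ((1 - t * (u * X j)) * (1 - t * (u / X j))) / ((1 - u * X j) * (1 - u / X j))

/-- The polynomial `(1-az)(1-bz)(1-cz)(1-dz)`. -/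
def quartic (a b c d : F) : F[X] :=
  (1 - C a * X) * (1 - C b * X) * ((1 - C c * X) * (1 - C d * X))

theorem quartic_eval (a b c d z : F) :
    (quartic a b c d).eval z = (1 - a * z) * (1 - b * z) * (1 - c * z) * (1 - d * z) := by
  simp [quartic, mul_assoc]

theorem quartic_natDegree (a b c d : F) : (quartic a b c d).natDegree ≤ 4 := by
  rw [quartic]; compute_degree

theorem quartic_coeff (a b c d : F) : (quartic a b c d).coeff 4 = a * b * c * d := by
  have h1 : ∀ a : F, (1 - C a * X).natDegree ≤ 1 := fun a => by compute_degree
  have hc : ∀ a : F, (1 - C a * X).coeff 1 = -a := fun a => by simp [coeff_one]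
  have h2 : ∀ a b : F, ((1 - C a * X) * (1 - C b * X)).natDegree ≤ 2 := fun a b => by
    compute_degree
  have hc2 : ∀ a b : F, ((1 - C a * X) * (1 - C b * X)).coeff (1 + 1) = a * b := fun a b => by
    rw [coeff_mul_add_eq_of_natDegree_le (h1 a) (h1 b), hc, hc, neg_mul_neg]
  rw [quartic, show 4 = 2 + 2 from rfl, coeff_mul_add_eq_of_natDegree_le (h2 a b) (h2 c d)]
  rw [show 2 = 1 + 1 from rfl, hc2, hc2]; ring

/-- A quadratic polynomial `(α - β z) (γ - δ z)`. -/
def quadratic (α β γ δ : F) : F[X] := (C α - C β * X) * (C γ - C δ * X)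

theorem quadratic_eval (α β γ δ z : F) :
    (quadratic α β γ δ).eval z = (α - β * z) * (γ - δ * z) := by
  simp [quadratic]

theorem quadratic_natDegree (α β γ δ : F) : (quadratic α β γ δ).natDegree ≤ 2 := by
  rw [quadratic]; compute_degree

theorem quadratic_coeff (α β γ δ : F) : (quadratic α β γ δ).coeff 2 = β * δ := by
  have h1 : ∀ a b : F, (C a - C b * X).natDegree ≤ 1 := fun a b => by compute_degree
  have hc : ∀ a b : F, (C a - C b * X).coeff 1 = -b := fun a b => by simp [coeff_C]
  rw [quadratic, show 2 = 1 + 1 from rfl, coeff_mul_add_eq_of_natDegree_le (h1 α β) (h1 γ δ),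
    hc, hc, neg_mul_neg]

theorem eval_telescope {n : ℕ} (N D : Fin n → F[X]) (z : F) :
    (telescope n N D).eval z = telescope n (fun i => (N i).eval z) fun i => (D i).eval z :=
  map_telescope (evalRingHom z) n N D

theorem prod_erase_inl {I J : Type*} [Fintype I] [Fintype J] [DecidableEq I] [DecidableEq J]
    (i : I) (f : I ⊕ J → F) :
    ∏ j ∈ Finset.univ.erase (Sum.inl i), f j =
      (∏ j ∈ Finset.univ.erase i, f (Sum.inl j)) * ∏ k, f (Sum.inr k) := by
  rw [show Finset.univ.erase (Sum.inl i : I ⊕ J) = (Finset.univ.erase i).disjSum Finset.univ by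
    ext (j | j) <;> simp, Finset.prod_disjSum]

theorem prod_erase_inr {I J : Type*} [Fintype I] [Fintype J] [DecidableEq I] [DecidableEq J]
    (k : J) (f : I ⊕ J → F) :
    ∏ j ∈ Finset.univ.erase (Sum.inr k), f j =
      (∏ i, f (Sum.inl i)) * ∏ l ∈ Finset.univ.erase k, f (Sum.inr l) := by
  rw [show Finset.univ.erase (Sum.inr k : I ⊕ J) = Finset.univ.disjSum (Finset.univ.erase k) by
    ext (j | j) <;> simp, Finset.prod_disjSum]

/-- The factor `T_{q,x}Π / Π` as a function of `z = x`. -/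
def ratioX {m : ℕ} (s τ : F) (y : Fin m → F) (z : F) : F :=
  ∏ k, ((1 - s / τ * (z * y k)) * (1 - τ / s * (y k / z))) /
    ((1 - s * τ * (z * y k)) * (1 - y k / (s * τ * z)))

/-- The factor `T_{q,y}Π / Π` as a function of `u = y`. -/
def ratioY {n : ℕ} (s τ : F) (x : Fin n → F) (u : F) : F :=
  ∏ i, (τ ^ 2 * ((1 - s / τ * (u * x i)) * (1 - s / τ * (u / x i)))) /
    ((1 - s * τ * (u * x i)) * (1 - s * τ * (u / x i)))

variable {n m : ℕ} (a b c d s τ : F) (x : Fin n → F) (y : Fin m → F)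

/-- Residue of the interpolating function at a node `z = x_i^{±1}`. -/
theorem residue_x (hs : s ≠ 0) (hτ : τ ≠ 0) (ht : τ ^ 2 ≠ 1) (hx : ∀ i, x i ≠ 0)
    (hy : ∀ k, y k ≠ 0)
    (i : Fin n) (u : F) (hu : u = x i ∨ u = (x i)⁻¹)
    (h2 : u ^ 2 ≠ 1) (hq : s ^ 2 * u ^ 2 ≠ 1)
    (hE : ∀ k, (u - y k / (s * τ)) * (u - 1 / (s * τ * y k)) ≠ 0)
    (hD : ∀ j ∈ Finset.univ.erase i, (u - x j) * (u - (x j)⁻¹) ≠ 0) :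
    (1 - a * u) * (1 - b * u) * (1 - c * u) * (1 - d * u) *
      telescope n (fun j => (1 - τ ^ 2 * x j * u) * (1 - τ ^ 2 * (x j)⁻¹ * u))
        (fun j => τ ^ 2 * ((u - x j) * (u - (x j)⁻¹))) *
      telescope m (fun k => (τ ^ 2)⁻¹ * ((u - τ / s * y k) * (u - τ / (s * y k))))
        (fun k => (u - y k / (s * τ)) * (u - 1 / (s * τ * y k))) /
      (u * (u - u⁻¹) * ((∏ j ∈ Finset.univ.erase i, ((u - x j) * (u - (x j)⁻¹))) *
        ∏ k, ((u - y k / (s * τ)) * (u - 1 / (s * τ * y k))))) =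
    s ^ 2 * τ ^ 2 / (1 - τ ^ 2) * (coeffCore a b c d (s ^ 2) (τ ^ 2) x i u *
      (ratioX s τ y u - 1)) := by
  have hxi := hx i
  have hu0 : u ≠ 0 := by rcases hu with rfl | rfl <;> simp [hxi]
  have hDi : (u - x i) * (u - (x i)⁻¹) = 0 := by rcases hu with rfl | rfl <;> simp
  -- At the node the telescoping quotient over the `x_j` reduces to the product over `j ≠ i`, and the
  -- one over the `y_k` is `(∏ M_k - ∏ E_k) / δ`, which produces the factor `T_{q,x} Π / Π - 1`.
  rw [telescope_of_eq_zero ((1 - τ ^ 2) * (1 - τ ^ 2 * u ^ 2)) n _ _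
    (fun j => by have := hx j; field_simp; ring) i (by rw [hDi, mul_zero])]
  have hU := mul_telescope (-((1 - τ ^ 2) / (s ^ 2 * τ ^ 2)) * (1 - s ^ 2 * u ^ 2)) m
    (fun k => (τ ^ 2)⁻¹ * ((u - τ / s * y k) * (u - τ / (s * y k))))
    (fun k => (u - y k / (s * τ)) * (u - 1 / (s * τ * y k)))
    (fun k => by have := hy k; field_simp; ring)
  have hr : ratioX s τ y u = (∏ k, (τ ^ 2)⁻¹ * ((u - τ / s * y k) * (u - τ / (s * y k)))) /
      ∏ k, ((u - y k / (s * τ)) * (u - 1 / (s * τ * y k))) := by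
    rw [ratioX, ← Finset.prod_div_distrib]
    refine Finset.prod_congr rfl fun k _ => ?_
    have h3 := hE k
    have hk := hy k
    have h4 : (1 - s * τ * (u * y k)) * (1 - y k / (s * τ * u)) =
        -(s * τ * y k / u) * ((u - y k / (s * τ)) * (u - 1 / (s * τ * y k))) := by
      field_simp; ring
    have h5 : (1 - s / τ * (u * y k)) * (1 - τ / s * (y k / u)) =
        -(s * τ * y k / u) * ((τ ^ 2)⁻¹ * ((u - τ / s * y k) * (u - τ / (s * y k)))) := by
      field_simp; ring
    rw [h4, h5, mul_div_mul_left]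
    exact neg_ne_zero.2 (div_ne_zero (mul_ne_zero (mul_ne_zero hs hτ) hk) hu0)
  rw [hr, coeffCore, Finset.prod_div_distrib]
  have hN : ∏ j ∈ Finset.univ.erase i, ((1 - τ ^ 2 * x j * u) * (1 - τ ^ 2 * (x j)⁻¹ * u)) =
      ∏ j ∈ Finset.univ.erase i, ((1 - τ ^ 2 * (u * x j)) * (1 - τ ^ 2 * (u / x j))) :=
    Finset.prod_congr rfl fun j _ => by have := hx j; field_simp
  have hD' : ∏ j ∈ Finset.univ.erase i, ((u - x j) * (u - (x j)⁻¹)) =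
      ∏ j ∈ Finset.univ.erase i, ((1 - u * x j) * (1 - u / x j)) :=
    Finset.prod_congr rfl fun j _ => by have := hx j; field_simp; ring
  have hD0 := Finset.prod_ne_zero_iff.2 hD
  have hE0 := Finset.prod_ne_zero_iff.2 fun k (_ : k ∈ Finset.univ) => hE k
  rw [hD'] at hD0 ⊢
  rw [hN]
  generalize (∏ j ∈ Finset.univ.erase i, ((1 - u * x j) * (1 - u / x j))) = PD at *
  generalize (∏ j ∈ Finset.univ.erase i, ((1 - τ ^ 2 * (u * x j)) * (1 - τ ^ 2 * (u / x j)))) = PN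
  generalize (∏ k, ((u - y k / (s * τ)) * (u - 1 / (s * τ * y k)))) = PE at *
  generalize (∏ k, (τ ^ 2)⁻¹ * ((u - τ / s * y k) * (u - τ / (s * y k)))) = PM at *
  generalize telescope (R := F) m _ _ = U at *
  have h1 : 1 - τ ^ 2 ≠ 0 := sub_ne_zero.2 (Ne.symm ht)
  have h2' : 1 - u ^ 2 ≠ 0 := sub_ne_zero.2 (Ne.symm h2)
  have hq' : 1 - s ^ 2 * u ^ 2 ≠ 0 := sub_ne_zero.2 (Ne.symm hq)
  have hUe : U = -(s ^ 2 * τ ^ 2 * (PM - PE)) / ((1 - τ ^ 2) * (1 - s ^ 2 * u ^ 2)) := by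
    rw [eq_div_iff (mul_ne_zero h1 hq'), ← hU]
    field_simp
  have h6 : u * (u - u⁻¹) = -(1 - u ^ 2) := by field_simp; ring
  rw [h6, hUe]
  field_simp

/-- Residue of the interpolating function at a node `z = (√(qt) u)⁻¹`, `u = y_k^{±1}`. -/
theorem residue_y (ha : a ≠ 0) (hb : b ≠ 0) (hc : c ≠ 0) (hd : d ≠ 0) (hm : 0 < m)
    (hs : s ≠ 0) (hτ : τ ≠ 0) (ht : τ ^ 2 ≠ 1) (hx : ∀ i, x i ≠ 0)
    (hy : ∀ k, y k ≠ 0)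
    (k : Fin m) (u : F) (hu : u = y k ∨ u = (y k)⁻¹)
    (h2 : u ^ 2 ≠ 1) (hq : s ^ 2 * u ^ 2 ≠ 1)
    (hE : ∀ l ∈ Finset.univ.erase k, (u - y l) * (u - (y l)⁻¹) ≠ 0)
    (hD : ∀ i, (1 / (s * τ * u) - x i) * (1 / (s * τ * u) - (x i)⁻¹) ≠ 0) (z : F)
    (hz : z = 1 / (s * τ * u)) :
    (1 - a * z) * (1 - b * z) * (1 - c * z) * (1 - d * z) *
      telescope n (fun j => (1 - τ ^ 2 * x j * z) * (1 - τ ^ 2 * (x j)⁻¹ * z))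
        (fun j => τ ^ 2 * ((z - x j) * (z - (x j)⁻¹))) *
      telescope m (fun k => (τ ^ 2)⁻¹ * ((z - τ / s * y k) * (z - τ / (s * y k))))
        (fun k => (z - y k / (s * τ)) * (z - 1 / (s * τ * y k))) /
      (z * (z - u / (s * τ)) * ((∏ j, ((z - x j) * (z - (x j)⁻¹))) *
        ∏ l ∈ Finset.univ.erase k, ((z - y l / (s * τ)) * (z - 1 / (s * τ * y l))))) =
    -(a * b * c * d * (τ ^ 2) ^ n / ((τ ^ 2) ^ m * (1 - τ ^ 2))) *
      (coeffCore (s * τ / a) (s * τ / b) (s * τ / c) (s * τ / d) (s ^ 2) (τ ^ 2) y k u *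
      (ratioY s τ x u - 1)) := by
  have hyk := hy k
  have hu0 : u ≠ 0 := by rcases hu with rfl | rfl <;> simp [hyk]
  have hz0 : z ≠ 0 := by rw [hz]; exact div_ne_zero one_ne_zero (mul_ne_zero (mul_ne_zero hs hτ) hu0)
  have hEk : (z - y k / (s * τ)) * (z - 1 / (s * τ * y k)) = 0 := by
    rw [hz]; rcases hu with rfl | rfl
    · simp
    · have : 1 / (s * τ * (y k)⁻¹) - y k / (s * τ) = 0 := by field_simp; ring
      rw [this, zero_mul]
  -- The roles of the two telescoping quotients are exchanged with respect to the nodes `x_i^{±1}`.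
  rw [telescope_of_eq_zero (-((1 - τ ^ 2) / (s ^ 2 * τ ^ 2)) * (1 - s ^ 2 * z ^ 2)) m
    (fun k => (τ ^ 2)⁻¹ * ((z - τ / s * y k) * (z - τ / (s * y k))))
    (fun k => (z - y k / (s * τ)) * (z - 1 / (s * τ * y k)))
    (fun k => by have := hy k; field_simp; ring) k hEk]
  have hW := mul_telescope ((1 - τ ^ 2) * (1 - τ ^ 2 * z ^ 2)) n
    (fun j => (1 - τ ^ 2 * x j * z) * (1 - τ ^ 2 * (x j)⁻¹ * z))
    (fun j => τ ^ 2 * ((z - x j) * (z - (x j)⁻¹)))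
    (fun j => by have := hx j; field_simp; ring)
  rw [← hz] at hD
  have hr : ratioY s τ x u = (∏ j, ((1 - τ ^ 2 * x j * z) * (1 - τ ^ 2 * (x j)⁻¹ * z))) /
      ∏ j, (τ ^ 2 * ((z - x j) * (z - (x j)⁻¹))) := by
    rw [ratioY, ← Finset.prod_div_distrib]
    refine Finset.prod_congr rfl fun i _ => ?_
    have h3 := hD i
    have hi := hx i
    have h4 : (1 - s * τ * (u * x i)) * (1 - s * τ * (u / x i)) =
        (s ^ 2 * u ^ 2) * (τ ^ 2 * ((z - x i) * (z - (x i)⁻¹))) := by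
      rw [hz]; field_simp
    have h5 : τ ^ 2 * ((1 - s / τ * (u * x i)) * (1 - s / τ * (u / x i))) =
        (s ^ 2 * u ^ 2) * ((1 - τ ^ 2 * x i * z) * (1 - τ ^ 2 * (x i)⁻¹ * z)) := by
      rw [hz]; field_simp; ring
    rw [h4, h5, mul_div_mul_left]
    exact mul_ne_zero (pow_ne_zero _ hs) (pow_ne_zero _ hu0)
  have hM : (∏ l ∈ Finset.univ.erase k, (τ ^ 2)⁻¹ * ((z - τ / s * y l) * (z - τ / (s * y l)))) =
      ((s ^ 2 * τ ^ 2 * u ^ 2)⁻¹ * (τ ^ 2)⁻¹) ^ (m - 1) * ∏ l ∈ Finset.univ.erase k,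
        ((1 - τ ^ 2 * (u * y l)) * (1 - τ ^ 2 * (u / y l))) := by
    have : m - 1 = (Finset.univ.erase k).card := by simp
    rw [this, ← Finset.prod_const, ← Finset.prod_mul_distrib]
    refine Finset.prod_congr rfl fun l _ => ?_
    have := hy l
    rw [hz]; field_simp
  have hE' : (∏ l ∈ Finset.univ.erase k, ((z - y l / (s * τ)) * (z - 1 / (s * τ * y l)))) =
      ((s ^ 2 * τ ^ 2 * u ^ 2)⁻¹) ^ (m - 1) * ∏ l ∈ Finset.univ.erase k,
        ((1 - u * y l) * (1 - u / y l)) := by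
    have : m - 1 = (Finset.univ.erase k).card := by simp
    rw [this, ← Finset.prod_const, ← Finset.prod_mul_distrib]
    refine Finset.prod_congr rfl fun l _ => ?_
    have := hy l
    rw [hz]; field_simp
  have hE0 : ∏ l ∈ Finset.univ.erase k, ((1 - u * y l) * (1 - u / y l)) ≠ 0 := by
    refine Finset.prod_ne_zero_iff.2 fun l hl => ?_
    have := hy l
    convert hE l hl using 1
    field_simp; ring
  have hD0 := Finset.prod_ne_zero_iff.2 fun k (_ : k ∈ Finset.univ) => hD k
  rw [Finset.prod_mul_distrib (f := fun _ => τ ^ 2), Finset.prod_const, Finset.card_univ,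
    Fintype.card_fin] at hW hr
  rw [hM, hE', hr, coeffCore, Finset.prod_div_distrib]
  generalize (∏ l ∈ Finset.univ.erase k, ((1 - u * y l) * (1 - u / y l))) = PE at *
  generalize (∏ l ∈ Finset.univ.erase k, ((1 - τ ^ 2 * (u * y l)) * (1 - τ ^ 2 * (u / y l)))) = PM
    at *
  generalize (∏ j, ((z - x j) * (z - (x j)⁻¹))) = PD at *
  generalize (∏ j, ((1 - τ ^ 2 * x j * z) * (1 - τ ^ 2 * (x j)⁻¹ * z))) = PN at *
  generalize telescope (R := F) n _ _ = W at *
  have h1 : 1 - τ ^ 2 ≠ 0 := sub_ne_zero.2 (Ne.symm ht)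
  have h2' : 1 - u ^ 2 ≠ 0 := sub_ne_zero.2 (Ne.symm h2)
  have hq' : 1 - s ^ 2 * u ^ 2 ≠ 0 := sub_ne_zero.2 (Ne.symm hq)
  have hz2 : 1 - τ ^ 2 * z ^ 2 = -(1 - s ^ 2 * u ^ 2) / (s ^ 2 * u ^ 2) := by
    rw [hz]; field_simp; ring
  have hWe : W = (PN - (τ ^ 2) ^ n * PD) * (s ^ 2 * u ^ 2) /
      (-((1 - τ ^ 2) * (1 - s ^ 2 * u ^ 2))) := by
    rw [eq_div_iff (neg_ne_zero.2 (mul_ne_zero h1 hq')), ← hW, hz2]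
    field_simp
  have h6 : z * (z - u / (s * τ)) = (1 - u ^ 2) / (s ^ 2 * τ ^ 2 * u ^ 2) := by
    rw [hz]; field_simp
  have h7 : (1 - a * z) * (1 - b * z) * (1 - c * z) * (1 - d * z) =
      a * b * c * d / (s * τ * u) ^ 4 *
      ((1 - s * τ / a * u) * (1 - s * τ / b * u) * (1 - s * τ / c * u) * (1 - s * τ / d * u)) := by
    rw [hz]; field_simp; ring
  obtain ⟨m, rfl⟩ : ∃ m', m = m' + 1 := ⟨m - 1, by omega⟩
  rw [h6, hWe, h7, mul_pow _ _ (m + 1 - 1)]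
  generalize ((1 - s * τ / a * u) * (1 - s * τ / b * u) * (1 - s * τ / c * u) *
    (1 - s * τ / d * u)) = w
  rw [Nat.add_sub_cancel]
  have h8 : ((s ^ 2 * τ ^ 2 * u ^ 2)⁻¹) ^ m ≠ 0 :=
    pow_ne_zero _ (inv_ne_zero (by simp [hs, hτ, hu0]))
  generalize ((s ^ 2 * τ ^ 2 * u ^ 2)⁻¹) ^ m = r at *
  rw [inv_pow]
  field_simp
  ring

/-- Genericity of the variables, for `s = √q` and `τ = √t`: the nodes `x_i^{±1}` and
`(√(qt) y_k^{±1})⁻¹` of the interpolation are distinct, and the denominators of the coefficients of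
the operators do not vanish. -/
structure Generic (s τ : F) (x : Fin n → F) (y : Fin m → F) : Prop where
  x_ne : ∀ i, x i ≠ 0
  y_ne : ∀ k, y k ≠ 0
  x_inj : Function.Injective x
  y_inj : Function.Injective y
  x_mul : ∀ i j, x i * x j ≠ 1
  y_mul : ∀ i j, y i * y j ≠ 1
  x_sq : ∀ i, s ^ 2 * x i ^ 2 ≠ 1
  x_inv_sq : ∀ i, s ^ 2 * (x i)⁻¹ ^ 2 ≠ 1
  y_sq : ∀ i, s ^ 2 * y i ^ 2 ≠ 1
  y_inv_sq : ∀ i, s ^ 2 * (y i)⁻¹ ^ 2 ≠ 1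
  xy₁ : ∀ i k, s * τ * x i ≠ y k
  xy₂ : ∀ i k, s * τ * (x i * y k) ≠ 1
  xy₃ : ∀ i k, s * τ ≠ x i * y k
  xy₄ : ∀ i k, s * τ * y k ≠ x i

/-- Multiplied by `1 - t`, the kernel identity as it comes out of the residue theorem. The form in
question is `P(z) dz / (z ∏ (z - x_i) (z - 1/x_i) ∏ (z - y_k/√(qt)) (z - 1/(√(qt) y_k)))`, where `P`
is the product of `(1-az)(1-bz)(1-cz)(1-dz)` and of the two telescoping quotients. Its residues at
the `x_i^{±1}` are the terms of the operator in `x`, those at the `(√(qt) y_k^{±1})⁻¹` are the terms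
of the operator in `y` with parameters `√(qt)/a, …, √(qt)/d`, and the residues at `0` and `∞` are
the constants. -/
theorem kernel_identity_of_ne_one {a b c d s τ : F} {x : Fin n → F} {y : Fin m → F}
    (ha : a ≠ 0) (hb : b ≠ 0) (hc : c ≠ 0)
    (hd : d ≠ 0) (hn : 0 < n) (hm : 0 < m) (hs : s ≠ 0) (hτ : τ ≠ 0) (ht : τ ^ 2 ≠ 1)
    (hg : Generic s τ x y) :
    τ ^ 2 * ∑ i, (coeffCore a b c d (s ^ 2) (τ ^ 2) x i (x i) * (ratioX s τ y (x i) - 1) +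
        coeffCore a b c d (s ^ 2) (τ ^ 2) x i (x i)⁻¹ * (ratioX s τ y (x i)⁻¹ - 1)) -
      a * b * c * d / s ^ 2 * ((τ ^ 2) ^ n / (τ ^ 2) ^ m) *
        ∑ k, (coeffCore (s * τ / a) (s * τ / b) (s * τ / c) (s * τ / d) (s ^ 2) (τ ^ 2) y k (y k) *
            (ratioY s τ x (y k) - 1) +
          coeffCore (s * τ / a) (s * τ / b) (s * τ / c) (s * τ / d) (s ^ 2) (τ ^ 2) y k (y k)⁻¹ *
            (ratioY s τ x (y k)⁻¹ - 1)) +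
      (1 - τ ^ 2) * τ ^ 2 * ((∑ j ∈ Finset.range n, (τ ^ 2) ^ j) *
        ∑ j ∈ Finset.range m, (τ ^ 2) ^ j) =
    (1 - τ ^ 2) * (a * b * c * d / s ^ 2) * (τ ^ 2) ^ (n - 1) *
      ((∑ j ∈ Finset.range n, (τ ^ 2) ^ j) * ∑ j ∈ Finset.range m, ((τ ^ 2)⁻¹) ^ j) := by
  classical
  have hκ : s * τ ≠ 0 := mul_ne_zero hs hτ
  have h1 : 1 - τ ^ 2 ≠ 0 := sub_ne_zero.2 (Ne.symm ht)
  have hxx : ∀ i j, x i ≠ (x j)⁻¹ := fun i j h => hg.x_mul i j (by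
    rw [h, inv_mul_cancel₀ (hg.x_ne j)])
  have hyy : ∀ i j, y i ≠ (y j)⁻¹ := fun i j h => hg.y_mul i j (by
    rw [h, inv_mul_cancel₀ (hg.y_ne j)])
  have e1 : ∀ i k, x i ≠ y k / (s * τ) := fun i k h => hg.xy₁ i k (by rw [h]; field_simp)
  have e2 : ∀ i k, x i ≠ 1 / (s * τ * y k) := fun i k h => hg.xy₂ i k (by
    have := hg.y_ne k; rw [h]; field_simp)
  have e3 : ∀ i k, (x i)⁻¹ ≠ y k / (s * τ) := fun i k h => hg.xy₃ i k (by
    have := hg.x_ne i; field_simp at h; linear_combination h)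
  have e4 : ∀ i k, (x i)⁻¹ ≠ 1 / (s * τ * y k) := fun i k h => hg.xy₄ i k (by
    have := hg.x_ne i; have := hg.y_ne k; field_simp at h; linear_combination h)
  -- The differences `N_j - D_j = (1-t)(1-tz²)` and `M_k - E_k = -(1-t)(1-qz²)/(qt)` do not depend on
  -- `j` and `k`, so that the factors `1-tz²` and `1-qz²` are cancelled by the telescoping quotients.
  let N : Fin n → F[X] := fun j => quadratic 1 (τ ^ 2 * x j) 1 (τ ^ 2 * (x j)⁻¹)
  let D : Fin n → F[X] := fun j => C (τ ^ 2) * quadratic (-x j) (-1) (-(x j)⁻¹) (-1)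
  let M : Fin m → F[X] := fun k =>
    C ((τ ^ 2)⁻¹) * quadratic (-(τ / s * y k)) (-1) (-(τ / (s * y k))) (-1)
  let E : Fin m → F[X] := fun k => quadratic (-(y k / (s * τ))) (-1) (-(1 / (s * τ * y k))) (-1)
  let P : F[X] := quartic a b c d * (telescope n N D * telescope m M E)
  have hPe : ∀ z, P.eval z = (1 - a * z) * (1 - b * z) * (1 - c * z) * (1 - d * z) *
      telescope n (fun j => (1 - τ ^ 2 * x j * z) * (1 - τ ^ 2 * (x j)⁻¹ * z))
        (fun j => τ ^ 2 * ((z - x j) * (z - (x j)⁻¹))) *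
      telescope m (fun k => (τ ^ 2)⁻¹ * ((z - τ / s * y k) * (z - τ / (s * y k))))
        (fun k => (z - y k / (s * τ)) * (z - 1 / (s * τ * y k))) := by
    intro z
    simp only [P, eval_mul, quartic_eval, eval_telescope, N, D, M, E, quadratic_eval, eval_C,
      mul_assoc]
    congr 6 <;> funext j <;> ring
  obtain ⟨n', rfl⟩ : ∃ n', n = n' + 1 := ⟨n - 1, by omega⟩
  obtain ⟨m', rfl⟩ : ∃ m', m = m' + 1 := ⟨m - 1, by omega⟩
  have hW := natDegree_telescope_le (τ ^ 2 * τ ^ 2) (τ ^ 2) n' N D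
    (fun i => quadratic_natDegree _ _ _ _)
    (fun i => (natDegree_C_mul_le _ _).trans (quadratic_natDegree _ _ _ _))
    (fun i => by have := hg.x_ne i; rw [quadratic_coeff]; field_simp)
    (fun i => by rw [coeff_C_mul, quadratic_coeff]; ring)
  have hU := natDegree_telescope_le (τ ^ 2)⁻¹ 1 m' M E
    (fun i => (natDegree_C_mul_le _ _).trans (quadratic_natDegree _ _ _ _))
    (fun i => quadratic_natDegree _ _ _ _)
    (fun i => by rw [coeff_C_mul, quadratic_coeff]; ring)
    (fun i => by rw [quadratic_coeff]; ring)
  have hWU : (telescope (n' + 1) N D * telescope (m' + 1) M E).natDegree ≤ n' * 2 + m' * 2 :=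
    natDegree_mul_le.trans (add_le_add hW.1 hU.1)
  -- The numerator has the degree at which the residue at infinity is its leading coefficient.
  have hcard : 2 * Fintype.card (Fin (n' + 1) ⊕ Fin (m' + 1)) = 4 + (n' * 2 + m' * 2) := by
    simp; ring
  have hres := sum_residues_pairs (I := Fin (n' + 1) ⊕ Fin (m' + 1))
    (Sum.elim x fun k => y k / (s * τ)) (Sum.elim (fun i => (x i)⁻¹) fun k => 1 / (s * τ * y k))
    (by rintro (i | k) <;> simp [hg.x_ne, hg.y_ne, hs, hτ])
    (by rintro (i | k) <;> simp [hg.x_ne, hg.y_ne, hs, hτ])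
    (by
      rintro (i | k) (j | l) h
      · rw [hg.x_inj h]
      · exact absurd h (e1 i l)
      · exact absurd h.symm (e1 j k)
      · rw [hg.y_inj ((div_left_inj' hκ).1 h)])
    (by
      rintro (i | k) (j | l) h
      · rw [hg.x_inj (inv_injective h)]
      · exact absurd h (e4 i l)
      · exact absurd h.symm (e4 j k)
      · have hk := hg.y_ne k
        have hl := hg.y_ne l
        rw [hg.y_inj (a₁ := k) (a₂ := l)]
        simp only [Sum.elim_inr] at h
        field_simp at h
        exact h.symm)
    (by
      rintro (i | k) (j | l) h
      · exact hxx i j h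
      · exact e2 i l h
      · exact e3 j k h.symm
      · refine hyy k l ?_
        have hk := hg.y_ne k
        have hl := hg.y_ne l
        simp only [Sum.elim_inr] at h
        field_simp at h ⊢
        exact h)
    P (by
      rw [hcard]
      exact natDegree_mul_le.trans (add_le_add (quartic_natDegree _ _ _ _) hWU))
  rw [hcard, coeff_mul_add_eq_of_natDegree_le (quartic_natDegree _ _ _ _) hWU, quartic_coeff,
    coeff_mul_add_eq_of_natDegree_le hW.1 hU.1, hW.2, hU.2, telescope_const, telescope_const] at hres
  simp only [Fintype.sum_sum_type, Sum.elim_inl, Sum.elim_inr, prod_erase_inl, prod_erase_inr,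
    Fintype.prod_sum_type, hPe] at hres
  have hx1 : ∀ i, _ := fun i => residue_x a b c d s τ x y hs hτ ht hg.x_ne hg.y_ne i (x i)
    (Or.inl rfl) (by rw [sq]; exact hg.x_mul i i) (hg.x_sq i)
    (fun k => mul_ne_zero (sub_ne_zero.2 (e1 i k)) (sub_ne_zero.2 (e2 i k)))
    (fun j hj => mul_ne_zero
      (sub_ne_zero.2 fun h => (Finset.ne_of_mem_erase hj).symm (hg.x_inj h))
      (sub_ne_zero.2 (hxx i j)))
  have hx2 : ∀ i, _ := fun i => residue_x a b c d s τ x y hs hτ ht hg.x_ne hg.y_ne i (x i)⁻¹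
    (Or.inr rfl) (by rw [inv_pow, sq]; exact inv_ne_one.2 (hg.x_mul i i)) (hg.x_inv_sq i)
    (fun k => mul_ne_zero (sub_ne_zero.2 (e3 i k)) (sub_ne_zero.2 (e4 i k)))
    (fun j hj => mul_ne_zero
      (sub_ne_zero.2 (hxx j i).symm)
      (sub_ne_zero.2 fun h => (Finset.ne_of_mem_erase hj).symm (hg.x_inj (inv_injective h))))
  have hy1 : ∀ k, _ := fun k => residue_y a b c d s τ x y ha hb hc hd hm hs hτ ht hg.x_ne hg.y_ne
    k (y k) (Or.inl rfl) (by rw [sq]; exact hg.y_mul k k) (hg.y_sq k)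
    (fun j hj => mul_ne_zero
      (sub_ne_zero.2 fun h => (Finset.ne_of_mem_erase hj).symm (hg.y_inj h))
      (sub_ne_zero.2 (hyy k j)))
    (fun i => mul_ne_zero (sub_ne_zero.2 (e2 i k).symm) (sub_ne_zero.2 (e4 i k).symm))
    (1 / (s * τ * y k)) rfl
  have hy2 : ∀ k, _ := fun k => residue_y a b c d s τ x y ha hb hc hd hm hs hτ ht hg.x_ne hg.y_ne
    k (y k)⁻¹ (Or.inr rfl) (by rw [inv_pow, sq]; exact inv_ne_one.2 (hg.y_mul k k)) (hg.y_inv_sq k)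
    (fun j hj => mul_ne_zero
      (sub_ne_zero.2 (hyy j k).symm)
      (sub_ne_zero.2 fun h => (Finset.ne_of_mem_erase hj).symm (hg.y_inj (inv_injective h))))
    (fun i => by
      have h0 : 1 / (s * τ * (y k)⁻¹) = y k / (s * τ) := by have := hg.y_ne k; field_simp
      rw [h0]
      exact mul_ne_zero (sub_ne_zero.2 (e1 i k).symm) (sub_ne_zero.2 (e3 i k).symm))
    (y k / (s * τ)) (by have := hg.y_ne k; field_simp)
  have h5 : ∀ k, (y k)⁻¹ / (s * τ) = 1 / (s * τ * y k) := fun k => by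
    have := hg.y_ne k; field_simp
  simp only [inv_inv] at hx2
  simp only [h5] at hy2
  simp only [hx1, hx2, hy1, hy2] at hres
  -- The values at `0` of the telescoping quotients and of the denominator.
  have h0W : telescope (n' + 1) (fun j => (1 - τ ^ 2 * x j * 0) * (1 - τ ^ 2 * (x j)⁻¹ * 0))
        (fun j => τ ^ 2 * ((0 - x j) * (0 - (x j)⁻¹))) =
      ∑ j ∈ Finset.range (n' + 1), (τ ^ 2) ^ j := by
    have : (fun j => τ ^ 2 * ((0 - x j) * (0 - (x j)⁻¹))) = fun _ => τ ^ 2 := by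
      funext j; have := hg.x_ne j; field_simp; ring
    rw [this]
    simp only [mul_zero, sub_zero, mul_one]
    rw [telescope_const, ← Finset.sum_range_reflect]
    refine Finset.sum_congr rfl fun j hj => ?_
    rw [one_pow, one_mul]
    congr 1
    have := Finset.mem_range.1 hj; omega
  have h0U : telescope (m' + 1) (fun k => (τ ^ 2)⁻¹ * ((0 - τ / s * y k) * (0 - τ / (s * y k))))
        (fun k => (0 - y k / (s * τ)) * (0 - 1 / (s * τ * y k))) =
      ((s ^ 2 * τ ^ 2)⁻¹) ^ m' * ∑ j ∈ Finset.range (m' + 1), (τ ^ 2) ^ j := by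
    have e5 : (fun k => (τ ^ 2)⁻¹ * ((0 - τ / s * y k) * (0 - τ / (s * y k)))) =
        fun _ => (s ^ 2 * τ ^ 2)⁻¹ * τ ^ 2 := by
      funext j; have := hg.y_ne j; field_simp; ring
    have e6 : (fun k => (0 - y k / (s * τ)) * (0 - 1 / (s * τ * y k))) =
        fun _ => (s ^ 2 * τ ^ 2)⁻¹ * 1 := by
      funext j; have := hg.y_ne j; field_simp; ring
    rw [e5, e6, telescope_smul, telescope_const, Nat.add_sub_cancel]
    simp
  have h0D : (∏ i, x i * (x i)⁻¹) * ∏ k, y k / (s * τ) * (1 / (s * τ * y k)) =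
      ((s ^ 2 * τ ^ 2)⁻¹) ^ (m' + 1) := by
    have e5 : ∀ i, x i * (x i)⁻¹ = 1 := fun i => mul_inv_cancel₀ (hg.x_ne i)
    have e6 : ∀ k, y k / (s * τ) * (1 / (s * τ * y k)) = (s ^ 2 * τ ^ 2)⁻¹ := fun k => by
      have := hg.y_ne k; field_simp
    simp only [e5, e6, Finset.prod_const, Finset.card_univ, Fintype.card_fin, one_pow, one_mul]
  -- The leading coefficient of the telescoping quotient over the `x_j`.
  have hlead : ∑ j ∈ Finset.range (n' + 1), (τ ^ 2 * τ ^ 2) ^ j * (τ ^ 2) ^ (n' + 1 - 1 - j) =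
      (τ ^ 2) ^ n' * ∑ j ∈ Finset.range (n' + 1), (τ ^ 2) ^ j := by
    rw [Finset.mul_sum]
    refine Finset.sum_congr rfl fun j hj => ?_
    have : n' = (n' - j) + j := by have := Finset.mem_range.1 hj; omega
    rw [Nat.add_sub_cancel]
    conv_rhs => rw [this]
    rw [mul_pow, pow_add]; ring
  rw [h0W, h0U, h0D, hlead] at hres
  simp only [one_pow, mul_one, mul_zero, sub_zero, one_mul] at hres
  simp only [← mul_add, ← Finset.mul_sum] at hres
  -- The node `1/(√(qt) y_k)` gives the term of `y_k` and `y_k/√(qt)` that of `1/y_k`.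
  have hcomm : ∀ k,
      coeffCore (s * τ / a) (s * τ / b) (s * τ / c) (s * τ / d) (s ^ 2) (τ ^ 2) y k (y k) *
            (ratioY s τ x (y k) - 1) +
          coeffCore (s * τ / a) (s * τ / b) (s * τ / c) (s * τ / d) (s ^ 2) (τ ^ 2) y k (y k)⁻¹ *
            (ratioY s τ x (y k)⁻¹ - 1) =
      coeffCore (s * τ / a) (s * τ / b) (s * τ / c) (s * τ / d) (s ^ 2) (τ ^ 2) y k (y k)⁻¹ *
            (ratioY s τ x (y k)⁻¹ - 1) +
          coeffCore (s * τ / a) (s * τ / b) (s * τ / c) (s * τ / d) (s ^ 2) (τ ^ 2) y k (y k) *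
            (ratioY s τ x (y k) - 1) := fun k => add_comm _ _
  simp only [hcomm]
  rw [Nat.add_sub_cancel]
  have hr : ((s ^ 2 * τ ^ 2)⁻¹) ^ m' ≠ 0 := pow_ne_zero _ (inv_ne_zero (by simp [hs, hτ]))
  rw [pow_succ ((s ^ 2 * τ ^ 2)⁻¹)] at hres
  generalize ((s ^ 2 * τ ^ 2)⁻¹) ^ m' = r at *
  generalize (∑ j ∈ Finset.range (n' + 1), (τ ^ 2) ^ j) = S1 at *
  generalize (∑ j ∈ Finset.range (m' + 1), (τ ^ 2) ^ j) = S2 at *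
  generalize (∑ j ∈ Finset.range (m' + 1), ((τ ^ 2)⁻¹) ^ j) = S3 at *
  generalize Finset.sum Finset.univ (_ : Fin (n' + 1) → F) = A1 at *
  generalize Finset.sum Finset.univ (_ : Fin (m' + 1) → F) = A2 at *
  -- The residues carry the factor `qt/(1-t)`; it is removed before comparing.
  have hmul := congrArg (fun z => z * ((1 - τ ^ 2) / s ^ 2)) hres
  have hm0 : (τ ^ 2) ^ (m' + 1) ≠ 0 := pow_ne_zero _ (pow_ne_zero _ hτ)
  generalize (τ ^ 2) ^ (m' + 1) = r2 at *
  generalize (τ ^ 2) ^ (n' + 1) = r3 at *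
  generalize (τ ^ 2) ^ n' = r4 at *
  field_simp at hmul ⊢
  linear_combination hmul

theorem ratioX_of_sq_eq_one {s τ : F} {y : Fin m → F} (hs : s ≠ 0) (hτ : τ ≠ 0)
    (ht : τ ^ 2 = 1) {z : F} (hz : z ≠ 0) (h1 : ∀ k, s * τ * (z * y k) ≠ 1)
    (h2 : ∀ k, s * τ * z ≠ y k) : ratioX s τ y z = 1 := by
  have e1 : s / τ = s * τ := by field_simp; rw [ht]
  have e2 : τ / s = (s * τ)⁻¹ := by field_simp; rw [ht]
  rw [ratioX, e1, e2]
  refine Finset.prod_eq_one fun k _ => ?_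
  have e3 : (s * τ)⁻¹ * (y k / z) = y k / (s * τ * z) := by field_simp
  rw [e3]
  refine div_self (mul_ne_zero (sub_ne_zero.2 (h1 k).symm) (sub_ne_zero.2 fun h => h2 k ?_))
  rw [eq_comm, div_eq_one_iff_eq (mul_ne_zero (mul_ne_zero hs hτ) hz)] at h
  exact h.symm

theorem ratioY_of_sq_eq_one {s τ : F} {x : Fin n → F} (hτ : τ ≠ 0)
    (ht : τ ^ 2 = 1) {u : F} (h1 : ∀ i, s * τ * (u * x i) ≠ 1)
    (h2 : ∀ i, s * τ * (u / x i) ≠ 1) : ratioY s τ x u = 1 := by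
  have e1 : s / τ = s * τ := by rw [div_eq_iff hτ, mul_assoc, ← sq, ht, mul_one]
  rw [ratioY, e1, ht]
  refine Finset.prod_eq_one fun k _ => ?_
  rw [one_mul]
  exact div_self (mul_ne_zero (sub_ne_zero.2 (h1 k).symm) (sub_ne_zero.2 (h2 k).symm))

/-- The kernel function identity, as an identity of rational functions. For `t = 1`, where the
telescoping quotients are not available, all shifts of the kernel are trivial and both sides
vanish. -/
theorem kernel_identity {a b c d s τ : F} {x : Fin n → F} {y : Fin m → F}
    (ha : a ≠ 0) (hb : b ≠ 0) (hc : c ≠ 0)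
    (hd : d ≠ 0) (hn : 0 < n) (hm : 0 < m) (hs : s ≠ 0) (hτ : τ ≠ 0)
    (hg : Generic s τ x y) :
    τ ^ 2 * ∑ i, (coeffCore a b c d (s ^ 2) (τ ^ 2) x i (x i) * (ratioX s τ y (x i) - 1) +
        coeffCore a b c d (s ^ 2) (τ ^ 2) x i (x i)⁻¹ * (ratioX s τ y (x i)⁻¹ - 1)) -
      a * b * c * d / s ^ 2 * ((τ ^ 2) ^ n / (τ ^ 2) ^ m) *
        ∑ k, (coeffCore (s * τ / a) (s * τ / b) (s * τ / c) (s * τ / d) (s ^ 2) (τ ^ 2) y k (y k) *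
            (ratioY s τ x (y k) - 1) +
          coeffCore (s * τ / a) (s * τ / b) (s * τ / c) (s * τ / d) (s ^ 2) (τ ^ 2) y k (y k)⁻¹ *
            (ratioY s τ x (y k)⁻¹ - 1)) +
      (1 - τ ^ 2) * τ ^ 2 * ((∑ j ∈ Finset.range n, (τ ^ 2) ^ j) *
        ∑ j ∈ Finset.range m, (τ ^ 2) ^ j) =
    (1 - τ ^ 2) * (a * b * c * d / s ^ 2) * (τ ^ 2) ^ (n - 1) *
      ((∑ j ∈ Finset.range n, (τ ^ 2) ^ j) * ∑ j ∈ Finset.range m, ((τ ^ 2)⁻¹) ^ j) := by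
  by_cases ht : τ ^ 2 = 1
  · have hκ : s * τ ≠ 0 := mul_ne_zero hs hτ
    have r1 : ∀ i, ratioX s τ y (x i) = 1 := fun i =>
      ratioX_of_sq_eq_one hs hτ ht (hg.x_ne i) (hg.xy₂ i) (hg.xy₁ i)
    have r2 : ∀ i, ratioX s τ y (x i)⁻¹ = 1 := fun i => by
      have := hg.x_ne i
      refine ratioX_of_sq_eq_one hs hτ ht (inv_ne_zero (hg.x_ne i)) (fun k h => hg.xy₄ i k ?_)
        (fun k h => hg.xy₃ i k ?_)
      · field_simp at h; exact h
      · field_simp at h; linear_combination h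
    have r3 : ∀ k, ratioY s τ x (y k) = 1 := fun k =>
      ratioY_of_sq_eq_one hτ ht (fun i h => hg.xy₂ i k (by linear_combination h))
        (fun i h => hg.xy₄ i k (by have := hg.x_ne i; field_simp at h; exact h))
    have r4 : ∀ k, ratioY s τ x (y k)⁻¹ = 1 := fun k => by
      have := hg.y_ne k
      refine ratioY_of_sq_eq_one hτ ht (fun i h => hg.xy₁ i k ?_) (fun i h => hg.xy₃ i k ?_)
      · field_simp at h; exact h
      · have := hg.x_ne i; field_simp at h; linear_combination h
    simp [r1, r2, r3, r4, ht]
  · exact kernel_identity_of_ne_one ha hb hc hd hn hm hs hτ ht hg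

end KernelIdentity

/-! ### The sum of the coefficients of a Koornwinder operator -/

section CoefficientSum

open Polynomial

variable {F : Type*} [Field F] {m : ℕ}

/-- The contribution of the pole at `z` with `z^2 = 1/q` to the sum of the coefficients. -/
def halfPeriodResidue (a b c d t : F) (y : Fin m → F) (z : F) : F :=
  (1 - a * z) * (1 - b * z) * (1 - c * z) * (1 - d * z) *
    telescope m (fun j => (1 - t * y j * z) * (1 - t * (y j)⁻¹ * z))
      (fun j => t * ((z - y j) * (z - (y j)⁻¹))) /
    ∏ j, ((z - y j) * (z - (y j)⁻¹))

/-- The sum of the coefficients of a Koornwinder operator, by the residue theorem with the nodes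
`y_k^{±1}` and `±1/√q`; here `s = √q`. -/
theorem sum_coeffCore {a b c d s t : F} {y : Fin m → F} (h2 : (2 : F) ≠ 0) (hm : 0 < m)
    (hs : s ≠ 0)
    (y_ne : ∀ k, y k ≠ 0) (y_inj : Function.Injective y) (y_mul : ∀ i j, y i * y j ≠ 1)
    (y_sq : ∀ i, s ^ 2 * y i ^ 2 ≠ 1) (y_inv_sq : ∀ i, s ^ 2 * (y i)⁻¹ ^ 2 ≠ 1) :
    ∑ k, (coeffCore a b c d (s ^ 2) t y k (y k) + coeffCore a b c d (s ^ 2) t y k (y k)⁻¹) =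
      (1 + a * b * c * d / s ^ 2 * t ^ (m - 1)) * (∑ j ∈ Finset.range m, t ^ j) -
        (halfPeriodResidue a b c d t y (1 / s) + halfPeriodResidue a b c d t y (-(1 / s))) / 2 := by
  classical
  have hyy : ∀ i j, y i ≠ (y j)⁻¹ := fun i j h => y_mul i j (by
    rw [h, inv_mul_cancel₀ (y_ne j)])
  let N : Fin m → F[X] := fun j => quadratic 1 (t * y j) 1 (t * (y j)⁻¹)
  let D : Fin m → F[X] := fun j => C t * quadratic (-y j) (-1) (-(y j)⁻¹) (-1)
  let P : F[X] := quartic a b c d * telescope m N D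
  have hPe : ∀ z, P.eval z = (1 - a * z) * (1 - b * z) * (1 - c * z) * (1 - d * z) *
      telescope m (fun j => (1 - t * y j * z) * (1 - t * (y j)⁻¹ * z))
        (fun j => t * ((z - y j) * (z - (y j)⁻¹))) := by
    intro z
    simp only [P, eval_mul, quartic_eval, eval_telescope, N, D, quadratic_eval, eval_C]
    congr 2; funext j; ring
  obtain ⟨m, rfl⟩ : ∃ m', m = m' + 1 := ⟨m - 1, by omega⟩
  have hW := natDegree_telescope_le (t * t) t m N D
    (fun i => quadratic_natDegree _ _ _ _)
    (fun i => (natDegree_C_mul_le _ _).trans (quadratic_natDegree _ _ _ _))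
    (fun i => by have := y_ne i; rw [quadratic_coeff]; field_simp)
    (fun i => by rw [coeff_C_mul, quadratic_coeff]; ring)
  have hcard : 2 * Fintype.card (Unit ⊕ Fin (m + 1)) = 4 + m * 2 := by
    simp; ring
  have hs1 : ∀ i, y i ≠ 1 / s := fun i h => y_sq i (by rw [h]; field_simp)
  have hs2 : ∀ i, y i ≠ -(1 / s) := fun i h => y_sq i (by rw [h]; field_simp)
  have hs3 : ∀ i, (y i)⁻¹ ≠ 1 / s := fun i h => y_inv_sq i (by rw [h]; field_simp)
  have hs4 : ∀ i, (y i)⁻¹ ≠ -(1 / s) := fun i h => y_inv_sq i (by rw [h]; field_simp)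
  have hs5 : 1 / s ≠ -(1 / s) := fun h => h2 (by field_simp at h; linear_combination h)
  have hres := sum_residues_pairs (I := Unit ⊕ Fin (m + 1))
    (Sum.elim (fun _ => 1 / s) y) (Sum.elim (fun _ => -(1 / s)) fun k => (y k)⁻¹)
    (by rintro (i | k) <;> simp [hs, y_ne])
    (by rintro (i | k) <;> simp [hs, y_ne])
    (by
      rintro (i | k) (j | l) h
      · rfl
      · exact absurd h.symm (hs1 l)
      · exact absurd h (hs1 k)
      · rw [y_inj h])
    (by
      rintro (i | k) (j | l) h
      · rfl
      · exact absurd h.symm (hs4 l)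
      · exact absurd h (hs4 k)
      · rw [y_inj (inv_injective h)])
    (by
      rintro (i | k) (j | l) h
      · exact hs5 h
      · exact hs3 l h.symm
      · exact hs2 k h
      · exact hyy k l h)
    P (by
      rw [hcard]
      exact natDegree_mul_le.trans (add_le_add (quartic_natDegree _ _ _ _) hW.1))
  rw [hcard, coeff_mul_add_eq_of_natDegree_le (quartic_natDegree _ _ _ _) hW.1, quartic_coeff,
    hW.2, telescope_const] at hres
  simp only [Fintype.sum_sum_type, Sum.elim_inl, Sum.elim_inr, prod_erase_inl, prod_erase_inr,
    Fintype.prod_sum_type, hPe, Finset.univ_unique, Finset.sum_singleton, Finset.prod_singleton,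
    Finset.erase_singleton, Finset.prod_empty, one_mul] at hres
  -- The residue at the node `u = y_k^{±1}` is the coefficient there, up to the factor `q`.
  have hnode : ∀ k u, (u = y k ∨ u = (y k)⁻¹) → u ^ 2 ≠ 1 → s ^ 2 * u ^ 2 ≠ 1 →
      (∏ j ∈ Finset.univ.erase k, ((u - y j) * (u - (y j)⁻¹)) ≠ 0) →
      (1 - a * u) * (1 - b * u) * (1 - c * u) * (1 - d * u) *
        telescope (m + 1) (fun j => (1 - t * y j * u) * (1 - t * (y j)⁻¹ * u))
        (fun j => t * ((u - y j) * (u - (y j)⁻¹))) /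
      (u * (u - u⁻¹) * ((u - 1 / s) * (u - -(1 / s)) *
        ∏ j ∈ Finset.univ.erase k, ((u - y j) * (u - (y j)⁻¹)))) =
      s ^ 2 * coeffCore a b c d (s ^ 2) t y k u := by
    intro k u hu hu2 hq hE
    have hyk := y_ne k
    have hu0 : u ≠ 0 := by rcases hu with rfl | rfl <;> simp [hyk]
    have hDk : (u - y k) * (u - (y k)⁻¹) = 0 := by rcases hu with rfl | rfl <;> simp
    rw [telescope_of_eq_zero ((1 - t) * (1 - t * u ^ 2)) (m + 1) _ _
      (fun j => by have := y_ne j; field_simp; ring) k (by rw [hDk, mul_zero]), coeffCore,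
      Finset.prod_div_distrib]
    have hN : ∏ j ∈ Finset.univ.erase k, ((1 - t * y j * u) * (1 - t * (y j)⁻¹ * u)) =
        ∏ j ∈ Finset.univ.erase k, ((1 - t * (u * y j)) * (1 - t * (u / y j))) :=
      Finset.prod_congr rfl fun j _ => by have := y_ne j; field_simp
    have hD' : ∏ j ∈ Finset.univ.erase k, ((u - y j) * (u - (y j)⁻¹)) =
        ∏ j ∈ Finset.univ.erase k, ((1 - u * y j) * (1 - u / y j)) :=
      Finset.prod_congr rfl fun j _ => by have := y_ne j; field_simp; ring
    rw [hD'] at hE ⊢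
    rw [hN]
    have h3 : 1 - u ^ 2 ≠ 0 := sub_ne_zero.2 (Ne.symm hu2)
    have h4 : 1 - s ^ 2 * u ^ 2 ≠ 0 := sub_ne_zero.2 (Ne.symm hq)
    have h5 : u * (u - u⁻¹) = -(1 - u ^ 2) := by field_simp; ring
    have h6 : (u - 1 / s) * (u - -(1 / s)) = -(1 - s ^ 2 * u ^ 2) / s ^ 2 := by
      field_simp; ring
    rw [h5, h6]
    generalize (∏ j ∈ Finset.univ.erase k, ((1 - u * y j) * (1 - u / y j))) = PD at *
    generalize (∏ j ∈ Finset.univ.erase k, ((1 - t * (u * y j)) * (1 - t * (u / y j)))) = PN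
    field_simp
  have hy1 : ∀ k, _ := fun k => hnode k (y k) (Or.inl rfl) (by rw [sq]; exact y_mul k k) (y_sq k)
    (Finset.prod_ne_zero_iff.2 fun j hj => mul_ne_zero
      (sub_ne_zero.2 fun h => (Finset.ne_of_mem_erase hj).symm (y_inj h))
      (sub_ne_zero.2 (hyy k j)))
  have hy2 : ∀ k, _ := fun k => hnode k (y k)⁻¹ (Or.inr rfl)
    (by rw [inv_pow, sq]; exact inv_ne_one.2 (y_mul k k)) (y_inv_sq k)
    (Finset.prod_ne_zero_iff.2 fun j hj => mul_ne_zero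
      (sub_ne_zero.2 (hyy j k).symm)
      (sub_ne_zero.2 fun h => (Finset.ne_of_mem_erase hj).symm (y_inj (inv_injective h))))
  simp only [inv_inv] at hy2
  simp only [hy1, hy2] at hres
  -- The residue at `0`.
  have h0W : telescope (m + 1) (fun j => (1 - t * y j * 0) * (1 - t * (y j)⁻¹ * 0))
        (fun j => t * ((0 - y j) * (0 - (y j)⁻¹))) =
      ∑ j ∈ Finset.range (m + 1), t ^ j := by
    have : (fun j => t * ((0 - y j) * (0 - (y j)⁻¹))) = fun _ => t := by
      funext j; have := y_ne j; field_simp; ring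
    rw [this]
    simp only [mul_zero, sub_zero, mul_one]
    rw [telescope_const, ← Finset.sum_range_reflect]
    refine Finset.sum_congr rfl fun j hj => ?_
    rw [one_pow, one_mul]
    congr 1
    have := Finset.mem_range.1 hj; omega
  have h0D : ∏ i, y i * (y i)⁻¹ = 1 :=
    Finset.prod_eq_one fun i _ => mul_inv_cancel₀ (y_ne i)
  have hlead : ∑ j ∈ Finset.range (m + 1), (t * t) ^ j * t ^ (m + 1 - 1 - j) =
      t ^ m * ∑ j ∈ Finset.range (m + 1), t ^ j := by
    rw [Finset.mul_sum]
    refine Finset.sum_congr rfl fun j hj => ?_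
    have : m = (m - j) + j := by have := Finset.mem_range.1 hj; omega
    rw [Nat.add_sub_cancel]
    conv_rhs => rw [this]
    rw [mul_pow, pow_add]; ring
  rw [h0W, h0D, hlead] at hres
  simp only [← mul_add, ← Finset.mul_sum] at hres
  rw [Nat.add_sub_cancel]
  simp only [halfPeriodResidue]
  generalize Finset.sum Finset.univ (_ : Fin (m + 1) → F) = A1 at *
  generalize (∑ j ∈ Finset.range (m + 1), t ^ j) = S1 at *
  have hP1 : (∏ j, ((1 / s - y j) * (1 / s - (y j)⁻¹))) ≠ 0 :=
    Finset.prod_ne_zero_iff.2 fun j _ => mul_ne_zero (sub_ne_zero.2 (hs1 j).symm)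
      (sub_ne_zero.2 (hs3 j).symm)
  have hP2 : (∏ j, ((-(1 / s) - y j) * (-(1 / s) - (y j)⁻¹))) ≠ 0 :=
    Finset.prod_ne_zero_iff.2 fun j _ => mul_ne_zero (sub_ne_zero.2 (hs2 j).symm)
      (sub_ne_zero.2 (hs4 j).symm)
  generalize (∏ j, ((1 / s - y j) * (1 / s - (y j)⁻¹))) = PP1 at *
  generalize (∏ j, ((-(1 / s) - y j) * (-(1 / s) - (y j)⁻¹))) = PP2 at *
  generalize telescope (m + 1) (fun j => (1 - t * y j * (1 / s)) * (1 - t * (y j)⁻¹ * (1 / s))) _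
    = W1 at *
  generalize telescope (m + 1)
    (fun j => (1 - t * y j * -(1 / s)) * (1 - t * (y j)⁻¹ * -(1 / s))) _ = W2 at *
  have e1 : 1 / s - -(1 / s) = 2 / s := by ring
  have e2 : -(1 / s) - 1 / s = -(2 / s) := by ring
  rw [e1, e2] at hres
  field_simp at hres ⊢
  linear_combination hres

/-- The residues at `z^2 = 1/q` agree, up to a factor, for parameters related by the duality
`a ↦ √(qt)/a ↔ √(q/t) a`, `t ↔ q/t`. -/
theorem halfPeriodResidue_dual {a b c d s τ : F} {y : Fin m → F} (ha : a ≠ 0) (hb : b ≠ 0)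
    (hc : c ≠ 0) (hd : d ≠ 0) (hm : 0 < m) (hs : s ≠ 0) (hτ : τ ≠ 0) (y_ne : ∀ k, y k ≠ 0) (z : F)
    (hz : s ^ 2 * z ^ 2 = 1) :
    halfPeriodResidue (s * τ / a) (s * τ / b) (s * τ / c) (s * τ / d) (τ ^ 2) y z =
      s ^ 2 * (τ ^ 4 / s ^ 2) ^ m / (a * b * c * d) *
      halfPeriodResidue (s / τ * a) (s / τ * b) (s / τ * c) (s / τ * d) (s ^ 2 / τ ^ 2) y z := by
  obtain ⟨m, rfl⟩ : ∃ m', m = m' + 1 := ⟨m - 1, by omega⟩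
  have hz0 : z ≠ 0 := by rintro rfl; simp at hz
  have e1 : (fun j => (1 - τ ^ 2 * y j * z) * (1 - τ ^ 2 * (y j)⁻¹ * z)) = fun j =>
      (τ ^ 4 / s ^ 2) * ((1 - s ^ 2 / τ ^ 2 * y j * z) * (1 - s ^ 2 / τ ^ 2 * (y j)⁻¹ * z)) := by
    funext j
    have := y_ne j
    field_simp
    linear_combination (-(y j) * s ^ 2 + y j * τ ^ 4) * hz
  have e2 : (fun j => τ ^ 2 * ((z - y j) * (z - (y j)⁻¹))) = fun j =>
      (τ ^ 4 / s ^ 2) * (s ^ 2 / τ ^ 2 * ((z - y j) * (z - (y j)⁻¹))) := by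
    funext j
    field_simp
  rw [halfPeriodResidue, e1, e2, telescope_smul, halfPeriodResidue, Nat.add_sub_cancel]
  generalize telescope (R := F) (m + 1) _ _ = W
  have e3 : ∀ a, a ≠ 0 → 1 - s * τ / a * z = -(s * τ * z / a) * (1 - s / τ * a * z) := by
    intro a ha
    field_simp
    linear_combination (-a) * hz
  rw [e3 a ha, e3 b hb, e3 c hc, e3 d hd, pow_succ (τ ^ 4 / s ^ 2) m]
  have hz4 : s ^ 4 * z ^ 4 = 1 := by linear_combination (s ^ 2 * z ^ 2 + 1) * hz
  generalize (1 - s / τ * a * z) = w1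
  generalize (1 - s / τ * b * z) = w2
  generalize (1 - s / τ * c * z) = w3
  generalize (1 - s / τ * d * z) = w4
  generalize (τ ^ 4 / s ^ 2) ^ m = r
  generalize (∏ j, ((z - y j) * (z - (y j)⁻¹)))  = PD
  rw [div_eq_mul_inv _ PD, div_eq_mul_inv _ PD]
  generalize PD⁻¹ = D
  field_simp
  linear_combination (w1 * w2 * w3 * w4 * r * W * D) * hz4

/-- The sums of the coefficients of a Koornwinder operator and of its dual differ by a constant. -/
theorem sum_coeffCore_dual {a b c d s τ α : F} {y : Fin m → F} (h2 : (2 : F) ≠ 0)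
    (ha : a ≠ 0) (hb : b ≠ 0) (hc : c ≠ 0) (hd : d ≠ 0) (hα : α ^ 2 * s ^ 2 = a * b * c * d)
    (hm : 0 < m) (hs : s ≠ 0) (hτ : τ ≠ 0)
    (y_ne : ∀ k, y k ≠ 0) (y_inj : Function.Injective y) (y_mul : ∀ i j, y i * y j ≠ 1)
    (y_sq : ∀ i, s ^ 2 * y i ^ 2 ≠ 1) (y_inv_sq : ∀ i, s ^ 2 * (y i)⁻¹ ^ 2 ≠ 1) :
    α / (τ ^ 2) ^ m * (∑ k,
        (coeffCore (s * τ / a) (s * τ / b) (s * τ / c) (s * τ / d) (s ^ 2) (τ ^ 2) y k (y k) +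
        coeffCore (s * τ / a) (s * τ / b) (s * τ / c) (s * τ / d) (s ^ 2) (τ ^ 2) y k (y k)⁻¹)) -
      (α * (s ^ 2 / τ ^ 2) ^ m)⁻¹ * (∑ k,
        (coeffCore (s / τ * a) (s / τ * b) (s / τ * c) (s / τ * d) (s ^ 2) (s ^ 2 / τ ^ 2)
            y k (y k) +
        coeffCore (s / τ * a) (s / τ * b) (s / τ * c) (s / τ * d) (s ^ 2) (s ^ 2 / τ ^ 2)
            y k (y k)⁻¹)) =
    (α / (τ ^ 2) ^ m + τ ^ 2 / α) * (∑ j ∈ Finset.range m, (τ ^ 2) ^ j) -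
      ((α * (s ^ 2 / τ ^ 2) ^ m)⁻¹ + α * (s ^ 2 / τ ^ 2)) *
        (∑ j ∈ Finset.range m, (s ^ 2 / τ ^ 2) ^ j) := by
  rw [sum_coeffCore h2 hm hs y_ne y_inj y_mul y_sq y_inv_sq,
    sum_coeffCore h2 hm hs y_ne y_inj y_mul y_sq y_inv_sq,
    halfPeriodResidue_dual ha hb hc hd hm hs hτ y_ne (1 / s) (by field_simp),
    halfPeriodResidue_dual ha hb hc hd hm hs hτ y_ne (-(1 / s)) (by field_simp)]
  generalize halfPeriodResidue (F := F) _ _ _ _ _ _ _ = H1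
  generalize halfPeriodResidue (F := F) _ _ _ _ _ _ _ = H2
  obtain ⟨m, rfl⟩ : ∃ m', m = m' + 1 := ⟨m - 1, by omega⟩
  have hα0 : α ≠ 0 := by
    rintro rfl
    simp [ha, hb, hc, hd, eq_comm] at hα
  rw [Nat.add_sub_cancel]
  generalize (∑ j ∈ Finset.range (m + 1), (s ^ 2 / τ ^ 2) ^ j) = S2
  generalize (∑ j ∈ Finset.range (m + 1), (τ ^ 2) ^ j) = S1
  have e1 : s * τ / a * (s * τ / b) * (s * τ / c) * (s * τ / d) = s ^ 2 * τ ^ 4 / α ^ 2 := by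
    field_simp
    linear_combination hα
  have e2 : s / τ * a * (s / τ * b) * (s / τ * c) * (s / τ * d) = s ^ 6 / τ ^ 4 * α ^ 2 := by
    field_simp
    linear_combination -hα
  rw [e1, e2, ← hα, div_pow, div_pow, div_pow]
  have e3 : (τ ^ 4) ^ (m + 1) = (τ ^ 2) ^ (m + 1) * (τ ^ 2) ^ (m + 1) := by
    rw [← mul_pow]; ring
  rw [e3, pow_succ (τ ^ 2), pow_succ (s ^ 2)]
  have hr : (τ ^ 2) ^ m ≠ 0 := pow_ne_zero _ (pow_ne_zero _ hτ)
  have hr' : (s ^ 2) ^ m ≠ 0 := pow_ne_zero _ (pow_ne_zero _ hs)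
  generalize (τ ^ 2) ^ m = r at *
  generalize (s ^ 2) ^ m = r' at *
  field_simp
  ring

end CoefficientSum

/-! ### Formal series with complex exponents -/

section Series

variable {m : ℕ} {K L : Type*} [Field K] [Field L]

theorem expo_add (γ δ : Fin m → ℂ) : expo (γ + δ) = expo γ + expo δ := rfl

@[simp] theorem expo_zero : expo (0 : Fin m → ℂ) = 0 := rfl

theorem expo_neg (γ : Fin m → ℂ) : expo (-γ) = -expo γ := rfl

theorem expo_sub (γ δ : Fin m → ℂ) : expo (γ - δ) = expo γ - expo δ := rfl

@[simp] theorem expoCoord_expo (γ : Fin m → ℂ) (i : Fin m) : expoCoord (expo γ) i = γ i := rfl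

theorem expo_injective : Function.Injective (expo : (Fin m → ℂ) → Expo m) := fun γ δ h => by
  funext i
  rw [← expoCoord_expo γ i, h, expoCoord_expo]

theorem expoCoord_add (γ δ : Expo m) (i : Fin m) :
    expoCoord (γ + δ) i = expoCoord γ i + expoCoord δ i := rfl

@[simp] theorem expoCoord_zero (i : Fin m) : expoCoord (0 : Expo m) i = 0 := rfl

/-- The exponent attached to an integral vector. -/
def zexpo (ν : Fin m → ℤ) : Expo m := expo fun i => (ν i : ℂ)

theorem zexpo_add (ν κ : Fin m → ℤ) : zexpo (ν + κ) = zexpo ν + zexpo κ := by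
  rw [zexpo, zexpo, zexpo, ← expo_add]; congr 1; funext i; simp

@[simp] theorem zexpo_zero : zexpo (0 : Fin m → ℤ) = 0 := by
  rw [zexpo, ← expo_zero]; congr 1; funext i; simp

theorem zexpo_neg (ν : Fin m → ℤ) : zexpo (-ν) = -zexpo ν := by
  rw [zexpo, zexpo, ← expo_neg]; congr 1; funext i; simp

theorem zexpo_sub (ν κ : Fin m → ℤ) : zexpo (ν - κ) = zexpo ν - zexpo κ := by
  rw [sub_eq_add_neg, zexpo_add, zexpo_neg, sub_eq_add_neg]

theorem zexpo_injective : Function.Injective (zexpo : (Fin m → ℤ) → Expo m) := fun ν κ h => by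
  funext i
  have := congrFun (expo_injective h) i
  exact_mod_cast this

theorem zexpo_single (i : Fin m) : zexpo (Pi.single i 1) = expo (Pi.single i 1) := by
  rw [zexpo]; congr 1; funext j
  by_cases h : j = i
  · subst h; simp
  · simp [h]

/-- The embedding of `ℤ^m` is monotone for the lexicographic orders. -/
theorem zexpo_lt_iff (ν κ : Fin m → ℤ) : zexpo ν < zexpo κ ↔ toLex ν < toLex κ := by
  have key : ∀ ν κ : Fin m → ℤ, toLex ν < toLex κ → zexpo ν < zexpo κ := by
    intro ν κ h
    obtain ⟨i, h1, h2⟩ := h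
    refine ⟨i, fun j hj => ?_, ?_⟩
    · have := h1 j hj
      simp only [zexpo, expo]
      change toLex ((ν j : ℂ).re, (ν j : ℂ).im) = toLex ((κ j : ℂ).re, (κ j : ℂ).im)
      rw [show ν j = κ j from this]
    · refine Prod.Lex.lt_iff.2 (Or.inl ?_)
      change (ν i : ℂ).re < (κ i : ℂ).re
      simpa using h2
  refine ⟨fun h => ?_, key ν κ⟩
  rcases lt_trichotomy (toLex ν) (toLex κ) with h1 | h1 | h1
  · exact h1
  · rw [toLex_inj.1 h1] at h
    exact absurd h (lt_irrefl _)
  · exact absurd h (key κ ν h1).not_gt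

/-- The monomial `y^ν` for an integral vector `ν`. -/
def zMono (ν : Fin m → ℤ) : SeriesY m K := HahnSeries.single (zexpo ν) 1

theorem zMono_add (ν κ : Fin m → ℤ) : (zMono (ν + κ) : SeriesY m K) = zMono ν * zMono κ := by
  rw [zMono, zMono, zMono, HahnSeries.single_mul_single, zexpo_add, one_mul]

@[simp] theorem zMono_zero : (zMono 0 : SeriesY m K) = 1 := by
  rw [zMono, zexpo_zero]; rfl

theorem zMono_ne_zero (ν : Fin m → ℤ) : (zMono ν : SeriesY m K) ≠ 0 :=
  HahnSeries.single_ne_zero one_ne_zero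

theorem zMono_neg (ν : Fin m → ℤ) : (zMono (-ν) : SeriesY m K) = (zMono ν)⁻¹ :=
  eq_inv_of_mul_eq_one_left (by rw [← zMono_add, neg_add_cancel, zMono_zero])

theorem zMono_sub (ν κ : Fin m → ℤ) : (zMono (ν - κ) : SeriesY m K) = zMono ν / zMono κ := by
  rw [sub_eq_add_neg, zMono_add, zMono_neg, div_eq_mul_inv]

theorem zMono_nsmul (k : ℕ) (ν : Fin m → ℤ) : (zMono (k • ν) : SeriesY m K) = zMono ν ^ k := by
  induction k with
  | zero => simp
  | succ k ih => rw [succ_nsmul, zMono_add, ih, pow_succ]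

theorem zMono_zsmul (k : ℤ) (ν : Fin m → ℤ) : (zMono (k • ν) : SeriesY m K) = zMono ν ^ k := by
  obtain ⟨k, rfl | rfl⟩ := k.eq_nat_or_neg
  · rw [natCast_zsmul, zMono_nsmul, zpow_natCast]
  · rw [neg_smul, zMono_neg, natCast_zsmul, zMono_nsmul, zpow_neg, zpow_natCast]

theorem zMono_sum {ι : Type*} (s : Finset ι) (ν : ι → Fin m → ℤ) :
    (zMono (∑ i ∈ s, ν i) : SeriesY m K) = ∏ i ∈ s, zMono (ν i) := by
  classical
  induction s using Finset.induction_on with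
  | empty => simp
  | insert i s hi ih => rw [Finset.sum_insert hi, Finset.prod_insert hi, zMono_add, ih]

theorem yVar_eq (i : Fin m) : (yVar i : SeriesY m K) = zMono (Pi.single i 1) := by
  rw [yVar, yMono, zMono, zexpo_single]

theorem yVar_ne_zero (i : Fin m) : (yVar i : SeriesY m K) ≠ 0 := by
  rw [yVar_eq]; exact zMono_ne_zero _

/-- Applying a homomorphism to the coefficients of a series. -/
def mapHom (φ : K →+* L) : SeriesY m K →+* SeriesY m L where
  toFun f := f.map φ
  map_one' := by
    ext γ
    change φ (HahnSeries.coeff 1 γ) = _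
    by_cases h : γ = 0
    · subst h; simp
    · simp [HahnSeries.coeff_one, h]
  map_mul' f g := by
    have := HahnSeries.map_mul (φ : K →ₙ+* L) (x := f) (y := g)
    exact this
  map_zero' := by ext; simp
  map_add' f g := by ext; simp

@[simp] theorem mapHom_coeff (φ : K →+* L) (f : SeriesY m K) (γ : Expo m) :
    (mapHom φ f).coeff γ = φ (f.coeff γ) := rfl

@[simp] theorem mapHom_single (φ : K →+* L) (γ : Expo m) (z : K) :
    mapHom φ (HahnSeries.single γ z) = HahnSeries.single γ (φ z) := by
  ext δ
  rw [mapHom_coeff]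
  by_cases h : δ = γ
  · subst h; simp
  · simp [HahnSeries.coeff_single_of_ne h]

@[simp] theorem mapHom_C (φ : K →+* L) (z : K) :
    mapHom (m := m) φ (HahnSeries.C z) = HahnSeries.C (φ z) := mapHom_single φ 0 z

@[simp] theorem mapHom_zMono (φ : K →+* L) (ν : Fin m → ℤ) : mapHom φ (zMono ν) = zMono ν := by
  rw [zMono, mapHom_single, map_one, zMono]

@[simp] theorem mapHom_yVar (φ : K →+* L) (i : Fin m) : mapHom φ (yVar i) = yVar i := by
  rw [yVar_eq, mapHom_zMono, yVar_eq]

theorem mapHom_yMono (φ : K →+* L) (γ : Fin m → ℂ) (z : K) :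
    mapHom φ (yMono γ z) = yMono γ (φ z) := mapHom_single φ _ z

theorem mapHom_weylDenominator (φ : K →+* L) :
    mapHom φ (weylDenominator m K) = weylDenominator m L := by
  simp [weylDenominator, map_prod, map_zpow₀]

theorem C_eq_algebraMap' [Algebra ℂ K] (z : ℂ) :
    algebraMap ℂ (SeriesY m K) z = HahnSeries.C (algebraMap ℂ K z) :=
  HahnSeries.algebraMap_apply

section Shift

variable [Algebra ℂ K] [Algebra ℂ L]

theorem cpow_unit_ne_zero (q : ℂˣ) (z : ℂ) : (q : ℂ) ^ z ≠ 0 := by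
  simp [Complex.cpow_eq_zero_iff]

/-- The `q`-shift `T_{q,y_i}^k` as a ring homomorphism. -/
def shiftHom (q : ℂˣ) (k : ℤ) (i : Fin m) : SeriesY m K →+* SeriesY m K where
  toFun := shiftY (q : ℂ) k i
  map_one' := by
    ext γ
    change ((q : ℂ) ^ ((k : ℂ) * expoCoord γ i)) • HahnSeries.coeff 1 γ = _
    by_cases h : γ = 0
    · subst h; simp
    · simp [HahnSeries.coeff_one, h]
  map_mul' f g := by
    ext γ
    change ((q : ℂ) ^ ((k : ℂ) * expoCoord γ i)) • (f * g).coeff γ = _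
    rw [HahnSeries.coeff_mul, HahnSeries.coeff_mul, Finset.smul_sum]
    refine Finset.sum_congr ?_ ?_
    · ext ⟨δ, ε⟩
      simp only [Finset.mem_antidiagonal, HahnSeries.mem_support, shiftY, ne_eq, smul_eq_zero,
        cpow_unit_ne_zero, false_or]
    · rintro ⟨δ, ε⟩ h
      have h3 : δ + ε = γ := (Finset.mem_antidiagonal.1 h).2.2
      change _ = ((q : ℂ) ^ ((k : ℂ) * expoCoord δ i)) • f.coeff δ *
        (((q : ℂ) ^ ((k : ℂ) * expoCoord ε i)) • g.coeff ε)
      rw [smul_mul_smul_comm, ← Complex.cpow_add _ _ q.ne_zero, ← mul_add, ← h3, expoCoord_add]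
  map_zero' := by
    ext γ
    exact smul_zero _
  map_add' f g := by
    ext γ
    exact smul_add _ _ _

theorem shiftHom_coeff (q : ℂˣ) (k : ℤ) (i : Fin m) (f : SeriesY m K) (γ : Expo m) :
    (shiftHom q k i f).coeff γ = ((q : ℂ) ^ ((k : ℂ) * expoCoord γ i)) • f.coeff γ := rfl

theorem shiftHom_single (q : ℂˣ) (k : ℤ) (i : Fin m) (γ : Expo m) (z : K) :
    shiftHom q k i (HahnSeries.single γ z) =
      HahnSeries.single γ (((q : ℂ) ^ ((k : ℂ) * expoCoord γ i)) • z) := by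
  ext δ
  rw [shiftHom_coeff]
  by_cases h : δ = γ
  · subst h; simp
  · simp [HahnSeries.coeff_single_of_ne h]

@[simp] theorem shiftHom_C (q : ℂˣ) (k : ℤ) (i : Fin m) (z : K) :
    shiftHom q k i (HahnSeries.C z : SeriesY m K) = HahnSeries.C z := by
  change shiftHom q k i (HahnSeries.single 0 z) = HahnSeries.single 0 z
  rw [shiftHom_single]; simp

@[simp] theorem shiftHom_algebraMap (q : ℂˣ) (k : ℤ) (i : Fin m) (z : ℂ) :
    shiftHom q k i (algebraMap ℂ (SeriesY m K) z) = algebraMap ℂ _ z := by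
  rw [C_eq_algebraMap', shiftHom_C]

theorem single_eq_algebraMap_mul (γ : Expo m) (c : ℂ) (z : K) :
    (HahnSeries.single γ (c • z) : SeriesY m K) = algebraMap ℂ _ c * HahnSeries.single γ z := by
  rw [C_eq_algebraMap', HahnSeries.C_mul_eq_smul, Algebra.smul_def]
  ext δ
  rw [HahnSeries.coeff_smul]
  by_cases h : δ = γ
  · subst h; simp
  · simp [HahnSeries.coeff_single_of_ne h]

theorem shiftHom_zMono (q : ℂˣ) (k : ℤ) (i : Fin m) (ν : Fin m → ℤ) :
    shiftHom q k i (zMono ν : SeriesY m K) =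
      algebraMap ℂ _ ((q : ℂ) ^ (k * ν i)) * zMono ν := by
  rw [zMono, shiftHom_single, zexpo, expoCoord_expo, single_eq_algebraMap_mul]
  congr 2
  rw [← Int.cast_mul, Complex.cpow_intCast]

theorem shiftHom_yVar_self (q : ℂˣ) (k : ℤ) (i : Fin m) :
    shiftHom q k i (yVar i : SeriesY m K) = algebraMap ℂ _ ((q : ℂ) ^ k) * yVar i := by
  rw [yVar_eq, shiftHom_zMono]; simp

theorem shiftHom_yVar_of_ne (q : ℂˣ) (k : ℤ) {i j : Fin m} (h : j ≠ i) :
    shiftHom q k i (yVar j : SeriesY m K) = yVar j := by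
  rw [yVar_eq, shiftHom_zMono]; simp [Pi.single_eq_of_ne h.symm]

theorem shiftHom_shiftHom_neg (q : ℂˣ) (k : ℤ) (i : Fin m) (f : SeriesY m K) :
    shiftHom q k i (shiftHom q (-k) i f) = f := by
  ext γ
  rw [shiftHom_coeff, shiftHom_coeff, smul_smul, ← Complex.cpow_add _ _ q.ne_zero]
  simp

theorem shiftHom_coeff_zero (q : ℂˣ) (k : ℤ) (i : Fin m) (f : SeriesY m K) :
    (shiftHom q k i f).coeff 0 = f.coeff 0 := by
  rw [shiftHom_coeff]; simp

theorem mapHom_shiftHom (φ : K →ₐ[ℂ] L) (q : ℂˣ) (k : ℤ) (i : Fin m) (f : SeriesY m K) :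
    mapHom (φ : K →+* L) (shiftHom q k i f) = shiftHom q k i (mapHom (φ : K →+* L) f) := by
  ext γ
  simp [shiftHom_coeff]

theorem mapHom_algebraMap (φ : K →ₐ[ℂ] L) (z : ℂ) :
    mapHom (φ : K →+* L) (algebraMap ℂ (SeriesY m K) z) = algebraMap ℂ _ z := by
  rw [C_eq_algebraMap', C_eq_algebraMap', mapHom_C]; simp

/-- The adjoint of a `q`-shift with respect to the constant term. -/
theorem coeff_zero_shiftHom_mul (q : ℂˣ) (k : ℤ) (i : Fin m) (f g : SeriesY m K) :
    (shiftHom q k i f * g).coeff 0 = (f * shiftHom q (-k) i g).coeff 0 := by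
  rw [← shiftHom_coeff_zero q k i (f * shiftHom q (-k) i g), map_mul, shiftHom_shiftHom_neg]

end Shift

section QPochhammer

theorem zexpo_nsmul (r : ℕ) (ν : Fin m → ℤ) : zexpo (r • ν) = r • zexpo ν := by
  induction r with
  | zero => simp
  | succ r ih => rw [succ_nsmul, zexpo_add, ih, succ_nsmul]

theorem zexpo_single_pos (j : Fin m) : (0 : Expo m) < zexpo (Pi.single j 1) := by
  rw [← zexpo_zero, zexpo_lt_iff]
  refine ⟨j, fun i hi => ?_, ?_⟩
  · change (0 : ℤ) = Pi.single (M := fun _ => ℤ) j 1 i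
    rw [Pi.single_eq_of_ne (by exact ne_of_lt hi)]
  · change (0 : ℤ) < Pi.single (M := fun _ => ℤ) j 1 j
    simp

/-- Coefficients of a power series in the variable `w y_j`. -/
theorem heval_yMono_coeff (j : Fin m) (w : K) (φ : PowerSeries K) (γ : Expo m) :
    (PowerSeries.heval (yMono (Pi.single j 1) w) φ).coeff γ =
      ∑ᶠ r : ℕ, if γ = zexpo (r • Pi.single j 1) then PowerSeries.coeff r φ * w ^ r else 0 := by
  have hpos : 0 < (yMono (Pi.single j 1) w : SeriesY m K).orderTop := by
    rw [yMono, ← zexpo_single]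
    by_cases hw : w = 0
    · subst hw; simp
    · rw [HahnSeries.orderTop_single hw]
      exact_mod_cast zexpo_single_pos j
  rw [PowerSeries.coeff_heval]
  refine finsum_congr fun r => ?_
  have hterm := HahnSeries.SummableFamily.powerSeriesFamily_of_orderTop_pos hpos φ r
  change ((HahnSeries.SummableFamily.powerSeriesFamily _ φ) r).coeff γ = _
  rw [hterm, HahnSeries.coeff_smul]
  rw [yMono, ← zexpo_single, HahnSeries.single_pow, ← zexpo_nsmul]
  by_cases h : γ = zexpo (r • Pi.single j 1)
  · subst h; simp
  · rw [if_neg h, HahnSeries.coeff_single_of_ne h, smul_zero]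

theorem heval_yMono_coeff_self (j : Fin m) (w : K) (φ : PowerSeries K) (r : ℕ) :
    (PowerSeries.heval (yMono (Pi.single j 1) w) φ).coeff (zexpo (r • Pi.single j 1)) =
      PowerSeries.coeff r φ * w ^ r := by
  rw [heval_yMono_coeff, finsum_eq_single _ r]
  · simp
  · intro k hk
    rw [if_neg]
    intro h
    have := congrFun (zexpo_injective h) j
    simp at this
    omega

theorem heval_yMono_coeff_of_ne (j : Fin m) (w : K) (φ : PowerSeries K) {γ : Expo m}
    (h : ∀ r : ℕ, γ ≠ zexpo (r • Pi.single j 1)) :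
    (PowerSeries.heval (yMono (Pi.single j 1) w) φ).coeff γ = 0 := by
  rw [heval_yMono_coeff, finsum_eq_zero_of_forall_eq_zero]
  intro r
  rw [if_neg (h r)]

/-- A series in `w y_j` is a rescaled series in `y_j`. -/
theorem heval_yMono_eq (j : Fin m) (w : K) (φ : PowerSeries K) :
    PowerSeries.heval (yMono (Pi.single j 1) w) φ =
      PowerSeries.heval (yVar j : SeriesY m K) (PowerSeries.rescale w φ) := by
  ext γ
  rw [yVar, heval_yMono_coeff, heval_yMono_coeff]
  refine finsum_congr fun r => ?_
  rw [PowerSeries.coeff_rescale, one_pow, mul_one, mul_comm]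

theorem mapHom_heval (φ : K →+* L) (j : Fin m) (w : K) (ψ : PowerSeries K) :
    mapHom φ (PowerSeries.heval (yMono (Pi.single j 1) w) ψ) =
      PowerSeries.heval (yMono (Pi.single j 1) (φ w)) (ψ.map φ) := by
  ext γ
  rw [mapHom_coeff]
  by_cases h : ∃ r : ℕ, γ = zexpo (r • Pi.single j 1)
  · obtain ⟨r, rfl⟩ := h
    rw [heval_yMono_coeff_self, heval_yMono_coeff_self]; simp
  · rw [heval_yMono_coeff_of_ne _ _ _ (fun r hr => h ⟨r, hr⟩),
      heval_yMono_coeff_of_ne _ _ _ (fun r hr => h ⟨r, hr⟩), map_zero]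

variable [Algebra ℂ K] [Algebra ℂ L]

theorem mapHom_qPochhammerY (φ : K →ₐ[ℂ] L) (q : ℂ) (w : K) (j : Fin m) :
    mapHom (φ : K →+* L) (qPochhammerY q w j) = qPochhammerY q (φ w) j := by
  rw [qPochhammerY, mapHom_heval, qPochhammerY]
  congr 1
  ext r
  simp

theorem shiftHom_heval_self (q : ℂˣ) (k : ℤ) (j : Fin m) (w : K) (ψ : PowerSeries K) :
    shiftHom q k j (PowerSeries.heval (yMono (Pi.single j 1) w) ψ) =
      PowerSeries.heval (yMono (Pi.single j 1) ((q : ℂ) ^ k • w)) ψ := by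
  ext γ
  rw [shiftHom_coeff]
  by_cases h : ∃ r : ℕ, γ = zexpo (r • Pi.single j 1)
  · obtain ⟨r, rfl⟩ := h
    rw [heval_yMono_coeff_self, heval_yMono_coeff_self, zexpo, expoCoord_expo, smul_pow,
      mul_smul_comm]
    congr 1
    rw [← Int.cast_mul, Complex.cpow_intCast]
    simp [zpow_mul]
  · rw [heval_yMono_coeff_of_ne _ _ _ (fun r hr => h ⟨r, hr⟩),
      heval_yMono_coeff_of_ne _ _ _ (fun r hr => h ⟨r, hr⟩), smul_zero]

theorem shiftHom_heval_of_ne (q : ℂˣ) (k : ℤ) {i j : Fin m} (hij : j ≠ i) (w : K)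
    (ψ : PowerSeries K) :
    shiftHom q k i (PowerSeries.heval (yMono (Pi.single j 1) w) ψ) =
      PowerSeries.heval (yMono (Pi.single j 1) w) ψ := by
  ext γ
  rw [shiftHom_coeff]
  by_cases h : ∃ r : ℕ, γ = zexpo (r • Pi.single j 1)
  · obtain ⟨r, rfl⟩ := h
    rw [zexpo, expoCoord_expo]
    simp [Pi.single_eq_of_ne hij.symm]
  · rw [heval_yMono_coeff_of_ne _ _ _ (fun r hr => h ⟨r, hr⟩), smul_zero]

/-- The coefficients of the partial products of `(z; q)_∞` converge. -/
theorem exists_tendsto_coeff_prod {q : ℂ} (hq : ‖q‖ < 1) (r : ℕ) :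
    ∃ l : ℂ, Filter.Tendsto (fun N : ℕ => PowerSeries.coeff r
      (∏ k ∈ Finset.range N, (1 - PowerSeries.C (q ^ k) * PowerSeries.X : PowerSeries ℂ)))
      Filter.atTop (nhds l) := by
  induction r with
  | zero =>
    refine ⟨1, tendsto_const_nhds.congr fun N => ?_⟩
    simp [PowerSeries.coeff_zero_eq_constantCoeff, map_prod]
  | succ r ih =>
    obtain ⟨l, hl⟩ := ih
    obtain ⟨B, hB⟩ := hl.norm.bddAbove_range
    set c : ℕ → ℕ → ℂ := fun r N => PowerSeries.coeff r
      (∏ k ∈ Finset.range N, (1 - PowerSeries.C (q ^ k) * PowerSeries.X : PowerSeries ℂ)) with hc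
    have hrec : ∀ N, c (r + 1) (N + 1) = c (r + 1) N - q ^ N * c r N := by
      intro N
      simp only [hc]
      rw [Finset.prod_range_succ, mul_sub, mul_one, map_sub, ← mul_assoc,
        PowerSeries.coeff_succ_mul_X, mul_comm _ (PowerSeries.C _), PowerSeries.coeff_C_mul]
    have hsum : Summable fun N => q ^ N * c r N := by
      refine Summable.of_norm_bounded (g := fun N => ‖q‖ ^ N * B)
        ((summable_geometric_of_lt_one (norm_nonneg _) hq).mul_right B) fun N => ?_
      rw [norm_mul, norm_pow]
      exact mul_le_mul_of_nonneg_left (hB ⟨N, rfl⟩) (by positivity)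
    have hform : ∀ N, c (r + 1) N = c (r + 1) 0 - ∑ k ∈ Finset.range N, q ^ k * c r k := by
      intro N
      induction N with
      | zero => simp
      | succ N ih => rw [hrec, ih, Finset.sum_range_succ]; ring
    refine ⟨c (r + 1) 0 - ∑' k, q ^ k * c r k, ?_⟩
    exact (tendsto_const_nhds.sub hsum.hasSum.tendsto_sum_nat).congr fun N => (hform N).symm

theorem tendsto_coeff_prod {q : ℂ} (hq : ‖q‖ < 1) (r : ℕ) :
    Filter.Tendsto (fun N : ℕ => PowerSeries.coeff r
      (∏ k ∈ Finset.range N, (1 - PowerSeries.C (q ^ k) * PowerSeries.X : PowerSeries ℂ)))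
      Filter.atTop (nhds (PowerSeries.coeff r (qPochhammer q))) := by
  rw [qPochhammer, PowerSeries.coeff_mk]
  exact tendsto_nhds_limUnder (exists_tendsto_coeff_prod hq r)

theorem constantCoeff_qPochhammer {q : ℂ} (hq : ‖q‖ < 1) :
    PowerSeries.constantCoeff (qPochhammer q) = 1 := by
  rw [← PowerSeries.coeff_zero_eq_constantCoeff_apply]
  refine tendsto_nhds_unique (tendsto_coeff_prod hq 0) (tendsto_const_nhds.congr fun N => ?_)
  simp [PowerSeries.coeff_zero_eq_constantCoeff, map_prod]

/-- `(z; q)_∞ = (1 - z) (qz; q)_∞`. -/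
theorem qPochhammer_eq {q : ℂ} (hq : ‖q‖ < 1) :
    qPochhammer q = (1 - PowerSeries.X) * PowerSeries.rescale q (qPochhammer q) := by
  have hfin : ∀ N, ∏ k ∈ Finset.range (N + 1),
      (1 - PowerSeries.C (q ^ k) * PowerSeries.X : PowerSeries ℂ) = (1 - PowerSeries.X) *
      PowerSeries.rescale q (∏ k ∈ Finset.range N,
        (1 - PowerSeries.C (q ^ k) * PowerSeries.X : PowerSeries ℂ)) := by
    intro N
    rw [Finset.prod_range_succ', map_prod, mul_comm]
    congr 1
    · simp
    · refine Finset.prod_congr rfl fun k _ => ?_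
      rw [map_sub, map_one, map_mul, PowerSeries.rescale_X, ← mul_assoc, pow_succ, map_mul]
      congr 3
      ext r
      rw [PowerSeries.coeff_rescale, PowerSeries.coeff_C]
      split_ifs with h
      · simp [h]
      · simp
  ext r
  refine tendsto_nhds_unique
    ((Filter.tendsto_add_atTop_iff_nat 1).2 (tendsto_coeff_prod hq r)) ?_
  simp only [hfin]
  cases r with
  | zero =>
    simp only [sub_mul, one_mul, map_sub, PowerSeries.coeff_rescale,
      PowerSeries.coeff_zero_X_mul]
    exact ((tendsto_coeff_prod hq 0).const_mul _).sub tendsto_const_nhds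
  | succ r =>
    simp only [sub_mul, one_mul, map_sub, PowerSeries.coeff_rescale,
      PowerSeries.coeff_succ_X_mul]
    exact ((tendsto_coeff_prod hq _).const_mul _).sub ((tendsto_coeff_prod hq r).const_mul _)

theorem qPochhammerY_eq {q : ℂ} (hq : ‖q‖ < 1) (w : K) (j : Fin m) :
    (qPochhammerY q w j : SeriesY m K) =
      (1 - HahnSeries.C w * yVar j) * qPochhammerY q (q • w) j := by
  have h : (qPochhammer q).map (algebraMap ℂ K) = (1 - PowerSeries.X) *
      PowerSeries.rescale (algebraMap ℂ K q) ((qPochhammer q).map (algebraMap ℂ K)) := by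
    conv_lhs => rw [qPochhammer_eq hq]
    rw [map_mul, map_sub, map_one, PowerSeries.map_X]
    congr 1
    ext r
    simp [PowerSeries.coeff_rescale]
  rw [qPochhammerY, h, map_mul, map_sub, map_one, qPochhammerY, heval_yMono_eq _ (q • w)]
  congr 1
  · congr 1
    rw [heval_yMono_eq, PowerSeries.rescale_X, map_mul]
    have hC : PowerSeries.heval (yVar j : SeriesY m K) (PowerSeries.C w) = HahnSeries.C w := by
      rw [PowerSeries.heval_C, HahnSeries.C_eq_algebraMap, Algebra.algebraMap_eq_smul_one]
    rw [hC, PowerSeries.heval_X]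
    rw [yVar, yMono, ← zexpo_single, HahnSeries.orderTop_single one_ne_zero]
    exact_mod_cast zexpo_single_pos j
  · rw [heval_yMono_eq, PowerSeries.rescale_rescale, Algebra.smul_def, mul_comm]

theorem qPochhammerY_ne_zero {q : ℂ} (hq : ‖q‖ < 1) (w : K) (j : Fin m) :
    (qPochhammerY q w j : SeriesY m K) ≠ 0 := by
  intro h
  have h1 := PowerSeries.coeff_heval_zero (yMono (Pi.single j 1) w : SeriesY m K)
    ((qPochhammer q).map (algebraMap ℂ K))
  rw [← qPochhammerY, h, ← PowerSeries.coeff_zero_eq_constantCoeff_apply, PowerSeries.coeff_map,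
    PowerSeries.coeff_zero_eq_constantCoeff_apply, constantCoeff_qPochhammer hq] at h1
  simp at h1

end QPochhammer

end Series

/-! ### The adjoint of a Koornwinder operator -/

section Adjoint

variable {F : Type*} [Field F] {m : ℕ}

theorem opCoeff_eq_coeffCore [Algebra ℂ F] (p : Params) (X : Fin m → F) (i : Fin m) (u : F) :
    opCoeff p X i u = (algebraMap ℂ F (p.α * p.t ^ (m - 1)))⁻¹ *
      coeffCore (algebraMap ℂ F p.a) (algebraMap ℂ F p.b) (algebraMap ℂ F p.c)
        (algebraMap ℂ F p.d) (algebraMap ℂ F p.q) (algebraMap ℂ F p.t) X i u := by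
  simp only [opCoeff, coeffCore, Algebra.smul_def, div_eq_mul_inv, mul_inv]
  ring

/-- The factors of the Weyl denominator which contain the variable `y_k`, as a function of
`u = y_k`. -/
def weylFactor (y : Fin m → F) (k : Fin m) (u : F) : F :=
  (u⁻¹ - u) * ∏ l ∈ Finset.univ.erase k, (u + u⁻¹ - y l - (y l)⁻¹)

theorem weylFactor_inv (y : Fin m → F) (k : Fin m) (u : F) :
    weylFactor y k u⁻¹ = -weylFactor y k u := by
  rw [weylFactor, weylFactor, inv_inv, ← neg_mul, neg_sub]
  congr 1
  refine Finset.prod_congr rfl fun l _ => ?_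
  ring

/-- The formal adjoint of a term of the Koornwinder operator, after conjugation by the Weyl
denominator, is the corresponding term for the dual parameters. -/
theorem coeffCore_mul_weylFactor {a b c d s τ α : F} {y : Fin m → F} {k : Fin m} {u : F}
    (ha : a ≠ 0) (hb : b ≠ 0) (hc : c ≠ 0) (hd : d ≠ 0) (hα : α ^ 2 * s ^ 2 = a * b * c * d)
    (hs : s ≠ 0) (hτ : τ ≠ 0) (hy : ∀ l, y l ≠ 0) (hu : u ≠ 0)
    (h1 : 1 - u ^ 2 ≠ 0) (h2 : s ^ 2 - u ^ 2 ≠ 0) (h3 : s ^ 4 - u ^ 2 ≠ 0)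
    (h4 : ∀ l ∈ Finset.univ.erase k, 1 - u * y l ≠ 0 ∧ y l - u ≠ 0 ∧
      s ^ 2 - u * y l ≠ 0 ∧ s ^ 2 * y l - u ≠ 0) :
    α / (τ ^ 2) ^ m *
        coeffCore (s * τ / a) (s * τ / b) (s * τ / c) (s * τ / d) (s ^ 2) (τ ^ 2) y k (u / s ^ 2) *
        weylFactor y k (u / s ^ 2) =
      weylFactor y k u * ((α * (s ^ 2 / τ ^ 2) ^ m)⁻¹ *
        coeffCore (s / τ * a) (s / τ * b) (s / τ * c) (s / τ * d) (s ^ 2) (s ^ 2 / τ ^ 2) y k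
          u⁻¹) := by
  have hα0 : α ≠ 0 := by
    rintro rfl
    have : a * b * c * d ≠ 0 := by simp [ha, hb, hc, hd]
    exact this (by rw [← hα]; ring)
  obtain ⟨m, rfl⟩ : ∃ m', m = m' + 1 := ⟨m - 1, by have := k.pos; omega⟩
  rw [coeffCore, coeffCore, weylFactor, weylFactor]
  have hprod : (∏ j ∈ Finset.univ.erase k,
      ((1 - τ ^ 2 * (u / s ^ 2 * y j)) * (1 - τ ^ 2 * (u / s ^ 2 / y j))) /
        ((1 - u / s ^ 2 * y j) * (1 - u / s ^ 2 / y j))) *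
      ∏ l ∈ Finset.univ.erase k, (u / s ^ 2 + (u / s ^ 2)⁻¹ - y l - (y l)⁻¹) =
      (τ ^ 4 / s ^ 2) ^ m * ((∏ l ∈ Finset.univ.erase k, (u + u⁻¹ - y l - (y l)⁻¹)) *
      ∏ j ∈ Finset.univ.erase k,
      ((1 - s ^ 2 / τ ^ 2 * (u⁻¹ * y j)) * (1 - s ^ 2 / τ ^ 2 * (u⁻¹ / y j))) /
        ((1 - u⁻¹ * y j) * (1 - u⁻¹ / y j))) := by
    have hcard : (Finset.univ.erase k).card = m := by simp
    have hpow : (τ ^ 4 / s ^ 2) ^ m = ∏ _l ∈ Finset.univ.erase k, (τ ^ 4 / s ^ 2) := by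
      rw [Finset.prod_const, hcard]
    rw [hpow, ← Finset.prod_mul_distrib, ← Finset.prod_mul_distrib,
      ← Finset.prod_mul_distrib]
    refine Finset.prod_congr rfl fun l hl => ?_
    obtain ⟨g1, g2, g3, g4⟩ := h4 l hl
    have := hy l
    have e1 : (1 - u / s ^ 2 * y l) = (s ^ 2 - u * y l) / s ^ 2 := by field_simp
    have e2 : (1 - u / s ^ 2 / y l) = (s ^ 2 * y l - u) / (s ^ 2 * y l) := by field_simp
    have e3 : (1 - u⁻¹ * y l) = -(y l - u) / u := by field_simp; ring
    have e4 : (1 - u⁻¹ / y l) = -(1 - u * y l) / (u * y l) := by field_simp; ring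
    rw [e1, e2, e3, e4]
    field_simp
    ring
  have e5 : (1 - (u / s ^ 2) ^ 2) = (s ^ 4 - u ^ 2) / s ^ 4 := by field_simp
  have e6 : (1 - s ^ 2 * (u / s ^ 2) ^ 2) = (s ^ 2 - u ^ 2) / s ^ 2 := by field_simp
  have e7 : (1 - u⁻¹ ^ 2) = -(1 - u ^ 2) / u ^ 2 := by field_simp; ring
  have e8 : (1 - s ^ 2 * u⁻¹ ^ 2) = -(s ^ 2 - u ^ 2) / u ^ 2 := by field_simp; ring
  have hfac : ∀ a, a ≠ 0 → (1 - s * τ / a * (u / s ^ 2)) =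
      -(u * τ / (s * a)) * (1 - s / τ * a * u⁻¹) := by
    intro a ha
    field_simp
    ring
  rw [e5, e6, e7, e8, hfac a ha, hfac b hb, hfac c hc, hfac d hd]
  generalize (∏ j ∈ Finset.univ.erase k,
      ((1 - τ ^ 2 * (u / s ^ 2 * y j)) * (1 - τ ^ 2 * (u / s ^ 2 / y j))) /
        ((1 - u / s ^ 2 * y j) * (1 - u / s ^ 2 / y j))) = P1 at *
  generalize (∏ l ∈ Finset.univ.erase k, (u / s ^ 2 + (u / s ^ 2)⁻¹ - y l - (y l)⁻¹)) = P2 at *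
  generalize (∏ l ∈ Finset.univ.erase k, (u + u⁻¹ - y l - (y l)⁻¹)) = P3 at *
  generalize (∏ j ∈ Finset.univ.erase k,
      ((1 - s ^ 2 / τ ^ 2 * (u⁻¹ * y j)) * (1 - s ^ 2 / τ ^ 2 * (u⁻¹ / y j))) /
        ((1 - u⁻¹ * y j) * (1 - u⁻¹ / y j))) = P4 at *
  generalize (1 - s / τ * a * u⁻¹) = A
  generalize (1 - s / τ * b * u⁻¹) = B
  generalize (1 - s / τ * c * u⁻¹) = C'
  generalize (1 - s / τ * d * u⁻¹) = D
  have hαi : (α * (s ^ 2 / τ ^ 2) ^ (m + 1))⁻¹ =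
      α * s ^ 2 / (a * b * c * d) * ((s ^ 2 / τ ^ 2) ^ (m + 1))⁻¹ := by
    rw [← hα]; field_simp
  rw [hαi]
  calc _ = α / (τ ^ 2) ^ (m + 1) * (-(u * τ / (s * a)) * A * (-(u * τ / (s * b)) * B) *
        (-(u * τ / (s * c)) * C') * (-(u * τ / (s * d)) * D) /
        ((s ^ 4 - u ^ 2) / s ^ 4 * ((s ^ 2 - u ^ 2) / s ^ 2))) *
        ((u / s ^ 2)⁻¹ - u / s ^ 2) * (P1 * P2) := by ring
    _ = _ := by
      have p1 : (τ ^ 4 / s ^ 2) ^ m = (τ ^ m) ^ 4 / (s ^ m) ^ 2 := by rw [div_pow]; ring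
      have p2 : (τ ^ 2) ^ (m + 1) = (τ ^ m) ^ 2 * τ ^ 2 := by ring
      have p3 : (s ^ 2 / τ ^ 2) ^ (m + 1) = ((s ^ m) ^ 2 * s ^ 2) / ((τ ^ m) ^ 2 * τ ^ 2) := by
        rw [div_pow]; ring
      have hS : s ^ m ≠ 0 := pow_ne_zero _ hs
      have hT : τ ^ m ≠ 0 := pow_ne_zero _ hτ
      rw [hprod, p1, p2, p3]
      generalize s ^ m = S at *
      generalize τ ^ m = T at *
      field_simp

end Adjoint

/-! ### Conjugation by the Weyl denominator -/

section WeylFactor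

variable {F : Type*} [Field F] {m : ℕ}

/-- The Weyl denominator as a product over the positive roots, for arbitrary elements `y_i`. -/
def weylProduct (y : Fin m → F) : F :=
  (∏ i, ((y i)⁻¹ - y i)) * ∏ i, ∏ j ∈ Finset.Ioi i, (y i + (y i)⁻¹ - y j - (y j)⁻¹)

/-- Among the pairs `i < j`, those which contain `k` are indexed by the other index. -/
theorem prod_Ioi_ite {M : Type*} [CommMonoid M] (k : Fin m) (h : Fin m → M) :
    ∏ i, ∏ j ∈ Finset.Ioi i, ((if i = k then h j else 1) * (if j = k then h i else 1)) =
      ∏ l ∈ Finset.univ.erase k, h l := by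
  simp only [Finset.prod_mul_distrib]
  have h1 : ∏ i, ∏ j ∈ Finset.Ioi i, (if i = k then h j else 1) = ∏ j ∈ Finset.Ioi k, h j := by
    rw [Finset.prod_eq_single k]
    · simp
    · intro i _ hi
      simp [hi]
    · simp
  have h2 : ∏ i, ∏ j ∈ Finset.Ioi i, (if j = k then h i else 1) = ∏ j ∈ Finset.Iio k, h j := by
    simp only [Finset.prod_ite_eq', Finset.mem_Ioi]
    rw [← Finset.prod_filter]
    congr 1
    ext; simp
  rw [h1, h2, ← Finset.prod_union]
  · congr 1
    ext l
    simp [lt_or_lt_iff_ne, ne_comm]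
  · rw [Finset.disjoint_left]
    intro l h1 h2
    simp only [Finset.mem_Ioi, Finset.mem_Iio] at h1 h2
    exact absurd h1 h2.not_gt

/-- Up to a factor which does not depend on `u`, replacing `y_k` by `u` in the Weyl denominator
gives `weylFactor y k u`. -/
theorem exists_weylProduct_update (y : Fin m → F) (k : Fin m) :
    ∃ c : F, ∀ u, weylProduct (Function.update y k u) = c * weylFactor y k u := by
  classical
  refine ⟨(∏ i ∈ Finset.univ.erase k, ((y i)⁻¹ - y i)) * ∏ i, ∏ j ∈ Finset.Ioi i,
    (if i = k then 1 else if j = k then -1 else (y i + (y i)⁻¹ - y j - (y j)⁻¹)), fun u => ?_⟩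
  have h1 : ∏ i, ((Function.update y k u i)⁻¹ - Function.update y k u i) =
      (u⁻¹ - u) * ∏ i ∈ Finset.univ.erase k, ((y i)⁻¹ - y i) := by
    rw [← Finset.mul_prod_erase _ _ (Finset.mem_univ k), Function.update_self]
    congr 1
    refine Finset.prod_congr rfl fun i hi => ?_
    rw [Function.update_of_ne (Finset.ne_of_mem_erase hi)]
  have h2 : ∏ i, ∏ j ∈ Finset.Ioi i, (Function.update y k u i + (Function.update y k u i)⁻¹ -
      Function.update y k u j - (Function.update y k u j)⁻¹) =
      (∏ i, ∏ j ∈ Finset.Ioi i,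
        (if i = k then 1 else if j = k then -1 else (y i + (y i)⁻¹ - y j - (y j)⁻¹))) *
      ∏ l ∈ Finset.univ.erase k, (u + u⁻¹ - y l - (y l)⁻¹) := by
    rw [← prod_Ioi_ite k, ← Finset.prod_mul_distrib]
    refine Finset.prod_congr rfl fun i _ => ?_
    rw [← Finset.prod_mul_distrib]
    refine Finset.prod_congr rfl fun j hj => ?_
    have hij : i < j := Finset.mem_Ioi.1 hj
    by_cases hi : i = k
    · subst hi
      simp [hij.ne']
    · by_cases hjk : j = k
      · subst hjk
        simp [hi]
        ring
      · simp [hi, hjk]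
  rw [weylProduct, h1, h2, weylFactor]
  ring

theorem weylProduct_update (y : Fin m → F) (k : Fin m) (u : F) :
    weylProduct (Function.update y k u) * weylFactor y k (y k) =
      weylProduct y * weylFactor y k u := by
  obtain ⟨c, hc⟩ := exists_weylProduct_update y k
  have := hc (y k)
  rw [Function.update_eq_self] at this
  rw [hc, this]; ring

theorem coeffCore_congr {a b c d q t : F} {y z : Fin m → F} {k : Fin m} {u : F}
    (h : ∀ l, l ≠ k → y l = z l) :
    coeffCore a b c d q t y k u = coeffCore a b c d q t z k u := by
  rw [coeffCore, coeffCore]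
  congr 1
  refine Finset.prod_congr rfl fun l hl => ?_
  rw [h l (Finset.ne_of_mem_erase hl)]

theorem map_coeffCore {G : Type*} [Field G] (φ : F →+* G) (a b c d q t : F) (y : Fin m → F)
    (k : Fin m) (u : F) :
    φ (coeffCore a b c d q t y k u) =
      coeffCore (φ a) (φ b) (φ c) (φ d) (φ q) (φ t) (fun l => φ (y l)) k (φ u) := by
  simp [coeffCore, map_prod]

theorem map_weylProduct {G : Type*} [Field G] (φ : F →+* G) (y : Fin m → F) :
    φ (weylProduct y) = weylProduct fun l => φ (y l) := by
  simp [weylProduct, map_prod]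

theorem weylDenominator_eq (m : ℕ) (K : Type*) [Field K] :
    weylDenominator m K = weylProduct yVar := by
  have h (k : Fin m) : (yVar k : SeriesY m K) ^ ((k : ℤ) - (m : ℤ)) =
      (yVar k)⁻¹ * ∏ _j ∈ Finset.Ioi k, (yVar k)⁻¹ := by
    rw [Finset.prod_const, Fin.card_Ioi, ← pow_succ', inv_pow, ← zpow_natCast, ← zpow_neg]
    congr 1
    have := k.isLt
    omega
  have h1 : ∏ i : Fin m, ((yVar i : SeriesY m K)⁻¹ - yVar i) =
      (∏ i : Fin m, (yVar i)⁻¹) * ∏ i : Fin m, (1 - yVar i ^ 2) := by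
    rw [← Finset.prod_mul_distrib]
    refine Finset.prod_congr rfl fun i _ => ?_
    have := yVar_ne_zero (K := K) i
    field_simp
  have h2 : ∏ i : Fin m, ∏ j ∈ Finset.Ioi i,
      ((yVar i : SeriesY m K) + (yVar i)⁻¹ - yVar j - (yVar j)⁻¹) =
      (∏ i : Fin m, ∏ _j ∈ Finset.Ioi i, (yVar i : SeriesY m K)⁻¹) *
        ∏ i : Fin m, ∏ j ∈ Finset.Ioi i, ((1 - yVar i * yVar j) * (1 - yVar i / yVar j)) := by
    rw [← Finset.prod_mul_distrib]
    refine Finset.prod_congr rfl fun i _ => ?_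
    rw [← Finset.prod_mul_distrib]
    refine Finset.prod_congr rfl fun j _ => ?_
    have := yVar_ne_zero (K := K) i
    have := yVar_ne_zero (K := K) j
    field_simp
    ring
  rw [weylDenominator, weylProduct, Finset.prod_congr rfl fun k _ => h k,
    Finset.prod_mul_distrib, h1, h2]
  ring

end WeylFactor

/-! ### Genericity of the variables -/

section Genericity

variable {m n : ℕ} {K : Type*} [Field K]

theorem C_mul_zMono (z : K) (ν : Fin m → ℤ) :
    (HahnSeries.C z * zMono ν : SeriesY m K) = HahnSeries.single (zexpo ν) z := by
  rw [zMono, HahnSeries.C_apply, HahnSeries.single_mul_single, zero_add, mul_one]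

theorem C_mul_zMono_ne_C {ν : Fin m → ℤ} (hν : ν ≠ 0) {z : K} (hz : z ≠ 0) (w : K) :
    (HahnSeries.C z * zMono ν : SeriesY m K) ≠ HahnSeries.C w := by
  intro h
  rw [C_mul_zMono] at h
  have h1 := congrArg (fun f => HahnSeries.coeff f (zexpo ν)) h
  have h2 : zexpo ν ≠ 0 := fun h => hν (zexpo_injective (h.trans zexpo_zero.symm))
  simp [HahnSeries.coeff_single_of_ne h2, HahnSeries.C_apply] at h1
  exact hz h1

theorem zMono_injective : Function.Injective (zMono : (Fin m → ℤ) → SeriesY m K) := by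
  intro ν κ h
  by_contra hne
  have h1 : ν - κ ≠ 0 := sub_ne_zero.2 hne
  refine C_mul_zMono_ne_C (K := K) h1 one_ne_zero 1 ?_
  rw [map_one, one_mul, zMono_sub, h, div_self (zMono_ne_zero κ)]

theorem yVar_injective : Function.Injective (yVar : Fin m → SeriesY m K) := by
  intro i j h
  rw [yVar_eq, yVar_eq] at h
  have := congrFun (zMono_injective h) i
  by_contra hne
  simp [Pi.single_eq_of_ne hne] at this

theorem yVar_zpow (i : Fin m) (k : ℤ) : (yVar i : SeriesY m K) ^ k = zMono (Pi.single i k) := by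
  rw [yVar_eq, ← zMono_zsmul]
  congr 1
  rw [← Pi.single_smul]; simp

theorem single_add_single_ne_zero (i j : Fin m) :
    (Pi.single i 1 + Pi.single j 1 : Fin m → ℤ) ≠ 0 := by
  intro h
  have := congrFun h i
  by_cases hij : i = j
  · subst hij; simp at this
  · simp [Pi.single_eq_of_ne hij] at this

theorem one_sub_C_mul_yVar_ne_zero (w : K) (j : Fin m) :
    (1 - HahnSeries.C w * yVar j : SeriesY m K) ≠ 0 := by
  intro h
  by_cases hw : w = 0
  · simp [hw] at h
  · refine C_mul_zMono_ne_C (ν := Pi.single j 1) (by simp) hw 1 ?_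
    rw [← yVar_eq, map_one]
    exact (sub_eq_zero.1 h).symm

theorem xVar_ne_zero (i : Fin n) : xVar i ≠ 0 := by
  rw [xVar, Ne, IsFractionRing.to_map_eq_zero_iff]
  exact MvPolynomial.X_ne_zero i

theorem xVar_injective : Function.Injective (xVar : Fin n → RatX n) := fun _ _ h =>
  MvPolynomial.X_injective (IsFractionRing.injective (MvPolynomial (Fin n) ℂ) (RatX n) h)

theorem algebraMap_ne_of_eval_ne {f g : MvPolynomial (Fin n) ℂ}
    (h : MvPolynomial.eval 0 f ≠ MvPolynomial.eval 0 g) :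
    algebraMap _ (RatX n) f ≠ algebraMap _ (RatX n) g := fun h1 =>
  h (by rw [IsFractionRing.injective (MvPolynomial (Fin n) ℂ) (RatX n) h1])

theorem xVar_mul_ne_one (i j : Fin n) : xVar i * xVar j ≠ 1 := by
  have := algebraMap_ne_of_eval_ne (n := n) (f := .X i * .X j) (g := 1) (by simp)
  rwa [map_mul, map_one] at this

theorem algebraMap_mul_xVar_sq_ne_one (z : ℂ) (i : Fin n) :
    algebraMap ℂ (RatX n) z * xVar i ^ 2 ≠ 1 := by
  have := algebraMap_ne_of_eval_ne (n := n) (f := .C z * .X i ^ 2) (g := 1) (by simp)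
  rwa [map_mul, map_one, map_pow, ← MvPolynomial.algebraMap_eq,
    ← IsScalarTower.algebraMap_apply] at this

theorem algebraMap_mul_xVar_inv_sq_ne_one {z : ℂ} (hz : z ≠ 0) (i : Fin n) :
    algebraMap ℂ (RatX n) z * (xVar i)⁻¹ ^ 2 ≠ 1 := by
  intro h
  have hx := xVar_ne_zero i
  have := algebraMap_ne_of_eval_ne (n := n) (f := .C z) (g := .X i ^ 2) (by simpa using hz)
  rw [map_pow, ← MvPolynomial.algebraMap_eq, ← IsScalarTower.algebraMap_apply] at this
  refine this ?_
  rw [inv_pow] at h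
  exact eq_of_div_eq_one (by rw [div_eq_mul_inv]; exact h)

theorem generic_xVar_yVar {s τ : ℂ} (hs : s ≠ 0) (hτ : τ ≠ 0) :
    Generic (algebraMap ℂ (SeriesY m (RatX n)) s) (algebraMap ℂ _ τ)
      (fun i => HahnSeries.C (xVar i)) yVar := by
  have hsK : algebraMap ℂ (RatX n) s ≠ 0 := by simpa using hs
  have hτK : algebraMap ℂ (RatX n) τ ≠ 0 := by simpa using hτ
  have hC : Function.Injective (HahnSeries.C : RatX n →+* SeriesY m (RatX n)) :=
    HahnSeries.C_injective
  have h1 : ∀ k : Fin m, (Pi.single k 1 : Fin m → ℤ) ≠ 0 := fun k => by simp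
  simp only [C_eq_algebraMap']
  constructor
  · exact fun i => by simpa using xVar_ne_zero i
  · exact yVar_ne_zero
  · exact hC.comp xVar_injective
  · exact yVar_injective
  · intro i j
    rw [← map_mul, ← map_one HahnSeries.C]
    exact hC.ne (xVar_mul_ne_one i j)
  · intro i j h
    rw [yVar_eq, yVar_eq, ← zMono_add] at h
    exact C_mul_zMono_ne_C (K := RatX n) (single_add_single_ne_zero i j) one_ne_zero 1 (by
      rw [map_one, one_mul, h])
  · intro i
    rw [← map_pow, ← map_pow, ← map_pow, ← map_mul, ← map_one HahnSeries.C]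
    refine hC.ne ?_
    exact algebraMap_mul_xVar_sq_ne_one _ i
  · intro i
    rw [← map_pow, ← map_pow, ← map_inv₀, ← map_pow, ← map_mul, ← map_one HahnSeries.C]
    refine hC.ne ?_
    exact algebraMap_mul_xVar_inv_sq_ne_one (pow_ne_zero 2 hs) i
  · intro i h
    rw [← zpow_natCast (yVar i), yVar_zpow, ← map_pow, ← map_one HahnSeries.C] at h
    exact C_mul_zMono_ne_C (by simp) (pow_ne_zero 2 hsK) 1 h
  · intro i h
    rw [inv_pow, ← zpow_natCast (yVar i), ← zpow_neg, yVar_zpow, ← map_pow,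
      ← map_one HahnSeries.C] at h
    exact C_mul_zMono_ne_C (by simp) (pow_ne_zero 2 hsK) 1 h
  · intro i k h
    rw [yVar_eq, ← map_mul, ← map_mul] at h
    refine C_mul_zMono_ne_C (h1 k) one_ne_zero _ (Eq.trans ?_ h.symm)
    rw [map_one, one_mul]
  · intro i k h
    rw [yVar_eq, ← mul_assoc, ← map_mul, ← map_mul, ← map_one HahnSeries.C] at h
    exact C_mul_zMono_ne_C (h1 k) (mul_ne_zero (mul_ne_zero hsK hτK) (xVar_ne_zero i)) _ h
  · intro i k h
    rw [yVar_eq, ← map_mul] at h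
    exact C_mul_zMono_ne_C (h1 k) (xVar_ne_zero i) _ h.symm
  · intro i k h
    rw [yVar_eq, ← map_mul] at h
    exact C_mul_zMono_ne_C (h1 k) (mul_ne_zero hsK hτK) _ h

end Genericity

/-! ### Shifts of the kernel function -/

section KernelShift

variable {m n : ℕ} {K L : Type*} [Field K] [Algebra ℂ K] [Field L] [Algebra ℂ L]

/-- The factor `(q^{1/2} t^{1/2} w y_j; q)_∞ / (q^{1/2} t^{-1/2} w y_j; q)_∞` of the kernel. -/
def kernelFactor (q sq st : ℂ) (j : Fin m) (w : K) : SeriesY m K :=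
  qPochhammerY q ((sq * st) • w) j / qPochhammerY q ((sq * st⁻¹) • w) j

theorem mapHom_kernelFactor (φ : K →ₐ[ℂ] L) (q sq st : ℂ) (j : Fin m) (w : K) :
    mapHom (φ : K →+* L) (kernelFactor q sq st j w) = kernelFactor q sq st j (φ w) := by
  simp [kernelFactor, mapHom_qPochhammerY]

theorem shiftHom_kernelFactor_of_ne (q : ℂˣ) (k : ℤ) (sq st : ℂ) {i j : Fin m} (h : j ≠ i)
    (w : K) : shiftHom q k i (kernelFactor q sq st j w) = kernelFactor q sq st j w := by
  rw [kernelFactor, map_div₀, qPochhammerY, qPochhammerY, shiftHom_heval_of_ne _ _ h,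
    shiftHom_heval_of_ne _ _ h]

theorem shiftHom_kernelFactor (q : ℂˣ) (k : ℤ) (sq st : ℂ) (j : Fin m) (w : K) :
    shiftHom q k j (kernelFactor (q : ℂ) sq st j w) =
      kernelFactor (q : ℂ) sq st j ((q : ℂ) ^ k • w) := by
  rw [kernelFactor, map_div₀, qPochhammerY, qPochhammerY, shiftHom_heval_self,
    shiftHom_heval_self, kernelFactor, qPochhammerY, qPochhammerY, smul_comm _ (sq * st),
    smul_comm _ (sq * st⁻¹)]

theorem kernelFactor_smul {q : ℂ} (hq : ‖q‖ < 1) (sq st : ℂ) (j : Fin m) (w : K) :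
    kernelFactor q sq st j (q • w) * (1 - HahnSeries.C ((sq * st) • w) * yVar j) =
      kernelFactor q sq st j w * (1 - HahnSeries.C ((sq * st⁻¹) • w) * yVar j) := by
  rw [kernelFactor, kernelFactor, qPochhammerY_eq hq ((sq * st) • w),
    qPochhammerY_eq hq ((sq * st⁻¹) • w), smul_comm q, smul_comm q]
  have h1 := qPochhammerY_ne_zero hq ((sq * st⁻¹) • q • w) j
  have h2 := one_sub_C_mul_yVar_ne_zero ((sq * st⁻¹) • w) j
  generalize sq * st⁻¹ = r at *
  generalize (1 - HahnSeries.C (r • w) * yVar j : SeriesY m K) = E at *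
  field_simp

end KernelShift

section KernelRatio

variable {m n : ℕ} {K : Type*} [Field K] [Algebra ℂ K]

theorem C_smul (z : ℂ) (w : K) :
    (HahnSeries.C (z • w) : SeriesY m K) = algebraMap ℂ _ z * HahnSeries.C w := by
  rw [C_eq_algebraMap', ← map_mul, Algebra.smul_def]

theorem scaleX_algebraMap (i : Fin n) (u : ℂˣ) (f : MvPolynomial (Fin n) ℂ) :
    scaleX i u (algebraMap _ (RatX n) f) = algebraMap _ (RatX n) (scalePoly i (u : ℂ) f) :=
  IsFractionRing.algEquivOfAlgEquiv_algebraMap _ f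

theorem scaleX_xVar_self (i : Fin n) (u : ℂˣ) : scaleX i u (xVar i) = (u : ℂ) • xVar i := by
  rw [xVar, scaleX_algebraMap, scalePoly, MvPolynomial.aeval_X, if_pos rfl, Algebra.smul_def,
    map_mul, ← IsScalarTower.algebraMap_apply, ← Algebra.smul_def]

theorem scaleX_xVar_of_ne {i j : Fin n} (h : j ≠ i) (u : ℂˣ) : scaleX i u (xVar j) = xVar j := by
  rw [xVar, scaleX_algebraMap, scalePoly, MvPolynomial.aeval_X, if_neg h]

/-- The product of the two kernel factors attached to `x` and `x⁻¹`. -/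
def kernelPair (q sq st : ℂ) (j : Fin m) (w : K) : SeriesY m K :=
  kernelFactor q sq st j w * kernelFactor q sq st j w⁻¹

theorem kernelPair_inv (q sq st : ℂ) (j : Fin m) (w : K) :
    kernelPair q sq st j w⁻¹ = kernelPair q sq st j w := by
  rw [kernelPair, kernelPair, inv_inv, mul_comm]

theorem kernelPair_smul {q : ℂ} (hq : ‖q‖ < 1) (hq0 : q ≠ 0) {sq st : ℂ} (hsq : sq ^ 2 = q)
    (hst : st ≠ 0) (j : Fin m) (w : K) :
    kernelPair q sq st j (q • w) =
      ((1 - algebraMap ℂ _ sq / algebraMap ℂ _ st * (HahnSeries.C w * yVar j)) *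
        (1 - algebraMap ℂ _ st / algebraMap ℂ _ sq * (yVar j / HahnSeries.C w))) /
      ((1 - algebraMap ℂ _ sq * algebraMap ℂ _ st * (HahnSeries.C w * yVar j)) *
        (1 - yVar j / (algebraMap ℂ _ sq * algebraMap ℂ _ st * HahnSeries.C w))) *
      kernelPair q sq st j w := by
  have hsq0 : sq ≠ 0 := by rintro rfl; simp at hsq; exact hq0 hsq.symm
  have h1 := kernelFactor_smul hq sq st j w
  have h2 := kernelFactor_smul hq sq st j (q⁻¹ • w⁻¹)
  rw [smul_smul q, mul_inv_cancel₀ hq0, one_smul] at h2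
  have h3 : (q • w)⁻¹ = q⁻¹ • w⁻¹ := by
    rw [Algebra.smul_def, Algebra.smul_def, mul_inv, map_inv₀]
  have n1 := one_sub_C_mul_yVar_ne_zero ((sq * st) • w) j
  have n2 := one_sub_C_mul_yVar_ne_zero ((sq * st⁻¹) • q⁻¹ • w⁻¹) j
  have e1 : (1 - HahnSeries.C ((sq * st) • w) * yVar j : SeriesY m K) =
      1 - algebraMap ℂ _ sq * algebraMap ℂ _ st * (HahnSeries.C w * yVar j) := by
    rw [C_smul, map_mul]; ring
  have e2 : (1 - HahnSeries.C ((sq * st⁻¹) • w) * yVar j : SeriesY m K) =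
      1 - algebraMap ℂ _ sq / algebraMap ℂ _ st * (HahnSeries.C w * yVar j) := by
    rw [C_smul, map_mul, map_inv₀]; ring
  have e3 : (1 - HahnSeries.C ((sq * st) • q⁻¹ • w⁻¹) * yVar j : SeriesY m K) =
      1 - algebraMap ℂ _ st / algebraMap ℂ _ sq * (yVar j / HahnSeries.C w) := by
    rw [smul_smul, C_smul, show sq * st * q⁻¹ = st / sq by rw [← hsq]; field_simp, map_div₀,
      map_inv₀]; ring
  have e4 : (1 - HahnSeries.C ((sq * st⁻¹) • q⁻¹ • w⁻¹) * yVar j : SeriesY m K) =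
      1 - yVar j / (algebraMap ℂ _ sq * algebraMap ℂ _ st * HahnSeries.C w) := by
    rw [smul_smul, C_smul, show sq * st⁻¹ * q⁻¹ = (sq * st)⁻¹ by rw [← hsq]; field_simp, map_inv₀,
      map_inv₀, map_mul]; ring
  rw [e1] at n1
  rw [e4] at n2
  rw [e1, e2] at h1
  rw [e3, e4] at h2
  rw [kernelPair, kernelPair, h3, div_mul_eq_mul_div, eq_div_iff (mul_ne_zero n1 n2)]
  linear_combination (kernelFactor q sq st j (q⁻¹ • w⁻¹) *
    (1 - yVar j / (algebraMap ℂ _ sq * algebraMap ℂ _ st * HahnSeries.C w))) * h1 -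
    (kernelFactor q sq st j w *
      (1 - algebraMap ℂ _ sq / algebraMap ℂ _ st * (HahnSeries.C w * yVar j))) * h2

theorem prod_kernelPair_smul {q : ℂ} (hq : ‖q‖ < 1) (hq0 : q ≠ 0) {sq st : ℂ} (hsq : sq ^ 2 = q)
    (hst : st ≠ 0) (w : K) :
    ∏ j : Fin m, kernelPair q sq st j (q • w) =
      ratioX (algebraMap ℂ (SeriesY m K) sq) (algebraMap ℂ _ st) yVar (HahnSeries.C w) *
        ∏ j : Fin m, kernelPair q sq st j w := by
  rw [ratioX, ← Finset.prod_mul_distrib]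
  exact Finset.prod_congr rfl fun j _ => kernelPair_smul hq hq0 hsq hst j w

theorem kernelFunction_eq_prod_kernelPair (q sq st β : ℂ) : kernelFunction n m q sq st β =
    yMono (fun _ => (n : ℂ) * β) 1 * ∏ i : Fin n, ∏ j : Fin m,
      kernelPair q sq st j (xVar i) := rfl

theorem mapHom_scaleX_kernelFunction (q sq st β : ℂ) (i : Fin n) (u : ℂˣ) (r : SeriesY m (RatX n))
    (hr : ∏ j : Fin m, kernelPair q sq st j ((u : ℂ) • xVar i) =
      r * ∏ j : Fin m, kernelPair q sq st j (xVar i)) :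
    mapHom (scaleX i u : RatX n →+* RatX n) (kernelFunction n m q sq st β) =
      r * kernelFunction n m q sq st β := by
  have hmap : ∀ l, mapHom (scaleX i u : RatX n →+* RatX n)
      (∏ j : Fin m, kernelPair q sq st j (xVar l)) =
      ∏ j : Fin m, kernelPair q sq st j (scaleX i u (xVar l)) := by
    intro l
    rw [map_prod]
    refine Finset.prod_congr rfl fun j _ => ?_
    have h1 := mapHom_kernelFactor ((scaleX i u : RatX n ≃ₐ[ℂ] RatX n) : RatX n →ₐ[ℂ] RatX n)
      q sq st j (xVar l)
    have h2 := mapHom_kernelFactor ((scaleX i u : RatX n ≃ₐ[ℂ] RatX n) : RatX n →ₐ[ℂ] RatX n)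
      q sq st j (xVar l)⁻¹
    rw [map_inv₀] at h2
    rw [kernelPair, map_mul]
    exact congrArg₂ _ h1 h2
  rw [kernelFunction_eq_prod_kernelPair, map_mul, mapHom_yMono, map_one, mul_left_comm]
  refine congrArg _ ?_
  rw [map_prod]
  simp only [hmap]
  rw [← Finset.mul_prod_erase Finset.univ _ (Finset.mem_univ i),
    ← Finset.mul_prod_erase Finset.univ (fun l => ∏ j : Fin m, kernelPair q sq st j (xVar l))
      (Finset.mem_univ i), scaleX_xVar_self, hr, mul_assoc]
  refine congrArg _ (congrArg _ (Finset.prod_congr rfl fun l hl => ?_))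
  rw [scaleX_xVar_of_ne (Finset.ne_of_mem_erase hl)]

theorem mapHom_scaleX_one_kernelFunction {q : ℂˣ} (hq : ‖(q : ℂ)‖ < 1) {sq st : ℂ} (β : ℂ)
    (hsq : sq ^ 2 = (q : ℂ)) (hst : st ≠ 0) (i : Fin n) :
    mapHom (scaleX i (q ^ (1 : ℤ)) : RatX n →+* RatX n) (kernelFunction n m (q : ℂ) sq st β) =
      ratioX (algebraMap ℂ (SeriesY m (RatX n)) sq) (algebraMap ℂ _ st) yVar
        (HahnSeries.C (xVar i)) * kernelFunction n m (q : ℂ) sq st β := by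
  refine mapHom_scaleX_kernelFunction _ _ _ _ _ _ _ ?_
  rw [zpow_one]
  exact prod_kernelPair_smul hq q.ne_zero hsq hst _

theorem mapHom_scaleX_neg_one_kernelFunction {q : ℂˣ} (hq : ‖(q : ℂ)‖ < 1) {sq st : ℂ} (β : ℂ)
    (hsq : sq ^ 2 = (q : ℂ)) (hst : st ≠ 0) (i : Fin n) :
    mapHom (scaleX i (q ^ (-1 : ℤ)) : RatX n →+* RatX n) (kernelFunction n m (q : ℂ) sq st β) =
      ratioX (algebraMap ℂ (SeriesY m (RatX n)) sq) (algebraMap ℂ _ st) yVar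
        (HahnSeries.C (xVar i))⁻¹ * kernelFunction n m (q : ℂ) sq st β := by
  refine mapHom_scaleX_kernelFunction _ _ _ _ _ _ _ ?_
  rw [← map_inv₀]
  have h := prod_kernelPair_smul (m := m) hq q.ne_zero hsq hst (xVar i)⁻¹
  have h1 : ((q ^ (-1 : ℤ) : ℂˣ) : ℂ) • xVar i = ((q : ℂ) • (xVar i)⁻¹)⁻¹ := by
    rw [Algebra.smul_def, Algebra.smul_def, mul_inv, inv_inv]
    simp
  simp only [h1, kernelPair_inv] at h ⊢
  exact h

theorem kernelFunction_eq_kernelPair (q sq st β : ℂ) : kernelFunction n m q sq st β =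
    yMono (fun _ => (n : ℂ) * β) 1 * ∏ j : Fin m, ∏ i : Fin n,
      kernelPair q sq st j (xVar i) := by
  rw [kernelFunction_eq_prod_kernelPair, Finset.prod_comm]

theorem shiftHom_kernelFunction (q : ℂˣ) (k : ℤ) (sq st β : ℂ) (j : Fin m)
    (ρ : Fin n → SeriesY m (RatX n))
    (hρ : ∀ i, shiftHom q k j (kernelPair (q : ℂ) sq st j (xVar i)) =
      ρ i * kernelPair (q : ℂ) sq st j (xVar i)) :
    shiftHom q k j (kernelFunction n m (q : ℂ) sq st β) =
      algebraMap ℂ _ ((q : ℂ) ^ ((k : ℂ) * (n * β))) * (∏ i, ρ i) *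
        kernelFunction n m (q : ℂ) sq st β := by
  rw [kernelFunction_eq_kernelPair, map_mul, yMono, shiftHom_single, single_eq_algebraMap_mul,
    expoCoord_expo, mul_mul_mul_comm]
  congr 1
  rw [map_prod, ← Finset.mul_prod_erase _ _ (Finset.mem_univ j),
    ← Finset.mul_prod_erase _ (fun l => ∏ i : Fin n, kernelPair (q : ℂ) sq st l (xVar i))
      (Finset.mem_univ j), map_prod, Finset.prod_congr rfl fun i _ => hρ i,
    Finset.prod_mul_distrib, mul_assoc]
  congr 2
  refine Finset.prod_congr rfl fun l hl => ?_
  rw [map_prod]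
  refine Finset.prod_congr rfl fun i _ => ?_
  rw [kernelPair, map_mul, shiftHom_kernelFactor_of_ne _ _ _ _ (Finset.ne_of_mem_erase hl),
    shiftHom_kernelFactor_of_ne _ _ _ _ (Finset.ne_of_mem_erase hl)]

theorem shiftHom_one_kernelPair {q : ℂˣ} (hq : ‖(q : ℂ)‖ < 1) (sq : ℂ) {st : ℂ}
    (j : Fin m) (w : K) :
    shiftHom q 1 j (kernelPair (q : ℂ) sq st j w) =
      ((1 - algebraMap ℂ _ sq / algebraMap ℂ _ st * (yVar j * HahnSeries.C w)) *
        (1 - algebraMap ℂ _ sq / algebraMap ℂ _ st * (yVar j / HahnSeries.C w))) /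
      ((1 - algebraMap ℂ _ sq * algebraMap ℂ _ st * (yVar j * HahnSeries.C w)) *
        (1 - algebraMap ℂ _ sq * algebraMap ℂ _ st * (yVar j / HahnSeries.C w))) *
      kernelPair (q : ℂ) sq st j w := by
  have e1 (w : K) : (1 - HahnSeries.C ((sq * st) • w) * yVar j : SeriesY m K) =
      1 - algebraMap ℂ _ sq * algebraMap ℂ _ st * (yVar j * HahnSeries.C w) := by
    rw [C_smul, map_mul]; ring
  have e2 (w : K) : (1 - HahnSeries.C ((sq * st⁻¹) • w) * yVar j : SeriesY m K) =
      1 - algebraMap ℂ _ sq / algebraMap ℂ _ st * (yVar j * HahnSeries.C w) := by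
    rw [C_smul, map_mul, map_inv₀]; ring
  have h1 := kernelFactor_smul hq sq st j w
  have h2 := kernelFactor_smul hq sq st j w⁻¹
  have n1 := one_sub_C_mul_yVar_ne_zero ((sq * st) • w) j
  have n2 := one_sub_C_mul_yVar_ne_zero ((sq * st) • w⁻¹) j
  rw [e1] at n1 n2
  rw [e1, e2] at h1 h2
  rw [map_inv₀, ← div_eq_mul_inv] at h2 n2
  rw [kernelPair, map_mul, shiftHom_kernelFactor, shiftHom_kernelFactor, zpow_one,
    div_mul_eq_mul_div, eq_div_iff (mul_ne_zero n1 n2)]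
  linear_combination (kernelFactor (q : ℂ) sq st j ((q : ℂ) • w⁻¹) *
    (1 - algebraMap ℂ _ sq * algebraMap ℂ _ st * (yVar j / HahnSeries.C w))) * h1 +
    (kernelFactor (q : ℂ) sq st j w *
      (1 - algebraMap ℂ _ sq / algebraMap ℂ _ st * (yVar j * HahnSeries.C w))) * h2

theorem shiftHom_neg_one_kernelPair {q : ℂˣ} (hq : ‖(q : ℂ)‖ < 1) {sq st : ℂ}
    (hsq : sq ^ 2 = (q : ℂ)) (hst : st ≠ 0) (j : Fin m) {w : K} (hw : w ≠ 0) :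
    shiftHom q (-1) j (kernelPair (q : ℂ) sq st j w) =
      (((1 - algebraMap ℂ _ sq / algebraMap ℂ _ st * ((yVar j)⁻¹ * HahnSeries.C w)) *
        (1 - algebraMap ℂ _ sq / algebraMap ℂ _ st * ((yVar j)⁻¹ / HahnSeries.C w))) /
      ((1 - algebraMap ℂ _ sq * algebraMap ℂ _ st * ((yVar j)⁻¹ * HahnSeries.C w)) *
        (1 - algebraMap ℂ _ sq * algebraMap ℂ _ st * ((yVar j)⁻¹ / HahnSeries.C w)))) *
      algebraMap ℂ _ (st ^ 4) * kernelPair (q : ℂ) sq st j w := by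
  have hsq0 : sq ≠ 0 := by rintro rfl; simp at hsq; exact q.ne_zero hsq.symm
  have hS : algebraMap ℂ (SeriesY m K) sq ≠ 0 := by simpa using hsq0
  have hT : algebraMap ℂ (SeriesY m K) st ≠ 0 := by simpa using hst
  have hy := yVar_ne_zero (K := K) j
  have hC : ∀ w : K, w ≠ 0 → (HahnSeries.C w : SeriesY m K) ≠ 0 := fun w hw => by simpa using hw
  have key : ∀ w : K, w ≠ 0 →
      kernelFactor (q : ℂ) sq st j ((q : ℂ) ^ (-1 : ℤ) • w) *
        (1 - algebraMap ℂ _ sq * algebraMap ℂ _ st * ((yVar j)⁻¹ / HahnSeries.C w)) =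
      kernelFactor (q : ℂ) sq st j w * algebraMap ℂ _ (st ^ 2) *
        (1 - algebraMap ℂ _ sq / algebraMap ℂ _ st * ((yVar j)⁻¹ / HahnSeries.C w)) := by
    intro w hw
    have h := kernelFactor_smul hq sq st j ((q : ℂ)⁻¹ • w)
    rw [smul_smul, mul_inv_cancel₀ q.ne_zero, one_smul, smul_smul, smul_smul, C_smul, C_smul,
      show sq * st * (q : ℂ)⁻¹ = st / sq by rw [← hsq]; field_simp,
      show sq * st⁻¹ * (q : ℂ)⁻¹ = (sq * st)⁻¹ by rw [← hsq]; field_simp, map_div₀, map_inv₀,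
      map_mul] at h
    have hw' := hC w hw
    rw [zpow_neg_one, map_pow]
    generalize kernelFactor (q : ℂ) sq st j w = A at *
    generalize kernelFactor (q : ℂ) sq st j ((q : ℂ)⁻¹ • w) = B at *
    generalize algebraMap ℂ (SeriesY m K) sq = S at *
    generalize algebraMap ℂ (SeriesY m K) st = T at *
    generalize (yVar j : SeriesY m K) = y at *
    generalize (HahnSeries.C w : SeriesY m K) = x at *
    field_simp at h ⊢
    linear_combination h
  have hne : ∀ w : K, w ≠ 0 → (1 - algebraMap ℂ _ sq * algebraMap ℂ _ st *
      ((yVar j)⁻¹ / HahnSeries.C w) : SeriesY m K) ≠ 0 := by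
    intro w hw h
    have hw' := hC w hw
    have := one_sub_C_mul_yVar_ne_zero ((sq * st)⁻¹ • w) j
    rw [C_smul, map_inv₀, map_mul] at this
    refine this ?_
    field_simp at h ⊢
    linear_combination -h
  have h1 := key w hw
  have h2 := key w⁻¹ (inv_ne_zero hw)
  have n1 := hne w hw
  have n2 := hne w⁻¹ (inv_ne_zero hw)
  rw [map_inv₀, div_inv_eq_mul] at h2 n2
  rw [kernelPair, map_mul, shiftHom_kernelFactor, shiftHom_kernelFactor,
    div_mul_eq_mul_div, div_mul_eq_mul_div, eq_div_iff (mul_ne_zero n2 n1),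
    show st ^ 4 = st ^ 2 * st ^ 2 by ring, map_mul]
  linear_combination (kernelFactor (q : ℂ) sq st j ((q : ℂ) ^ (-1 : ℤ) • w⁻¹) *
    (1 - algebraMap ℂ _ sq * algebraMap ℂ _ st * ((yVar j)⁻¹ * HahnSeries.C w))) * h1 +
    (kernelFactor (q : ℂ) sq st j w * algebraMap ℂ _ (st ^ 2) *
      (1 - algebraMap ℂ _ sq / algebraMap ℂ _ st * ((yVar j)⁻¹ / HahnSeries.C w))) * h2

theorem shiftHom_one_kernelFunction {q : ℂˣ} (hq : ‖(q : ℂ)‖ < 1) {sq st β : ℂ}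
    (hβ : st ^ 2 = (q : ℂ) ^ β) (j : Fin m) :
    shiftHom q 1 j (kernelFunction n m (q : ℂ) sq st β) =
      ratioY (algebraMap ℂ (SeriesY m (RatX n)) sq) (algebraMap ℂ _ st)
        (fun i => HahnSeries.C (xVar i)) (yVar j) * kernelFunction n m (q : ℂ) sq st β := by
  rw [shiftHom_kernelFunction q 1 sq st β j _ fun i => shiftHom_one_kernelPair hq sq j (xVar i)]
  congr 1
  have h : ((1 : ℤ) : ℂ) * (n * β) = n * β := by push_cast; ring
  simp only [ratioY, mul_div_assoc]
  rw [Finset.prod_mul_distrib (f := fun _ => algebraMap ℂ (SeriesY m (RatX n)) st ^ 2),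
    Finset.prod_const, Finset.card_univ, Fintype.card_fin, h, Complex.cpow_nat_mul, ← hβ]
  simp only [map_pow]

theorem shiftHom_neg_one_kernelFunction {q : ℂˣ} (hq : ‖(q : ℂ)‖ < 1) {sq st β : ℂ}
    (hsq : sq ^ 2 = (q : ℂ)) (hst : st ≠ 0) (hβ : st ^ 2 = (q : ℂ) ^ β) (j : Fin m) :
    shiftHom q (-1) j (kernelFunction n m (q : ℂ) sq st β) =
      ratioY (algebraMap ℂ (SeriesY m (RatX n)) sq) (algebraMap ℂ _ st)
        (fun i => HahnSeries.C (xVar i)) (yVar j)⁻¹ * kernelFunction n m (q : ℂ) sq st β := by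
  rw [shiftHom_kernelFunction q (-1) sq st β j _ fun i =>
    shiftHom_neg_one_kernelPair hq hsq hst j (xVar_ne_zero i)]
  congr 1
  have h : (q : ℂ) ^ (((-1 : ℤ) : ℂ) * (n * β)) = ((st ^ 2) ^ n)⁻¹ := by
    rw [hβ, ← Complex.cpow_nat_mul, ← Complex.cpow_neg]; congr 1; push_cast; ring
  have hT : algebraMap ℂ (SeriesY m (RatX n)) st ≠ 0 := by simpa using hst
  simp only [ratioY, mul_div_assoc]
  rw [Finset.prod_mul_distrib (f := fun _ => algebraMap ℂ (SeriesY m (RatX n)) st ^ 2),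
    Finset.prod_mul_distrib (g := fun _ => algebraMap ℂ (SeriesY m (RatX n)) (st ^ 4)),
    Finset.prod_const, Finset.prod_const, Finset.card_univ, Fintype.card_fin, h]
  rw [mul_left_comm, mul_comm]
  congr 1
  rw [← map_pow, ← map_mul, ← map_pow, ← map_pow]
  congr 1
  field_simp
  ring

end KernelRatio

/-! ### The adjoint operator on series -/

section ShiftAdjoint

variable {m : ℕ} {K : Type*} [Field K] [Algebra ℂ K]

theorem algebraMap_mul_zMono_ne {ν : Fin m → ℤ} (hν : ν ≠ 0) {z : ℂ} (hz : z ≠ 0) (w : ℂ) :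
    (algebraMap ℂ (SeriesY m K) z * zMono ν) ≠ algebraMap ℂ _ w := by
  rw [C_eq_algebraMap', C_eq_algebraMap']
  exact C_mul_zMono_ne_C hν (by simpa using hz) _

theorem algebraMap_mul_zMono_ne_zMono {ν κ : Fin m → ℤ} (h : ν ≠ κ) {z : ℂ} (hz : z ≠ 0) :
    (algebraMap ℂ (SeriesY m K) z * zMono ν) ≠ zMono κ := by
  intro h1
  refine algebraMap_mul_zMono_ne (K := K) (sub_ne_zero.2 h) hz 1 ?_
  rw [zMono_sub, ← mul_div_assoc, h1, div_self (zMono_ne_zero _), map_one]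

/-- Conjugating a term of the Koornwinder operator by the Weyl denominator and taking its adjoint;
here `ε` and `u = y_k ^ ε` single out one of the `2m` terms. -/
theorem shiftHom_coeffCore_mul_weylDenominator {q : ℂˣ} {a b c d s τ α : ℂ}
    (ha : a ≠ 0) (hb : b ≠ 0) (hc : c ≠ 0) (hd : d ≠ 0)
    (hα : α ^ 2 * s ^ 2 = a * b * c * d) (hs : s ^ 2 = q) (hτ : τ ≠ 0) (k : Fin m) {ε : ℤ}
    (hε : ε = 1 ∨ ε = -1) {A B C D S T : SeriesY m K} (hA : A = algebraMap ℂ _ a)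
    (hB : B = algebraMap ℂ _ b) (hC : C = algebraMap ℂ _ c) (hD : D = algebraMap ℂ _ d)
    (hS : S = algebraMap ℂ _ s) (hT : T = algebraMap ℂ _ τ) :
    shiftHom q (-ε) k (algebraMap ℂ _ α / (T ^ 2) ^ m *
        coeffCore (S * T / A) (S * T / B) (S * T / C) (S * T / D) (S ^ 2) (T ^ 2) yVar k
          (yVar k ^ ε) * weylDenominator m K) =
      weylDenominator m K * ((algebraMap ℂ _ α * (S ^ 2 / T ^ 2) ^ m)⁻¹ *
        coeffCore (S / T * A) (S / T * B) (S / T * C) (S / T * D) (S ^ 2) (S ^ 2 / T ^ 2) yVar k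
          (yVar k ^ (-ε))) := by
  have hs0 : s ≠ 0 := by rintro rfl; simp at hs; exact q.ne_zero hs.symm
  have hε0 : ε ≠ 0 := by omega
  have hu : (yVar k : SeriesY m K) ^ ε = zMono (Pi.single k ε) := yVar_zpow k ε
  have hsub : Function.update yVar k (algebraMap ℂ _ ((q : ℂ) ^ (-ε)) * yVar k) =
      fun l => shiftHom q (-ε) k (yVar l : SeriesY m K) := by
    funext l
    by_cases h : l = k
    · subst h; rw [Function.update_self, shiftHom_yVar_self]
    · rw [Function.update_of_ne h, shiftHom_yVar_of_ne _ _ h]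
  have hTu : shiftHom q (-ε) k ((yVar k : SeriesY m K) ^ ε) = yVar k ^ ε / S ^ 2 := by
    rw [hS, ← map_pow, hs, hu, shiftHom_zMono, div_eq_mul_inv, ← map_inv₀, mul_comm]
    congr 2
    rcases hε with rfl | rfl <;> simp
  have hV : shiftHom q (-ε) k (weylDenominator m K) * weylFactor yVar k (yVar k ^ ε) =
      weylDenominator m K * weylFactor yVar k (yVar k ^ ε / S ^ 2) := by
    have h := weylProduct_update (yVar : Fin m → SeriesY m K) k
      (algebraMap ℂ _ ((q : ℂ) ^ (-ε)) * yVar k)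
    rw [hsub, ← map_weylProduct, ← weylDenominator_eq] at h
    rw [← hTu]
    rcases hε with rfl | rfl
    · rw [zpow_one, h, shiftHom_yVar_self]
    · rw [zpow_neg_one, weylFactor_inv, map_inv₀, weylFactor_inv, mul_neg, h, shiftHom_yVar_self,
        mul_neg]
  have hpow : ∀ r : ℕ, ((yVar k : SeriesY m K) ^ ε) ^ r = zMono (Pi.single k (ε * r)) := by
    intro r
    rw [← zpow_natCast, ← zpow_mul, yVar_zpow]
  have n1 : 1 - ((yVar k : SeriesY m K) ^ ε) ^ 2 ≠ 0 := by
    rw [hpow]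
    intro h
    refine algebraMap_mul_zMono_ne (K := K) (ν := Pi.single k (ε * (2 : ℕ))) (by simp [hε0])
      one_ne_zero 1 ?_
    rw [map_one, one_mul]; exact (sub_eq_zero.1 h).symm
  have n2 : S ^ 2 - ((yVar k : SeriesY m K) ^ ε) ^ 2 ≠ 0 := by
    rw [hpow, hS, ← map_pow]
    intro h
    refine algebraMap_mul_zMono_ne (K := K) (ν := Pi.single k (ε * (2 : ℕ))) (by simp [hε0])
      one_ne_zero (s ^ 2) ?_
    rw [map_one, one_mul]; exact (sub_eq_zero.1 h).symm
  have n3 : S ^ 4 - ((yVar k : SeriesY m K) ^ ε) ^ 2 ≠ 0 := by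
    rw [hpow, hS, ← map_pow]
    intro h
    refine algebraMap_mul_zMono_ne (K := K) (ν := Pi.single k (ε * (2 : ℕ))) (by simp [hε0])
      one_ne_zero (s ^ 4) ?_
    rw [map_one, one_mul]; exact (sub_eq_zero.1 h).symm
  have n4 : ∀ l ∈ Finset.univ.erase k, 1 - (yVar k : SeriesY m K) ^ ε * yVar l ≠ 0 ∧
      yVar l - (yVar k : SeriesY m K) ^ ε ≠ 0 ∧ S ^ 2 - (yVar k : SeriesY m K) ^ ε * yVar l ≠ 0 ∧
      S ^ 2 * yVar l - (yVar k : SeriesY m K) ^ ε ≠ 0 := by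
    intro l hl
    have hl := Finset.ne_of_mem_erase hl
    have hne : (Pi.single k ε + Pi.single l 1 : Fin m → ℤ) ≠ 0 := by
      intro h
      have := congrFun h l
      simp [Pi.single_eq_of_ne hl] at this
    have hne2 : (Pi.single l 1 : Fin m → ℤ) ≠ Pi.single k ε := by
      intro h
      have := congrFun h l
      simp [Pi.single_eq_of_ne hl] at this
    rw [hu, yVar_eq l, ← zMono_add, hS, ← map_pow]
    refine ⟨?_, ?_, ?_, ?_⟩ <;> intro h <;> rw [sub_eq_zero] at h
    · refine algebraMap_mul_zMono_ne (K := K) hne one_ne_zero 1 ?_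
      rw [map_one, one_mul, h]
    · refine algebraMap_mul_zMono_ne_zMono (K := K) hne2 one_ne_zero ?_
      rw [map_one, one_mul, h]
    · refine algebraMap_mul_zMono_ne (K := K) hne one_ne_zero (s ^ 2) ?_
      rw [map_one, one_mul, h]
    · exact algebraMap_mul_zMono_ne_zMono (K := K) hne2 (pow_ne_zero 2 hs0) h
  have hy0 : (yVar k : SeriesY m K) ^ ε ≠ 0 := zpow_ne_zero _ (yVar_ne_zero k)
  have hw : weylFactor yVar k ((yVar k : SeriesY m K) ^ ε) ≠ 0 := by
    refine mul_ne_zero ?_ (Finset.prod_ne_zero_iff.2 fun l hl => ?_)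
    · intro h
      refine n1 ?_
      generalize (yVar k : SeriesY m K) ^ ε = u at *
      field_simp at h
      linear_combination h
    · obtain ⟨g1, g2, -, -⟩ := n4 l hl
      have := yVar_ne_zero (K := K) l
      intro h
      refine mul_ne_zero g1 g2 ?_
      generalize (yVar k : SeriesY m K) ^ ε = u at *
      field_simp at h
      linear_combination h
  have hmap : ∀ z : ℂ, shiftHom q (-ε) k (algebraMap ℂ (SeriesY m K) z) = algebraMap ℂ _ z :=
    fun z => shiftHom_algebraMap q _ k z
  have hne0 : ∀ z : ℂ, z ≠ 0 → algebraMap ℂ (SeriesY m K) z ≠ 0 := fun z hz => by simpa using hz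
  have hmain := coeffCore_mul_weylFactor (F := SeriesY m K) (y := yVar) (k := k)
    (a := A) (b := B) (c := C) (d := D) (s := S) (τ := T) (α := algebraMap ℂ _ α)
    (hA ▸ hne0 a ha) (hB ▸ hne0 b hb) (hC ▸ hne0 c hc) (hD ▸ hne0 d hd)
    (by rw [hA, hB, hC, hD, hS, ← map_pow, ← map_pow, ← map_mul, hα]; simp only [map_mul])
    (hS ▸ hne0 s hs0) (hT ▸ hne0 τ hτ) yVar_ne_zero hy0 n1 n2 n3 n4
  refine mul_right_cancel₀ hw ?_
  rw [map_mul, map_mul, map_coeffCore, hTu, coeffCore_congr (z := yVar)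
    fun l hl => shiftHom_yVar_of_ne q (-ε) hl, mul_assoc, hV]
  simp only [map_div₀, map_mul, map_pow, hA, hB, hC, hD, hS, hT, hmap] at hmain ⊢
  rw [zpow_neg]
  linear_combination weylDenominator m K * hmain

end ShiftAdjoint

/-! ### Matching of the eigenvalues -/

section Eigenvalues

/-- The eigenvalue of the dual eigenseries, corrected by the constant of the adjoint and by the
constants of the kernel identity, is the eigenvalue in `x`. -/
theorem sum_bracket_dual {n m : ℕ} (hmn : m ≤ n) {q : ℂˣ} {t α β : ℂ}
    (hα : α ≠ 0) (ht : t ≠ 0) (hβ : t = (q : ℂ) ^ β) (lam : Fin m → ℕ) (e s : Fin m → ℂ)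
    (he : ∀ i, e i = -(lam i.rev : ℂ) + ((m : ℂ) - ((i : ℕ) : ℂ)) - (n : ℂ) * β)
    (hs : ∀ i, s i = ((q : ℂ) / t) ^ (-(m : ℤ) + ((i : ℕ) : ℤ) + 1) * (q : ℂ) ^ e i) :
    (∑ i : Fin m, bracket (α * t ^ (n - 1 - (i : ℕ)) * (q : ℂ) ^ lam i)
        (α * t ^ (n - 1 - (i : ℕ)))) =
      (∑ i : Fin m, bracket ((q : ℂ) * α / t * (s i)⁻¹)
        ((q : ℂ) * α / t * ((q : ℂ) / t) ^ (m - 1 - (i : ℕ)))) +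
      ((1 - t ^ n) * (α / t * ∑ j ∈ Finset.range m, t⁻¹ ^ j -
        (t ^ n)⁻¹ * t / α * ∑ j ∈ Finset.range m, t ^ j)) -
      ((α / t ^ m + t / α) * (∑ j ∈ Finset.range m, t ^ j) -
      ((α * ((q : ℂ) / t) ^ m)⁻¹ + α * ((q : ℂ) / t)) *
        (∑ j ∈ Finset.range m, ((q : ℂ) / t) ^ j)) := by
  have hq := q.ne_zero
  have key : ∀ i : Fin m, (q : ℂ) * α / t * (s i)⁻¹ =
      α * t ^ (n - 1 - (i.rev : ℕ)) * (q : ℂ) ^ lam i.rev := by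
    intro i
    have hi := i.isLt
    have hrev : n - 1 - (i.rev : ℕ) = n - (m - i) := by rw [Fin.val_rev]; omega
    have h1 : ((q : ℂ) / t) ^ (-(m : ℤ) + ((i : ℕ) : ℤ) + 1) =
        (((q : ℂ) / t) ^ (m - (i : ℕ)))⁻¹ * (q / t) := by
      rw [zpow_add_one₀ (div_ne_zero hq ht)]
      congr 1
      rw [← zpow_natCast, ← zpow_neg]
      congr 1
      push_cast [hi.le]
      ring
    have h2 : (q : ℂ) ^ e i = ((q : ℂ) ^ lam i.rev)⁻¹ * (q : ℂ) ^ (m - (i : ℕ)) * (t ^ n)⁻¹ := by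
      rw [he, Complex.cpow_sub _ _ hq, Complex.cpow_add _ _ hq, Complex.cpow_neg,
        Complex.cpow_natCast, Complex.cpow_nat_mul, ← hβ, div_eq_mul_inv]
      congr 2
      rw [← Complex.cpow_natCast]
      congr 1
      push_cast [hi.le]
      ring
    have h3 : t ^ n = t ^ (n - (m - (i : ℕ))) * t ^ (m - (i : ℕ)) := by
      rw [← pow_add]; congr 1; omega
    rw [hs, h1, h2, hrev, h3, div_pow]
    field_simp
  have hrefl : ∀ f : Fin m → ℂ, ∑ i : Fin m, f i.rev = ∑ i, f i := fun f =>
    Equiv.sum_comp Fin.revPerm f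
  have hsplit : ∀ x y : ℂ, bracket x y = (x + x⁻¹) - (y + y⁻¹) := fun x y => by
    rw [bracket]; ring
  simp only [hsplit, Finset.sum_sub_distrib, key]
  rw [hrefl fun j => α * t ^ (n - 1 - (j : ℕ)) * (q : ℂ) ^ lam j +
    (α * t ^ (n - 1 - (j : ℕ)) * (q : ℂ) ^ lam j)⁻¹]
  have hhat : ∑ i : Fin m, ((q : ℂ) * α / t * ((q : ℂ) / t) ^ (m - 1 - (i : ℕ)) +
      ((q : ℂ) * α / t * ((q : ℂ) / t) ^ (m - 1 - (i : ℕ)))⁻¹) =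
      ((α * ((q : ℂ) / t) ^ m)⁻¹ + α * ((q : ℂ) / t)) *
        (∑ j ∈ Finset.range m, ((q : ℂ) / t) ^ j) := by
    have hr : (q : ℂ) / t ≠ 0 := div_ne_zero hq ht
    have e1 : ∀ x : ℂ, (q : ℂ) * α / t * x = α * ((q : ℂ) / t) * x := fun x => by ring
    simp only [e1]
    generalize (q : ℂ) / t = r at *
    rw [Finset.sum_add_distrib, add_comm, add_mul]
    congr 1
    · rw [Finset.mul_sum, ← Fin.sum_univ_eq_sum_range
        (fun j => (α * r ^ m)⁻¹ * r ^ j)]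
      refine Finset.sum_congr rfl fun i _ => ?_
      have hi := i.isLt
      have : r ^ m = r ^ (m - 1 - (i : ℕ)) * r * r ^ (i : ℕ) := by
        rw [← pow_succ, ← pow_add]; congr 1; omega
      rw [this]
      field_simp
    · rw [← hrefl, Finset.mul_sum, ← Fin.sum_univ_eq_sum_range (fun j => α * r * r ^ j)]
      refine Finset.sum_congr rfl fun i _ => ?_
      have hi := i.isLt
      congr 2
      rw [Fin.val_rev]; omega
  have hx : ∑ i : Fin m, (α * t ^ (n - 1 - (i : ℕ)) + (α * t ^ (n - 1 - (i : ℕ)))⁻¹) =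
      (α * t ^ n / t ^ m + t / (α * t ^ n)) * ∑ j ∈ Finset.range m, t ^ j := by
    rw [Finset.sum_add_distrib, add_mul]
    congr 1
    · rw [← hrefl, Finset.mul_sum,
        ← Fin.sum_univ_eq_sum_range (fun j => α * t ^ n / t ^ m * t ^ j)]
      refine Finset.sum_congr rfl fun i _ => ?_
      have hi := i.isLt
      have h1 : n - 1 - (i.rev : ℕ) = (n - m) + i := by rw [Fin.val_rev]; omega
      have h2 : t ^ n = t ^ (n - m) * t ^ m := by rw [← pow_add]; congr 1; omega
      rw [h1, h2, pow_add]
      field_simp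
    · rw [Finset.mul_sum, ← Fin.sum_univ_eq_sum_range (fun j => t / (α * t ^ n) * t ^ j)]
      refine Finset.sum_congr rfl fun i _ => ?_
      have hi := i.isLt
      have : t ^ n = t ^ (n - 1 - (i : ℕ)) * t * t ^ (i : ℕ) := by
        rw [← pow_succ, ← pow_add]; congr 1; omega
      rw [this]
      field_simp
  have hinv : α / t * ∑ j ∈ Finset.range m, t⁻¹ ^ j =
      α / t ^ m * ∑ j ∈ Finset.range m, t ^ j := by
    rw [← Finset.sum_range_reflect (fun j => t ^ j), Finset.mul_sum, Finset.mul_sum]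
    refine Finset.sum_congr rfl fun j hj => ?_
    have hj := Finset.mem_range.1 hj
    have : t ^ m = t ^ (m - 1 - j) * t * t ^ j := by
      rw [← pow_succ, ← pow_add]; congr 1; omega
    rw [this, inv_pow]
    field_simp
  rw [hhat, hx, hinv]
  generalize (∑ j ∈ Finset.range m, t ^ j) = S
  generalize (∑ j ∈ Finset.range m, ((q : ℂ) / t) ^ j) = S'
  generalize ((α * ((q : ℂ) / t) ^ m)⁻¹ + α * ((q : ℂ) / t)) = U
  field_simp
  ring

end Eigenvalues

/-! ### The constant term is an eigenfunction -/

section ConstantTerm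

variable {m n : ℕ} {K : Type*} [Field K]

theorem coeff_C_mul' (z : K) (G : SeriesY m K) (γ : Expo m) :
    (HahnSeries.C z * G).coeff γ = z * G.coeff γ := by
  rw [HahnSeries.C_mul_eq_smul, HahnSeries.coeff_smul, smul_eq_mul]

theorem coeff_sum' {ι : Type*} (s : Finset ι) (G : ι → SeriesY m K) (γ : Expo m) :
    (∑ i ∈ s, G i).coeff γ = ∑ i ∈ s, (G i).coeff γ := by
  rw [HahnSeries.coeff_sum]

variable [Algebra ℂ K]

theorem coeff_algebraMap_mul (z : ℂ) (G : SeriesY m K) (γ : Expo m) :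
    (algebraMap ℂ (SeriesY m K) z * G).coeff γ = z • G.coeff γ := by
  rw [C_eq_algebraMap', HahnSeries.C_mul_eq_smul, HahnSeries.coeff_smul, smul_eq_mul,
    ← Algebra.smul_def]

/-- The behaviour of a kernel function `Ψ` with respect to the shifts `σ` in the variables `x`
and the shifts in the variables `y`, with `S = q^{1/2}` and `T = t^{1/2}`. -/
structure IsKernel (q : ℂˣ) (x : Fin n → K) (σ : ℤ → Fin n → K →ₐ[ℂ] K) (S T : SeriesY m K)
    (Ψ : SeriesY m K) : Prop where
  shift_x : ∀ i, mapHom (σ 1 i : K →+* K) Ψ = ratioX S T yVar (HahnSeries.C (x i)) * Ψ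
  shift_x_inv : ∀ i, mapHom (σ (-1) i : K →+* K) Ψ = ratioX S T yVar (HahnSeries.C (x i))⁻¹ * Ψ
  shift_y : ∀ k, shiftHom q 1 k Ψ = ratioY S T (fun i => HahnSeries.C (x i)) (yVar k) * Ψ
  shift_y_inv : ∀ k, shiftHom q (-1) k Ψ =
    ratioY S T (fun i => HahnSeries.C (x i)) (yVar k)⁻¹ * Ψ

/-- The Koornwinder operator in `x`, applied to the constant term of a product `Ψ G` where `G`
does not involve `x`. -/
theorem koornwinderOp_coeff_zero {p : Params} {sq st : ℂ}
    (hsq : sq ^ 2 = (p.q : ℂ)) (hst2 : st ^ 2 = p.t)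
    {x : Fin n → K} {σ : ℤ → Fin n → K →ₐ[ℂ] K} {Ψ : SeriesY m K} (G : SeriesY m K)
    (hG : ∀ (k : ℤ) (i : Fin n), mapHom (σ k i : K →+* K) G = G)
    {A B C D S T : SeriesY m K} (hΨ : IsKernel p.q x σ S T Ψ) (hA : A = algebraMap ℂ _ p.a)
    (hB : B = algebraMap ℂ _ p.b) (hC : C = algebraMap ℂ _ p.c) (hD : D = algebraMap ℂ _ p.d)
    (hS : S = algebraMap ℂ _ sq) (hT : T = algebraMap ℂ _ st) :
    koornwinderOp p x (fun k i => σ k i) ((Ψ * G).coeff 0) =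
      (((algebraMap ℂ _ p.α * (T ^ 2) ^ (n - 1))⁻¹ *
        ∑ i, (coeffCore A B C D (S ^ 2) (T ^ 2) (fun i => HahnSeries.C (x i)) i
          (HahnSeries.C (x i)) * (ratioX S T yVar (HahnSeries.C (x i)) - 1) +
        coeffCore A B C D (S ^ 2) (T ^ 2) (fun i => HahnSeries.C (x i)) i
          (HahnSeries.C (x i))⁻¹ * (ratioX S T yVar (HahnSeries.C (x i))⁻¹ - 1))) *
        (Ψ * G)).coeff 0 := by
  have hop : ∀ (i : Fin n) (u : K), (HahnSeries.C (opCoeff p x i u) : SeriesY m K) =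
      (algebraMap ℂ _ p.α * (T ^ 2) ^ (n - 1))⁻¹ *
        coeffCore A B C D (S ^ 2) (T ^ 2) (fun i => HahnSeries.C (x i)) i (HahnSeries.C u) := by
    intro i u
    rw [opCoeff_eq_coeffCore, map_mul, map_coeffCore (HahnSeries.C : K →+* SeriesY m K), map_inv₀,
      hA, hB, hC, hD, hS, hT, ← map_pow, ← map_pow, ← map_pow, ← map_mul, hsq, hst2]
    simp only [C_eq_algebraMap']
  have h1 : ∀ (i : Fin n) (k : ℤ) (r : SeriesY m K) (u : K),
      mapHom (σ k i : K →+* K) Ψ = r * Ψ →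
      opCoeff p x i u * (σ k i ((Ψ * G).coeff 0) - (Ψ * G).coeff 0) =
      ((algebraMap ℂ _ p.α * (T ^ 2) ^ (n - 1))⁻¹ *
        (coeffCore A B C D (S ^ 2) (T ^ 2) (fun i => HahnSeries.C (x i)) i (HahnSeries.C u) *
          (r - 1)) * (Ψ * G)).coeff 0 := by
    intro i k r u hr
    have h2 : σ k i ((Ψ * G).coeff 0) = (r * Ψ * G).coeff 0 := by
      rw [← hr]
      conv_rhs => rw [← hG k i, ← map_mul]
      rfl
    rw [h2, ← HahnSeries.coeff_sub, ← coeff_C_mul', hop]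
    exact congrArg (fun G => HahnSeries.coeff G 0) (by ring)
  rw [koornwinderOp, ← Finset.sum_add_distrib, Finset.mul_sum, Finset.sum_mul, coeff_sum']
  refine Finset.sum_congr rfl fun i _ => ?_
  rw [h1 i 1 _ (x i) (hΨ.shift_x i), h1 i (-1) _ (x i)⁻¹ (hΨ.shift_x_inv i),
    ← HahnSeries.coeff_add, map_inv₀]
  exact congrArg (fun G => HahnSeries.coeff G 0) (by ring)

/-- The kernel identity divided by `α t^n`, where `u = t^{n-1}` and `v = t^m`, where `X` and `Y` are
the sums over the two sets of variables, and `N`, `M`, `M'` the geometric sums. -/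
theorem kernel_constants {F : Type*} [Field F] {α t u v X Y N M M' : F} (hα : α ≠ 0) (ht : t ≠ 0)
    (hu : u ≠ 0) (hv : v ≠ 0)
    (h : t * X - α ^ 2 * (u * t / v) * Y + (1 - t) * t * (N * M) =
      (1 - t) * α ^ 2 * u * (N * M')) :
    (α * u)⁻¹ * X = α / v * Y + (1 - t) * N * (α / t * M' - (u * t)⁻¹ * t / α * M) := by
  have hX : X = (α ^ 2 * (u * t / v) * Y - (1 - t) * t * (N * M) +
      (1 - t) * α ^ 2 * u * (N * M')) / t := by
    rw [eq_div_iff ht]; linear_combination h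
  rw [hX]
  field_simp
  ring

/-- The constant term of a kernel function times the Weyl denominator times a dual eigenseries
is an eigenfunction of the Koornwinder operator in `x`. -/
theorem koornwinderOp_constantTerm (hm : 0 < m) (hmn : m ≤ n)
    {p : Params} {sq st β : ℂ}
    (ha : p.a ≠ 0) (hb : p.b ≠ 0) (hc : p.c ≠ 0) (hd : p.d ≠ 0)
    (hα : p.α ^ 2 = p.a * p.b * p.c * p.d / (p.q : ℂ))
    (hβ : p.t = (p.q : ℂ) ^ β) (hsq : sq ^ 2 = (p.q : ℂ)) (hst : st ^ 2 = p.t)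
    (lam : Fin m → ℕ) (e s : Fin m → ℂ)
    (he : ∀ i, e i = -(lam i.rev : ℂ) + ((m : ℂ) - ((i : ℕ) : ℂ)) - (n : ℂ) * β)
    (hs : ∀ i, s i = ((p.q : ℂ) / p.t) ^ (-(m : ℤ) + ((i : ℕ) : ℤ) + 1) * (p.q : ℂ) ^ e i)
    (f : SeriesY m ℂ)
    (hf : opY (p.hat (sq / st)) f = (∑ i : Fin m, bracket ((p.hat (sq / st)).α * (s i)⁻¹)
      ((p.hat (sq / st)).α * (p.hat (sq / st)).t ^ (m - 1 - (i : ℕ)))) • f)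
    {x : Fin n → K} {σ : ℤ → Fin n → K →ₐ[ℂ] K} {Ψ : SeriesY m K}
    (hg : Generic (algebraMap ℂ (SeriesY m K) sq) (algebraMap ℂ _ st)
      (fun i : Fin n => HahnSeries.C (x i)) (yVar : Fin m → _))
    (hΨ : IsKernel p.q x σ (algebraMap ℂ _ sq) (algebraMap ℂ _ st) Ψ) :
    koornwinderOp p x (fun k i => σ k i)
      ((Ψ * weylDenominator m K * mapHom (algebraMap ℂ K) f).coeff 0) =
    (∑ i : Fin m, bracket (p.α * p.t ^ (n - 1 - (i : ℕ)) * (p.q : ℂ) ^ lam i)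
      (p.α * p.t ^ (n - 1 - (i : ℕ)))) •
    (Ψ * weylDenominator m K * mapHom (algebraMap ℂ K) f).coeff 0 := by
  have hq0 := p.q.ne_zero
  have ht0 : p.t ≠ 0 := by rw [hβ]; exact cpow_unit_ne_zero _ _
  have hst0 : st ≠ 0 := by rintro rfl; exact ht0 (by rw [← hst]; simp)
  have hsq0 : sq ≠ 0 := by rintro rfl; exact hq0 (by rw [← hsq]; simp)
  have hα0 : p.α ≠ 0 := by
    intro h
    rw [h] at hα
    have : p.a * p.b * p.c * p.d / (p.q : ℂ) ≠ 0 := by simp [ha, hb, hc, hd]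
    exact this (by rw [← hα]; simp)
  have hαs : p.α ^ 2 * sq ^ 2 = p.a * p.b * p.c * p.d := by
    rw [hα, hsq]; field_simp
  have hinj : ∀ z : ℂ, z ≠ 0 → algebraMap ℂ (SeriesY m K) z ≠ 0 := fun z hz => by
    simpa using hz
  obtain ⟨A, hA⟩ : ∃ A, A = algebraMap ℂ (SeriesY m K) p.a := ⟨_, rfl⟩
  obtain ⟨B, hB⟩ : ∃ A, A = algebraMap ℂ (SeriesY m K) p.b := ⟨_, rfl⟩
  obtain ⟨C, hC⟩ : ∃ A, A = algebraMap ℂ (SeriesY m K) p.c := ⟨_, rfl⟩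
  obtain ⟨D, hD⟩ : ∃ A, A = algebraMap ℂ (SeriesY m K) p.d := ⟨_, rfl⟩
  obtain ⟨S, hS⟩ : ∃ A, A = algebraMap ℂ (SeriesY m K) sq := ⟨_, rfl⟩
  obtain ⟨T, hT⟩ : ∃ A, A = algebraMap ℂ (SeriesY m K) st := ⟨_, rfl⟩
  obtain ⟨α, hα'⟩ : ∃ A, A = algebraMap ℂ (SeriesY m K) p.α := ⟨_, rfl⟩
  have hA0 : A ≠ 0 := hA ▸ hinj _ ha
  have hB0 : B ≠ 0 := hB ▸ hinj _ hb
  have hC0 : C ≠ 0 := hC ▸ hinj _ hc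
  have hD0 : D ≠ 0 := hD ▸ hinj _ hd
  have hS0 : S ≠ 0 := hS ▸ hinj _ hsq0
  have hT0 : T ≠ 0 := hT ▸ hinj _ hst0
  have hα1 : α ≠ 0 := hα' ▸ hinj _ hα0
  rw [← hS, ← hT] at hg hΨ
  have hαS : α ^ 2 * S ^ 2 = A * B * C * D := by
    rw [hα', hS, hA, hB, hC, hD, ← map_pow, ← map_pow, ← map_mul, hαs]; simp only [map_mul]
  have hn : 0 < n := hm.trans_le hmn
  have hkernel := kernel_identity hA0 hB0 hC0 hD0 hn hm hS0 hT0 hg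
  have hdual := sum_coeffCore_dual (y := (yVar : Fin m → SeriesY m K))
    (by rw [← map_ofNat (algebraMap ℂ (SeriesY m K))]; exact hinj 2 two_ne_zero)
    hA0 hB0 hC0 hD0 hαS hm hS0 hT0 hg.y_ne hg.y_inj hg.y_mul hg.y_sq hg.y_inv_sq
  rw [mul_assoc, koornwinderOp_coeff_zero hsq hst _ ?_ hΨ hA hB hC hD hS hT]
  swap
  · intro k i
    rw [map_mul, mapHom_weylDenominator]
    congr 1
    ext γ
    simp
  rw [← hα']
  -- notation for the terms of the operator in `y` and of its adjoint
  obtain ⟨b, hb'⟩ : ∃ b : Fin m → SeriesY m K → SeriesY m K, b = fun k u =>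
    coeffCore (S * T / A) (S * T / B) (S * T / C) (S * T / D) (S ^ 2) (T ^ 2) yVar k u := ⟨_, rfl⟩
  obtain ⟨b', hbd'⟩ : ∃ b : Fin m → SeriesY m K → SeriesY m K, b = fun k u =>
    coeffCore (S / T * A) (S / T * B) (S / T * C) (S / T * D) (S ^ 2) (S ^ 2 / T ^ 2) yVar k u :=
    ⟨_, rfl⟩
  have hb1 : ∀ k u, coeffCore (S * T / A) (S * T / B) (S * T / C) (S * T / D) (S ^ 2) (T ^ 2)
      yVar k u = b k u := fun k u => by rw [hb']
  have hb2 : ∀ k u, coeffCore (S / T * A) (S / T * B) (S / T * C) (S / T * D) (S ^ 2)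
      (S ^ 2 / T ^ 2) yVar k u = b' k u := fun k u => by rw [hbd']
  simp only [hb1, hb2] at hkernel hdual
  set V := weylDenominator m K with hV
  set g := mapHom (algebraMap ℂ K) f with hgdef
  -- The adjoint of a single term: the shift is moved from `Ψ` to the other factors, and the shifted
  -- coefficient is conjugated by the Weyl denominator into one of the dual operator.
  have hshift : ∀ k : Fin m, ∀ ε : ℤ, (ε = 1 ∨ ε = -1) →
      ((α / (T ^ 2) ^ m * (b k (yVar k ^ ε) * ratioY S T (fun i => HahnSeries.C (x i))
        (yVar k ^ ε))) * (Ψ * (V * g))).coeff 0 =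
      (Ψ * (V * ((α * (S ^ 2 / T ^ 2) ^ m)⁻¹ * b' k (yVar k ^ (-ε)) *
        shiftHom p.q (-ε) k g))).coeff 0 := by
    intro k ε hε
    have hadj := shiftHom_coeffCore_mul_weylDenominator (K := K) ha hb hc hd hαs hsq hst0 k hε
      hA hB hC hD hS hT
    rw [hb1, hb2, ← hα'] at hadj
    have hΨk : shiftHom p.q ε k Ψ =
        ratioY S T (fun i => HahnSeries.C (x i)) (yVar k ^ ε) * Ψ := by
      rcases hε with rfl | rfl
      · rw [zpow_one]
        exact hΨ.shift_y k
      · rw [zpow_neg_one]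
        exact hΨ.shift_y_inv k
    calc _ = (shiftHom p.q ε k Ψ * (α / (T ^ 2) ^ m * b k (yVar k ^ ε) * V * g)).coeff 0 := by
          rw [hΨk]; exact congrArg (fun G => HahnSeries.coeff G 0) (by ring)
      _ = _ := by
          rw [coeff_zero_shiftHom_mul, map_mul, hadj]
          exact congrArg (fun G => HahnSeries.coeff G 0) (by ring)
  -- the eigenvalue equation in `y`, over the larger field of coefficients
  have heig : ∑ k, ((α * (S ^ 2 / T ^ 2) ^ m)⁻¹ * b' k (yVar k ^ (1 : ℤ)) *
        (shiftHom p.q 1 k g - g) + (α * (S ^ 2 / T ^ 2) ^ m)⁻¹ * b' k (yVar k ^ (-1 : ℤ)) *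
        (shiftHom p.q (-1) k g - g)) =
      algebraMap ℂ _ (∑ i : Fin m, bracket ((p.hat (sq / st)).α * (s i)⁻¹)
      ((p.hat (sq / st)).α * (p.hat (sq / st)).t ^ (m - 1 - (i : ℕ)))) * g := by
    have h1 := congrArg (mapHom (m := m) (algebraMap ℂ K)) hf
    have hsh : ∀ (k : ℤ) (i : Fin m) (f : SeriesY m ℂ), mapHom (algebraMap ℂ K)
        (shiftY ((p.hat (sq / st)).q : ℂ) k i f) = shiftHom p.q k i (mapHom (algebraMap ℂ K) f) := fun k i f =>
      mapHom_shiftHom (Algebra.ofId ℂ K) p.q k i f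
    have halg : ∀ z : ℂ, mapHom (m := m) (algebraMap ℂ K) (algebraMap ℂ (SeriesY m ℂ) z) =
        algebraMap ℂ (SeriesY m K) z := fun z =>
      mapHom_algebraMap (Algebra.ofId ℂ K) z
    have hop : ∀ (i : Fin m) (u : SeriesY m ℂ), mapHom (algebraMap ℂ K)
        (opCoeff (p.hat (sq / st)) yVar i u) = (α * (S ^ 2 / T ^ 2) ^ m)⁻¹ *
        b' i (mapHom (algebraMap ℂ K) u) := by
      intro i u
      rw [opCoeff_eq_coeffCore, map_mul, map_coeffCore, map_inv₀]
      simp only [halg, mapHom_yVar, Params.hat, map_mul, map_div₀, map_pow]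
      rw [← hA, ← hB, ← hC, ← hD, ← hS, ← hT, ← hα', ← hst, ← hsq, map_pow, map_pow, ← hS, ← hT,
        hb2]
      refine congrArg (fun G => G⁻¹ * _) ?_
      obtain ⟨m, rfl⟩ : ∃ m', m = m' + 1 := ⟨m - 1, by omega⟩
      rw [Nat.add_sub_cancel, pow_succ]
      ring
    rw [Algebra.smul_def, map_mul, halg, opY, koornwinderOp, map_add, map_sum,
      map_sum, ← Finset.sum_add_distrib] at h1
    rw [← h1]
    refine Finset.sum_congr rfl fun k _ => ?_
    rw [map_mul, map_mul, map_sub, map_sub, hop, hop, map_inv₀, mapHom_yVar, zpow_one,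
      zpow_neg_one, hsh, hsh]
  -- The operator in `y` applied to `Ψ` acts under the constant term by the dual eigenvalue, up to the
  -- difference of the sums of the coefficients of the two operators, which is a constant.
  have hsum : (((α / (T ^ 2) ^ m) * ∑ k, (b k (yVar k) *
        (ratioY S T (fun i => HahnSeries.C (x i)) (yVar k) - 1) + b k (yVar k)⁻¹ *
        (ratioY S T (fun i => HahnSeries.C (x i)) (yVar k)⁻¹ - 1))) * (Ψ * (V * g))).coeff 0 =
      ((algebraMap ℂ _ (∑ i : Fin m, bracket ((p.hat (sq / st)).α * (s i)⁻¹)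
      ((p.hat (sq / st)).α * (p.hat (sq / st)).t ^ (m - 1 - (i : ℕ)))) -
        ((α / (T ^ 2) ^ m + T ^ 2 / α) * (∑ j ∈ Finset.range m, (T ^ 2) ^ j) -
      ((α * (S ^ 2 / T ^ 2) ^ m)⁻¹ + α * (S ^ 2 / T ^ 2)) *
        (∑ j ∈ Finset.range m, (S ^ 2 / T ^ 2) ^ j))) * (Ψ * (V * g))).coeff 0 := by
    rw [← hdual]
    have e1 : ((α / (T ^ 2) ^ m) * ∑ k, (b k (yVar k) *
        (ratioY S T (fun i => HahnSeries.C (x i)) (yVar k) - 1) + b k (yVar k)⁻¹ *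
        (ratioY S T (fun i => HahnSeries.C (x i)) (yVar k)⁻¹ - 1))) * (Ψ * (V * g)) =
        ∑ k, ((α / (T ^ 2) ^ m * (b k (yVar k ^ (1 : ℤ)) *
          ratioY S T (fun i => HahnSeries.C (x i)) (yVar k ^ (1 : ℤ)))) * (Ψ * (V * g)) +
          (α / (T ^ 2) ^ m * (b k (yVar k ^ (-1 : ℤ)) *
          ratioY S T (fun i => HahnSeries.C (x i)) (yVar k ^ (-1 : ℤ)))) * (Ψ * (V * g))) -
        α / (T ^ 2) ^ m * (∑ k, (b k (yVar k) + b k (yVar k)⁻¹)) * (Ψ * (V * g)) := by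
      rw [Finset.mul_sum, Finset.sum_mul, Finset.mul_sum, Finset.sum_mul,
        ← Finset.sum_sub_distrib]
      refine Finset.sum_congr rfl fun k _ => ?_
      rw [zpow_one, zpow_neg_one]
      ring
    have e2 : ∑ k, (Ψ * (V * ((α * (S ^ 2 / T ^ 2) ^ m)⁻¹ * b' k (yVar k ^ (-1 : ℤ)) *
        shiftHom p.q (-1) k g)) + Ψ * (V * ((α * (S ^ 2 / T ^ 2) ^ m)⁻¹ *
        b' k (yVar k ^ (1 : ℤ)) * shiftHom p.q 1 k g))) =
        (algebraMap ℂ _ (∑ i : Fin m, bracket ((p.hat (sq / st)).α * (s i)⁻¹)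
      ((p.hat (sq / st)).α * (p.hat (sq / st)).t ^ (m - 1 - (i : ℕ)))) +
        (α * (S ^ 2 / T ^ 2) ^ m)⁻¹ * (∑ k, (b' k (yVar k) + b' k (yVar k)⁻¹))) *
          (Ψ * (V * g)) := by
      have h2 : ∀ G : SeriesY m K, G * (Ψ * (V * g)) = Ψ * (V * (G * g)) := fun G => by ring
      rw [h2, add_mul, ← heig, Finset.mul_sum, Finset.sum_mul, ← Finset.sum_add_distrib,
        Finset.mul_sum, Finset.mul_sum]
      refine Finset.sum_congr rfl fun k _ => ?_
      rw [zpow_one, zpow_neg_one]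
      ring
    rw [e1, HahnSeries.coeff_sub, coeff_sum']
    have e3 : ∀ k : Fin m, ((α / (T ^ 2) ^ m * (b k (yVar k ^ (1 : ℤ)) *
          ratioY S T (fun i => HahnSeries.C (x i)) (yVar k ^ (1 : ℤ)))) * (Ψ * (V * g)) +
          (α / (T ^ 2) ^ m * (b k (yVar k ^ (-1 : ℤ)) *
          ratioY S T (fun i => HahnSeries.C (x i)) (yVar k ^ (-1 : ℤ)))) *
            (Ψ * (V * g))).coeff 0 =
        (Ψ * (V * ((α * (S ^ 2 / T ^ 2) ^ m)⁻¹ * b' k (yVar k ^ (-1 : ℤ)) *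
        shiftHom p.q (-1) k g)) + Ψ * (V * ((α * (S ^ 2 / T ^ 2) ^ m)⁻¹ *
        b' k (yVar k ^ (1 : ℤ)) * shiftHom p.q 1 k g))).coeff 0 := by
      intro k
      rw [HahnSeries.coeff_add, HahnSeries.coeff_add, hshift k 1 (Or.inl rfl),
        hshift k (-1) (Or.inr rfl), neg_neg]
    simp only [e3]
    rw [← coeff_sum', e2, ← HahnSeries.coeff_sub]
    exact congrArg (fun G => HahnSeries.coeff G 0) (by ring)
  -- The kernel identity exchanges the operator in `x` for the one in `y`.
  have hK : (α * (T ^ 2) ^ (n - 1))⁻¹ * (∑ i, (coeffCore A B C D (S ^ 2) (T ^ 2)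
        (fun i => HahnSeries.C (x i)) i
          (HahnSeries.C (x i)) * (ratioX S T yVar (HahnSeries.C (x i)) - 1) +
        coeffCore A B C D (S ^ 2) (T ^ 2) (fun i => HahnSeries.C (x i)) i
          (HahnSeries.C (x i))⁻¹ * (ratioX S T yVar (HahnSeries.C (x i))⁻¹ - 1))) =
      (α / (T ^ 2) ^ m) * ∑ k, (b k (yVar k) *
        (ratioY S T (fun i => HahnSeries.C (x i)) (yVar k) - 1) + b k (yVar k)⁻¹ *
        (ratioY S T (fun i => HahnSeries.C (x i)) (yVar k)⁻¹ - 1)) +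
      (1 - (T ^ 2) ^ n) * (α / T ^ 2 * ∑ j ∈ Finset.range m, (T ^ 2)⁻¹ ^ j -
        ((T ^ 2) ^ n)⁻¹ * T ^ 2 / α * ∑ j ∈ Finset.range m, (T ^ 2) ^ j) := by
    have hgeom : (1 - T ^ 2) * ∑ j ∈ Finset.range n, (T ^ 2) ^ j = 1 - (T ^ 2) ^ n :=
      mul_neg_geom_sum _ _
    have hABCD : A * B * C * D / S ^ 2 = α ^ 2 := by rw [← hαS]; field_simp
    rw [hABCD] at hkernel
    rw [← hgeom]
    obtain ⟨n, rfl⟩ : ∃ n', n = n' + 1 := ⟨n - 1, by omega⟩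
    rw [Nat.add_sub_cancel] at hkernel ⊢
    rw [pow_succ (T ^ 2) n] at hkernel ⊢
    exact kernel_constants hα1 (pow_ne_zero 2 hT0) (pow_ne_zero n (pow_ne_zero 2 hT0))
      (pow_ne_zero m (pow_ne_zero 2 hT0)) hkernel
  rw [hK, add_mul, HahnSeries.coeff_add, hsum, ← HahnSeries.coeff_add, ← add_mul,
    sum_bracket_dual hmn hα0 ht0 hβ lam e s he hs, ← coeff_algebraMap_mul]
  congr 2
  simp only [Params.hat, map_add, map_sub, map_mul, map_div₀, map_pow, map_inv₀, map_one, map_sum]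
  rw [← hα', ← hst, ← hsq, map_pow, map_pow, ← hS, ← hT]
  ring

end ConstantTerm

section ConcreteKernel

variable {m n : ℕ}

theorem isKernel_kernelFunction {q : ℂˣ} (hq : ‖(q : ℂ)‖ < 1) {sq st β : ℂ}
    (hsq : sq ^ 2 = (q : ℂ)) (hst : st ≠ 0) (hβ : st ^ 2 = (q : ℂ) ^ β) :
    IsKernel q (xVar : Fin n → RatX n)
      (fun k i => ((scaleX i (q ^ k) : RatX n ≃ₐ[ℂ] RatX n) : RatX n →ₐ[ℂ] RatX n))
      (algebraMap ℂ (SeriesY m (RatX n)) sq) (algebraMap ℂ _ st)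
      (kernelFunction n m (q : ℂ) sq st β) where
  shift_x i := mapHom_scaleX_one_kernelFunction hq β hsq hst i
  shift_x_inv i := mapHom_scaleX_neg_one_kernelFunction hq β hsq hst i
  shift_y k := shiftHom_one_kernelFunction hq hβ k
  shift_y_inv k := shiftHom_neg_one_kernelFunction hq hsq hst hβ k

theorem extendScalars_eq (f : SeriesY m ℂ) :
    extendScalars n f = mapHom (algebraMap ℂ (RatX n)) f := rfl

theorem opX_eq_koornwinderOp (p : Params) (f : RatX n) : opX p f = koornwinderOp p xVar
    (fun k i => ((scaleX i (p.q ^ k) : RatX n ≃ₐ[ℂ] RatX n) : RatX n →ₐ[ℂ] RatX n)) f := rfl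

/-- The constant term of the kernel function times the Weyl denominator times a dual eigenseries
is an eigenfunction of the Koornwinder operator in `x`. -/
theorem opX_constantTerm (hm : 0 < m) (hmn : m ≤ n)
    {p : Params} {sq st β : ℂ}
    (ha : p.a ≠ 0) (hb : p.b ≠ 0) (hc : p.c ≠ 0) (hd : p.d ≠ 0)
    (hq : ‖(p.q : ℂ)‖ < 1)
    (hα : p.α ^ 2 = p.a * p.b * p.c * p.d / (p.q : ℂ))
    (hβ : p.t = (p.q : ℂ) ^ β) (hsq : sq ^ 2 = (p.q : ℂ)) (hst : st ^ 2 = p.t)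
    (lam : Fin m → ℕ) (e s : Fin m → ℂ)
    (he : ∀ i, e i = -(lam i.rev : ℂ) + ((m : ℂ) - ((i : ℕ) : ℂ)) - (n : ℂ) * β)
    (hs : ∀ i, s i = ((p.q : ℂ) / p.t) ^ (-(m : ℤ) + ((i : ℕ) : ℤ) + 1) * (p.q : ℂ) ^ e i)
    (f : SeriesY m ℂ) (hf : IsEigenseries (p.hat (sq / st)) e s f) :
    opX p ((kernelFunction n m (p.q : ℂ) sq st β * weylDenominator m (RatX n) *
      extendScalars n f).coeff 0) =
    (∑ i : Fin m, bracket (p.α * p.t ^ (n - 1 - (i : ℕ)) * (p.q : ℂ) ^ lam i)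
      (p.α * p.t ^ (n - 1 - (i : ℕ)))) •
    (kernelFunction n m (p.q : ℂ) sq st β * weylDenominator m (RatX n) *
      extendScalars n f).coeff 0 := by
  have ht0 : p.t ≠ 0 := by rw [hβ]; exact cpow_unit_ne_zero _ _
  have hst0 : st ≠ 0 := by rintro rfl; exact ht0 (by rw [← hst]; simp)
  have hsq0 : sq ≠ 0 := by rintro rfl; exact p.q.ne_zero (by rw [← hsq]; simp)
  have hΨ := isKernel_kernelFunction (m := m) (n := n) hq hsq hst0 (hst.trans hβ)
  rw [extendScalars_eq, opX_eq_koornwinderOp]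
  generalize kernelFunction n m (p.q : ℂ) sq st β = Ψ at hΨ ⊢
  exact koornwinderOp_constantTerm hm hmn ha hb hc hd hα hβ hsq hst lam e s he hs f hf.eigen
    (generic_xVar_yVar hsq0 hst0) hΨ

end ConcreteKernel

/-! ### Leading terms of series -/

section Lead

variable {m : ℕ} {K : Type*} [Field K]

/-- `f` is a series in `y^v (c + …)` whose other exponents lie in `v + M`; for a submonoid `M` of
nonnegative exponents, `c` is then the coefficient of the lowest monomial (possibly zero). -/
structure HasLead (M : AddSubmonoid (Expo m)) (v : Expo m) (c : K) (f : SeriesY m K) : Prop where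
  sub_mem : ∀ γ, f.coeff γ ≠ 0 → γ - v ∈ M
  coeff_eq : f.coeff v = c

variable {M : AddSubmonoid (Expo m)} {v w : Expo m} {c d : K} {f g : SeriesY m K}

theorem HasLead.zero (v : Expo m) : HasLead M v 0 (0 : SeriesY m K) :=
  ⟨fun _ h => (h rfl).elim, rfl⟩

theorem HasLead.single (v : Expo m) (c : K) : HasLead M v c (HahnSeries.single v c) := by
  refine ⟨fun γ h => ?_, HahnSeries.coeff_single_same _ _⟩
  by_cases hγ : γ = v
  · rw [hγ, sub_self]; exact M.zero_mem
  · exact (h (HahnSeries.coeff_single_of_ne hγ)).elim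

theorem HasLead.one : HasLead M 0 1 (1 : SeriesY m K) := HasLead.single 0 1

theorem HasLead.add (hf : HasLead M v c f) (hg : HasLead M v d g) :
    HasLead M v (c + d) (f + g) := by
  refine ⟨fun γ h => ?_, by rw [HahnSeries.coeff_add, hf.coeff_eq, hg.coeff_eq]⟩
  by_cases hγ : f.coeff γ = 0
  · refine hg.sub_mem γ fun h' => h ?_
    rw [HahnSeries.coeff_add, hγ, h', add_zero]
  · exact hf.sub_mem γ hγ

theorem HasLead.smul (z : K) (hf : HasLead M v c f) : HasLead M v (z * c) (z • f) := by
  refine ⟨fun γ h => hf.sub_mem γ fun h' => h ?_, ?_⟩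
  · rw [HahnSeries.coeff_smul, h', smul_zero]
  · rw [HahnSeries.coeff_smul, hf.coeff_eq, smul_eq_mul]

theorem HasLead.neg (hf : HasLead M v c f) : HasLead M v (-c) (-f) := by
  have := hf.smul (-1)
  rwa [neg_one_smul, neg_one_mul] at this

theorem HasLead.sub (hf : HasLead M v c f) (hg : HasLead M v d g) :
    HasLead M v (c - d) (f - g) := by
  rw [sub_eq_add_neg, sub_eq_add_neg]; exact hf.add hg.neg

theorem HasLead.sum {ι : Type*} {s : Finset ι} {c : ι → K} {f : ι → SeriesY m K}
    (h : ∀ i ∈ s, HasLead M v (c i) (f i)) : HasLead M v (∑ i ∈ s, c i) (∑ i ∈ s, f i) := by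
  classical
  induction s using Finset.induction_on with
  | empty => exact HasLead.zero v
  | insert i s hi ih =>
    rw [Finset.sum_insert hi, Finset.sum_insert hi]
    exact (h i (Finset.mem_insert_self i s)).add
      (ih fun j hj => h j (Finset.mem_insert_of_mem hj))

/-- Lowering the reference exponent. -/
theorem HasLead.lower (hM : ∀ γ ∈ M, 0 ≤ γ) (hf : HasLead M w c f) (h : w - v ∈ M) (hne : w ≠ v) :
    HasLead M v 0 f := by
  refine ⟨fun γ hγ => ?_, ?_⟩
  · have := M.add_mem (hf.sub_mem γ hγ) h
    rwa [sub_add_sub_cancel] at this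
  · by_contra h0
    have h1 := hM _ (hf.sub_mem v h0)
    have h2 := hM _ h
    exact hne (le_antisymm (sub_nonneg.1 h1) (sub_nonneg.1 h2))

theorem HasLead.mul (hM : ∀ γ ∈ M, 0 ≤ γ) (hf : HasLead M v c f) (hg : HasLead M w d g) :
    HasLead M (v + w) (c * d) (f * g) := by
  refine ⟨fun γ hγ => ?_, ?_⟩
  · rw [HahnSeries.coeff_mul] at hγ
    obtain ⟨⟨δ, ε⟩, hδε, -⟩ := Finset.exists_ne_zero_of_sum_ne_zero hγ
    obtain ⟨h1, h2, h3⟩ := Finset.mem_antidiagonal.1 hδε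
    have := M.add_mem (hf.sub_mem δ h1) (hg.sub_mem ε h2)
    have h4 : δ - v + (ε - w) = γ - (v + w) := by
      rw [← show δ + ε = γ from h3]; abel
    rwa [h4] at this
  · rw [HahnSeries.coeff_mul, Finset.sum_eq_single (v, w), hf.coeff_eq, hg.coeff_eq]
    · rintro ⟨δ, ε⟩ hδε hne
      obtain ⟨h1, h2, h3⟩ := Finset.mem_antidiagonal.1 hδε
      exfalso
      have h4 := sub_nonneg.1 (hM _ (hf.sub_mem δ h1))
      have h5 := sub_nonneg.1 (hM _ (hg.sub_mem ε h2))
      have h3 : δ + ε = v + w := h3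
      have h6 : δ = v := by
        refine le_antisymm ?_ h4
        by_contra hlt
        exact absurd h3 (add_lt_add_of_lt_of_le (not_le.1 hlt) h5).ne'
      have h7 : ε = w := by rw [h6] at h3; exact add_left_cancel h3
      exact hne (by rw [h6, h7])
    · intro hnot
      by_contra h0
      exact hnot (Finset.mem_antidiagonal.2 ⟨left_ne_zero_of_mul h0, right_ne_zero_of_mul h0, rfl⟩)

theorem HasLead.prod (hM : ∀ γ ∈ M, 0 ≤ γ) {ι : Type*} {s : Finset ι} {v : ι → Expo m} {c : ι → K}
    {f : ι → SeriesY m K} (h : ∀ i ∈ s, HasLead M (v i) (c i) (f i)) :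
    HasLead M (∑ i ∈ s, v i) (∏ i ∈ s, c i) (∏ i ∈ s, f i) := by
  classical
  induction s using Finset.induction_on with
  | empty => exact HasLead.one
  | insert i s hi ih =>
    rw [Finset.sum_insert hi, Finset.prod_insert hi, Finset.prod_insert hi]
    exact (h i (Finset.mem_insert_self i s)).mul hM
      (ih fun j hj => h j (Finset.mem_insert_of_mem hj))

theorem HasLead.prod_zero (hM : ∀ γ ∈ M, 0 ≤ γ) {ι : Type*} {s : Finset ι} {c : ι → K}
    {f : ι → SeriesY m K} (h : ∀ i ∈ s, HasLead M 0 (c i) (f i)) :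
    HasLead M 0 (∏ i ∈ s, c i) (∏ i ∈ s, f i) := by
  simpa using HasLead.prod hM h

theorem HasLead.pow (hM : ∀ γ ∈ M, 0 ≤ γ) (h : HasLead M v c f) (k : ℕ) :
    HasLead M (k • v) (c ^ k) (f ^ k) := by
  induction k with
  | zero => simpa using HasLead.one
  | succ k ih => rw [pow_succ, pow_succ, succ_nsmul]; exact ih.mul hM h

/-- The inverse has the inverse leading term. That its other exponents stay in the cone is not
automatic when the cone is smaller than the cone of nonnegative exponents. -/
theorem HasLead.inv (hM : ∀ γ ∈ M, 0 ≤ γ) (hf : HasLead M v c f) (hc : c ≠ 0) :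
    HasLead M (-v) c⁻¹ f⁻¹ := by
  have hf0 : f ≠ 0 := by
    rintro rfl
    exact hc hf.coeff_eq.symm
  have h1 : f * f⁻¹ = 1 := mul_inv_cancel₀ hf0
  have hsub : ∀ γ, f⁻¹.coeff γ ≠ 0 → γ - -v ∈ M := by
    by_contra hcon
    push Not at hcon
    -- a minimal exponent of the inverse outside the cone gives a nonzero coefficient of `f * f⁻¹`
    have hwf : {γ ∈ f⁻¹.support | γ - -v ∉ M}.IsWF :=
      f⁻¹.isPWO_support.isWF.mono (Set.sep_subset _ _)
    have hne : {γ ∈ f⁻¹.support | γ - -v ∉ M}.Nonempty := hcon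
    obtain ⟨γ₀, ⟨hγ₀, hγM⟩, hmin⟩ : ∃ γ₀ ∈ {γ ∈ f⁻¹.support | γ - -v ∉ M},
        ∀ ε ∈ {γ ∈ f⁻¹.support | γ - -v ∉ M}, ¬ ε < γ₀ :=
      ⟨hwf.min hne, hwf.min_mem hne, fun ε hε => hwf.not_lt_min hne hε⟩
    rw [sub_neg_eq_add] at hγM
    have h2 : (f * f⁻¹).coeff (v + γ₀) = c * f⁻¹.coeff γ₀ := by
      rw [HahnSeries.coeff_mul, Finset.sum_eq_single (v, γ₀), hf.coeff_eq]
      · rintro ⟨δ, ε⟩ hδε hne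
        obtain ⟨h1, h2, h3⟩ := Finset.mem_antidiagonal.1 hδε
        exfalso
        have h3 : δ + ε = v + γ₀ := h3
        have h4 := hf.sub_mem δ h1
        have h5 := sub_nonneg.1 (hM _ h4)
        by_cases h6 : δ = v
        · rw [h6] at h3
          exact hne (by rw [h6, add_left_cancel h3])
        · have h7 : ε < γ₀ := by
            by_contra hlt
            exact absurd h3 (add_lt_add_of_lt_of_le (lt_of_le_of_ne h5 (Ne.symm h6))
              (not_lt.1 hlt)).ne'
          have h8 : ε - -v ∈ M := by
            by_contra hε
            exact hmin ε ⟨h2, hε⟩ h7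
          refine hγM ?_
          have h9 := M.add_mem h4 h8
          rwa [show δ - v + (ε - -v) = δ + ε by abel, h3, add_comm] at h9
      · intro hnot
        by_contra h0
        exact hnot (Finset.mem_antidiagonal.2 ⟨fun h => hc (hf.coeff_eq.symm.trans h), hγ₀, rfl⟩)
    have h3 : v + γ₀ ≠ 0 := fun h => hγM (by rw [add_comm, h]; exact M.zero_mem)
    rw [h1, HahnSeries.coeff_one, if_neg h3] at h2
    exact mul_ne_zero hc hγ₀ h2.symm
  refine ⟨hsub, ?_⟩
  have h2 := (hf.mul hM ⟨hsub, rfl⟩).coeff_eq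
  rw [h1, add_neg_cancel, HahnSeries.coeff_one, if_pos rfl] at h2
  exact eq_inv_of_mul_eq_one_right h2.symm

theorem HasLead.div (hM : ∀ γ ∈ M, 0 ≤ γ) (hf : HasLead M v c f) (hg : HasLead M w d g)
    (hd : d ≠ 0) : HasLead M (v - w) (c / d) (f / g) := by
  rw [div_eq_mul_inv, div_eq_mul_inv, sub_eq_add_neg]
  exact hf.mul hM (hg.inv hM hd)

theorem HasLead.zMono (ν : Fin m → ℤ) : HasLead M (zexpo ν) 1 (zMono ν : SeriesY m K) :=
  HasLead.single _ _

theorem zexpo_ne_zero {ν : Fin m → ℤ} (h : ν ≠ 0) : zexpo ν ≠ 0 := fun h' =>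
  h (zexpo_injective (h'.trans zexpo_zero.symm))

theorem hasLead_one_sub (hM : ∀ γ ∈ M, 0 ≤ γ) {ν : Fin m → ℤ} (hν : ν ≠ 0) (h : zexpo ν ∈ M)
    (z : K) : HasLead M 0 1 (1 - z • zMono ν : SeriesY m K) := by
  have h1 := (HasLead.zMono (K := K) (M := M) ν).smul z
  have h2 := (HasLead.one (K := K) (M := M)).sub
    (h1.lower hM (v := 0) (by rwa [sub_zero]) (zexpo_ne_zero hν))
  rwa [sub_zero] at h2

theorem hasLead_one_sub_neg (hM : ∀ γ ∈ M, 0 ≤ γ) {ν : Fin m → ℤ} (hν : ν ≠ 0)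
    (h : zexpo (-ν) ∈ M) (z : K) : HasLead M (zexpo ν) (-z) (1 - z • zMono ν : SeriesY m K) := by
  have h1 := (HasLead.zMono (K := K) (M := M) ν).smul z
  have h2 := ((HasLead.one (K := K) (M := M)).lower hM (v := zexpo ν)
    (by rwa [zero_sub, ← zexpo_neg]) (zexpo_ne_zero hν).symm).sub h1
  rwa [zero_sub, mul_one] at h2

theorem hasLead_ratio (hM : ∀ γ ∈ M, 0 ≤ γ) {ν : Fin m → ℤ} (hν : ν ≠ 0) (h : zexpo ν ∈ M)
    (z : K) : HasLead M 0 1 ((1 - z • zMono ν) / (1 - zMono ν) : SeriesY m K) := by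
  have h1 := (hasLead_one_sub hM hν h z).div hM (hasLead_one_sub hM hν h 1) one_ne_zero
  rwa [sub_zero, div_one, one_smul] at h1

theorem hasLead_ratio_neg (hM : ∀ γ ∈ M, 0 ≤ γ) {ν : Fin m → ℤ} (hν : ν ≠ 0)
    (h : zexpo (-ν) ∈ M) (z : K) :
    HasLead M 0 z ((1 - z • zMono ν) / (1 - zMono ν) : SeriesY m K) := by
  have h1 := (hasLead_one_sub_neg hM hν h z).div hM (hasLead_one_sub_neg hM hν h 1)
    (neg_ne_zero.2 one_ne_zero)
  rwa [sub_self, div_neg, div_one, neg_neg, one_smul] at h1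

end Lead

/-! ### Koornwinder operators and leading terms -/

section Cone

variable {m : ℕ}

/-- A submonoid of the nonnegative exponents which contains the positive roots. -/
structure IsPositiveCone (M : AddSubmonoid (Expo m)) : Prop where
  nonneg : ∀ γ ∈ M, 0 ≤ γ
  single_mem : ∀ i, zexpo (Pi.single i 1) ∈ M
  sub_mem : ∀ i j, i < j → zexpo (Pi.single i 1 - Pi.single j 1) ∈ M

/-- The cone of all nonnegative exponents. -/
def lexCone (m : ℕ) : AddSubmonoid (Expo m) where
  carrier := {γ | 0 ≤ γ}
  zero_mem' := le_refl (0 : Expo m)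
  add_mem' h1 h2 := add_nonneg (α := Expo m) h1 h2

theorem mem_lexCone {γ : Expo m} : γ ∈ lexCone m ↔ 0 ≤ γ := Iff.rfl

theorem isPositiveCone_lexCone : IsPositiveCone (lexCone m) where
  nonneg _ h := mem_lexCone.1 h
  single_mem i := mem_lexCone.2 (le_of_lt (zexpo_single_pos i))
  sub_mem i j hij := by
    refine mem_lexCone.2 (le_of_lt ?_)
    rw [← zexpo_zero]
    refine (zexpo_lt_iff _ _).2 ?_
    refine ⟨i, fun k hk => ?_, ?_⟩
    · change (0 : ℤ) = (Pi.single i 1 - Pi.single j 1 : Fin m → ℤ) k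
      have h1 : k ≠ i := ne_of_lt hk
      have h2 : k ≠ j := ne_of_lt (lt_trans hk hij)
      simp [h1, h2]
    · change (0 : ℤ) < (Pi.single i 1 - Pi.single j 1 : Fin m → ℤ) i
      simp [Pi.single_eq_of_ne hij.ne]

/-- The cone of the integral exponents with nonnegative partial sums, that is, the cone of the
nonnegative integral combinations of the simple roots. -/
def rootCone (m : ℕ) : AddSubmonoid (Expo m) where
  carrier := {γ | ∃ ν : Fin m → ℤ, γ = zexpo ν ∧ ∀ k, 0 ≤ ∑ i ∈ Finset.Iic k, ν i}
  zero_mem' := ⟨0, zexpo_zero.symm, by simp⟩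
  add_mem' := by
    rintro _ _ ⟨ν, rfl, h1⟩ ⟨κ, rfl, h2⟩
    refine ⟨ν + κ, (zexpo_add ν κ).symm, fun k => ?_⟩
    simp only [Pi.add_apply, Finset.sum_add_distrib]
    exact add_nonneg (h1 k) (h2 k)

theorem zexpo_mem_rootCone {ν : Fin m → ℤ} :
    zexpo ν ∈ rootCone m ↔ ∀ k, 0 ≤ ∑ i ∈ Finset.Iic k, ν i := by
  refine ⟨?_, fun h => ⟨ν, rfl, h⟩⟩
  rintro ⟨κ, h1, h2⟩
  rwa [zexpo_injective h1]

theorem isPositiveCone_rootCone : IsPositiveCone (rootCone m) where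
  nonneg := by
    rintro _ ⟨ν, rfl, h⟩
    by_contra hlt
    rw [not_le, ← zexpo_zero] at hlt
    obtain ⟨i, h1, h2⟩ := (zexpo_lt_iff ν 0).1 hlt
    have h3 : ∑ j ∈ Finset.Iic i, ν j = ν i := by
      refine Finset.sum_eq_single i (fun j hj hne => ?_) (by simp)
      exact h1 j (lt_of_le_of_ne (Finset.mem_Iic.1 hj) hne)
    have h4 := h i
    rw [h3] at h4
    exact absurd h2 h4.not_gt
  single_mem i := by
    rw [zexpo_mem_rootCone]
    intro k
    exact Finset.sum_nonneg fun j _ => by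
      by_cases h : j = i
      · subst h; simp
      · simp [h]
  sub_mem i j hij := by
    rw [zexpo_mem_rootCone]
    intro k
    simp only [Pi.sub_apply, Finset.sum_sub_distrib, Finset.sum_pi_single', Finset.mem_Iic]
    split_ifs with h1 h2 <;> omega

variable {M : AddSubmonoid (Expo m)}

theorem IsPositiveCone.add_mem (hM : IsPositiveCone M) (i j : Fin m) :
    zexpo (Pi.single i 1 + Pi.single j 1) ∈ M := by
  rw [zexpo_add]; exact M.add_mem (hM.single_mem i) (hM.single_mem j)

theorem single_sub_single_ne_zero {i j : Fin m} (h : i ≠ j) :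
    (Pi.single i 1 - Pi.single j 1 : Fin m → ℤ) ≠ 0 := by
  intro h'
  have := congrFun h' i
  simp [Pi.single_eq_of_ne h] at this

theorem yVar_mul_yVar (i j : Fin m) :
    (yVar i * yVar j : SeriesY m ℂ) = zMono (Pi.single i 1 + Pi.single j 1) := by
  rw [yVar_eq, yVar_eq, zMono_add]

theorem yVar_div_yVar (i j : Fin m) :
    (yVar i / yVar j : SeriesY m ℂ) = zMono (Pi.single i 1 - Pi.single j 1) := by
  rw [yVar_eq, yVar_eq, zMono_sub]

theorem prod_erase_ite_lt {F : Type*} [CommMonoid F] (i : Fin m) (z : F) :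
    ∏ j ∈ Finset.univ.erase i, (if i < j then 1 else z) = z ^ (i : ℕ) := by
  rw [Finset.prod_ite, Finset.prod_const_one, one_mul, Finset.prod_const]
  congr 1
  rw [← Fin.card_Iio i]
  congr 1
  ext j
  simp only [Finset.mem_filter, Finset.mem_erase, Finset.mem_univ, Finset.mem_Iio, and_true]
  constructor
  · rintro ⟨h1, h2⟩; exact lt_of_le_of_ne (not_lt.1 h2) h1
  · intro h; exact ⟨h.ne, h.not_gt⟩

theorem prod_erase_ite_gt {F : Type*} [CommMonoid F] (i : Fin m) (z : F) :
    ∏ j ∈ Finset.univ.erase i, (if j < i then 1 else z) = z ^ (m - 1 - (i : ℕ)) := by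
  rw [Finset.prod_ite, Finset.prod_const_one, one_mul, Finset.prod_const]
  congr 1
  rw [← Fin.card_Ioi i]
  congr 1
  ext j
  simp only [Finset.mem_filter, Finset.mem_erase, Finset.mem_univ, Finset.mem_Ioi, and_true]
  constructor
  · rintro ⟨h1, h2⟩; exact lt_of_le_of_ne (not_lt.1 h2) (Ne.symm h1)
  · intro h; exact ⟨h.ne', h.not_gt⟩

/-- In the region `|y_1| ≪ … ≪ |y_m| ≪ 1` the coefficient of `T_{q,y_i} - 1` tends to
`t^i / (α t^{m-1})`, where `i` counts from `0`. -/
theorem hasLead_opCoeff (hM : IsPositiveCone M) {p : Params} (hα : p.α ≠ 0) (ht : p.t ≠ 0)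
    (i : Fin m) :
    HasLead M 0 (p.t ^ (i : ℕ) / (p.α * p.t ^ (m - 1))) (opCoeff p yVar i (yVar i)) := by
  have hs := hM.single_mem i
  have hne : (Pi.single i 1 : Fin m → ℤ) ≠ 0 := by simp
  have hlin : ∀ z : ℂ, HasLead M 0 1 (1 - z • (yVar i : SeriesY m ℂ)) := fun z => by
    rw [yVar_eq]; exact hasLead_one_sub hM.nonneg hne hs z
  have hsq : ∀ z : ℂ, HasLead M 0 1 (1 - z • (yVar i : SeriesY m ℂ) ^ 2) := fun z => by
    rw [pow_two, yVar_mul_yVar]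
    exact hasLead_one_sub hM.nonneg (single_add_single_ne_zero i i) (hM.add_mem i i) z
  have hc : HasLead M 0 (p.α * p.t ^ (m - 1))
      (algebraMap ℂ (SeriesY m ℂ) (p.α * p.t ^ (m - 1))) := HasLead.single 0 _
  have hfirst := ((((hlin p.a).mul hM.nonneg (hlin p.b)).mul hM.nonneg (hlin p.c)).mul hM.nonneg
    (hlin p.d)).div hM.nonneg ((hc.mul hM.nonneg (hsq 1)).mul hM.nonneg (hsq p.q))
    (by simp [hα, ht])
  have hprod : HasLead M 0 (∏ j ∈ Finset.univ.erase i, (if i < j then 1 else p.t))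
      (∏ j ∈ Finset.univ.erase i, ((1 - p.t • (yVar i * yVar j)) * (1 - p.t • (yVar i / yVar j))) /
        ((1 - yVar i * yVar j) * (1 - yVar i / yVar j) : SeriesY m ℂ)) := by
    refine HasLead.prod_zero hM.nonneg fun j hj => ?_
    have hij := (Finset.ne_of_mem_erase hj).symm
    rw [mul_div_mul_comm, yVar_mul_yVar, yVar_div_yVar]
    have h1 := hasLead_ratio hM.nonneg (single_add_single_ne_zero i j) (hM.add_mem i j) p.t
    split_ifs with h
    · have := h1.mul hM.nonneg
        (hasLead_ratio hM.nonneg (single_sub_single_ne_zero hij) (hM.sub_mem i j h) p.t)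
      rwa [add_zero, one_mul] at this
    · have := h1.mul hM.nonneg
        (hasLead_ratio_neg hM.nonneg (single_sub_single_ne_zero hij)
          (by rw [neg_sub]; exact hM.sub_mem j i (lt_of_le_of_ne (not_lt.1 h) hij.symm)) p.t)
      rwa [add_zero, one_mul] at this
  have h := hfirst.mul hM.nonneg hprod
  rw [prod_erase_ite_lt] at h
  simp only [one_smul] at h
  rw [opCoeff]
  convert h using 1
  · simp
  · ring

/-- In the region `|y_1| ≪ … ≪ |y_m| ≪ 1` the coefficient of `T_{q,y_i}⁻¹ - 1` tends to
`abcd t^{2m-2-i} / (q α t^{m-1}) = α t^{m-1-i}`, where `i` counts from `0`. -/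
theorem hasLead_opCoeff_inv (hM : IsPositiveCone M) {p : Params} (hα0 : p.α ≠ 0) (ht : p.t ≠ 0)
    (hα : p.α ^ 2 = p.a * p.b * p.c * p.d / (p.q : ℂ)) (i : Fin m) :
    HasLead M 0 (p.α * p.t ^ (m - 1 - (i : ℕ))) (opCoeff p yVar i (yVar i)⁻¹) := by
  have hq := p.q.ne_zero
  have hinv : (yVar i : SeriesY m ℂ)⁻¹ = zMono (-Pi.single i 1) := by rw [yVar_eq, zMono_neg]
  have hinv2 : (yVar i : SeriesY m ℂ)⁻¹ ^ 2 = zMono (-(Pi.single i 1 + Pi.single i 1)) := by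
    rw [zMono_neg, ← yVar_mul_yVar, inv_pow, pow_two]
  have hlin : ∀ z : ℂ, HasLead M (zexpo (-Pi.single i 1)) (-z)
      (1 - z • (yVar i : SeriesY m ℂ)⁻¹) := fun z => by
    rw [hinv]
    exact hasLead_one_sub_neg hM.nonneg (by simp) (by rw [neg_neg]; exact hM.single_mem i) z
  have hsq : ∀ z : ℂ, HasLead M (zexpo (-(Pi.single i 1 + Pi.single i 1))) (-z)
      (1 - z • (yVar i : SeriesY m ℂ)⁻¹ ^ 2) := fun z => by
    rw [hinv2]
    exact hasLead_one_sub_neg hM.nonneg (neg_ne_zero.2 (single_add_single_ne_zero i i))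
      (by rw [neg_neg]; exact hM.add_mem i i) z
  have hc : HasLead M 0 (p.α * p.t ^ (m - 1))
      (algebraMap ℂ (SeriesY m ℂ) (p.α * p.t ^ (m - 1))) := HasLead.single 0 _
  have hfirst := ((((hlin p.a).mul hM.nonneg (hlin p.b)).mul hM.nonneg (hlin p.c)).mul hM.nonneg
    (hlin p.d)).div hM.nonneg ((hc.mul hM.nonneg (hsq 1)).mul hM.nonneg (hsq p.q))
    (by simp [hα0, ht])
  have hprod : HasLead M 0 (∏ j ∈ Finset.univ.erase i, ((if j < i then 1 else p.t) * p.t))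
      (∏ j ∈ Finset.univ.erase i,
        ((1 - p.t • ((yVar i)⁻¹ * yVar j)) * (1 - p.t • ((yVar i)⁻¹ / yVar j))) /
        ((1 - (yVar i)⁻¹ * yVar j) * (1 - (yVar i)⁻¹ / yVar j) : SeriesY m ℂ)) := by
    refine HasLead.prod_zero hM.nonneg fun j hj => ?_
    have hij := (Finset.ne_of_mem_erase hj).symm
    have e1 : ((yVar i)⁻¹ * yVar j : SeriesY m ℂ) = zMono (Pi.single j 1 - Pi.single i 1) := by
      rw [← yVar_div_yVar, mul_comm, div_eq_mul_inv]
    have e2 : ((yVar i)⁻¹ / yVar j : SeriesY m ℂ) = zMono (-(Pi.single i 1 + Pi.single j 1)) := by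
      rw [zMono_neg, ← yVar_mul_yVar, mul_inv, div_eq_mul_inv]
    rw [mul_div_mul_comm, e1, e2]
    have h1 := hasLead_ratio_neg hM.nonneg (neg_ne_zero.2 (single_add_single_ne_zero i j))
      (by rw [neg_neg]; exact hM.add_mem i j) p.t
    split_ifs with h
    · have := (hasLead_ratio hM.nonneg (single_sub_single_ne_zero hij.symm)
        (hM.sub_mem j i h) p.t).mul hM.nonneg h1
      rwa [add_zero] at this
    · have := (hasLead_ratio_neg hM.nonneg (single_sub_single_ne_zero hij.symm)
        (by rw [neg_sub]; exact hM.sub_mem i j (lt_of_le_of_ne (not_lt.1 h) hij)) p.t).mul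
        hM.nonneg h1
      rwa [add_zero] at this
  have h := hfirst.mul hM.nonneg hprod
  rw [Finset.prod_mul_distrib, prod_erase_ite_gt, Finset.prod_const,
    Finset.card_erase_of_mem (Finset.mem_univ i), Finset.card_univ, Fintype.card_fin] at h
  simp only [one_smul] at h
  rw [opCoeff]
  convert h using 1
  · simp only [zexpo_neg, zexpo_add]
    abel
  · have h1 : p.a * p.b * p.c * p.d = p.α ^ 2 * p.q := by rw [hα]; field_simp
    have h2 : -p.a * -p.b * -p.c * -p.d = p.α ^ 2 * p.q := by rw [← h1]; ring
    rw [h2]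
    field_simp

theorem HasLead.shift {q : ℂˣ} {μ : Fin m → ℤ} {c : ℂ} {f : SeriesY m ℂ}
    (h : HasLead M (zexpo μ) c f) (k : ℤ) (i : Fin m) :
    HasLead M (zexpo μ) ((q : ℂ) ^ (k * μ i) * c) (shiftY (q : ℂ) k i f) := by
  refine ⟨fun γ hγ => h.sub_mem γ fun h0 => hγ ?_, ?_⟩
  · change _ • f.coeff γ = 0
    rw [h0, smul_zero]
  · change ((q : ℂ) ^ ((k : ℂ) * expoCoord (zexpo μ) i)) • f.coeff (zexpo μ) = _
    rw [h.coeff_eq, smul_eq_mul, zexpo, expoCoord_expo, ← Int.cast_mul, Complex.cpow_intCast]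

/-- The eigenvalue `d_μ` for an integral vector `μ`. -/
def eigenvalueInt {n : ℕ} (p : Params) (μ : Fin n → ℤ) : ℂ :=
  ∑ j : Fin n, bracket (p.α * p.t ^ (n - 1 - (j : ℕ)) * (p.q : ℂ) ^ μ j)
    (p.α * p.t ^ (n - 1 - (j : ℕ)))

theorem eigenvalueInt_natCast {n : ℕ} (p : Params) (lam : Fin n → ℕ) :
    eigenvalueInt p (fun i => (lam i : ℤ)) = eigenvalue p lam := by
  simp [eigenvalueInt, eigenvalue]

/-- Triangularity of the Koornwinder operator: it multiplies the coefficient of the leading term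
`y^{-μ}` by `d_μ` and creates no terms outside the cone below it. -/
theorem HasLead.opY (hM : IsPositiveCone M) {p : Params} (hα0 : p.α ≠ 0) (ht : p.t ≠ 0)
    (hα : p.α ^ 2 = p.a * p.b * p.c * p.d / (p.q : ℂ)) {μ : Fin m → ℤ} {c : ℂ} {f : SeriesY m ℂ}
    (h : HasLead M (zexpo (-μ)) c f) :
    HasLead M (zexpo (-μ)) (eigenvalueInt p μ * c) (opY p f) := by
  have hterm : ∀ i : Fin m, HasLead M (zexpo (-μ))
      (bracket (p.α * p.t ^ (m - 1 - (i : ℕ)) * (p.q : ℂ) ^ μ i)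
        (p.α * p.t ^ (m - 1 - (i : ℕ))) * c)
      (opCoeff p yVar i (yVar i) * (shiftY (p.q : ℂ) 1 i f - f) +
        opCoeff p yVar i (yVar i)⁻¹ * (shiftY (p.q : ℂ) (-1) i f - f)) := by
    intro i
    have h1 := (hasLead_opCoeff hM hα0 ht i).mul hM.nonneg ((h.shift (q := p.q) 1 i).sub h)
    have h2 := (hasLead_opCoeff_inv hM hα0 ht hα i).mul hM.nonneg
      ((h.shift (q := p.q) (-1) i).sub h)
    rw [zero_add] at h1 h2
    have h3 := h1.add h2
    convert h3 using 1
    have hi := i.isLt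
    have ht1 : p.t ^ (m - 1) = p.t ^ (m - 1 - (i : ℕ)) * p.t ^ (i : ℕ) := by
      rw [← pow_add]; congr 1; omega
    have hq := zpow_ne_zero (μ i) p.q.ne_zero
    rw [ht1, bracket, Pi.neg_apply, neg_one_mul, neg_neg, one_mul, zpow_neg]
    field_simp
    ring
  have e : Koornwinder.opY p f = ∑ i : Fin m,
      (opCoeff p yVar i (yVar i) * (shiftY (p.q : ℂ) 1 i f - f) +
        opCoeff p yVar i (yVar i)⁻¹ * (shiftY (p.q : ℂ) (-1) i f - f)) := by
    rw [Koornwinder.opY, koornwinderOp, ← Finset.sum_add_distrib]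
  rw [e, eigenvalueInt, Finset.sum_mul]
  exact HasLead.sum (s := Finset.univ) fun i _ => hterm i

end Cone

/-! ### Expansion of Laurent polynomials at infinity -/

section Inversion

variable {n : ℕ} {K L : Type*} [Field K] [Field L] [Algebra ℂ K] [Algebra ℂ L]

/-- A Koornwinder operator is invariant under the inversion of all variables and shifts. -/
theorem map_koornwinderOp_inv (p : Params) (φ : K →+* L) (hφ : ∀ (z : ℂ) f, φ (z • f) = z • φ f)
    {X : Fin n → K} {Y : Fin n → L} (hX : ∀ i, φ (X i) = (Y i)⁻¹) {T : ℤ → Fin n → K → K}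
    {U : ℤ → Fin n → L → L} (hT : ∀ k i f, φ (T k i f) = U (-k) i (φ f)) (f : K) :
    φ (koornwinderOp p X T f) = koornwinderOp p Y U (φ f) := by
  have hC : ∀ z : ℂ, φ (algebraMap ℂ K z) = algebraMap ℂ L z := fun z => by
    rw [Algebra.algebraMap_eq_smul_one, hφ, map_one, ← Algebra.algebraMap_eq_smul_one]
  have hc : ∀ (i : Fin n) (u : K) (v : L), φ u = v →
      φ (opCoeff p X i u) = opCoeff p Y i v := by
    rintro i u _ rfl
    rw [opCoeff, opCoeff, map_mul, map_div₀, map_prod]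
    congr 1
    · simp only [map_mul, map_sub, map_one, hφ, hC, map_pow]
    · refine Finset.prod_congr rfl fun j _ => ?_
      simp only [map_div₀, map_mul, map_sub, map_one, hφ, hX, div_inv_eq_mul]
      rw [mul_comm (1 - p.t • _), mul_comm (1 - φ u * _)]
      simp only [div_eq_mul_inv]
  rw [koornwinderOp, koornwinderOp, map_add, map_sum, map_sum, add_comm]
  congr 1
  · refine Finset.sum_congr rfl fun i _ => ?_
    rw [map_mul, map_sub, hc i _ (Y i) (by rw [map_inv₀, hX, inv_inv]), hT, neg_neg]
  · refine Finset.sum_congr rfl fun i _ => ?_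
    rw [map_mul, map_sub, hc i _ _ (hX i), hT]

end Inversion

section LaurentAlgebra

variable {n : ℕ}

/-- The algebra of Laurent polynomials in `x_1, …, x_n`. -/
abbrev LaurentAlg (n : ℕ) : Type := AddMonoidAlgebra ℂ (Fin n → ℤ)

/-- Laurent polynomials as rational functions. -/
def toRatX : LaurentAlg n →ₐ[ℂ] RatX n :=
  AddMonoidAlgebra.lift ℂ (RatX n) (Fin n → ℤ)
    { toFun := fun μ => ∏ i, xVar i ^ (Multiplicative.toAdd μ i)
      map_one' := by simp
      map_mul' := fun μ ν => by
        rw [← Finset.prod_mul_distrib]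
        exact Finset.prod_congr rfl fun i _ => zpow_add₀ (xVar_ne_zero i) _ _ }

theorem toRatX_single (μ : Fin n → ℤ) (z : ℂ) :
    toRatX (AddMonoidAlgebra.single μ z) = z • ∏ i, xVar i ^ μ i :=
  AddMonoidAlgebra.lift_single _ _ _

theorem laurent_eq (P : (Fin n → ℤ) →₀ ℂ) : laurent P = toRatX (AddMonoidAlgebra.ofCoeff P) := by
  rw [toRatX, AddMonoidAlgebra.lift_apply]
  rfl

/-- Laurent polynomials in `x` as series in `y_i = 1/x_i`. -/
def expandLaurent : LaurentAlg n →ₐ[ℂ] SeriesY n ℂ :=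
  AddMonoidAlgebra.lift ℂ (SeriesY n ℂ) (Fin n → ℤ)
    { toFun := fun μ => zMono (-(Multiplicative.toAdd μ))
      map_one' := by simp [zMono_zero]
      map_mul' := fun μ ν => by rw [toAdd_mul, neg_add, zMono_add] }

theorem expandLaurent_single (μ : Fin n → ℤ) (z : ℂ) :
    expandLaurent (AddMonoidAlgebra.single μ z) = z • zMono (-μ) :=
  AddMonoidAlgebra.lift_single _ _ _

theorem expandLaurent_coeff (H : LaurentAlg n) (μ : Fin n → ℤ) :
    (expandLaurent H).coeff (zexpo (-μ)) = H.coeff μ := by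
  induction H using AddMonoidAlgebra.induction_linear with
  | zero => rw [map_zero]; rfl
  | add f g hf hg => rw [map_add, HahnSeries.coeff_add, hf, hg]; rfl
  | single ν z =>
    rw [expandLaurent_single, HahnSeries.coeff_smul, zMono, HahnSeries.coeff_single,
      AddMonoidAlgebra.coeff_single,
      Finsupp.single_apply]
    have : zexpo (-μ) = zexpo (-ν) ↔ ν = μ :=
      ⟨fun h => (neg_injective (zexpo_injective h)).symm, fun h => by rw [h]⟩
    by_cases h : ν = μ
    · rw [if_pos (this.2 h), if_pos h, smul_eq_mul, mul_one]
    · rw [if_neg (fun h' => h (this.1 h')), if_neg h, smul_zero]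

theorem exists_of_expandLaurent_coeff_ne_zero {H : LaurentAlg n} {γ : Expo n}
    (h : (expandLaurent H).coeff γ ≠ 0) : ∃ μ, γ = zexpo (-μ) ∧ H.coeff μ ≠ 0 := by
  suffices h' : ∃ μ, γ = zexpo (-μ) by
    obtain ⟨μ, rfl⟩ := h'
    exact ⟨μ, rfl, by rwa [expandLaurent_coeff] at h⟩
  induction H using AddMonoidAlgebra.induction_linear with
  | zero => rw [map_zero] at h; exact (h rfl).elim
  | add f g hf hg =>
    rw [map_add, HahnSeries.coeff_add] at h
    by_cases h0 : (expandLaurent f).coeff γ = 0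
    · exact hg (by rwa [h0, zero_add] at h)
    · exact hf h0
  | single ν z =>
    refine ⟨ν, ?_⟩
    by_contra hne
    rw [expandLaurent_single, HahnSeries.coeff_smul, zMono, HahnSeries.coeff_single_of_ne hne,
      smul_zero] at h
    exact h rfl

theorem expandLaurent_injective : Function.Injective (expandLaurent (n := n)) := fun G H h => by
  ext μ
  rw [← expandLaurent_coeff, h, expandLaurent_coeff]

/-- Polynomials in `x` as Laurent polynomials. -/
def polyToLaurent : MvPolynomial (Fin n) ℂ →ₐ[ℂ] LaurentAlg n :=
  MvPolynomial.aeval fun i => AddMonoidAlgebra.single (Pi.single i 1) 1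

theorem polyToLaurent_monomial (d : Fin n →₀ ℕ) (z : ℂ) :
    polyToLaurent (MvPolynomial.monomial d z) =
      AddMonoidAlgebra.single (fun i => (d i : ℤ)) z := by
  rw [polyToLaurent, MvPolynomial.aeval_monomial, Finsupp.prod_fintype _ _ (by simp)]
  simp only [AddMonoidAlgebra.single_pow, one_pow]
  rw [AddMonoidAlgebra.prod_single, Finset.prod_const_one, AddMonoidAlgebra.coe_algebraMap]
  have h : ∑ i, d i • (Pi.single i 1 : Fin n → ℤ) = fun i => (d i : ℤ) := by
    ext j
    simp [Finset.sum_apply, Pi.single_apply]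
  rw [h, Function.comp_apply, AddMonoidAlgebra.single_mul_single, zero_add, mul_one]
  rfl

theorem polyToLaurent_injective : Function.Injective (polyToLaurent (n := n)) := by
  rw [injective_iff_map_eq_zero]
  intro f hf
  ext d
  have h : ∀ f : MvPolynomial (Fin n) ℂ,
      (polyToLaurent f).coeff (fun i => (d i : ℤ)) = f.coeff d := by
    intro f
    induction f using MvPolynomial.induction_on' with
    | monomial e z =>
      rw [polyToLaurent_monomial, AddMonoidAlgebra.coeff_single, Finsupp.single_apply,
        MvPolynomial.coeff_monomial]
      have : (fun i => (e i : ℤ)) = (fun i => (d i : ℤ)) ↔ e = d :=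
        ⟨fun h => Finsupp.ext fun i => Int.ofNat_inj.1 (congrFun h i), fun h => by rw [h]⟩
      simp only [this]
    | add p r hp hr => rw [map_add, MvPolynomial.coeff_add, ← hp, ← hr]; rfl
  rw [← h, hf]
  rfl

/-- The expansion of a rational function of `x` in `y_i = 1/x_i`. -/
def expandX : RatX n →+* SeriesY n ℂ :=
  IsFractionRing.lift (A := MvPolynomial (Fin n) ℂ)
    (g := ((expandLaurent (n := n)).comp polyToLaurent).toRingHom)
    (expandLaurent_injective.comp polyToLaurent_injective)

theorem expandX_algebraMap (f : MvPolynomial (Fin n) ℂ) :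
    expandX (algebraMap _ (RatX n) f) = expandLaurent (polyToLaurent f) :=
  IsFractionRing.lift_algebraMap _ _

theorem ringHom_ext_xVar {R : Type*} [Field R] {φ ψ : RatX n →+* R}
    (hC : ∀ z : ℂ, φ (algebraMap ℂ (RatX n) z) = ψ (algebraMap ℂ (RatX n) z))
    (hX : ∀ i, φ (xVar i) = ψ (xVar i)) : φ = ψ := by
  apply IsLocalization.ringHom_ext (nonZeroDivisors (MvPolynomial (Fin n) ℂ))
  apply MvPolynomial.ringHom_ext
  · intro z
    have := hC z
    rwa [IsScalarTower.algebraMap_apply ℂ (MvPolynomial (Fin n) ℂ) (RatX n),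
      MvPolynomial.algebraMap_eq] at this
  · exact hX

theorem expandX_C (z : ℂ) : expandX (algebraMap ℂ (RatX n) z) = algebraMap ℂ (SeriesY n ℂ) z := by
  rw [IsScalarTower.algebraMap_apply ℂ (MvPolynomial (Fin n) ℂ) (RatX n), expandX_algebraMap,
    AlgHom.commutes, AlgHom.commutes]

theorem expandX_smul (z : ℂ) (f : RatX n) : expandX (z • f) = z • expandX f := by
  rw [Algebra.smul_def, map_mul, expandX_C, ← Algebra.smul_def]

theorem expandX_xVar (i : Fin n) : expandX (xVar i) = (yVar i)⁻¹ := by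
  rw [xVar, expandX_algebraMap, polyToLaurent, MvPolynomial.aeval_X, expandLaurent_single, one_smul,
    yVar_eq, zMono_neg]

theorem expandX_toRatX (H : LaurentAlg n) : expandX (toRatX H) = expandLaurent H := by
  induction H using AddMonoidAlgebra.induction_linear with
  | zero => simp only [map_zero]
  | add f g hf hg => rw [map_add, map_add, map_add, hf, hg]
  | single μ z =>
    rw [toRatX_single, expandLaurent_single, expandX_smul, map_prod]
    congr 1
    have h : -μ = ∑ i, -(μ i • (Pi.single i 1 : Fin n → ℤ)) := by
      ext j
      simp [Finset.sum_apply, Pi.single_apply]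
    rw [h, zMono_sum]
    refine Finset.prod_congr rfl fun i _ => ?_
    rw [map_zpow₀, expandX_xVar, yVar_eq, zMono_neg, zMono_zsmul, inv_zpow]

theorem expandX_comp_eq_shiftHom (q : ℂˣ) (k : ℤ) (i : Fin n) {σ : RatX n →+* RatX n}
    (hC : ∀ z : ℂ, σ (algebraMap ℂ (RatX n) z) = algebraMap ℂ (RatX n) z)
    (hi : σ (xVar i) = ((q ^ k : ℂˣ) : ℂ) • xVar i) (hne : ∀ j, j ≠ i → σ (xVar j) = xVar j)
    (f : RatX n) : expandX (σ f) = shiftHom q (-k) i (expandX f) := by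
  have h : (expandX (n := n)).comp σ = (shiftHom q (-k) i).comp expandX := by
    apply ringHom_ext_xVar
    · intro z
      rw [RingHom.comp_apply, RingHom.comp_apply, hC, expandX_C, shiftHom_algebraMap]
    · intro j
      rw [RingHom.comp_apply, RingHom.comp_apply, expandX_xVar, map_inv₀]
      by_cases hj : j = i
      · subst hj
        rw [hi, shiftHom_yVar_self, expandX_smul, expandX_xVar, Algebra.smul_def,
          mul_inv, ← map_inv₀, zpow_neg, inv_inv, Units.val_zpow_eq_zpow_val]
      · rw [hne j hj, shiftHom_yVar_of_ne _ _ hj, expandX_xVar]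
  rw [← RingHom.comp_apply, h, RingHom.comp_apply]

theorem expandX_scaleX (q : ℂˣ) (k : ℤ) (i : Fin n) (f : RatX n) :
    expandX (scaleX i (q ^ k) f) = shiftY (q : ℂ) (-k) i (expandX f) :=
  expandX_comp_eq_shiftHom q k i (σ := (scaleX i (q ^ k)).toRingEquiv.toRingHom)
    (fun z => (scaleX i (q ^ k)).commutes z) (scaleX_xVar_self i _)
    (fun _ hj => scaleX_xVar_of_ne hj _) f

/-- The expansion `x_i = 1/y_i` takes the operator in `x` to the operator in `y` with the same
parameters, since the operator is invariant under the inversion of the variables. -/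
theorem expandX_opX (p : Params) (f : RatX n) : expandX (opX p f) = opY p (expandX f) :=
  map_koornwinderOp_inv p expandX expandX_smul expandX_xVar
    (fun k i g => expandX_scaleX p.q k i g) f

end LaurentAlgebra

/-! ### Laurent polynomials invariant under the hyperoctahedral group -/

section WeylGroup

variable {n : ℕ}

/-- The permutation `σ` of the coordinates of exponent vectors. -/
def permEquiv (σ : Equiv.Perm (Fin n)) : (Fin n → ℤ) ≃+ (Fin n → ℤ) where
  toFun μ := μ ∘ σ.symm
  invFun μ := μ ∘ σ
  left_inv μ := by ext i; simp
  right_inv μ := by ext i; simp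
  map_add' _ _ := rfl

/-- The sign change of the `i`-th coordinate of exponent vectors. -/
def negEquiv (i : Fin n) : (Fin n → ℤ) ≃+ (Fin n → ℤ) where
  toFun μ := Function.update μ i (-μ i)
  invFun μ := Function.update μ i (-μ i)
  left_inv μ := by simp
  right_inv μ := by simp
  map_add' μ ν := by
    ext j
    by_cases h : j = i
    · subst h; simp [add_comm]
    · simp [h]

/-- The generators of the hyperoctahedral group acting on exponent vectors. -/
def weylGenerators (n : ℕ) : Set ((Fin n → ℤ) ≃+ (Fin n → ℤ)) :=
  Set.range permEquiv ∪ Set.range negEquiv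

/-- The action on Laurent polynomials of an automorphism of the group of exponent vectors. -/
def weylAction (e : (Fin n → ℤ) ≃+ (Fin n → ℤ)) : LaurentAlg n ≃ₐ[ℂ] LaurentAlg n :=
  AddMonoidAlgebra.domCongr ℂ ℂ e

theorem weylAction_single (e : (Fin n → ℤ) ≃+ (Fin n → ℤ)) (μ : Fin n → ℤ) (z : ℂ) :
    weylAction e (AddMonoidAlgebra.single μ z) = AddMonoidAlgebra.single (e μ) z :=
  AddMonoidAlgebra.domCongr_single ..

/-- The Laurent polynomials which are invariant under permutations and inversions of the
variables. -/
def weylInvariants (n : ℕ) : Subalgebra ℂ (LaurentAlg n) where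
  carrier := {H | ∀ e ∈ weylGenerators n, weylAction e H = H}
  mul_mem' hf hg e he := by rw [map_mul, hf e he, hg e he]
  add_mem' hf hg e he := by rw [map_add, hf e he, hg e he]
  algebraMap_mem' z e _ := AlgEquiv.commutes _ z

theorem mem_weylInvariants {H : LaurentAlg n} :
    H ∈ weylInvariants n ↔ ∀ e ∈ weylGenerators n, weylAction e H = H := Iff.rfl

theorem mem_weylInvariants_iff {H : LaurentAlg n} : H ∈ weylInvariants n ↔
    (∀ (σ : Equiv.Perm (Fin n)) (μ : Fin n → ℤ), H.coeff (μ ∘ σ) = H.coeff μ) ∧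
      ∀ (i : Fin n) (μ : Fin n → ℤ), H.coeff (Function.update μ i (-μ i)) = H.coeff μ := by
  constructor
  · intro h
    constructor
    · intro σ μ
      have h1 := h _ (Or.inl ⟨σ, rfl⟩)
      conv_rhs => rw [← h1]
      rw [weylAction, AddMonoidAlgebra.coeff_domCongr]
      rfl
    · intro i μ
      have h1 := h _ (Or.inr ⟨i, rfl⟩)
      conv_rhs => rw [← h1]
      rw [weylAction, AddMonoidAlgebra.coeff_domCongr]
      rfl
  · rintro ⟨h1, h2⟩ e (⟨σ, rfl⟩ | ⟨i, rfl⟩)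
    · ext μ
      rw [weylAction, AddMonoidAlgebra.coeff_domCongr]
      exact h1 σ μ
    · ext μ
      rw [weylAction, AddMonoidAlgebra.coeff_domCongr]
      exact h2 i μ

/-- The lexicographically highest exponent of an invariant Laurent polynomial is a partition. -/
theorem exists_highest_exponent {H : LaurentAlg n} (hH : H ∈ weylInvariants n) (h0 : H ≠ 0) :
    ∃ μ : Fin n → ℕ, Antitone μ ∧ H.coeff (fun i => (μ i : ℤ)) ≠ 0 ∧
      ∀ ν, H.coeff ν ≠ 0 → toLex ν ≤ toLex (fun i => (μ i : ℤ)) := by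
  obtain ⟨hperm, hneg⟩ := mem_weylInvariants_iff.1 hH
  have hne : H.coeff.support.Nonempty := by
    rw [Finsupp.support_nonempty_iff]
    intro h
    exact h0 (by ext μ; rw [h]; rfl)
  obtain ⟨ν, hν, hmax⟩ := Finset.exists_max_image H.coeff.support
    (fun μ => (toLex μ : Lex (Fin n → ℤ))) hne
  rw [Finsupp.mem_support_iff] at hν
  have hmax' : ∀ μ, H.coeff μ ≠ 0 → toLex μ ≤ toLex ν := fun μ hμ =>
    hmax μ (Finsupp.mem_support_iff.2 hμ)
  have hpos : ∀ i, 0 ≤ ν i := by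
    intro i
    by_contra h
    have h1 := hmax' (Function.update ν i (-ν i)) (by rwa [hneg])
    refine absurd h1 (not_le.2 ⟨i, fun j hj => ?_, ?_⟩)
    · exact (Function.update_of_ne (ne_of_lt hj) _ _).symm
    · change ν i < Function.update ν i (-ν i) i
      rw [Function.update_self]
      omega
  have hanti : Antitone ν := by
    intro i j hij
    by_contra h
    rw [not_le] at h
    have hij : i < j := lt_of_le_of_ne hij fun h' => by rw [h'] at h; exact h.false
    have h1 := hmax' (ν ∘ Equiv.swap i j) (by rwa [hperm])
    refine absurd h1 (not_le.2 ⟨i, fun k hk => ?_, ?_⟩)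
    · change ν k = ν (Equiv.swap i j k)
      rw [Equiv.swap_apply_of_ne_of_ne (ne_of_lt hk) (ne_of_lt (lt_trans hk hij))]
    · change ν i < ν (Equiv.swap i j i)
      rwa [Equiv.swap_apply_left]
  have hcast : (fun i => ((ν i).toNat : ℤ)) = ν := funext fun i => Int.toNat_of_nonneg (hpos i)
  refine ⟨fun i => (ν i).toNat, fun i j hij => Int.toNat_le_toNat (hanti hij), ?_, ?_⟩
  · rwa [hcast]
  · rwa [hcast]

theorem hasLead_lexCone_of_highest {H : LaurentAlg n} {μ : Fin n → ℤ}
    (h : ∀ ν, H.coeff ν ≠ 0 → toLex ν ≤ toLex μ) :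
    HasLead (lexCone n) (zexpo (-μ)) (H.coeff μ) (expandLaurent H) := by
  refine ⟨fun γ hγ => ?_, expandLaurent_coeff H μ⟩
  obtain ⟨ν, rfl, hν⟩ := exists_of_expandLaurent_coeff_ne_zero hγ
  rw [mem_lexCone, sub_nonneg]
  by_contra hlt
  obtain ⟨i, h1, h2⟩ := (zexpo_lt_iff _ _).1 (not_le.1 hlt)
  refine absurd (h ν hν) (not_le.2 ⟨i, fun j hj => ?_, ?_⟩)
  · exact (neg_injective (h1 j hj)).symm
  · exact neg_lt_neg_iff.1 h2

/-- Under the separation of eigenvalues, an invariant eigenfunction for `d_λ` of degree at most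
`|λ|` is determined by its coefficient of `x^λ`. -/
theorem eq_zero_of_eigen {p : Params} (hα0 : p.α ≠ 0) (ht : p.t ≠ 0)
    (hα : p.α ^ 2 = p.a * p.b * p.c * p.d / (p.q : ℂ)) {lam : Fin n → ℕ}
    (hsep : ∀ μ : Fin n → ℕ, Antitone μ → μ ≠ lam → ∑ i, μ i ≤ ∑ i, lam i →
      eigenvalue p μ ≠ eigenvalue p lam)
    {H : LaurentAlg n} (hH : H ∈ weylInvariants n)
    (hdeg : ∀ μ : Fin n → ℕ, Antitone μ → H.coeff (fun i => (μ i : ℤ)) ≠ 0 →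
      ∑ i, μ i ≤ ∑ i, lam i)
    (heig : opX p (toRatX H) = eigenvalue p lam • toRatX H)
    (hlam : H.coeff (fun i => (lam i : ℤ)) = 0) : H = 0 := by
  by_contra h0
  obtain ⟨μ, hμ, hμ0, hmax⟩ := exists_highest_exponent hH h0
  -- The lexicographically highest exponent `μ` is a partition, and by triangularity it satisfies
  -- `d_μ = d_λ`.
  refine hsep μ hμ (fun h => hμ0 (by rw [h]; exact hlam)) (hdeg μ hμ hμ0) ?_
  have h1 := (hasLead_lexCone_of_highest hmax).opY isPositiveCone_lexCone hα0 ht hα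
  have h2 := congrArg expandX heig
  rw [expandX_opX, expandX_smul, expandX_toRatX] at h2
  have h3 := h1.coeff_eq
  rw [h2, HahnSeries.coeff_smul, expandLaurent_coeff, eigenvalueInt_natCast, smul_eq_mul] at h3
  exact (mul_right_cancel₀ hμ0 h3).symm

end WeylGroup

/-! ### Koornwinder operators preserve invariant Laurent polynomials -/

section Polynomiality

open Polynomial

variable {n : ℕ} {L : Type*} [Field L]

/-- The polynomial `∏_j (z - x_j) (z - 1/x_j)`, whose coefficients generate the invariants. -/
def nodePoly (x : Fin n → L) : L[X] := ∏ j, ((X - C (x j)) * (X - C (x j)⁻¹))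

/-- The cofactor `∏_{j ≠ i} (z - x_j) (z - 1/x_j)`. -/
def nodeCofactor (x : Fin n → L) (i : Fin n) : L[X] :=
  ∏ j ∈ Finset.univ.erase i, ((X - C (x j)) * (X - C (x j)⁻¹))

/-- The nodes `x_1, …, x_n, 1/x_1, …, 1/x_n`. -/
def node (x : Fin n → L) : Fin n ⊕ Fin n → L := Sum.elim x fun i => (x i)⁻¹

/-- The index `i` of the nodes `x_i` and `1/x_i`. -/
def nodeIndex : Fin n ⊕ Fin n → Fin n := Sum.elim id id

variable {x : Fin n → L}

theorem nodePoly_monic (x : Fin n → L) : (nodePoly x).Monic :=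
  monic_prod_of_monic _ _ fun _ _ => (monic_X_sub_C _).mul (monic_X_sub_C _)

theorem natDegree_nodePoly (x : Fin n → L) : (nodePoly x).natDegree = 2 * n := by
  rw [nodePoly, natDegree_prod_of_monic _ _ fun _ _ => (monic_X_sub_C _).mul (monic_X_sub_C _)]
  simp only [(monic_X_sub_C _).natDegree_mul (monic_X_sub_C _), natDegree_X_sub_C]
  simp [mul_comm]

theorem mul_nodeCofactor (x : Fin n → L) (ν : Fin n ⊕ Fin n) :
    (X - C (node x ν)) * (X - C (node x ν)⁻¹) * nodeCofactor x (nodeIndex ν) = nodePoly x := by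
  rw [nodePoly, ← Finset.mul_prod_erase _ _ (Finset.mem_univ (nodeIndex ν)), nodeCofactor]
  cases ν with
  | inl i => rfl
  | inr i => simp only [node, nodeIndex, Sum.elim_inr, inv_inv, id]; rw [mul_comm (X - C (x i))]

theorem node_ne_zero (hx : ∀ i, x i ≠ 0) (ν : Fin n ⊕ Fin n) : node x ν ≠ 0 := by
  cases ν with
  | inl i => exact hx i
  | inr i => exact inv_ne_zero (hx i)

theorem natDegree_nodeCofactor_le (x : Fin n → L) (i : Fin n) :
    (nodeCofactor x i).natDegree ≤ 2 * n := by
  have h : (X - C (x i)) * (X - C (x i)⁻¹) * nodeCofactor x i = nodePoly x :=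
    mul_nodeCofactor x (Sum.inl i)
  have h1 : (nodeCofactor x i).Monic :=
    monic_prod_of_monic _ _ fun _ _ => (monic_X_sub_C _).mul (monic_X_sub_C _)
  rw [← natDegree_nodePoly x, ← h, Monic.natDegree_mul ((monic_X_sub_C _).mul (monic_X_sub_C _)) h1]
  exact Nat.le_add_left _ _

variable [Algebra ℂ L]

/-- The algebra generated by the coefficients of `∏_j (z - x_j) (z - 1/x_j)`. -/
def coeffAlg (x : Fin n → L) : Subalgebra ℂ L := Algebra.adjoin ℂ (Set.range (nodePoly x).coeff)

/-- The families over the nodes which are given by a polynomial with invariant coefficients. -/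
def nodeAlg (x : Fin n → L) : Subalgebra (coeffAlg x) (Fin n ⊕ Fin n → L) :=
  Algebra.adjoin (coeffAlg x) {node x}

theorem coeff_nodePoly_mem (x : Fin n → L) (k : ℕ) : (nodePoly x).coeff k ∈ coeffAlg x :=
  Algebra.subset_adjoin ⟨k, rfl⟩

theorem const_mem_nodeAlg {s : L} (hs : s ∈ coeffAlg x) : (fun _ => s) ∈ nodeAlg x :=
  (nodeAlg x).algebraMap_mem ⟨s, hs⟩

theorem node_mem_nodeAlg : node x ∈ nodeAlg x := Algebra.subset_adjoin rfl

theorem smul_mem_nodeAlg (z : ℂ) {φ : Fin n ⊕ Fin n → L} (hφ : φ ∈ nodeAlg x) :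
    (fun ν => z • φ ν) ∈ nodeAlg x := by
  have := mul_mem (const_mem_nodeAlg ((coeffAlg x).algebraMap_mem z)) hφ
  convert this using 1
  ext ν
  rw [Pi.mul_apply, Algebra.smul_def]

/-- The values at elements of the node algebra of polynomials with coefficients in the node
algebra. -/
theorem eval_mem_nodeAlg {P : Fin n ⊕ Fin n → L[X]} {d : ℕ} (hd : ∀ ν, (P ν).natDegree ≤ d)
    (hP : ∀ k, (fun ν => (P ν).coeff k) ∈ nodeAlg x) {φ : Fin n ⊕ Fin n → L}
    (hφ : φ ∈ nodeAlg x) : (fun ν => (P ν).eval (φ ν)) ∈ nodeAlg x := by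
  have : (fun ν => (P ν).eval (φ ν)) =
      ∑ k ∈ Finset.range (d + 1), (fun ν => (P ν).coeff k) * φ ^ k := by
    ext ν
    rw [eval_eq_sum_range' (Nat.lt_succ_of_le (hd ν)), Finset.sum_apply]
    rfl
  rw [this]
  exact sum_mem fun k _ => mul_mem (hP k) (pow_mem hφ k)

/-- The inverses of the nodes, by the equation which they satisfy. -/
theorem node_inv_mem_nodeAlg (hx : ∀ i, x i ≠ 0) : (fun ν => (node x ν)⁻¹) ∈ nodeAlg x := by
  have h0 : (nodePoly x).coeff 0 = 1 := by
    rw [coeff_zero_eq_eval_zero, nodePoly, eval_prod]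
    exact Finset.prod_eq_one fun j _ => by simp [hx j]
  have h1 : (fun ν => (node x ν)⁻¹) = -fun ν => (nodePoly x).divX.eval (node x ν) := by
    ext ν
    have h2 : (nodePoly x).eval (node x ν) = 0 := by rw [← mul_nodeCofactor x ν]; simp
    rw [← divX_mul_X_add (nodePoly x), h0] at h2
    simp only [eval_add, eval_mul, eval_X, eval_C] at h2
    rw [Pi.neg_apply]
    exact inv_eq_of_mul_eq_one_left (by linear_combination -h2)
  rw [h1]
  refine neg_mem (eval_mem_nodeAlg (fun _ => le_rfl) (fun k => ?_) node_mem_nodeAlg)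
  rw [coeff_divX]
  exact const_mem_nodeAlg (coeff_nodePoly_mem x _)

/-- The cofactor `Q_u` of a node `u` is determined recursively by the equation
`Q = (z² - (u + 1/u) z + 1) Q_u`; hence its coefficients are polynomials in `u` with invariant coefficients. -/
theorem coeff_nodeCofactor_mem (hx : ∀ i, x i ≠ 0) (k : ℕ) :
    (fun ν => (nodeCofactor x (nodeIndex ν)).coeff k) ∈ nodeAlg x := by
  have hrec : ∀ ν, nodePoly x = nodeCofactor x (nodeIndex ν) * X ^ 2 -
      C (node x ν + (node x ν)⁻¹) * (nodeCofactor x (nodeIndex ν) * X) +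
        nodeCofactor x (nodeIndex ν) := by
    intro ν
    have h : C (node x ν) * C (node x ν)⁻¹ = 1 := by
      rw [← C_mul, mul_inv_cancel₀ (node_ne_zero hx ν), C_1]
    rw [← mul_nodeCofactor x ν, C_add]
    linear_combination nodeCofactor x (nodeIndex ν) * h
  have he : (fun ν => node x ν + (node x ν)⁻¹) ∈ nodeAlg x :=
    add_mem node_mem_nodeAlg (node_inv_mem_nodeAlg hx)
  induction k using Nat.strong_induction_on with
  | _ k ih =>
    match k with
    | 0 =>
      convert const_mem_nodeAlg (coeff_nodePoly_mem x 0) using 1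
      ext ν
      conv_rhs => rw [hrec ν]
      simp
    | 1 =>
      have h1 := ih 0 (by omega)
      convert add_mem (const_mem_nodeAlg (coeff_nodePoly_mem x 1)) (mul_mem he h1) using 1
      ext ν
      simp only [Pi.add_apply, Pi.mul_apply]
      rw [hrec ν]
      rw [coeff_add, coeff_sub, coeff_C_mul, coeff_mul_X_pow', if_neg (by norm_num),
        coeff_mul_X _ 0]
      ring
    | k + 2 =>
      have h1 := ih (k + 1) (by omega)
      have h0 := ih k (by omega)
      convert sub_mem (add_mem (const_mem_nodeAlg (coeff_nodePoly_mem x (k + 2)))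
        (mul_mem he h1)) h0 using 1
      ext ν
      simp only [Pi.add_apply, Pi.sub_apply, Pi.mul_apply]
      rw [hrec ν]
      simp only [coeff_add, coeff_sub, coeff_C_mul, coeff_mul_X_pow, coeff_mul_X]
      ring

/-- The sum of the residues of a form whose numerator has invariant coefficients is invariant. -/
theorem sum_residues_mem (hx : ∀ i, x i ≠ 0) (hinj : Function.Injective x)
    (hxx : ∀ i j, x i * x j ≠ 1) {φ : Fin n ⊕ Fin n → L} (hφ : φ ∈ nodeAlg x) :
    ∑ ν, φ ν / ((node x ν - (node x ν)⁻¹) * (nodeCofactor x (nodeIndex ν)).eval (node x ν)) ∈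
      coeffAlg x := by
  obtain ⟨g, hg⟩ : ∃ g : (coeffAlg x)[X], aeval (node x) g = φ := by
    rwa [nodeAlg, Algebra.adjoin_singleton_eq_range_aeval] at hφ
  obtain ⟨Q, hQ, -, hQm⟩ : ∃ Q : (coeffAlg x)[X], Q.map (algebraMap (coeffAlg x) L) = nodePoly x ∧
      Q.degree = (nodePoly x).degree ∧ Q.Monic := by
    refine lifts_and_degree_eq_and_monic ?_ (nodePoly_monic x)
    rw [lifts_iff_coeff_lifts]
    intro k
    exact ⟨⟨_, coeff_nodePoly_mem x k⟩, rfl⟩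
  -- The values at the nodes depend on the numerator only modulo the node polynomial; the remainder
  -- has degree below `2n`, and the sum of the residues is its coefficient of degree `2n - 1`.
  set r := (g %ₘ Q).map (algebraMap (coeffAlg x) L) with hr
  have hrφ : ∀ ν, r.eval (node x ν) = φ ν := by
    intro ν
    have h1 : φ ν = (g.map (algebraMap (coeffAlg x) L)).eval (node x ν) := by
      rw [eval_map_algebraMap, ← hg]
      exact (aeval_algHom_apply (Pi.evalAlgHom (coeffAlg x) (fun _ : Fin n ⊕ Fin n => L) ν)
        (node x) g).symm
    have h2 : (nodePoly x).eval (node x ν) = 0 := by rw [← mul_nodeCofactor x ν]; simp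
    rw [h1, hr, map_modByMonic _ hQm, hQ]
    conv_rhs => rw [← modByMonic_add_div (g.map (algebraMap (coeffAlg x) L)) (nodePoly x)]
    rw [eval_add, eval_mul, h2, zero_mul, add_zero]
  have hdeg : r.degree < (2 * n : ℕ) := by
    rw [hr, map_modByMonic _ hQm, hQ, ← natDegree_nodePoly x,
      ← degree_eq_natDegree (nodePoly_monic x).ne_zero]
    exact degree_modByMonic_lt _ (nodePoly_monic x)
  have h := sum_residues_pairs x (fun i => (x i)⁻¹) hx (fun i => inv_ne_zero (hx i)) hinj
    (inv_injective.comp hinj) (fun i j h => hxx i j (by rw [h, inv_mul_cancel₀ (hx j)])) (X * r)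
    (by
      rw [Fintype.card_fin, mul_comm X r]
      by_cases h0 : r = 0
      · simp [h0]
      · rw [natDegree_mul_X h0]
        exact (natDegree_lt_iff_degree_lt h0).2 hdeg)
  have hterm : ∀ ν, (X * r).eval (node x ν) / (node x ν * (node x ν - (node x ν)⁻¹) *
      (nodeCofactor x (nodeIndex ν)).eval (node x ν)) = φ ν /
        ((node x ν - (node x ν)⁻¹) * (nodeCofactor x (nodeIndex ν)).eval (node x ν)) := by
    intro ν
    rw [eval_mul, eval_X, hrφ, mul_assoc, mul_div_mul_left _ _ (node_ne_zero hx ν)]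
  have hsum : ∑ ν, φ ν / ((node x ν - (node x ν)⁻¹) *
      (nodeCofactor x (nodeIndex ν)).eval (node x ν)) = (X * r).coeff (2 * n) := by
    rw [Fintype.card_fin] at h
    rw [← h, eval_mul, eval_X, zero_mul, zero_div, zero_add,
      Finset.sum_add_distrib, ← Finset.sum_congr rfl fun ν _ => hterm ν, Fintype.sum_sum_type]
    simp only [node, nodeIndex, nodeCofactor, Sum.elim_inl, Sum.elim_inr, eval_prod, eval_mul,
      eval_sub, eval_X, eval_C, inv_inv, id]
  rw [hsum]
  rcases Nat.eq_zero_or_pos n with rfl | hn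
  · simp
  · obtain ⟨k, hk⟩ : ∃ k, 2 * n = k + 1 := ⟨2 * n - 1, by omega⟩
    rw [hk, coeff_X_mul, hr, coeff_map]
    exact SetLike.coe_mem _

/-- The `q`-shift of the node polynomial at a node `u` is obtained from it by replacing the
factors of `u` and `1/u`. -/
def ShiftsNodes (q : ℂ) (x : Fin n → L) (σ : Fin n ⊕ Fin n → L →ₐ[ℂ] L) : Prop :=
  ∀ ν, (nodePoly x).map (σ ν : L →+* L) =
    (X - C (q • node x ν)) * (X - C (q⁻¹ • (node x ν)⁻¹)) * nodeCofactor x (nodeIndex ν)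

/-- For `h` invariant, `(T_u h - h) / (1 - q u²)` is a polynomial in the node `u` with invariant
coefficients. -/
theorem exists_shift_sub_eq (hx : ∀ i, x i ≠ 0) {q : ℂ} (hq : q ≠ 0)
    {σ : Fin n ⊕ Fin n → L →ₐ[ℂ] L} (hσ : ShiftsNodes q x σ) {h : L} (hh : h ∈ coeffAlg x) :
    (fun ν => σ ν h) ∈ nodeAlg x ∧
      ∃ ψ ∈ nodeAlg x, ∀ ν, σ ν h - h = (1 - q • node x ν ^ 2) * ψ ν := by
  have hu := node_mem_nodeAlg (x := x)
  have hw := node_inv_mem_nodeAlg hx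
  induction hh using Algebra.adjoin_induction with
  | algebraMap z =>
    simp only [AlgHom.commutes, sub_self]
    exact ⟨const_mem_nodeAlg ((coeffAlg x).algebraMap_mem z), 0, zero_mem _, fun ν => by simp⟩
  | add f g hf hg ihf ihg =>
    obtain ⟨h1, ψ, hψ, h2⟩ := ihf
    obtain ⟨h3, χ, hχ, h4⟩ := ihg
    simp only [map_add]
    refine ⟨add_mem h1 h3, ψ + χ, add_mem hψ hχ, fun ν => ?_⟩
    rw [Pi.add_apply]
    linear_combination h2 ν + h4 ν
  | mul f g hf hg ihf ihg =>
    obtain ⟨h1, ψ, hψ, h2⟩ := ihf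
    obtain ⟨h3, χ, hχ, h4⟩ := ihg
    simp only [map_mul]
    refine ⟨mul_mem h1 h3, ψ * (fun ν => σ ν g) + (fun _ => f) * χ,
      add_mem (mul_mem hψ h3) (mul_mem (const_mem_nodeAlg hf) hχ), fun ν => ?_⟩
    rw [Pi.add_apply, Pi.mul_apply, Pi.mul_apply]
    linear_combination (σ ν g) * h2 ν + f * h4 ν
  | mem h hh =>
    obtain ⟨k, rfl⟩ := hh
    have hdiff : ∀ ν, (nodePoly x).map (σ ν : L →+* L) - nodePoly x =
        C ((1 - q • node x ν ^ 2) * (((1 - q⁻¹) • (node x ν)⁻¹))) *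
          (nodeCofactor x (nodeIndex ν) * X) := by
      intro ν
      rw [hσ ν, ← mul_nodeCofactor x ν]
      have h1 : C (node x ν) * C (node x ν)⁻¹ = 1 := by
        rw [← C_mul, mul_inv_cancel₀ (node_ne_zero hx ν), C_1]
      have h2 : C (algebraMap ℂ L q) * C (algebraMap ℂ L q⁻¹) = 1 := by
        rw [← C_mul, ← map_mul, mul_inv_cancel₀ hq, map_one, C_1]
      simp only [Algebra.smul_def, C_mul, C_pow, map_sub, map_one]
      generalize C (node x ν) = V at *
      generalize C (node x ν)⁻¹ = W at *
      generalize C (algebraMap ℂ L q) = A at *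
      generalize C (algebraMap ℂ L q⁻¹) = B at *
      linear_combination nodeCofactor x (nodeIndex ν) * (V * W * h2 + X * A * V * h1 -
        X * V * (V * W * h2 + h1))
    have hcoeff : ∀ ν, σ ν ((nodePoly x).coeff k) - (nodePoly x).coeff k =
        (1 - q • node x ν ^ 2) * (((1 - q⁻¹) • (node x ν)⁻¹) *
          (nodeCofactor x (nodeIndex ν) * X).coeff k) := by
      intro ν
      rw [← mul_assoc, ← coeff_C_mul, ← hdiff, coeff_sub, coeff_map]
      rfl
    have hX : (fun ν => (nodeCofactor x (nodeIndex ν) * X).coeff k) ∈ nodeAlg x := by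
      cases k with
      | zero => simp only [coeff_mul_X_zero]; exact (nodeAlg x).zero_mem
      | succ k => simpa only [coeff_mul_X] using coeff_nodeCofactor_mem hx k
    have hψ : (fun ν => ((1 - q⁻¹) • (node x ν)⁻¹) *
          (nodeCofactor x (nodeIndex ν) * X).coeff k) ∈ nodeAlg x :=
      mul_mem (smul_mem_nodeAlg _ hw) hX
    refine ⟨?_, _, hψ, hcoeff⟩
    have h1 := add_mem (mul_mem (sub_mem (one_mem (nodeAlg x))
      (smul_mem_nodeAlg q (pow_mem hu 2))) hψ) (const_mem_nodeAlg (coeff_nodePoly_mem x k))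
    convert h1 using 1
    ext ν
    rw [Pi.add_apply, Pi.mul_apply, Pi.sub_apply, Pi.one_apply, Pi.pow_apply, ← hcoeff ν,
      sub_add_cancel]

/-- The coefficient of the Koornwinder operator at a node, with its denominator written in terms
of the node polynomial. -/
theorem opCoeff_node (hx : ∀ i, x i ≠ 0) (p : Params) (ν : Fin n ⊕ Fin n) :
    opCoeff p x (nodeIndex ν) (node x ν) * (1 - (p.q : ℂ) • node x ν ^ 2) =
      (1 - (p.q : ℂ) • node x ν ^ 2) * (1 - (p.q : ℂ) • node x ν ^ 2)⁻¹ *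
        ((p.α * p.t ^ (n - 1))⁻¹ •
          (((1 - p.a • node x ν) * (1 - p.b • node x ν) * (1 - p.c • node x ν) *
              (1 - p.d • node x ν) * (nodeCofactor x (nodeIndex ν)).eval (p.t • node x ν) *
                (-(node x ν)⁻¹)) /
            ((node x ν - (node x ν)⁻¹) *
              (nodeCofactor x (nodeIndex ν)).eval (node x ν)))) := by
  have h1 : ∀ z : ℂ, ∏ j ∈ Finset.univ.erase (nodeIndex ν),
      ((1 - z • (node x ν * x j)) * (1 - z • (node x ν / x j))) =
        (nodeCofactor x (nodeIndex ν)).eval (z • node x ν) := by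
    intro z
    rw [nodeCofactor, eval_prod]
    refine Finset.prod_congr rfl fun j _ => ?_
    simp only [eval_mul, eval_sub, eval_X, eval_C, Algebra.smul_def]
    field_simp [hx j]
    ring
  have h2 := h1 1
  simp only [one_smul] at h2
  rw [opCoeff, Finset.prod_div_distrib, h1, h2]
  have h3 : 1 - node x ν ^ 2 = -node x ν * (node x ν - (node x ν)⁻¹) := by
    have := mul_inv_cancel₀ (node_ne_zero hx ν)
    linear_combination -this
  rw [h3, Algebra.smul_def (p.α * p.t ^ (n - 1))⁻¹, map_inv₀]
  simp only [div_eq_mul_inv, mul_inv, inv_neg]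
  ring

/-- The Koornwinder operator preserves the invariants. -/
theorem koornwinderOp_mem_coeffAlg (hx : ∀ i, x i ≠ 0) (hinj : Function.Injective x)
    (hxx : ∀ i j, x i * x j ≠ 1) {p : Params}
    {T : ℤ → Fin n → L →ₐ[ℂ] L}
    (hσ : ShiftsNodes (p.q : ℂ) x (Sum.elim (T 1) (T (-1))))
    (hq : ∀ ν, 1 - (p.q : ℂ) • node x ν ^ 2 ≠ 0) {h : L} (hh : h ∈ coeffAlg x) :
    koornwinderOp p x (fun k i => T k i) h ∈ coeffAlg x := by
  obtain ⟨-, ψ, hψ, hdiff⟩ := exists_shift_sub_eq hx p.q.ne_zero hσ hh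
  have hu := node_mem_nodeAlg (x := x)
  have hlin : ∀ z : ℂ, (fun ν => 1 - z • node x ν) ∈ nodeAlg x := fun z =>
    sub_mem (one_mem _) (smul_mem_nodeAlg z hu)
  have hφ := mul_mem (mul_mem (mul_mem (mul_mem (mul_mem (mul_mem (hlin p.a) (hlin p.b))
    (hlin p.c)) (hlin p.d)) (eval_mem_nodeAlg (fun ν => natDegree_nodeCofactor_le x (nodeIndex ν))
      (coeff_nodeCofactor_mem hx) (smul_mem_nodeAlg p.t hu))) (neg_mem (node_inv_mem_nodeAlg hx))) hψ
  have hsum := (coeffAlg x).smul_mem (sum_residues_mem hx hinj hxx hφ) (p.α * p.t ^ (n - 1))⁻¹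
  convert hsum using 1
  have hterm : ∀ ν, opCoeff p x (nodeIndex ν) (node x ν) *
      (Sum.elim (T 1) (T (-1)) ν h - h) = (p.α * p.t ^ (n - 1))⁻¹ •
        (((1 - p.a • node x ν) * (1 - p.b • node x ν) * (1 - p.c • node x ν) *
              (1 - p.d • node x ν) * (nodeCofactor x (nodeIndex ν)).eval (p.t • node x ν) *
                (-(node x ν)⁻¹)) * ψ ν /
            ((node x ν - (node x ν)⁻¹) *
              (nodeCofactor x (nodeIndex ν)).eval (node x ν))) := by
    intro ν
    rw [hdiff ν, ← mul_assoc, opCoeff_node hx, mul_inv_cancel₀ (hq ν), one_mul, smul_mul_assoc,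
      div_mul_eq_mul_div]
  rw [koornwinderOp, Finset.smul_sum]
  refine Eq.trans ?_ (Finset.sum_congr rfl fun ν _ => hterm ν)
  rw [Fintype.sum_sum_type]
  rfl

end Polynomiality

/-! ### Generators of the invariants -/

section Generators

open Polynomial

variable {n : ℕ}

/-- The polynomial `∏_j (z - x_j) (z - 1/x_j)` over the Laurent polynomials. -/
def laurentNodePoly (n : ℕ) : (LaurentAlg n)[X] :=
  ∏ j, ((X - C (AddMonoidAlgebra.single (Pi.single j 1) 1)) *
    (X - C (AddMonoidAlgebra.single (-Pi.single j 1) 1)))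

theorem toRatX_single_one (j : Fin n) :
    toRatX (AddMonoidAlgebra.single (Pi.single j 1) 1) = xVar j := by
  rw [toRatX_single, one_smul, Finset.prod_eq_single j
    (fun k _ hk => by rw [Pi.single_eq_of_ne hk, zpow_zero]) (by simp), Pi.single_eq_same, zpow_one]

theorem toRatX_single_neg_one (j : Fin n) :
    toRatX (AddMonoidAlgebra.single (-Pi.single j 1) 1) = (xVar j)⁻¹ := by
  rw [toRatX_single, one_smul, Finset.prod_eq_single j
    (fun k _ hk => by rw [Pi.neg_apply, Pi.single_eq_of_ne hk, neg_zero, zpow_zero]) (by simp),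
    Pi.neg_apply, Pi.single_eq_same, zpow_neg_one]

theorem map_laurentNodePoly :
    (laurentNodePoly n).map (toRatX (n := n) : LaurentAlg n →+* RatX n) = nodePoly xVar := by
  rw [laurentNodePoly, nodePoly, Polynomial.map_prod]
  refine Finset.prod_congr rfl fun j _ => ?_
  rw [Polynomial.map_mul, Polynomial.map_sub, Polynomial.map_sub, map_X, map_C, map_C]
  congr 3
  · exact toRatX_single_one j
  · exact toRatX_single_neg_one j

/-- Invariance of a product over the variables of a function of `x_j` and `1/x_j` which does not
change under `x_j ↦ 1/x_j`. -/
theorem prod_pair_weyl_invariant {R : Type*} [CommMonoid R] (g : (Fin n → ℤ) → R)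
    (hg : ∀ j, g (-Pi.single j 1) = g (Pi.single j 1)) {e : (Fin n → ℤ) ≃+ (Fin n → ℤ)}
    (he : e ∈ weylGenerators n) :
    ∏ j, g (e (Pi.single j 1)) = ∏ j, g (Pi.single j 1) := by
  rcases he with ⟨σ, rfl⟩ | ⟨i, rfl⟩
  · rw [← Equiv.prod_comp σ fun j => g (Pi.single j 1)]
    refine Finset.prod_congr rfl fun j _ => congrArg g ?_
    ext k
    change (Pi.single j 1 : Fin n → ℤ) (σ.symm k) = _
    simp only [Pi.single_apply, Equiv.symm_apply_eq]
  · refine Finset.prod_congr rfl fun j _ => ?_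
    change g (Function.update (Pi.single j 1) i (-(Pi.single j 1 : Fin n → ℤ) i)) = _
    by_cases h : i = j
    · subst h
      rw [← hg]
      congr 1
      ext k
      by_cases hk : k = i
      · subst hk; simp
      · simp [hk]
    · rw [Pi.single_eq_of_ne h, neg_zero]
      congr 1
      ext k
      by_cases hk : k = i
      · subst hk; simp [h]
      · simp [hk]

theorem coeff_laurentNodePoly_mem (k : ℕ) : (laurentNodePoly n).coeff k ∈ weylInvariants n := by
  rw [mem_weylInvariants]
  intro e he
  have h : (laurentNodePoly n).map (weylAction e : LaurentAlg n →+* LaurentAlg n) =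
      laurentNodePoly n := by
    rw [laurentNodePoly, Polynomial.map_prod]
    have h1 := prod_pair_weyl_invariant (fun μ : Fin n → ℤ =>
      ((X - C (AddMonoidAlgebra.single μ (1 : ℂ))) * (X - C (AddMonoidAlgebra.single (-μ) (1 : ℂ)))))
      (fun j => by rw [neg_neg, mul_comm]) he
    rw [← h1]
    refine Finset.prod_congr rfl fun j _ => ?_
    rw [Polynomial.map_mul, Polynomial.map_sub, Polynomial.map_sub, map_X, map_C, map_C]
    congr 3
    · exact weylAction_single e _ _
    · rw [← map_neg e]
      exact weylAction_single e _ _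
  conv_rhs => rw [← h]
  rw [coeff_map]
  rfl

/-- The elements of the algebra are Laurent polynomials invariant under the Weyl group. -/
theorem exists_laurent_of_mem_coeffAlg {h : RatX n} (hh : h ∈ coeffAlg (xVar (n := n))) :
    ∃ H ∈ weylInvariants n, toRatX H = h := by
  have : coeffAlg (xVar (n := n)) ≤ (weylInvariants n).map toRatX := by
    refine Algebra.adjoin_le ?_
    rintro _ ⟨k, rfl⟩
    refine ⟨(laurentNodePoly n).coeff k, coeff_laurentNodePoly_mem k, ?_⟩
    rw [← map_laurentNodePoly, coeff_map]
  exact this hh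

theorem map_nodePoly_of_shift {L : Type*} [Field L] [Algebra ℂ L] {x : Fin n → L}
    {i : Fin n} {u : ℂ} {σ : L →ₐ[ℂ] L} (hi : σ (x i) = u • x i)
    (hne : ∀ j, j ≠ i → σ (x j) = x j) : (nodePoly x).map (σ : L →+* L) =
      (X - C (u • x i)) * (X - C (u⁻¹ • (x i)⁻¹)) * nodeCofactor x i := by
  rw [nodePoly, Polynomial.map_prod, ← Finset.mul_prod_erase _ _ (Finset.mem_univ i), nodeCofactor]
  have hC : ∀ w : L, (C w).map (σ : L →+* L) = C (σ w) := fun w => map_C _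
  congr 1
  · rw [Polynomial.map_mul, Polynomial.map_sub, Polynomial.map_sub, map_X, hC, hC, map_inv₀, hi]
    congr 3
    rw [Algebra.smul_def, mul_inv, ← map_inv₀, ← Algebra.smul_def]
  · refine Finset.prod_congr rfl fun j hj => ?_
    rw [Polynomial.map_mul, Polynomial.map_sub, Polynomial.map_sub, map_X, hC, hC, map_inv₀,
      hne j (Finset.ne_of_mem_erase hj)]

theorem shiftsNodes_of_shift {L : Type*} [Field L] [Algebra ℂ L] {x : Fin n → L} {q : ℂ}
    {S T : Fin n → L →ₐ[ℂ] L} (hS : ∀ i, S i (x i) = q • x i)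
    (hS' : ∀ i j, j ≠ i → S i (x j) = x j) (hT : ∀ i, T i (x i) = q⁻¹ • x i)
    (hT' : ∀ i j, j ≠ i → T i (x j) = x j) : ShiftsNodes q x (Sum.elim S T) := by
  rintro (i | i)
  · exact map_nodePoly_of_shift (hS i) (hS' i)
  · refine (map_nodePoly_of_shift (hT i) (hT' i)).trans ?_
    simp only [node, nodeIndex, Sum.elim_inr, id, inv_inv]
    rw [mul_comm (X - C _)]

/-- The operator `D_x` preserves the algebra generated by the coefficients of
`∏_j (z - x_j) (z - 1/x_j)`; no division is left. -/
theorem opX_mem_coeffAlg (p : Params) {h : RatX n} (hh : h ∈ coeffAlg (xVar (n := n))) :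
    opX p h ∈ coeffAlg (xVar (n := n)) := by
  have h1 : ∀ i : Fin n, scaleX i (p.q ^ (1 : ℤ)) (xVar i) = (p.q : ℂ) • xVar i := fun i => by
    rw [scaleX_xVar_self, zpow_one]
  have h2 : ∀ i : Fin n, scaleX i (p.q ^ (-1 : ℤ)) (xVar i) = (p.q : ℂ)⁻¹ • xVar i := fun i => by
    rw [scaleX_xVar_self, zpow_neg_one, Units.val_inv_eq_inv_val]
  have hq : ∀ ν, 1 - (p.q : ℂ) • node (xVar (n := n)) ν ^ 2 ≠ 0 := by
    rintro (i | i)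
    · rw [Algebra.smul_def]
      exact sub_ne_zero.2 (algebraMap_mul_xVar_sq_ne_one _ i).symm
    · rw [Algebra.smul_def]
      exact sub_ne_zero.2 (algebraMap_mul_xVar_inv_sq_ne_one p.q.ne_zero i).symm
  rw [opX_eq_koornwinderOp]
  exact koornwinderOp_mem_coeffAlg xVar_ne_zero xVar_injective xVar_mul_ne_one
    (shiftsNodes_of_shift h1 (fun i j hj => scaleX_xVar_of_ne hj _) h2
      (fun i j hj => scaleX_xVar_of_ne hj _)) hq hh

end Generators

/-! ### Invariants with prescribed leading term -/

section LeadingTerms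

open Polynomial

variable {n : ℕ}

/-- The exponent in `y = 1/x` of `x_1 ⋯ x_k`. -/
def columnExpo (n k : ℕ) : Fin n → ℤ := fun i => if (i : ℕ) < k then -1 else 0

theorem columnExpo_sub_mem {a b : ℕ} (h : a ≤ b) :
    zexpo (columnExpo n a) - zexpo (columnExpo n b) ∈ rootCone n := by
  rw [← zexpo_sub, zexpo_mem_rootCone]
  refine fun k => Finset.sum_nonneg fun i _ => ?_
  rw [Pi.sub_apply, columnExpo, columnExpo]
  split_ifs <;> omega

theorem columnExpo_ne {a b : ℕ} (h : a < b) (hb : b ≤ n) :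
    zexpo (columnExpo n a) ≠ zexpo (columnExpo n b) := by
  intro h'
  have := congrFun (zexpo_injective h') ⟨a, h.trans_le hb⟩
  simp [columnExpo, h] at this

theorem HasLead.columnExpo_lower {a b : ℕ} (h : a < b) (hb : b ≤ n) {c : ℂ} {f : SeriesY n ℂ}
    (hf : HasLead (rootCone n) (zexpo (columnExpo n a)) c f) :
    HasLead (rootCone n) (zexpo (columnExpo n b)) 0 f :=
  hf.lower isPositiveCone_rootCone.nonneg (columnExpo_sub_mem h.le) (columnExpo_ne h hb)

theorem hasLead_yVar_inv_add (i : Fin n) : HasLead (rootCone n) (zexpo (-Pi.single i 1)) 1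
    ((yVar i)⁻¹ + (yVar i)⁻¹⁻¹ : SeriesY n ℂ) := by
  have h1 : HasLead (rootCone n) (zexpo (-Pi.single i 1)) 1 ((yVar i)⁻¹ : SeriesY n ℂ) := by
    rw [yVar_eq, ← zMono_neg]
    exact HasLead.zMono _
  have h2 : HasLead (rootCone n) (zexpo (Pi.single i 1)) 1 (yVar i : SeriesY n ℂ) := by
    rw [yVar_eq]
    exact HasLead.zMono _
  have h3 := h2.lower isPositiveCone_rootCone.nonneg (v := zexpo (-Pi.single i 1))
    (by
      rw [zexpo_neg, sub_neg_eq_add]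
      exact add_mem (isPositiveCone_rootCone.single_mem i) (isPositiveCone_rootCone.single_mem i))
    (by
      intro h
      have := congrFun (zexpo_injective h) i
      simp at this)
  rw [inv_inv]
  simpa using h1.add h3

/-- The leading terms of the coefficients of a partial product of the node polynomial. -/
theorem hasLead_coeff_partial_nodePoly (r : ℕ) (hr : r ≤ n) (k : ℕ) :
    ∃ c : ℂ, HasLead (rootCone n) (zexpo (columnExpo n (min k r))) c
      ((∏ j ∈ Finset.univ.filter (fun j : Fin n => (j : ℕ) < r),
        ((X - C (yVar j : SeriesY n ℂ)⁻¹) * (X - C (yVar j : SeriesY n ℂ)⁻¹⁻¹))).coeff k) ∧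
      (k ≤ r → c = (-1) ^ k) := by
  induction r generalizing k with
  | zero =>
    have h0 : zexpo (columnExpo n 0) = 0 := by
      rw [← zexpo_zero]
      congr 1
    rw [Nat.min_zero, h0]
    simp only [Nat.not_lt_zero, Finset.filter_false, Finset.prod_empty, coeff_one]
    by_cases hk : k = 0
    · exact ⟨1, by rw [if_pos hk]; exact HasLead.one, fun _ => by rw [hk, pow_zero]⟩
    · exact ⟨0, by rw [if_neg hk]; exact HasLead.zero 0, fun h => absurd (Nat.le_zero.1 h) hk⟩
  | succ r ih =>
    have hrn : r < n := hr
    have ih := ih hrn.le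
    have hset : Finset.univ.filter (fun j : Fin n => (j : ℕ) < r + 1) =
        insert ⟨r, hrn⟩ (Finset.univ.filter (fun j : Fin n => (j : ℕ) < r)) := by
      ext j
      simp only [Finset.mem_filter, Finset.mem_univ, true_and, Finset.mem_insert, Fin.ext_iff]
      omega
    rw [hset, Finset.prod_insert (by simp)]
    generalize ∏ j ∈ Finset.univ.filter (fun j : Fin n => (j : ℕ) < r),
        ((X - C (yVar j : SeriesY n ℂ)⁻¹) * (X - C (yVar j : SeriesY n ℂ)⁻¹⁻¹)) = P at ih ⊢
    have hE := hasLead_yVar_inv_add (⟨r, hrn⟩ : Fin n)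
    have hP : (X - C (yVar (⟨r, hrn⟩ : Fin n) : SeriesY n ℂ)⁻¹) *
        (X - C (yVar (⟨r, hrn⟩ : Fin n) : SeriesY n ℂ)⁻¹⁻¹) * P = P * X ^ 2 -
        C ((yVar (⟨r, hrn⟩ : Fin n) : SeriesY n ℂ)⁻¹ + (yVar ⟨r, hrn⟩)⁻¹⁻¹) * (P * X) + P := by
      have h : C (yVar (⟨r, hrn⟩ : Fin n) : SeriesY n ℂ)⁻¹ * C (yVar ⟨r, hrn⟩)⁻¹⁻¹ = 1 := by
        rw [← C_mul, mul_inv_cancel₀ (inv_ne_zero (yVar_ne_zero _)), C_1]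
      rw [C_add]
      linear_combination P * h
    rw [hP]
    generalize (yVar (⟨r, hrn⟩ : Fin n) : SeriesY n ℂ)⁻¹ + (yVar ⟨r, hrn⟩)⁻¹⁻¹ = E at hE ⊢
    -- the two contributions which do not involve the new variable
    have h0 : ∀ k, ∃ c, HasLead (rootCone n) (zexpo (columnExpo n (min k (r + 1)))) c (P.coeff k) ∧
        (k ≤ r → c = (-1) ^ k) ∧ (k = r + 1 → c = 0) := by
      intro k
      obtain ⟨c, hc, hc'⟩ := ih k
      rcases Nat.lt_or_ge r k with hk | hk
      · rw [min_eq_right hk.le] at hc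
        rw [min_eq_right (show r + 1 ≤ k from hk)]
        exact ⟨0, hc.columnExpo_lower (Nat.lt_succ_self r) hr, fun h => absurd h (not_le.2 hk),
          fun _ => rfl⟩
      · rw [min_eq_left hk] at hc
        rw [min_eq_left (Nat.le_succ_of_le hk)]
        exact ⟨c, hc, hc', fun h => absurd hk (by omega)⟩
    have h1 : ∀ k, ∃ c, HasLead (rootCone n) (zexpo (columnExpo n (min (k + 1) (r + 1)))) c
        (E * P.coeff k) ∧ (k < r → c = 0) ∧ (k = r → c = (-1) ^ r) := by
      intro k
      obtain ⟨c, hc, hc'⟩ := ih k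
      have hm := hE.mul isPositiveCone_rootCone.nonneg hc
      rw [one_mul, ← zexpo_add] at hm
      rcases Nat.lt_or_ge k r with hk | hk
      · rw [min_eq_left hk.le] at hm
        rw [min_eq_left (by omega)]
        refine ⟨0, hm.lower isPositiveCone_rootCone.nonneg ?_ ?_, fun _ => rfl, fun h => ?_⟩
        · rw [← zexpo_sub]
          have e : -Pi.single ⟨r, hrn⟩ 1 + columnExpo n k - columnExpo n (k + 1) =
              Pi.single (⟨k, hk.trans hrn⟩ : Fin n) 1 - Pi.single ⟨r, hrn⟩ 1 := by
            ext i
            simp only [Pi.add_apply, Pi.sub_apply, Pi.neg_apply, columnExpo, Pi.single_apply,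
              Fin.ext_iff]
            split_ifs <;> omega
          rw [e]
          exact isPositiveCone_rootCone.sub_mem _ _ hk
        · intro h
          have := congrFun (zexpo_injective h) ⟨k, hk.trans hrn⟩
          simp [columnExpo, hk.ne] at this
        · exact absurd h hk.ne
      · rw [min_eq_right hk] at hm
        rw [min_eq_right (by omega)]
        have e : -Pi.single ⟨r, hrn⟩ 1 + columnExpo n r = columnExpo n (r + 1) := by
          ext i
          simp only [Pi.add_apply, Pi.neg_apply, columnExpo, Pi.single_apply, Fin.ext_iff]
          split_ifs <;> omega
        rw [e] at hm
        exact ⟨c, hm, fun h => absurd h (not_lt.2 hk), fun h => by rw [hc' h.le, h]⟩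
    have h2 : ∀ k, HasLead (rootCone n) (zexpo (columnExpo n (min (k + 2) (r + 1)))) 0
        (P.coeff k) := by
      intro k
      obtain ⟨c, hc, -⟩ := ih k
      exact hc.columnExpo_lower (by omega) (by omega)
    match k with
    | 0 =>
      obtain ⟨c, hc, hc', -⟩ := h0 0
      refine ⟨c, ?_, fun _ => hc' (Nat.zero_le _)⟩
      simpa using hc
    | 1 =>
      obtain ⟨c, hc, hc1, hc2⟩ := h0 1
      obtain ⟨d, hd, hd1, hd2⟩ := h1 0
      refine ⟨-d + c, ?_, fun hk => ?_⟩
      · rw [coeff_add, coeff_sub, coeff_mul_X_pow', if_neg (by norm_num), zero_sub, coeff_C_mul,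
          coeff_mul_X P 0]
        exact hd.neg.add hc
      · rcases Nat.eq_zero_or_pos r with hr0 | hr0
        · rw [hc2 (by omega), hd2 hr0.symm, hr0]; norm_num
        · rw [hc1 hr0, hd1 hr0]; norm_num
    | k + 2 =>
      obtain ⟨c, hc, hc1, hc2⟩ := h0 (k + 2)
      obtain ⟨d, hd, hd1, hd2⟩ := h1 (k + 1)
      refine ⟨0 - d + c, ?_, fun hk => ?_⟩
      · rw [coeff_add, coeff_sub, coeff_mul_X_pow, coeff_C_mul, coeff_mul_X]
        exact ((h2 k).sub hd).add hc
      · rcases Nat.lt_or_ge (k + 1) r with hr0 | hr0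
        · rw [hc1 hr0, hd1 hr0]; ring
        · have : k + 1 = r := by omega
          rw [hc2 (by omega), hd2 this, ← this]; ring

theorem hasLead_coeff_nodePoly {k : ℕ} (hk : k ≤ n) :
    HasLead (rootCone n) (zexpo (columnExpo n k)) ((-1) ^ k)
      (expandX ((nodePoly (xVar (n := n))).coeff k)) := by
  obtain ⟨c, hc, hc'⟩ := hasLead_coeff_partial_nodePoly n (le_refl n) k
  rw [hc' hk, min_eq_left hk] at hc
  have h : (nodePoly (xVar (n := n))).map expandX =
      ∏ j ∈ Finset.univ.filter (fun j : Fin n => (j : ℕ) < n),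
        ((X - C (yVar j : SeriesY n ℂ)⁻¹) * (X - C (yVar j : SeriesY n ℂ)⁻¹⁻¹)) := by
    rw [nodePoly, Polynomial.map_prod, Finset.filter_true_of_mem fun j _ => j.isLt]
    refine Finset.prod_congr rfl fun j _ => ?_
    rw [Polynomial.map_mul, Polynomial.map_sub, Polynomial.map_sub, map_X, map_C, map_C, map_inv₀,
      expandX_xVar]
  rwa [← h, coeff_map] at hc

/-- For each partition `λ`, an invariant with leading term a nonzero multiple of `x^λ`. -/
theorem exists_mem_coeffAlg_hasLead {lam : Fin n → ℕ} (hlam : Antitone lam) :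
    ∃ h ∈ coeffAlg (xVar (n := n)), ∃ c : ℂ, c ≠ 0 ∧
      HasLead (rootCone n) (zexpo (-fun i => (lam i : ℤ))) c (expandX h) := by
  let L : ℕ → ℕ := fun k => if h : k < n then lam ⟨k, h⟩ else 0
  have hL : ∀ k, L (k + 1) ≤ L k := by
    intro k
    simp only [L]
    split_ifs with h1 h2
    · exact hlam (by simp [Fin.le_def])
    · omega
    · exact Nat.zero_le _
    · exact le_rfl
  -- The product of the powers of the coefficients `e_k` with exponents `λ_k - λ_{k+1}`: each `e_k`
  -- has the leading term `±x_1 ⋯ x_k`.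
  refine ⟨∏ k ∈ Finset.range n, (nodePoly (xVar (n := n))).coeff (k + 1) ^ (L k - L (k + 1)),
    prod_mem fun k _ => pow_mem (coeff_nodePoly_mem _ _) _,
    ∏ k ∈ Finset.range n, ((-1 : ℂ) ^ (k + 1)) ^ (L k - L (k + 1)),
    Finset.prod_ne_zero_iff.2 fun k _ => pow_ne_zero _ (pow_ne_zero _ (by norm_num)), ?_⟩
  rw [map_prod]
  simp only [map_pow expandX]
  have h := HasLead.prod isPositiveCone_rootCone.nonneg (s := Finset.range n) fun k hk =>
    (hasLead_coeff_nodePoly (n := n) (k := k + 1) (Finset.mem_range.1 hk)).pow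
      isPositiveCone_rootCone.nonneg (L k - L (k + 1))
  convert h using 1
  have hz : ∀ s : Finset ℕ, ∑ k ∈ s, (L k - L (k + 1)) • zexpo (columnExpo n (k + 1)) =
      zexpo (∑ k ∈ s, (L k - L (k + 1)) • columnExpo n (k + 1)) := by
    intro s
    classical
    induction s using Finset.induction_on with
    | empty => rw [Finset.sum_empty, Finset.sum_empty, zexpo_zero]
    | insert k s hk ih => rw [Finset.sum_insert hk, Finset.sum_insert hk, zexpo_add, ih, zexpo_nsmul]
  rw [hz]
  congr 1
  ext i
  have htel : ∀ a b, a ≤ b → ∑ k ∈ Finset.Ico a b, ((L k - L (k + 1) : ℕ) : ℤ) = L a - L b := by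
    intro a b hab
    induction b, hab using Nat.le_induction with
    | base => simp
    | succ b hab ih =>
      rw [Finset.sum_Ico_succ_top hab, ih, Nat.cast_sub (hL b)]
      ring
  have h1 := htel i n i.isLt.le
  have h2 : L n = 0 := by simp [L]
  have h3 : L i = lam i := by simp [L]
  rw [h2, h3] at h1
  rw [Finset.sum_apply, Pi.neg_apply]
  simp only [Pi.smul_apply, columnExpo, nsmul_eq_mul, mul_ite, mul_neg, mul_one, mul_zero]
  rw [← Finset.sum_filter, Finset.sum_neg_distrib]
  have h4 : (Finset.range n).filter (fun k => (i : ℕ) < k + 1) = Finset.Ico (i : ℕ) n := by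
    ext k
    simp only [Finset.mem_filter, Finset.mem_range, Finset.mem_Ico]
    omega
  rw [h4, h1]
  simp

end LeadingTerms

/-! ### Existence and uniqueness of Koornwinder polynomials -/

section Existence

variable {n : ℕ}

theorem koornwinderOp_add {K : Type*} [Field K] [Algebra ℂ K] (p : Params) (X : Fin n → K)
    {T : ℤ → Fin n → K → K} (hT : ∀ k i f g, T k i (f + g) = T k i f + T k i g) (f g : K) :
    koornwinderOp p X T (f + g) = koornwinderOp p X T f + koornwinderOp p X T g := by
  simp only [koornwinderOp, hT, add_sub_add_comm, mul_add, Finset.sum_add_distrib]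
  ring

theorem koornwinderOp_smul {K : Type*} [Field K] [Algebra ℂ K] (p : Params) (X : Fin n → K)
    {T : ℤ → Fin n → K → K} (hT : ∀ k i (z : ℂ) f, T k i (z • f) = z • T k i f) (z : ℂ) (f : K) :
    koornwinderOp p X T (z • f) = z • koornwinderOp p X T f := by
  simp only [koornwinderOp, hT, ← smul_sub, mul_smul_comm, ← Finset.smul_sum, ← smul_add]

/-- The operator `D_x` as a linear map. -/
def opXLinear (p : Params) : RatX n →ₗ[ℂ] RatX n where
  toFun := opX p
  map_add' := koornwinderOp_add p xVar fun k i f g => map_add (scaleX i (p.q ^ k)) f g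
  map_smul' := koornwinderOp_smul p xVar fun k i z f => (scaleX i (p.q ^ k)).toLinearMap.map_smul z f

theorem opXLinear_apply (p : Params) (f : RatX n) : opXLinear p f = opX p f := rfl

theorem sum_nonneg_of_mem_rootCone {ν : Fin n → ℤ} (h : zexpo ν ∈ rootCone n) : 0 ≤ ∑ i, ν i := by
  rw [zexpo_mem_rootCone] at h
  rcases Nat.eq_zero_or_pos n with rfl | hn
  · simp
  · have := h ⟨n - 1, by omega⟩
    convert this using 2
    ext i
    simp [Fin.le_def]
    omega

/-- The invariants with all terms strictly below `x^λ` in the dominance order. -/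
def lowerInvariants (lam : Fin n → ℕ) : Submodule ℂ (RatX n) where
  carrier := {h | h ∈ coeffAlg (xVar (n := n)) ∧
    HasLead (rootCone n) (zexpo (-fun i => (lam i : ℤ))) 0 (expandX h)}
  zero_mem' := ⟨zero_mem _, by rw [map_zero]; exact HasLead.zero _⟩
  add_mem' := by
    rintro f g ⟨h1, h2⟩ ⟨h3, h4⟩
    refine ⟨add_mem h1 h3, ?_⟩
    have := h2.add h4
    rwa [add_zero, ← map_add] at this
  smul_mem' := by
    rintro z f ⟨h1, h2⟩
    refine ⟨(coeffAlg xVar).smul_mem h1 z, ?_⟩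
    have := h2.smul z
    rwa [mul_zero, ← expandX_smul] at this

/-- Dominance of exponents, read off from the expansion. The condition on the total degree is the
one for `k = n`, stated separately so as to cover `n = 0`. -/
theorem coeff_dominance {lam μ : Fin n → ℕ} {c : ℂ} {H : LaurentAlg n}
    (h : HasLead (rootCone n) (zexpo (-fun i => (lam i : ℤ))) c (expandLaurent H))
    (hμ : H.coeff (fun i => (μ i : ℤ)) ≠ 0) :
    (∀ k : Fin n, ∑ i ∈ Finset.Iic k, μ i ≤ ∑ i ∈ Finset.Iic k, lam i) ∧
      ∑ i, μ i ≤ ∑ i, lam i := by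
  rw [← expandLaurent_coeff] at hμ
  have h1 := h.sub_mem _ hμ
  rw [← zexpo_sub] at h1
  constructor
  · intro k
    have h2 := zexpo_mem_rootCone.1 h1 k
    simp only [Pi.sub_apply, Pi.neg_apply, Finset.sum_sub_distrib, Finset.sum_neg_distrib] at h2
    zify
    linarith
  · have h2 := sum_nonneg_of_mem_rootCone h1
    simp only [Pi.sub_apply, Pi.neg_apply, Finset.sum_sub_distrib, Finset.sum_neg_distrib] at h2
    zify
    linarith

/-- An invariant is determined by its coefficients at partitions, of which only finitely many lie
below `λ`. -/
theorem finiteDimensional_lowerInvariants (lam : Fin n → ℕ) :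
    FiniteDimensional ℂ (lowerInvariants lam) := by
  let φ : lowerInvariants lam →ₗ[ℂ] ((Fin n → Fin (∑ i, lam i + 1)) → ℂ) :=
    { toFun := fun h κ => (expandX (h : RatX n)).coeff (zexpo (-fun i => ((κ i : ℕ) : ℤ)))
      map_add' := fun f g => by
        ext κ
        rw [Submodule.coe_add, map_add]
        rfl
      map_smul' := fun z f => by
        ext κ
        rw [Submodule.coe_smul, expandX_smul]
        rfl }
  refine FiniteDimensional.of_injective φ ?_
  rw [injective_iff_map_eq_zero]
  rintro ⟨h, hmem⟩ hφ
  obtain ⟨H, hH, rfl⟩ := exists_laurent_of_mem_coeffAlg hmem.1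
  have hlead := hmem.2
  rw [Submodule.mk_eq_zero]
  by_contra h0
  obtain ⟨μ, -, hμ0, -⟩ := exists_highest_exponent hH fun h => h0 (by rw [h, map_zero])
  rw [expandX_toRatX] at hlead
  have h1 := (coeff_dominance hlead hμ0).2
  have h2 : ∀ i, μ i < ∑ i, lam i + 1 := fun i =>
    Nat.lt_succ_of_le ((Finset.single_le_sum (f := μ) (fun _ _ => Nat.zero_le _)
      (Finset.mem_univ i)).trans h1)
  have h3 := congrFun hφ fun i => ⟨μ i, h2 i⟩
  change (expandX (toRatX H)).coeff (zexpo (-fun i => (μ i : ℤ))) = 0 at h3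
  rw [expandX_toRatX, expandLaurent_coeff] at h3
  exact hμ0 h3

section Separation

variable {p : Params} {lam : Fin n → ℕ}

/-- Existence of the Koornwinder polynomial under the separation of eigenvalues. -/
theorem exists_isKoornwinderPolynomial (hα0 : p.α ≠ 0) (ht : p.t ≠ 0)
    (hα : p.α ^ 2 = p.a * p.b * p.c * p.d / (p.q : ℂ)) (hlam : Antitone lam)
    (hsep : ∀ μ : Fin n → ℕ, Antitone μ → μ ≠ lam → ∑ i, μ i ≤ ∑ i, lam i →
      eigenvalue p μ ≠ eigenvalue p lam) : ∃ P, IsKoornwinderPolynomial p lam P := by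
  obtain ⟨A, hA⟩ : ∃ A : RatX n →ₗ[ℂ] RatX n, ∀ h, A h = opX p h - eigenvalue p lam • h :=
    ⟨opXLinear p - eigenvalue p lam • LinearMap.id, fun _ => rfl⟩
  have hD : ∀ {c : ℂ} {h : RatX n}, h ∈ coeffAlg (xVar (n := n)) →
      HasLead (rootCone n) (zexpo (-fun i => (lam i : ℤ))) c (expandX h) →
      A h ∈ lowerInvariants lam := by
    intro c h hh hlead
    rw [hA]
    refine ⟨sub_mem (opX_mem_coeffAlg p hh) ((coeffAlg xVar).smul_mem hh _), ?_⟩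
    have h1 := (hlead.opY isPositiveCone_rootCone hα0 ht hα).sub (hlead.smul (eigenvalue p lam))
    rw [eigenvalueInt_natCast, sub_self] at h1
    rwa [map_sub, expandX_opX, expandX_smul]
  -- The operator `A = D_x - d_λ` maps the invariants below `λ` to themselves, injectively and
  -- therefore surjectively. As it maps `E`, with leading term `c x^λ`, to them as well, `E` can be
  -- corrected by lower terms to an eigenfunction.
  obtain ⟨E, hE, c, hc, hlead⟩ := exists_mem_coeffAlg_hasLead hlam
  have := finiteDimensional_lowerInvariants lam
  have hmaps : ∀ h ∈ lowerInvariants lam,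
      A h ∈ lowerInvariants lam :=
    fun h hh => hD hh.1 hh.2
  have hinj : Function.Injective
      (A.restrict hmaps) := by
    rw [injective_iff_map_eq_zero]
    rintro ⟨h, hmem⟩ h0
    have h1 : A h = 0 := congrArg Subtype.val h0
    rw [hA] at h1
    obtain ⟨H, hH, rfl⟩ := exists_laurent_of_mem_coeffAlg hmem.1
    have hhl := hmem.2
    rw [expandX_toRatX] at hhl
    rw [Submodule.mk_eq_zero, eq_zero_of_eigen hα0 ht hα hsep hH
      (fun μ _ hμ => (coeff_dominance hhl hμ).2) (sub_eq_zero.1 h1)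
      ((expandLaurent_coeff _ _).symm.trans hhl.coeff_eq), map_zero]
  obtain ⟨⟨g, hg⟩, hgE⟩ := LinearMap.injective_iff_surjective.1 hinj ⟨_, hD hE hlead⟩
  have hgE : A g = A E := congrArg Subtype.val hgE
  have hEg := sub_mem hE hg.1
  have hlead' : HasLead (rootCone n) (zexpo (-fun i => (lam i : ℤ))) 1
      (expandX (c⁻¹ • (E - g))) := by
    have := (hlead.sub hg.2).smul c⁻¹
    rwa [sub_zero, inv_mul_cancel₀ hc, ← map_sub, ← expandX_smul] at this
  obtain ⟨H, hH, hHE⟩ := exists_laurent_of_mem_coeffAlg ((coeffAlg xVar).smul_mem hEg c⁻¹)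
  have hlaur : laurent H.coeff = toRatX H := laurent_eq _
  rw [← hHE, expandX_toRatX] at hlead'
  refine ⟨H.coeff, (mem_weylInvariants_iff.1 hH).1, (mem_weylInvariants_iff.1 hH).2,
    (expandLaurent_coeff _ _).symm.trans hlead'.coeff_eq,
    fun μ _ hμ => (coeff_dominance hlead' hμ).1, ?_⟩
  have h1 : A (c⁻¹ • (E - g)) = 0 := by
    rw [map_smul, map_sub, hgE, sub_self, smul_zero]
  rw [hA] at h1
  rw [hlaur, hHE]
  exact sub_eq_zero.1 h1

theorem IsKoornwinderPolynomial.mem_weylInvariants {P : (Fin n → ℤ) →₀ ℂ}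
    (hP : IsKoornwinderPolynomial p lam P) : AddMonoidAlgebra.ofCoeff P ∈ weylInvariants n :=
  mem_weylInvariants_iff.2 ⟨hP.perm, hP.inversion⟩

theorem sum_le_of_partial {n : ℕ} {μ lam : Fin n → ℕ}
    (h : ∀ k : Fin n, ∑ i ∈ Finset.Iic k, μ i ≤ ∑ i ∈ Finset.Iic k, lam i) :
    ∑ i, μ i ≤ ∑ i, lam i := by
  rcases Nat.eq_zero_or_pos n with rfl | hn
  · simp
  · have h1 := h ⟨n - 1, by omega⟩
    have h2 : Finset.Iic (⟨n - 1, by omega⟩ : Fin n) = Finset.univ := by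
      ext i
      simp [Fin.le_def]
      omega
    rwa [h2] at h1

/-- An invariant eigenfunction for `d_λ` of degree at most `|λ|` is proportional to a given
Koornwinder polynomial `P_λ`. -/
theorem eq_smul_of_eigen (hα0 : p.α ≠ 0) (ht : p.t ≠ 0)
    (hα : p.α ^ 2 = p.a * p.b * p.c * p.d / (p.q : ℂ))
    (hsep : ∀ μ : Fin n → ℕ, Antitone μ → μ ≠ lam → ∑ i, μ i ≤ ∑ i, lam i →
      eigenvalue p μ ≠ eigenvalue p lam) {P : (Fin n → ℤ) →₀ ℂ}
    (hP : IsKoornwinderPolynomial p lam P) {H : LaurentAlg n} (hH : H ∈ weylInvariants n)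
    (hdeg : ∀ μ : Fin n → ℕ, Antitone μ → H.coeff (fun i => (μ i : ℤ)) ≠ 0 →
      ∑ i, μ i ≤ ∑ i, lam i)
    (heig : opX p (toRatX H) = eigenvalue p lam • toRatX H) :
    H = H.coeff (fun i => (lam i : ℤ)) • AddMonoidAlgebra.ofCoeff P := by
  set κ := H.coeff (fun i => (lam i : ℤ)) with hκ
  have hPe := hP.eigen
  rw [laurent_eq] at hPe
  rw [← sub_eq_zero]
  refine eq_zero_of_eigen hα0 ht hα hsep
    (sub_mem hH ((weylInvariants n).smul_mem hP.mem_weylInvariants κ)) ?_ ?_ ?_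
  · intro μ hμ hne
    by_cases h0 : H.coeff (fun i => (μ i : ℤ)) = 0
    · refine sum_le_of_partial (hP.lower μ hμ fun h1 => hne ?_)
      change H.coeff _ - κ • P _ = 0
      rw [h0, h1, smul_zero, sub_zero]
    · exact hdeg μ hμ h0
  · rw [← opXLinear_apply, map_sub, map_sub, map_smul, map_smul, opXLinear_apply, opXLinear_apply,
      heig, hPe, smul_sub, smul_comm]
  · change H.coeff _ - κ • P _ = 0
    rw [← hκ, hP.leading, smul_eq_mul, mul_one, sub_self]

theorem existsUnique_isKoornwinderPolynomial (hα0 : p.α ≠ 0) (ht : p.t ≠ 0)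
    (hα : p.α ^ 2 = p.a * p.b * p.c * p.d / (p.q : ℂ)) (hlam : Antitone lam)
    (hsep : ∀ μ : Fin n → ℕ, Antitone μ → μ ≠ lam → ∑ i, μ i ≤ ∑ i, lam i →
      eigenvalue p μ ≠ eigenvalue p lam) : ∃! P, IsKoornwinderPolynomial p lam P := by
  obtain ⟨P, hP⟩ := exists_isKoornwinderPolynomial hα0 ht hα hlam hsep
  refine ⟨P, hP, fun R hR => ?_⟩
  have h := eq_smul_of_eigen hα0 ht hα hsep hP hR.mem_weylInvariants
    (fun μ hμ h => sum_le_of_partial (hR.lower μ hμ h)) (by rw [← laurent_eq]; exact hR.eigen)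
  have h1 : (AddMonoidAlgebra.ofCoeff R : LaurentAlg n).coeff (fun i => (lam i : ℤ)) = 1 :=
    hR.leading
  rw [h1, one_smul] at h
  exact congrArg AddMonoidAlgebra.coeff h

end Separation
end Existence

/-! ### Coefficients of the kernel function -/

section ProductOfSeries

variable {m : ℕ} {K : Type*} [Field K]

/-- A natural exponent vector as an exponent. -/
def natExpo (η : Fin m → ℕ) : Expo m := zexpo fun j => (η j : ℤ)

theorem natExpo_injective : Function.Injective (natExpo : (Fin m → ℕ) → Expo m) := fun _ _ h =>
  funext fun j => Int.ofNat_inj.1 (congrFun (zexpo_injective h) j)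

theorem natExpo_add (η θ : Fin m → ℕ) : natExpo (η + θ) = natExpo η + natExpo θ := by
  rw [natExpo, natExpo, natExpo, ← zexpo_add]
  congr 1

theorem zexpo_nsmul_single (j : Fin m) (r : ℕ) :
    zexpo (r • Pi.single j 1) = natExpo (Pi.single j r : Fin m → ℕ) := by
  rw [natExpo]
  congr 1
  ext k
  by_cases h : k = j
  · subst h; simp
  · simp [h]

/-- Products of power series in the single variables have natural numbers as exponents. -/
theorem prod_heval_support (φ : Fin m → PowerSeries K) (s : Finset (Fin m)) {γ : Expo m}
    (h : (∏ j ∈ s, PowerSeries.heval (yVar j : SeriesY m K) (φ j)).coeff γ ≠ 0) :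
    ∃ η : Fin m → ℕ, (∀ j ∉ s, η j = 0) ∧ γ = natExpo η := by
  classical
  induction s using Finset.induction_on generalizing γ with
  | empty =>
    rw [Finset.prod_empty, HahnSeries.coeff_one] at h
    refine ⟨0, fun _ _ => rfl, ?_⟩
    by_contra hne
    refine h (if_neg fun h0 => hne ?_)
    rw [h0, natExpo, ← zexpo_zero]
    rfl
  | insert i s hi ih =>
    rw [Finset.prod_insert hi, HahnSeries.coeff_mul] at h
    obtain ⟨⟨δ, ε⟩, hδε, -⟩ := Finset.exists_ne_zero_of_sum_ne_zero h
    obtain ⟨h1, h2, h3⟩ := Finset.mem_antidiagonal.1 hδε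
    obtain ⟨θ, hθ, h4⟩ := ih h2
    obtain ⟨r, h5⟩ : ∃ r : ℕ, δ = zexpo (r • Pi.single i 1) := by
      by_contra hcon
      push Not at hcon
      exact h1 (heval_yMono_coeff_of_ne i 1 (φ i) hcon)
    refine ⟨Pi.single i r + θ, fun j hj => ?_, ?_⟩
    · rw [Finset.mem_insert, not_or] at hj
      rw [Pi.add_apply, Pi.single_eq_of_ne hj.1, hθ j hj.2]
    · rw [natExpo_add, ← zexpo_nsmul_single, ← h5, ← h4]
      exact h3.symm

theorem prod_heval_coeff (φ : Fin m → PowerSeries K) (s : Finset (Fin m)) {η : Fin m → ℕ}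
    (hη : ∀ j ∉ s, η j = 0) :
    (∏ j ∈ s, PowerSeries.heval (yVar j : SeriesY m K) (φ j)).coeff (natExpo η) =
      ∏ j ∈ s, PowerSeries.coeff (η j) (φ j) := by
  classical
  induction s using Finset.induction_on generalizing η with
  | empty =>
    have h0 : natExpo η = 0 := by
      rw [← zexpo_zero, natExpo]
      congr 1
      ext j
      simp [hη j]
    rw [Finset.prod_empty, Finset.prod_empty, h0, HahnSeries.coeff_one, if_pos rfl]
  | insert i s hi ih =>
    rw [Finset.prod_insert hi, Finset.prod_insert hi, HahnSeries.coeff_mul]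
    have hsplit : η = Pi.single i (η i) + Function.update η i 0 := by
      ext j
      by_cases h : j = i
      · subst h; simp
      · simp [h]
    have hc : ∀ r : ℕ, (PowerSeries.heval (yVar i : SeriesY m K) (φ i)).coeff
        (natExpo (Pi.single i r)) = PowerSeries.coeff r (φ i) := fun r => by
      rw [← zexpo_nsmul_single, yVar, heval_yMono_coeff_self, one_pow, mul_one]
    have hu : ∀ j ∉ s, Function.update η i 0 j = 0 := by
      intro j hj
      by_cases h : j = i
      · subst h; simp
      · rw [Function.update_of_ne h]
        exact hη j (by simp [h, hj])
    have hP : (∏ j ∈ s, PowerSeries.heval (yVar j : SeriesY m K) (φ j)).coeff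
        (natExpo (Function.update η i 0)) = ∏ j ∈ s, PowerSeries.coeff (η j) (φ j) := by
      rw [ih hu]
      refine Finset.prod_congr rfl fun j hj => ?_
      rw [Function.update_of_ne (ne_of_mem_of_not_mem hj hi)]
    rw [Finset.sum_eq_single (natExpo (Pi.single i (η i)), natExpo (Function.update η i 0)),
      hc, hP]
    · rintro ⟨δ, ε⟩ hδε hne
      exfalso
      obtain ⟨h1, h2, h3⟩ := Finset.mem_antidiagonal.1 hδε
      obtain ⟨θ, hθ, h4⟩ := prod_heval_support φ s h2
      obtain ⟨r, h5⟩ : ∃ r : ℕ, δ = zexpo (r • Pi.single i 1) := by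
        by_contra hcon
        push Not at hcon
        exact h1 (heval_yMono_coeff_of_ne i 1 (φ i) hcon)
      rw [zexpo_nsmul_single] at h5
      have h3 : δ + ε = natExpo η := h3
      have h4 : ε = natExpo θ := h4
      rw [h4, h5, ← natExpo_add] at h3
      have h6 := natExpo_injective h3
      have hr : r = η i := by
        have := congrFun h6 i
        rw [Pi.add_apply, Pi.single_eq_same, hθ i hi, add_zero] at this
        exact this
      have ht : θ = Function.update η i 0 := by
        ext j
        by_cases h : j = i
        · subst h; rw [hθ j hi]; simp
        · have := congrFun h6 j
          rw [Pi.add_apply, Pi.single_eq_of_ne h, zero_add] at this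
          rw [this, Function.update_of_ne h]
      exact hne (by rw [h5, h4, hr, ht])
    · intro hnot
      by_contra h0
      refine hnot (Finset.mem_antidiagonal.2 ⟨left_ne_zero_of_mul h0, right_ne_zero_of_mul h0, ?_⟩)
      change natExpo _ + natExpo _ = natExpo η
      rw [← natExpo_add, ← hsplit]

/-- The constant term of a product of power series in the `y_j` and a series whose exponents are
bounded below. -/
theorem coeff_zero_prod_heval_mul (φ : Fin m → PowerSeries K) (G : SeriesY m K)
    (s : Finset (Fin m → ℕ)) (hs : ∀ η : Fin m → ℕ, G.coeff (-natExpo η) ≠ 0 → η ∈ s) :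
    ((∏ j, PowerSeries.heval (yVar j : SeriesY m K) (φ j)) * G).coeff 0 =
      ∑ η ∈ s, (∏ j, PowerSeries.coeff (η j) (φ j)) * G.coeff (-natExpo η) := by
  rw [HahnSeries.coeff_mul]
  symm
  refine Finset.sum_bij_ne_zero (fun η _ _ => (natExpo η, -natExpo η)) ?_ ?_ ?_ ?_
  · intro η _ hne
    refine Finset.mem_antidiagonal.2 ⟨?_, right_ne_zero_of_mul hne, add_neg_cancel _⟩
    change (∏ j, PowerSeries.heval (yVar j : SeriesY m K) (φ j)).coeff (natExpo η) ≠ 0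
    rw [prod_heval_coeff φ Finset.univ (fun j hj => absurd (Finset.mem_univ j) hj)]
    exact left_ne_zero_of_mul hne
  · intro η _ _ θ _ _ h
    exact natExpo_injective (congrArg Prod.fst h)
  · rintro ⟨δ, ε⟩ hδε hne
    obtain ⟨h1, h2, h3⟩ := Finset.mem_antidiagonal.1 hδε
    obtain ⟨η, -, rfl⟩ := prod_heval_support φ Finset.univ h1
    have h4 : ε = -natExpo η := eq_neg_of_add_eq_zero_right h3
    subst h4
    refine ⟨η, hs η h2, ?_, rfl⟩
    rwa [prod_heval_coeff φ Finset.univ (fun j hj => absurd (Finset.mem_univ j) hj)] at hne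
  · intro η _ _
    rw [prod_heval_coeff φ Finset.univ (fun j hj => absurd (Finset.mem_univ j) hj)]

end ProductOfSeries

section LaurentKernel

variable {m n : ℕ}

/-- The series `(q^{1/2} t^{1/2} z; q)_∞ / (q^{1/2} t^{-1/2} z; q)_∞`. -/
def kernelSeries (q sq st : ℂ) : PowerSeries ℂ :=
  PowerSeries.rescale (sq * st) (qPochhammer q) *
    (PowerSeries.rescale (sq * st⁻¹) (qPochhammer q))⁻¹

theorem kernelSeries_mul {q : ℂ} (hq : ‖q‖ < 1) (sq st : ℂ) :
    kernelSeries q sq st * PowerSeries.rescale (sq * st⁻¹) (qPochhammer q) =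
      PowerSeries.rescale (sq * st) (qPochhammer q) := by
  rw [kernelSeries, mul_assoc, PowerSeries.inv_mul_cancel, mul_one]
  rw [← PowerSeries.coeff_zero_eq_constantCoeff_apply, PowerSeries.coeff_rescale, pow_zero, one_mul,
    PowerSeries.coeff_zero_eq_constantCoeff_apply, constantCoeff_qPochhammer hq]
  exact one_ne_zero

theorem constantCoeff_kernelSeries {q : ℂ} (hq : ‖q‖ < 1) (sq st : ℂ) :
    PowerSeries.coeff 0 (kernelSeries q sq st) = 1 := by
  have hc : ∀ z : ℂ, PowerSeries.constantCoeff (PowerSeries.rescale z (qPochhammer q)) = 1 := by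
    intro z
    rw [← PowerSeries.coeff_zero_eq_constantCoeff_apply, PowerSeries.coeff_rescale, pow_zero,
      one_mul, PowerSeries.coeff_zero_eq_constantCoeff_apply, constantCoeff_qPochhammer hq]
  have h := congrArg PowerSeries.constantCoeff (kernelSeries_mul hq sq st)
  rw [map_mul, hc, hc, mul_one] at h
  rw [PowerSeries.coeff_zero_eq_constantCoeff_apply, h]

theorem qPochhammerY_smul {K : Type*} [Field K] [Algebra ℂ K] (q z : ℂ) (j : Fin m) (w : K) :
    (qPochhammerY q (z • w) j : SeriesY m K) = PowerSeries.heval (yVar j)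
      (PowerSeries.rescale w ((PowerSeries.rescale z (qPochhammer q)).map (algebraMap ℂ K))) := by
  rw [qPochhammerY, heval_yMono_eq, Algebra.smul_def, PowerSeries.rescale_mul, RingHom.comp_apply]
  congr 2
  ext r
  simp [PowerSeries.coeff_rescale]

theorem kernelFactor_eq_heval {K : Type*} [Field K] [Algebra ℂ K] {q : ℂ} (hq : ‖q‖ < 1)
    (sq st : ℂ) (j : Fin m) (w : K) :
    (kernelFactor q sq st j w : SeriesY m K) = PowerSeries.heval (yVar j)
      (PowerSeries.rescale w ((kernelSeries q sq st).map (algebraMap ℂ K))) := by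
  rw [kernelFactor, div_eq_iff (qPochhammerY_ne_zero hq _ _), qPochhammerY_smul, qPochhammerY_smul,
    ← map_mul, ← map_mul, ← map_mul, kernelSeries_mul hq]

/-- The kernel for one variable `y`, as a power series over the Laurent polynomials in `x`. -/
def laurentKernel (n : ℕ) (φ : PowerSeries ℂ) : PowerSeries (LaurentAlg n) :=
  ∏ i, (PowerSeries.rescale (AddMonoidAlgebra.single (Pi.single i 1) 1)
      (φ.map (algebraMap ℂ (LaurentAlg n))) *
    PowerSeries.rescale (AddMonoidAlgebra.single (-Pi.single i 1) 1)
      (φ.map (algebraMap ℂ (LaurentAlg n))))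

theorem map_rescale_algebraMap {A B : Type*} [CommRing A] [CommRing B] [Algebra ℂ A] [Algebra ℂ B]
    (f : A →ₐ[ℂ] B) (w : A) (φ : PowerSeries ℂ) :
    (PowerSeries.rescale w (φ.map (algebraMap ℂ A))).map (f : A →+* B) =
      PowerSeries.rescale (f w) (φ.map (algebraMap ℂ B)) := by
  ext r
  simp [PowerSeries.coeff_rescale]

theorem prod_kernelPair_eq_heval {q : ℂ} (hq : ‖q‖ < 1) (sq st : ℂ) (j : Fin m) :
    ∏ i : Fin n, kernelPair q sq st j (xVar i) = PowerSeries.heval (yVar j : SeriesY m (RatX n))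
      ((laurentKernel n (kernelSeries q sq st)).map (toRatX (n := n) : LaurentAlg n →+* RatX n)) := by
  rw [laurentKernel, map_prod, map_prod]
  refine Finset.prod_congr rfl fun i _ => ?_
  rw [map_mul, map_rescale_algebraMap, map_rescale_algebraMap, toRatX_single_one,
    toRatX_single_neg_one, map_mul, kernelPair, kernelFactor_eq_heval hq, kernelFactor_eq_heval hq]

theorem coeff_laurentKernel_mem (φ : PowerSeries ℂ) (r : ℕ) :
    PowerSeries.coeff r (laurentKernel n φ) ∈ weylInvariants n := by
  rw [mem_weylInvariants]
  intro e he
  have h : (laurentKernel n φ).map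
      ((weylAction e : LaurentAlg n →ₐ[ℂ] LaurentAlg n) : LaurentAlg n →+* LaurentAlg n) =
      laurentKernel n φ := by
    rw [laurentKernel, map_prod]
    have h1 := prod_pair_weyl_invariant (fun μ : Fin n → ℤ =>
      (PowerSeries.rescale (AddMonoidAlgebra.single μ 1)
        (φ.map (algebraMap ℂ (LaurentAlg n))) *
      PowerSeries.rescale (AddMonoidAlgebra.single (-μ) 1)
        (φ.map (algebraMap ℂ (LaurentAlg n))))) (fun j => by rw [neg_neg, mul_comm]) he
    rw [← h1]
    refine Finset.prod_congr rfl fun j _ => ?_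
    rw [map_mul, map_rescale_algebraMap, map_rescale_algebraMap]
    have h2 : ∀ μ : Fin n → ℤ, (weylAction e : LaurentAlg n →ₐ[ℂ] LaurentAlg n)
      (AddMonoidAlgebra.single μ 1) = AddMonoidAlgebra.single (e μ) 1 := fun μ =>
        weylAction_single e μ 1
    rw [h2, h2, map_neg]
  conv_rhs => rw [← h]
  rw [PowerSeries.coeff_map]
  rfl

end LaurentKernel

/-! ### The leading term of the twisted eigenseries -/

section ConstantTerm

variable {m n : ℕ}

theorem sum_simpleRoot_nonneg (i k : Fin m) : 0 ≤ ∑ j ∈ Finset.Iic k, simpleRoot i j := by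
  by_cases hi : (i : ℕ) + 1 < m
  · have h : simpleRoot i = Pi.single i 1 - Pi.single ⟨i + 1, hi⟩ 1 := by
      ext j
      simp only [simpleRoot, Pi.sub_apply, Pi.single_apply, Fin.ext_iff]
      split_ifs <;> omega
    rw [h]
    exact zexpo_mem_rootCone.1 (isPositiveCone_rootCone.sub_mem i ⟨i + 1, hi⟩
      (Fin.lt_def.2 (Nat.lt_succ_self _))) k
  · have h : simpleRoot i = Pi.single i 1 := by
      ext j
      simp only [simpleRoot, Pi.single_apply, Fin.ext_iff]
      split_ifs <;> omega
    rw [h]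
    exact zexpo_mem_rootCone.1 (isPositiveCone_rootCone.single_mem i) k

theorem zexpo_mem_rootCone_of_mem_QPlus {ν : Fin m → ℤ} (h : ν ∈ QPlus m) :
    zexpo ν ∈ rootCone m := by
  obtain ⟨k, rfl⟩ := h
  rw [zexpo_mem_rootCone]
  intro l
  simp only [Finset.sum_apply, Pi.smul_apply]
  rw [Finset.sum_comm]
  refine Finset.sum_nonneg fun i _ => ?_
  rw [← Finset.smul_sum]
  exact nsmul_nonneg (sum_simpleRoot_nonneg i l) _

theorem IsEigenseries.hasLead {p : Params} {e s : Fin m → ℂ} {f : SeriesY m ℂ}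
    (hf : IsEigenseries p e s f) : HasLead (rootCone m) (expo e) 1 f := by
  refine ⟨fun γ hγ => ?_, hf.normalized⟩
  obtain ⟨ν, hν, rfl⟩ := hf.support γ hγ
  have h : (expo fun i => e i + (ν i : ℂ)) - expo e = zexpo ν := by
    rw [← expo_sub, zexpo]
    congr 1
    ext i
    simp
  rw [h]
  exact zexpo_mem_rootCone_of_mem_QPlus hν

theorem hasLead_weylDenominator : HasLead (rootCone m)
    (zexpo fun k => ((k : ℕ) : ℤ) - (m : ℤ)) 1 (weylDenominator m ℂ) := by
  have hM := isPositiveCone_rootCone (m := m)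
  have h1 : HasLead (rootCone m) (zexpo fun k => ((k : ℕ) : ℤ) - (m : ℤ)) 1
      (∏ k : Fin m, yVar k ^ (((k : ℕ) : ℤ) - (m : ℤ)) : SeriesY m ℂ) := by
    have h := HasLead.prod hM.nonneg (s := Finset.univ) fun (k : Fin m) _ =>
      HasLead.zMono (K := ℂ) (M := rootCone m) (Pi.single k (((k : ℕ) : ℤ) - (m : ℤ)))
    simp only [← yVar_zpow, Finset.prod_const_one] at h
    have hz : ∀ s : Finset (Fin m), ∑ k ∈ s, zexpo (Pi.single k (((k : ℕ) : ℤ) - (m : ℤ))) =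
        zexpo (∑ k ∈ s, Pi.single k (((k : ℕ) : ℤ) - (m : ℤ))) := by
      intro s
      induction s using Finset.induction_on with
      | empty => rw [Finset.sum_empty, Finset.sum_empty, zexpo_zero]
      | insert k s hk ih => rw [Finset.sum_insert hk, Finset.sum_insert hk, zexpo_add, ih]
    rwa [hz, Finset.univ_sum_single] at h
  have h2 : HasLead (rootCone m) 0 (∏ _i : Fin m, 1) (∏ i : Fin m, (1 - yVar i ^ 2) : SeriesY m ℂ) := by
    refine HasLead.prod_zero hM.nonneg fun i _ => ?_
    have := hasLead_one_sub hM.nonneg (single_add_single_ne_zero i i) (hM.add_mem i i) (1 : ℂ)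
    rwa [one_smul, ← yVar_mul_yVar, ← pow_two] at this
  have h3 : HasLead (rootCone m) 0 (∏ i : Fin m, ∏ j ∈ Finset.Ioi i, 1)
      (∏ i : Fin m, ∏ j ∈ Finset.Ioi i, ((1 - yVar i * yVar j) * (1 - yVar i / yVar j)) :
        SeriesY m ℂ) := by
    refine HasLead.prod_zero hM.nonneg fun i _ => HasLead.prod_zero hM.nonneg fun j hj => ?_
    have hij := Finset.mem_Ioi.1 hj
    have h4 := hasLead_one_sub hM.nonneg (single_add_single_ne_zero i j) (hM.add_mem i j) (1 : ℂ)
    have h5 := hasLead_one_sub hM.nonneg (single_sub_single_ne_zero hij.ne) (hM.sub_mem i j hij)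
      (1 : ℂ)
    have h6 := h4.mul hM.nonneg h5
    rwa [one_smul, one_smul, ← yVar_mul_yVar, ← yVar_div_yVar, add_zero, one_mul] at h6
  have h := (h1.mul hM.nonneg h2).mul hM.nonneg h3
  simp only [Finset.prod_const_one, mul_one, add_zero] at h
  exact h

/-- The factor of the constant term which does not involve `x`. -/
theorem hasLead_series {p : Params} {e s : Fin m → ℂ} {f : SeriesY m ℂ}
    (hf : IsEigenseries p e s f) {lam : Fin m → ℕ} {b : ℂ}
    (he : ∀ i, e i = -(lam i.rev : ℂ) + ((m : ℂ) - ((i : ℕ) : ℂ)) - b) :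
    HasLead (rootCone m) (-natExpo fun i => lam i.rev) 1
      (yMono (fun _ => b) 1 * weylDenominator m ℂ * f) := by
  have hM := isPositiveCone_rootCone (m := m)
  have h := ((HasLead.single (M := rootCone m) (expo fun _ => b) (1 : ℂ)).mul hM.nonneg
    hasLead_weylDenominator).mul hM.nonneg hf.hasLead
  rw [one_mul, one_mul, zexpo, ← expo_add, ← expo_add] at h
  convert h using 1
  · rw [natExpo, zexpo, ← expo_neg]
    congr 1
    ext i
    simp only [Pi.neg_apply, Pi.add_apply, he i]
    push_cast
    ring
  · rfl

end ConstantTerm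

/-! ### The top-degree coefficients of the constant term -/

section MatrixFormula

variable {m n : ℕ}

theorem coeff_prod_univ {R ι : Type*} [CommRing R] [Fintype ι] [DecidableEq ι]
    (φ : ι → PowerSeries R) (r : ℕ) : PowerSeries.coeff r (∏ i, φ i) =
      ∑ k ∈ Finset.piAntidiag Finset.univ r, ∏ i, PowerSeries.coeff (k i) (φ i) := by
  rw [PowerSeries.coeff_prod]
  refine Finset.sum_nbij' (fun k => (k : ι → ℕ)) (fun k => Finsupp.equivFunOnFinite.symm k)
    ?_ ?_ ?_ ?_ ?_
  · intro k hk
    simpa using hk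
  · intro k hk
    simpa using hk
  · intro k _
    ext; rfl
  · intro k _
    rfl
  · intro k _
    rfl

/-- The exponents of the variables `x_1, …, x_n, 1/x_1, …, 1/x_n`. -/
def nodeExpo : Fin n ⊕ Fin n → Fin n → ℤ :=
  Sum.elim (fun i => Pi.single i 1) fun i => -Pi.single i 1

theorem laurentKernel_eq (φ : PowerSeries ℂ) : laurentKernel n φ =
    ∏ ν, PowerSeries.rescale (AddMonoidAlgebra.single (nodeExpo ν) 1)
      (φ.map (algebraMap ℂ (LaurentAlg n))) := by
  rw [Fintype.prod_sum_type, ← Finset.prod_mul_distrib]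
  rfl

theorem coeff_laurentKernel (φ : PowerSeries ℂ) (r : ℕ) :
    PowerSeries.coeff r (laurentKernel n φ) = ∑ k ∈ Finset.piAntidiag Finset.univ r,
      AddMonoidAlgebra.single (∑ ν, k ν • nodeExpo ν) (∏ ν, PowerSeries.coeff (k ν) φ) := by
  rw [laurentKernel_eq, coeff_prod_univ]
  refine Finset.sum_congr rfl fun k _ => ?_
  rw [← AddMonoidAlgebra.prod_single]
  refine Finset.prod_congr rfl fun ν _ => ?_
  rw [PowerSeries.coeff_rescale, PowerSeries.coeff_map, AddMonoidAlgebra.single_pow, one_pow,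
    AddMonoidAlgebra.coe_algebraMap, Function.comp_apply, AddMonoidAlgebra.single_mul_single,
    add_zero, one_mul]
  rfl

theorem coeff_prod_laurentKernel (φ : PowerSeries ℂ) (η : Fin m → ℕ) (μ : Fin n → ℤ) :
    (∏ j, PowerSeries.coeff (η j) (laurentKernel n φ)).coeff μ =
      ∑ K ∈ (Fintype.piFinset fun j => Finset.piAntidiag Finset.univ (η j)).filter
        (fun K : Fin m → Fin n ⊕ Fin n → ℕ => ∑ j, ∑ ν, K j ν • nodeExpo ν = μ),
        ∏ j, ∏ ν, PowerSeries.coeff (K j ν) φ := by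
  simp only [coeff_laurentKernel]
  rw [Finset.prod_univ_sum, Finset.sum_filter]
  simp only [AddMonoidAlgebra.prod_single]
  rw [AddMonoidAlgebra.coeff_sum, Finsupp.finsetSum_apply]
  refine Finset.sum_congr rfl fun K _ => ?_
  rw [AddMonoidAlgebra.coeff_single, Finsupp.single_apply]

/-- The series `∏_j φ(y_j X)`. -/
def rowSeries (m : ℕ) (φ : PowerSeries ℂ) : PowerSeries (MvPolynomial (Fin m) ℂ) :=
  ∏ j, PowerSeries.rescale (MvPolynomial.X j) (φ.map MvPolynomial.C)

/-- The coefficients `h_k(y)` of `∏_j φ(y_j X)`. -/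
def rowPoly (m : ℕ) (φ : PowerSeries ℂ) (k : ℕ) : MvPolynomial (Fin m) ℂ :=
  PowerSeries.coeff k (rowSeries m φ)

theorem rowPoly_eq (φ : PowerSeries ℂ) (k : ℕ) :
    rowPoly m φ k = ∑ κ ∈ Finset.piAntidiag Finset.univ k,
      MvPolynomial.monomial (Finsupp.equivFunOnFinite.symm κ) (∏ j, PowerSeries.coeff (κ j) φ) := by
  rw [rowPoly, rowSeries, coeff_prod_univ]
  refine Finset.sum_congr rfl fun κ _ => ?_
  rw [MvPolynomial.monomial_eq, Finsupp.prod_fintype _ _ (by simp), map_prod,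
    ← Finset.prod_mul_distrib]
  refine Finset.prod_congr rfl fun j _ => ?_
  rw [PowerSeries.coeff_rescale, PowerSeries.coeff_map, mul_comm]
  rfl

theorem rowPoly_zero {φ : PowerSeries ℂ} (h : PowerSeries.coeff 0 φ = 1) : rowPoly m φ 0 = 1 := by
  rw [rowPoly_eq, Finset.piAntidiag_zero, Finset.sum_singleton]
  have h0 : (Finsupp.equivFunOnFinite.symm 0 : Fin m →₀ ℕ) = 0 := by ext j; rfl
  simp [h, h0]

theorem coeff_prod_rowPoly {ι : Type*} [Fintype ι] [DecidableEq ι] (φ : PowerSeries ℂ) (ρ : ι → ℕ)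
    (η : Fin m → ℕ) :
    (∏ i, rowPoly m φ (ρ i)).coeff (Finsupp.equivFunOnFinite.symm η) =
      ∑ K ∈ (Fintype.piFinset fun i => Finset.piAntidiag Finset.univ (ρ i)).filter
        (fun K : ι → Fin m → ℕ => ∀ j, ∑ i, K i j = η j),
        ∏ i, ∏ j, PowerSeries.coeff (K i j) φ := by
  simp only [rowPoly_eq]
  rw [Finset.prod_univ_sum, Finset.sum_filter, MvPolynomial.coeff_sum]
  refine Finset.sum_congr rfl fun K _ => ?_
  rw [← MvPolynomial.monomial_sum_prod, MvPolynomial.coeff_monomial]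
  have h : (∑ i, Finsupp.equivFunOnFinite.symm (K i) : Fin m →₀ ℕ) =
      Finsupp.equivFunOnFinite.symm η ↔ ∀ j, ∑ i, K i j = η j := by
    rw [Finsupp.ext_iff]
    refine forall_congr' fun j => ?_
    rw [Finsupp.finsetSum_apply]
    rfl
  simp only [h]

theorem sum_smul_nodeExpo (k : Fin n ⊕ Fin n → ℕ) (i : Fin n) :
    (∑ ν, k ν • nodeExpo ν) i = (k (Sum.inl i) : ℤ) - k (Sum.inr i) := by
  rw [Fintype.sum_sum_type]
  simp [nodeExpo, Finset.sum_apply, Pi.single_apply]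
  ring

/-- The degree in `x` of a coefficient of the kernel is at most its degree in `y`. -/
theorem sum_le_of_coeff_ne_zero {φ : PowerSeries ℂ} {η : Fin m → ℕ} {μ : Fin n → ℕ}
    (h : (∏ j, PowerSeries.coeff (η j) (laurentKernel n φ)).coeff (fun i => (μ i : ℤ)) ≠ 0) :
    ∑ i, μ i ≤ ∑ j, η j := by
  rw [coeff_prod_laurentKernel] at h
  obtain ⟨K, hK, -⟩ := Finset.exists_ne_zero_of_sum_ne_zero h
  rw [Finset.mem_filter, Fintype.mem_piFinset] at hK
  obtain ⟨h1, h2⟩ := hK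
  have h3 : ∀ i, (μ i : ℤ) = ∑ j, ((K j (Sum.inl i) : ℤ) - K j (Sum.inr i)) := by
    intro i
    have := congrFun h2 i
    rw [← this, Finset.sum_apply]
    exact Finset.sum_congr rfl fun j _ => sum_smul_nodeExpo (K j) i
  zify
  rw [Finset.sum_congr rfl fun i _ => h3 i, Finset.sum_comm]
  refine Finset.sum_le_sum fun j _ => ?_
  have h4 := (Finset.mem_piAntidiag.1 (h1 j)).1
  rw [← h4, Fintype.sum_sum_type]
  push_cast
  rw [← Finset.sum_add_distrib]
  exact Finset.sum_le_sum fun i _ => by omega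

/-- Transposition of matrices: the coefficients of top degree in `x` of the kernel are those of the
products of the `h_k(y)`. -/
theorem coeff_prod_laurentKernel_eq {φ : PowerSeries ℂ} (hφ : PowerSeries.coeff 0 φ = 1)
    {η : Fin m → ℕ} {μ : Fin n → ℕ} (hdeg : ∑ j, η j = ∑ i, μ i) :
    (∏ j, PowerSeries.coeff (η j) (laurentKernel n φ)).coeff (fun i => (μ i : ℤ)) =
      (∏ i, rowPoly m φ (μ i)).coeff (Finsupp.equivFunOnFinite.symm η) := by
  have h0 : ∏ i, rowPoly m φ (μ i) =
      ∏ ν : Fin n ⊕ Fin n, rowPoly m φ (Sum.elim μ (fun _ => 0) ν) := by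
    rw [Fintype.prod_sum_type]
    simp [rowPoly_zero hφ]
  rw [h0, coeff_prod_laurentKernel, coeff_prod_rowPoly]
  refine Finset.sum_nbij' (fun K ν j => K j ν) (fun K j ν => K ν j) ?_ ?_ (fun _ _ => rfl)
    (fun _ _ => rfl) (fun K _ => Finset.prod_comm)
  · intro K hK
    rw [Finset.mem_filter, Fintype.mem_piFinset] at hK ⊢
    obtain ⟨h1, h2⟩ := hK
    have h1' : ∀ j, ∑ ν, K j ν = η j := fun j => (Finset.mem_piAntidiag.1 (h1 j)).1
    have h3 : ∀ i, (μ i : ℤ) = ∑ j, ((K j (Sum.inl i) : ℤ) - K j (Sum.inr i)) := by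
      intro i
      have := congrFun h2 i
      rw [← this, Finset.sum_apply]
      exact Finset.sum_congr rfl fun j _ => sum_smul_nodeExpo (K j) i
    -- the exponents of the `1/x_i` add up to zero
    have h4 : ∑ i, ∑ j, (K j (Sum.inr i) : ℤ) = 0 := by
      have h5 : ∑ j, (η j : ℤ) = ∑ i, (μ i : ℤ) := by exact_mod_cast hdeg
      have h6 : ∑ j, (η j : ℤ) = ∑ i, ∑ j, (K j (Sum.inl i) : ℤ) +
          ∑ i, ∑ j, (K j (Sum.inr i) : ℤ) := by
        rw [Finset.sum_comm, Finset.sum_comm (γ := Fin n) (f := fun i j => (K j (Sum.inr i) : ℤ)),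
          ← Finset.sum_add_distrib]
        refine Finset.sum_congr rfl fun j _ => ?_
        rw [← h1' j, Fintype.sum_sum_type]
        push_cast
        rfl
      have h7 : ∑ i, (μ i : ℤ) = ∑ i, ∑ j, (K j (Sum.inl i) : ℤ) -
          ∑ i, ∑ j, (K j (Sum.inr i) : ℤ) := by
        rw [Finset.sum_congr rfl fun i _ => h3 i]
        simp only [Finset.sum_sub_distrib]
      linarith
    have h8 : ∀ i, ∑ j, (K j (Sum.inr i) : ℤ) = 0 := fun i =>
      (Finset.sum_eq_zero_iff_of_nonneg fun i _ => Finset.sum_nonneg fun j _ =>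
        Int.natCast_nonneg _).1 h4 i (Finset.mem_univ i)
    refine ⟨fun ν => Finset.mem_piAntidiag.2 ⟨?_, fun j _ => Finset.mem_univ j⟩, h1'⟩
    cases ν with
    | inl i =>
      change ∑ j, K j (Sum.inl i) = μ i
      zify
      rw [h3 i, Finset.sum_sub_distrib, h8 i, sub_zero]
    | inr i =>
      change ∑ j, K j (Sum.inr i) = 0
      zify
      exact h8 i
  · intro K hK
    rw [Finset.mem_filter, Fintype.mem_piFinset] at hK ⊢
    obtain ⟨h1, h2⟩ := hK
    refine ⟨fun j => Finset.mem_piAntidiag.2 ⟨h2 j, fun ν _ => Finset.mem_univ ν⟩, ?_⟩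
    ext i
    rw [Finset.sum_apply, Finset.sum_congr rfl fun j _ => sum_smul_nodeExpo (fun ν => K ν j) i,
      Finset.sum_sub_distrib]
    have h3 := (Finset.mem_piAntidiag.1 (h1 (Sum.inl i))).1
    have h4 := (Finset.mem_piAntidiag.1 (h1 (Sum.inr i))).1
    simp only [Sum.elim_inl, Sum.elim_inr] at h3 h4
    rw [← h3]
    zify at h4
    rw [h4, sub_zero]
    push_cast
    rfl

/-- The products of the `h_k(y)` are homogeneous. -/
theorem sum_eq_of_coeff_rowPoly_ne_zero {ι : Type*} [Fintype ι] [DecidableEq ι]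
    {φ : PowerSeries ℂ} {ρ : ι → ℕ} {η : Fin m → ℕ}
    (h : (∏ i, rowPoly m φ (ρ i)).coeff (Finsupp.equivFunOnFinite.symm η) ≠ 0) :
    ∑ j, η j = ∑ i, ρ i := by
  rw [coeff_prod_rowPoly] at h
  obtain ⟨K, hK, -⟩ := Finset.exists_ne_zero_of_sum_ne_zero h
  rw [Finset.mem_filter, Fintype.mem_piFinset] at hK
  obtain ⟨h1, h2⟩ := hK
  rw [← Finset.sum_congr rfl fun j _ => h2 j, Finset.sum_comm]
  exact Finset.sum_congr rfl fun i _ => (Finset.mem_piAntidiag.1 (h1 i)).1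

end MatrixFormula

/-! ### A recursion for the row polynomials -/

section Span

variable {m : ℕ}

open MvPolynomial

/-- The coefficients of `∏_j (1 + z y_j X)`. -/
theorem coeff_prod_one_add (z : ℂ) (s : ℕ) :
    PowerSeries.coeff s (∏ j : Fin m, (1 + PowerSeries.C (C z * X j) * PowerSeries.X)) =
      (C (z ^ s) * esymm (Fin m) ℂ s : MvPolynomial (Fin m) ℂ) := by
  rw [Finset.prod_one_add, map_sum]
  have h : ∀ t : Finset (Fin m), PowerSeries.coeff s
      (∏ j ∈ t, (PowerSeries.C (C z * X j) * PowerSeries.X : PowerSeries (MvPolynomial (Fin m) ℂ))) =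
      if t.card = s then C (z ^ s) * ∏ j ∈ t, X j else 0 := by
    intro t
    rw [Finset.prod_mul_distrib, Finset.prod_const, ← map_prod, PowerSeries.coeff_C_mul,
      PowerSeries.coeff_X_pow, Finset.prod_mul_distrib, Finset.prod_const]
    by_cases ht : t.card = s
    · rw [if_pos ht.symm, if_pos ht, mul_one, ht, map_pow]
    · rw [if_neg (Ne.symm ht), if_neg ht, mul_zero]
  rw [Finset.sum_congr rfl fun t _ => h t, ← Finset.sum_filter, esymm, Finset.mul_sum]
  refine Finset.sum_congr ?_ fun _ _ => rfl
  ext t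
  simp

variable {φ : PowerSeries ℂ} {q t k : ℂ}

/-- The recursion of the `h_r(y)` for a series with `φ(qz) (1 - k t z) = φ(z) (1 - k z)`. -/
theorem rowPoly_recursion (hφ : PowerSeries.rescale q φ * (1 - PowerSeries.C (k * t) * PowerSeries.X) =
      φ * (1 - PowerSeries.C k * PowerSeries.X)) (r : ℕ) :
    ∑ s ∈ Finset.range (r + 1), C ((-k) ^ s * (1 - t ^ s * q ^ (r - s))) *
      (esymm (Fin m) ℂ s * rowPoly m φ (r - s)) = 0 := by
  have hmap : ∀ j : Fin m, PowerSeries.rescale (C q) (PowerSeries.rescale (X j) (φ.map C)) *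
      (1 + PowerSeries.C (C (-(k * t)) * X j) * PowerSeries.X) =
      PowerSeries.rescale (X j) (φ.map C) *
        (1 + PowerSeries.C (C (-k) * X j) * PowerSeries.X) := by
    intro j
    have e : PowerSeries.rescale (C q) (PowerSeries.rescale (X j) (φ.map C)) =
        PowerSeries.rescale (X j : MvPolynomial (Fin m) ℂ) ((PowerSeries.rescale q φ).map C) := by
      ext r : 1
      simp only [PowerSeries.coeff_rescale, PowerSeries.coeff_map, map_mul, map_pow]
      ring
    have h1 : ∀ z : ℂ, 1 + PowerSeries.C (C (-z) * X j) * PowerSeries.X =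
        PowerSeries.rescale (X j : MvPolynomial (Fin m) ℂ)
          ((1 - PowerSeries.C z * PowerSeries.X).map C) := by
      intro z
      have h2 : PowerSeries.rescale (X j : MvPolynomial (Fin m) ℂ) (PowerSeries.C (C z)) =
          PowerSeries.C (C z) := by
        ext r : 1
        rw [PowerSeries.coeff_rescale, PowerSeries.coeff_C]
        split_ifs with h
        · rw [h, pow_zero, one_mul]
        · rw [mul_zero]
      simp only [map_sub, map_one, map_mul, PowerSeries.map_X, PowerSeries.map_C,
        PowerSeries.rescale_X, map_neg, h2]
      ring
    rw [e, h1, h1, ← map_mul, ← map_mul, ← map_mul, ← map_mul, hφ]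
  have hprod : PowerSeries.rescale (C q) (rowSeries m φ) *
      ∏ j : Fin m, (1 + PowerSeries.C (C (-(k * t)) * X j) * PowerSeries.X) =
      rowSeries m φ * ∏ j : Fin m, (1 + PowerSeries.C (C (-k) * X j) * PowerSeries.X) := by
    rw [rowSeries, map_prod, ← Finset.prod_mul_distrib, ← Finset.prod_mul_distrib]
    exact Finset.prod_congr rfl fun j _ => hmap j
  have hc := congrArg (PowerSeries.coeff r) hprod
  rw [mul_comm, mul_comm (rowSeries m φ), PowerSeries.coeff_mul, PowerSeries.coeff_mul,
    Finset.Nat.sum_antidiagonal_eq_sum_range_succ_mk,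
    Finset.Nat.sum_antidiagonal_eq_sum_range_succ_mk] at hc
  simp only [coeff_prod_one_add, PowerSeries.coeff_rescale] at hc
  rw [← sub_eq_zero, ← Finset.sum_sub_distrib, ← neg_eq_zero, ← Finset.sum_neg_distrib] at hc
  rw [← hc]
  refine Finset.sum_congr rfl fun s _ => ?_
  have h1 : PowerSeries.coeff (r - s) (rowSeries m φ) = rowPoly m φ (r - s) := rfl
  rw [h1]
  simp only [map_mul, map_sub, map_one, map_pow, map_neg]
  ring

/-- The polynomials `h_k(y)` for integral `k`, zero for negative `k`. -/
def rowPolyInt (m : ℕ) (φ : PowerSeries ℂ) (k : ℤ) : MvPolynomial (Fin m) ℂ :=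
  if 0 ≤ k then rowPoly m φ k.toNat else 0

theorem rowPolyInt_natCast (k : ℕ) : rowPolyInt m φ k = rowPoly m φ k := by
  rw [rowPolyInt, if_pos (Int.natCast_nonneg k), Int.toNat_natCast]

theorem rowPolyInt_of_neg {k : ℤ} (h : k < 0) : rowPolyInt m φ k = 0 := if_neg (not_le.2 h)

/-- The recursion for the `h_k`, valid for all integers. -/
theorem rowPolyInt_recursion
    (hφ : PowerSeries.rescale q φ * (1 - PowerSeries.C (k * t) * PowerSeries.X) =
      φ * (1 - PowerSeries.C k * PowerSeries.X)) (r : ℤ) :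
    C (1 - q ^ r) * rowPolyInt m φ r + ∑ a : Fin m,
      C ((-k) ^ ((a : ℕ) + 1) * (1 - t ^ ((a : ℕ) + 1) * q ^ (r - ((a : ℕ) + 1)))) *
        (esymm (Fin m) ℂ ((a : ℕ) + 1) * rowPolyInt m φ (r - ((a : ℕ) + 1))) = 0 := by
  rcases lt_or_ge r 0 with hr | hr
  · rw [rowPolyInt_of_neg hr, mul_zero, zero_add]
    refine Finset.sum_eq_zero fun a _ => ?_
    rw [rowPolyInt_of_neg (by omega), mul_zero, mul_zero]
  · obtain ⟨r, rfl⟩ := Int.eq_ofNat_of_zero_le hr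
    let T : ℕ → MvPolynomial (Fin m) ℂ := fun s =>
      C ((-k) ^ s * (1 - t ^ s * q ^ ((r : ℤ) - s))) *
        (esymm (Fin m) ℂ s * rowPolyInt m φ ((r : ℤ) - s))
    have h1 : ∑ s ∈ Finset.range (r + 1), T s = 0 := by
      rw [← rowPoly_recursion hφ r]
      refine Finset.sum_congr rfl fun s hs => ?_
      have hs : s ≤ r := Nat.lt_succ_iff.1 (Finset.mem_range.1 hs)
      have e : ((r : ℤ) - s) = ((r - s : ℕ) : ℤ) := by omega
      simp only [T]
      rw [e, rowPolyInt_natCast, zpow_natCast]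
    have h2 : ∀ N, r + 1 ≤ N → ∑ s ∈ Finset.range N, T s = 0 := by
      intro N hN
      rw [← h1]
      symm
      refine Finset.sum_subset (Finset.range_mono hN) fun s _ hs => ?_
      simp only [T]
      rw [rowPolyInt_of_neg (by rw [Finset.mem_range] at hs; omega), mul_zero, mul_zero]
    have h3 : ∑ s ∈ Finset.range (m + 1), T s = 0 := by
      rw [← h2 (max (r + 1) (m + 1)) (le_max_left _ _)]
      refine Finset.sum_subset (Finset.range_mono (le_max_right _ _)) fun s _ hs => ?_
      have : esymm (Fin m) ℂ s = 0 := by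
        rw [esymm, Finset.powersetCard_eq_empty.2, Finset.sum_empty]
        rw [Finset.mem_range] at hs
        rw [Finset.card_univ, Fintype.card_fin]
        omega
      simp only [T]
      rw [this, zero_mul, mul_zero]
    rw [Finset.sum_range_succ', ← Fin.sum_univ_eq_sum_range (fun a => T (a + 1))] at h3
    have hT0 : T 0 = C (1 - q ^ (r : ℤ)) * rowPolyInt m φ r := by
      simp only [T, pow_zero, one_mul, Nat.cast_zero, sub_zero, esymm_zero]
    rw [← h3, hT0, add_comm]
    refine congrArg (· + _) (Finset.sum_congr rfl fun a _ => ?_)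
    simp only [T]
    push_cast
    rfl

variable (φ) in
/-- The values of a functional at `e_s ∏_i h_{ρ_i}`. -/
def rowValue (l : MvPolynomial (Fin m) ℂ →ₗ[ℂ] ℂ) (s : ℕ) (ρ : Fin m → ℤ) : ℂ :=
  l (esymm (Fin m) ℂ s * ∏ i, rowPolyInt m φ (ρ i))

variable {l : MvPolynomial (Fin m) ℂ →ₗ[ℂ] ℂ}

theorem rowValue_of_neg {s : ℕ} {ρ : Fin m → ℤ} {i : Fin m} (h : ρ i < 0) :
    rowValue φ l s ρ = 0 := by
  rw [rowValue, Finset.prod_eq_zero (Finset.mem_univ i) (rowPolyInt_of_neg h), mul_zero, map_zero]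

theorem rowValue_zero (hl : ∀ ρ : Fin m → ℕ, l (∏ i, rowPoly m φ (ρ i)) = 0) (ρ : Fin m → ℤ) :
    rowValue φ l 0 ρ = 0 := by
  by_cases h : ∃ i, ρ i < 0
  · obtain ⟨i, hi⟩ := h
    exact rowValue_of_neg hi
  · push Not at h
    rw [rowValue, esymm_zero, one_mul, ← hl fun i => (ρ i).toNat]
    congr 1
    exact Finset.prod_congr rfl fun i _ => if_pos (h i)

/-- The linear equations for the values at `e_s ∏_i h_{ρ_i}`, one for each row. -/
theorem sum_rowValue (hφ : PowerSeries.rescale q φ * (1 - PowerSeries.C (k * t) * PowerSeries.X) =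
      φ * (1 - PowerSeries.C k * PowerSeries.X))
    (hl : ∀ ρ : Fin m → ℕ, l (∏ i, rowPoly m φ (ρ i)) = 0) (ρ : Fin m → ℤ) (i : Fin m) :
    ∑ a : Fin m, (-k) ^ ((a : ℕ) + 1) * (1 - t ^ ((a : ℕ) + 1) * q ^ (ρ i - ((a : ℕ) + 1))) *
      rowValue φ l ((a : ℕ) + 1) (ρ - Pi.single i (((a : ℕ) : ℤ) + 1)) = 0 := by
  have h := rowPolyInt_recursion (m := m) hφ (ρ i)
  have h0 : l (C (1 - q ^ ρ i) * rowPolyInt m φ (ρ i) *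
      ∏ j ∈ Finset.univ.erase i, rowPolyInt m φ (ρ j)) = 0 := by
    rw [mul_assoc, Finset.mul_prod_erase Finset.univ (fun j => rowPolyInt m φ (ρ j))
      (Finset.mem_univ i), C_mul', map_smul]
    have := rowValue_zero (φ := φ) hl ρ
    rw [rowValue, esymm_zero, one_mul] at this
    rw [this, smul_zero]
  have hterm : ∀ a : Fin m, (-k) ^ ((a : ℕ) + 1) *
      (1 - t ^ ((a : ℕ) + 1) * q ^ (ρ i - ((a : ℕ) + 1))) *
        rowValue φ l ((a : ℕ) + 1) (ρ - Pi.single i (((a : ℕ) : ℤ) + 1)) =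
      l (C ((-k) ^ ((a : ℕ) + 1) * (1 - t ^ ((a : ℕ) + 1) * q ^ (ρ i - ((a : ℕ) + 1)))) *
        (esymm (Fin m) ℂ ((a : ℕ) + 1) * rowPolyInt m φ (ρ i - ((a : ℕ) + 1))) *
          ∏ j ∈ Finset.univ.erase i, rowPolyInt m φ (ρ j)) := by
    intro a
    have h1 : ∏ j, rowPolyInt m φ ((ρ - Pi.single i (((a : ℕ) : ℤ) + 1) : Fin m → ℤ) j) =
        rowPolyInt m φ (ρ i - ((a : ℕ) + 1)) *
          ∏ j ∈ Finset.univ.erase i, rowPolyInt m φ (ρ j) := by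
      rw [← Finset.mul_prod_erase _ _ (Finset.mem_univ i), Pi.sub_apply, Pi.single_eq_same]
      refine congrArg (_ * ·) (Finset.prod_congr rfl fun j hj => ?_)
      rw [Pi.sub_apply, Pi.single_eq_of_ne (Finset.ne_of_mem_erase hj), sub_zero]
    rw [mul_assoc (C _), C_mul', map_smul, smul_eq_mul, rowValue, h1, mul_assoc (esymm _ _ _)]
  rw [Finset.sum_congr rfl fun a _ => hterm a, ← map_sum, ← Finset.sum_mul]
  generalize ∑ a : Fin m, (C _ * _ : MvPolynomial (Fin m) ℂ) = A at h ⊢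
  rw [eq_neg_of_add_eq_zero_right h, neg_mul, map_neg, h0, neg_zero]

end Span

/-! ### The row polynomials span the symmetric polynomials -/

section Elimination

variable {m : ℕ}

open MvPolynomial

/-- Elimination by Cramer's rule in a system of linear difference equations: if the equations
`∑_a c_{ia} V_a(ρ - τ - (a+1) ε_i) = 0` hold for all `τ ≥ 0` with `τ_i = 0`, then each `V_{a₀}`
satisfies the equation given by the determinant of the symbols `c_{ia} x_i^{a+1}`. -/
theorem sum_perm_eq_zero (V : Fin m → (Fin m → ℤ) → ℂ) (c : Fin m → Fin m → ℂ) (ρ : Fin m → ℤ)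
    (h : ∀ (i : Fin m) (τ : Fin m → ℕ), τ i = 0 → ∑ a : Fin m, c i a *
      V a (ρ - (fun j => (τ j : ℤ)) - Pi.single i (((a : ℕ) : ℤ) + 1)) = 0) (a₀ : Fin m) :
    ∑ σ : Equiv.Perm (Fin m), ((Equiv.Perm.sign σ : ℤ) : ℂ) * (∏ i, c i (σ i)) *
      V a₀ (ρ - fun i => ((σ i : ℕ) : ℤ) + 1) = 0 := by
  -- Encode the values as functionals `L a` on polynomials, the exponent of a monomial being the shift
  -- of `ρ`. The relations then say that the rows of the matrix `B` are orthogonal to `L`, after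
  -- multiplication by polynomials free of the variable of the row; the adjugate has such entries.
  let L : Fin m → MvPolynomial (Fin m) ℂ →ₗ[ℂ] ℂ := fun a =>
    (basisMonomials (Fin m) ℂ).constr ℂ fun τ => V a (ρ - fun j => (τ j : ℤ))
  have hL : ∀ a τ z, L a (monomial τ z) = z * V a (ρ - fun j => (τ j : ℤ)) := by
    intro a τ z
    have : monomial τ z = z • basisMonomials (Fin m) ℂ τ := by
      rw [coe_basisMonomials, smul_monomial, smul_eq_mul, mul_one]
    rw [this, map_smul, Module.Basis.constr_basis, smul_eq_mul]
  let B : Matrix (Fin m) (Fin m) (MvPolynomial (Fin m) ℂ) :=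
    fun i a => monomial (Finsupp.single i ((a : ℕ) + 1)) (c i a)
  have hrow : ∀ (i : Fin m) (P : MvPolynomial (Fin m) ℂ), P ∈ supported ℂ ({i}ᶜ : Set (Fin m)) →
      ∑ a, L a (B i a * P) = 0 := by
    intro i P hP
    have hterm : ∀ τ ∈ P.support, ∑ a, L a (B i a * monomial τ (P.coeff τ)) = 0 := by
      intro τ hτ
      have h0 : τ i = 0 := by
        by_contra hne
        exact (mem_supported.1 hP (mem_vars_iff_mem_support i |>.2
          ⟨τ, hτ, Finsupp.mem_support_iff.2 hne⟩)) rfl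
      have h1 := h i τ h0
      have h2 : ∀ a, L a (B i a * monomial τ (P.coeff τ)) = P.coeff τ * (c i a *
          V a (ρ - (fun j => (τ j : ℤ)) - Pi.single i (((a : ℕ) : ℤ) + 1))) := by
        intro a
        rw [monomial_mul, hL]
        have h3 : (ρ - fun j => (((Finsupp.single i ((a : ℕ) + 1) + τ : Fin m →₀ ℕ) j : ℕ) : ℤ)) =
            ρ - (fun j => (τ j : ℤ)) - Pi.single i (((a : ℕ) : ℤ) + 1) := by
          funext j
          by_cases hj : j = i
          · subst hj
            simp
            ring
          · simp [Finsupp.single_eq_of_ne hj, hj]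
        rw [h3]
        ring
      rw [Finset.sum_congr rfl fun a _ => h2 a, ← Finset.mul_sum, h1, mul_zero]
    have hsum : ∀ a, L a (B i a * P) = ∑ τ ∈ P.support, L a (B i a * monomial τ (P.coeff τ)) := by
      intro a
      conv_lhs => rw [P.as_sum]
      rw [Finset.mul_sum, map_sum]
    rw [Finset.sum_congr rfl fun a _ => hsum a, Finset.sum_comm]
    exact Finset.sum_eq_zero hterm
  have hadj : ∀ i, B.adjugate a₀ i ∈ supported ℂ ({i}ᶜ : Set (Fin m)) := by
    intro i
    rw [Matrix.adjugate_apply, Matrix.det_apply']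
    refine Subalgebra.sum_mem _ fun σ _ => Subalgebra.mul_mem _ ?_ (Subalgebra.prod_mem _ ?_)
    · exact Subalgebra.intCast_mem _ _
    · intro j _
      by_cases hj : σ j = i
      · rw [hj, Matrix.updateRow_self]
        by_cases hja : j = a₀
        · subst hja
          rw [Pi.single_eq_same]
          exact Subalgebra.one_mem _
        · rw [Pi.single_eq_of_ne hja]
          exact Subalgebra.zero_mem _
      · rw [Matrix.updateRow_ne hj]
        have : B (σ j) j = C (c (σ j) j) * X (σ j) ^ ((j : ℕ) + 1) := by
          rw [C_mul_X_pow_eq_monomial]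
        rw [this]
        refine Subalgebra.mul_mem _ ?_ (Subalgebra.pow_mem _ ?_ _)
        · exact Subalgebra.algebraMap_mem _ _
        · exact X_mem_supported.2 hj
  have hdet : L a₀ B.det = 0 := by
    have h1 : ∀ a, L a ((B.adjugate * B) a₀ a) = if a = a₀ then L a₀ B.det else 0 := by
      intro a
      rw [Matrix.adjugate_mul, Matrix.smul_apply, Matrix.one_apply]
      by_cases ha : a = a₀
      · subst ha
        rw [if_pos rfl, if_pos rfl, smul_eq_mul, mul_one]
      · rw [if_neg (Ne.symm ha), if_neg ha, smul_zero, map_zero]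
    have h2 : ∑ a, L a ((B.adjugate * B) a₀ a) = L a₀ B.det := by
      rw [Finset.sum_congr rfl fun a _ => h1 a, Finset.sum_ite_eq' Finset.univ a₀,
        if_pos (Finset.mem_univ _)]
    rw [← h2]
    have h3 : ∀ a, L a ((B.adjugate * B) a₀ a) = ∑ i, L a (B i a * B.adjugate a₀ i) := by
      intro a
      rw [Matrix.mul_apply, map_sum]
      exact Finset.sum_congr rfl fun i _ => by rw [mul_comm]
    rw [Finset.sum_congr rfl fun a _ => h3 a, Finset.sum_comm]
    exact Finset.sum_eq_zero fun i _ => hrow i _ (hadj i)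
  rw [← Matrix.det_transpose, Matrix.det_apply', map_sum] at hdet
  rw [← hdet]
  refine Finset.sum_congr rfl fun σ _ => ?_
  have hprod : ∏ i, Matrix.transpose B (σ i) i =
      monomial (Finsupp.equivFunOnFinite.symm fun i => (σ i : ℕ) + 1) (∏ i, c i (σ i)) := by
    have : ∀ i, Matrix.transpose B (σ i) i =
        C (c i (σ i)) * monomial (Finsupp.single i ((σ i : ℕ) + 1)) 1 := fun i => by
      rw [C_mul_monomial, mul_one]
      rfl
    rw [Finset.prod_congr rfl fun i _ => this i, Finset.prod_mul_distrib, ← map_prod,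
      ← monomial_sum_index]
    congr 2
    ext j
    rw [Finsupp.finsetSum_apply, Finset.sum_eq_single j]
    · simp
    · intro b _ hb
      exact Finsupp.single_eq_of_ne hb.symm
    · simp
  have hsign : (((Equiv.Perm.sign σ : ℤ) : MvPolynomial (Fin m) ℂ)) =
      C ((Equiv.Perm.sign σ : ℤ) : ℂ) := by simp
  rw [hprod, hsign, C_mul_monomial, hL]
  simp

/-- A permutation other than the identity lowers `ρ_i + i - σ(i)` lexicographically. -/
theorem toLex_sub_perm_lt {ρ ν : Fin m → ℕ} {σ : Equiv.Perm (Fin m)} (hσ : σ ≠ 1)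
    (h : ∀ i, (ν i : ℤ) = ρ i + ((i : ℕ) : ℤ) - ((σ i : ℕ) : ℤ)) : toLex ν < toLex ρ := by
  have hex : ∃ i, σ i ≠ i := by
    by_contra hne
    push Not at hne
    exact hσ (Equiv.ext hne)
  obtain ⟨i, hi, hmin⟩ := WellFounded.has_min (wellFounded_lt (α := Fin m)) {i | σ i ≠ i} hex
  have hfix : ∀ j < i, σ j = j := fun j hj => by
    by_contra hne
    exact hmin j hne hj
  refine ⟨i, fun j hj => ?_, ?_⟩
  · have := h j
    rw [hfix j hj] at this
    change ν j = ρ j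
    omega
  · have hlt : i < σ i := by
      rcases lt_trichotomy (σ i) i with hlt | heq | hgt
      · exact absurd (σ.injective (hfix _ hlt)) hi
      · exact absurd heq hi
      · exact hgt
    have := h i
    have hlt' : (i : ℕ) < (σ i : ℕ) := hlt
    change ν i < ρ i
    omega

variable {φ : PowerSeries ℂ} {q t k : ℂ} {l : MvPolynomial (Fin m) ℂ →ₗ[ℂ] ℂ}

/-- The functional vanishes on the products of an elementary symmetric polynomial with `m` of the
`h_k`. This goes by induction on `ρ` in the lexicographic order: elimination from the recursion at
the exponents `ρ_i + i` (with `i` from `1`) gives a linear relation whose term of the identity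
permutation is the value at `ρ`, with a coefficient that is nonzero by the condition on `q` and `t`,
while the terms of the other permutations are lower. -/
theorem rowValue_eq_zero (hφ : PowerSeries.rescale q φ *
      (1 - PowerSeries.C (k * t) * PowerSeries.X) = φ * (1 - PowerSeries.C k * PowerSeries.X))
    (hk : k ≠ 0) (hqt : ∀ r s : ℕ, 1 ≤ s → s ≤ m → q ^ r * t ^ s ≠ 1)
    (hl : ∀ ρ : Fin m → ℕ, l (∏ i, rowPoly m φ (ρ i)) = 0) (a₀ : Fin m) (ρ : Fin m → ℕ) :
    rowValue φ l ((a₀ : ℕ) + 1) (fun i => (ρ i : ℤ)) = 0 := by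
  suffices H : ∀ ρ : Lex (Fin m → ℕ),
      rowValue φ l ((a₀ : ℕ) + 1) (fun i => (ofLex ρ i : ℤ)) = 0 from H (toLex ρ)
  intro ρ
  induction ρ using WellFoundedLT.induction with
  | ind ρ ih =>
  let c : Fin m → Fin m → ℂ := fun i a => (-k) ^ ((a : ℕ) + 1) *
    (1 - t ^ ((a : ℕ) + 1) * q ^ ((ofLex ρ i : ℤ) + ((i : ℕ) + 1) - ((a : ℕ) + 1)))
  have h := sum_perm_eq_zero (fun a => rowValue φ l ((a : ℕ) + 1)) c
    (fun i => (ofLex ρ i : ℤ) + ((i : ℕ) + 1)) (fun i τ hτ => by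
      have := sum_rowValue hφ hl ((fun i => (ofLex ρ i : ℤ) + ((i : ℕ) + 1)) - fun j => (τ j : ℤ)) i
      rw [← this]
      refine Finset.sum_congr rfl fun a _ => ?_
      simp only [c, Pi.sub_apply, hτ, Nat.cast_zero, sub_zero]) a₀
  rw [Finset.sum_eq_single 1] at h
  · have hne : ∏ i, c i i ≠ 0 := by
      refine Finset.prod_ne_zero_iff.2 fun i _ => mul_ne_zero (pow_ne_zero _ (neg_ne_zero.2 hk)) ?_
      rw [add_sub_cancel_right, zpow_natCast, mul_comm]
      exact sub_ne_zero.2 (hqt _ _ (Nat.succ_pos _) i.2).symm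
    rw [Equiv.Perm.sign_one] at h
    have e : ((fun i => (ofLex ρ i : ℤ) + (((i : Fin m) : ℕ) + 1)) -
        fun i => (((1 : Equiv.Perm (Fin m)) i : ℕ) : ℤ) + 1) = fun i => (ofLex ρ i : ℤ) := by
      funext i
      simp
    rw [e] at h
    simpa [hne] using h
  · intro σ _ hσ
    by_cases hneg : ∃ i, (ofLex ρ i : ℤ) + ((i : ℕ) + 1) - (((σ i : ℕ) : ℤ) + 1) < 0
    · obtain ⟨i, hi⟩ := hneg
      rw [rowValue_of_neg (i := i) hi, mul_zero]
    · push Not at hneg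
      let ν : Fin m → ℕ := fun i =>
        ((ofLex ρ i : ℤ) + ((i : ℕ) + 1) - (((σ i : ℕ) : ℤ) + 1)).toNat
      have hν : ∀ i, (ν i : ℤ) = (ofLex ρ i : ℤ) + ((i : ℕ) + 1) - (((σ i : ℕ) : ℤ) + 1) :=
        fun i => Int.toNat_of_nonneg (hneg i)
      have hlt : toLex ν < toLex (ofLex ρ) :=
        toLex_sub_perm_lt hσ fun i => by rw [hν]; ring
      have := ih (toLex ν) hlt
      have e : ((fun i => (ofLex ρ i : ℤ) + (((i : Fin m) : ℕ) + 1)) -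
          fun i => ((σ i : ℕ) : ℤ) + 1) = fun i => (ofLex (toLex ν) i : ℤ) := by
        funext i
        rw [ofLex_toLex, hν]
        rfl
      rw [e, this, mul_zero]
  · intro hn
    exact absurd (Finset.mem_univ _) hn

/-- If `q^r t^s ≠ 1`, the products of the `h_r(y)` span the symmetric polynomials: a functional
that kills the products of `m` of them kills every symmetric polynomial. -/
theorem eq_zero_of_isSymmetric (hφ : PowerSeries.rescale q φ *
      (1 - PowerSeries.C (k * t) * PowerSeries.X) = φ * (1 - PowerSeries.C k * PowerSeries.X))
    (hφ0 : PowerSeries.coeff 0 φ = 1)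
    (hk : k ≠ 0) (hqt : ∀ r s : ℕ, 1 ≤ s → s ≤ m → q ^ r * t ^ s ≠ 1)
    (hl : ∀ ρ : Fin m → ℕ, l (∏ i, rowPoly m φ (ρ i)) = 0) {P : MvPolynomial (Fin m) ℂ}
    (hP : P.IsSymmetric) : l P = 0 := by
  -- The multipliers that preserve the functionals killing all these products form a subalgebra.
  let A : Subalgebra ℂ (MvPolynomial (Fin m) ℂ) :=
    { carrier := {p | ∀ l : MvPolynomial (Fin m) ℂ →ₗ[ℂ] ℂ,
        (∀ ρ : Fin m → ℕ, l (∏ i, rowPoly m φ (ρ i)) = 0) →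
          ∀ ρ : Fin m → ℕ, l (p * ∏ i, rowPoly m φ (ρ i)) = 0}
      mul_mem' := fun {p p'} hp hp' l hl ρ => by
        have := hp' (l.comp (LinearMap.mulLeft ℂ p)) (fun ρ => hp l hl ρ) ρ
        rw [mul_assoc]
        exact this
      add_mem' := fun {p p'} hp hp' l hl ρ => by
        rw [add_mul, map_add, hp l hl, hp' l hl, add_zero]
      algebraMap_mem' := fun z l hl ρ => by
        rw [← Algebra.smul_def, map_smul, hl, smul_zero] }
  have hsymm : ∀ a : Fin m, esymm (Fin m) ℂ ((a : ℕ) + 1) ∈ A := by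
    intro a l hl ρ
    have := rowValue_eq_zero hφ hk hqt hl a ρ
    rw [rowValue] at this
    simpa only [rowPolyInt_natCast] using this
  have hPA : P ∈ A := by
    obtain ⟨R, hR⟩ := esymmAlgHom_surjective ℂ (σ := Fin m) (n := m) (by rw [Fintype.card_fin])
      ⟨P, hP⟩
    have hR' := congrArg Subtype.val hR
    rw [esymmAlgHom_apply] at hR'
    rw [← show aeval (fun i : Fin m => esymm (Fin m) ℂ ((i : ℕ) + 1)) R = P from hR']
    rw [aeval_def]
    exact MvPolynomial.eval₂_mem (fun _ _ => Subalgebra.algebraMap_mem _ _) hsymm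
  have := hPA l hl fun _ => 0
  simpa only [rowPoly_zero hφ0, Finset.prod_const_one, mul_one] using this

end Elimination

section FunctionalEquation

/-- The functional equation of the one-variable kernel series under `z ↦ q z`. -/
theorem rescale_kernelSeries {q : ℂ} (hq : ‖q‖ < 1) (sq st : ℂ) :
    PowerSeries.rescale q (kernelSeries q sq st) *
        (1 - PowerSeries.C (sq * st) * PowerSeries.X) =
      kernelSeries q sq st * (1 - PowerSeries.C (sq * st⁻¹) * PowerSeries.X) := by
  have hP : ∀ z : ℂ, PowerSeries.rescale z (qPochhammer q) =
      (1 - PowerSeries.C z * PowerSeries.X) *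
        PowerSeries.rescale q (PowerSeries.rescale z (qPochhammer q)) := by
    intro z
    have h := congrArg (PowerSeries.rescale z) (qPochhammer_eq hq)
    rw [map_mul, map_sub, map_one, PowerSeries.rescale_X, PowerSeries.rescale_rescale,
      mul_comm q z] at h
    rw [PowerSeries.rescale_rescale]
    exact h
  have h1 := kernelSeries_mul hq sq st
  have h2 := congrArg (PowerSeries.rescale q) h1
  rw [map_mul] at h2
  have hne : PowerSeries.rescale q (PowerSeries.rescale (sq * st⁻¹) (qPochhammer q)) ≠ 0 := by
    intro h0
    have := congrArg (PowerSeries.coeff 0) h0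
    rw [PowerSeries.coeff_rescale, PowerSeries.coeff_rescale, pow_zero, pow_zero, one_mul, one_mul,
      PowerSeries.coeff_zero_eq_constantCoeff_apply, constantCoeff_qPochhammer hq, map_zero] at this
    exact one_ne_zero this
  refine mul_right_cancel₀ hne ?_
  linear_combination (1 - PowerSeries.C (sq * st) * PowerSeries.X) * h2 - hP (sq * st) - h1 +
    kernelSeries q sq st * hP (sq * st⁻¹)

end FunctionalEquation

/-! ### The constant term as an invariant Laurent polynomial -/

section ConstantTerm

variable {m n : ℕ}

@[to_additive]
theorem prod_univ_eq_prod_castLE {M : Type*} [CommMonoid M] (hmn : m ≤ n) (F : Fin n → M)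
    (h : ∀ i : Fin n, m ≤ (i : ℕ) → F i = 1) : ∏ i, F i = ∏ i, F (Fin.castLE hmn i) := by
  obtain ⟨k, rfl⟩ := Nat.exists_eq_add_of_le hmn
  rw [Fin.prod_univ_add]
  rw [Finset.prod_eq_one fun i _ => h (Fin.natAdd m i) (by simp), mul_one]
  rfl

theorem extendZero_castLE (hmn : m ≤ n) (lam : Fin m → ℕ) (i : Fin m) :
    extendZero n lam (Fin.castLE hmn i) = lam i := dif_pos i.2

theorem extendZero_of_le (lam : Fin m → ℕ) {i : Fin n} (h : m ≤ (i : ℕ)) :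
    extendZero n lam i = 0 := dif_neg (not_lt.2 h)

theorem sum_extendZero (hmn : m ≤ n) (lam : Fin m → ℕ) :
    ∑ i, extendZero n lam i = ∑ i, lam i := by
  rw [sum_univ_eq_sum_castLE hmn _ fun i hi => extendZero_of_le lam hi]
  simp only [extendZero_castLE]

theorem antitone_extendZero {lam : Fin m → ℕ} (h : Antitone lam) :
    Antitone (extendZero n lam) := by
  intro i j hij
  by_cases hj : (j : ℕ) < m
  · have hi : (i : ℕ) < m := lt_of_le_of_lt hij hj
    rw [extendZero, extendZero, dif_pos hj, dif_pos hi]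
    exact h hij
  · rw [extendZero_of_le lam (not_lt.1 hj)]
    exact Nat.zero_le _

/-- The zeros added to a partition contribute nothing to the eigenvalue. -/
theorem eigenvalue_extendZero (hmn : m ≤ n) (p : Params) (lam : Fin m → ℕ) :
    eigenvalue p (extendZero n lam) = ∑ i : Fin m, bracket
      (p.α * p.t ^ (n - 1 - (i : ℕ)) * (p.q : ℂ) ^ lam i) (p.α * p.t ^ (n - 1 - (i : ℕ))) := by
  rw [eigenvalue, sum_univ_eq_sum_castLE hmn]
  · simp only [extendZero_castLE, Fin.val_castLE]
  · intro i hi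
    rw [extendZero_of_le lam hi, pow_zero, mul_one, bracket]
    ring

/-- The product splits into power series in the single `y_j`, with invariant Laurent polynomials in
`x` as coefficients, and a factor free of `x`. -/
theorem kernelFunction_mul_eq {q : ℂ} (hq : ‖q‖ < 1) (sq st β : ℂ) (f : SeriesY m ℂ) :
    kernelFunction n m q sq st β * weylDenominator m (RatX n) * extendScalars n f =
      (∏ j : Fin m, PowerSeries.heval (yVar j : SeriesY m (RatX n))
        ((laurentKernel n (kernelSeries q sq st)).map
          (toRatX (n := n) : LaurentAlg n →+* RatX n))) *
      mapHom (algebraMap ℂ (RatX n))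
        (yMono (fun _ => (n : ℂ) * β) 1 * weylDenominator m ℂ * f) := by
  rw [kernelFunction_eq_kernelPair, extendScalars_eq, map_mul, map_mul, mapHom_weylDenominator,
    mapHom_yMono, map_one]
  simp only [prod_kernelPair_eq_heval hq]
  ring

variable {r : Fin m → ℕ} {g : SeriesY m ℂ}

/-- The product has integral exponents only. -/
theorem exists_eq_zexpo_of_coeff_ne_zero {c : ℂ} (hg : HasLead (rootCone m) (-natExpo r) c g)
    {K : Type*} [Field K] (φ : Fin m → PowerSeries K) (ψ : ℂ →+* K) {γ : Expo m}
    (h : ((∏ j, PowerSeries.heval (yVar j : SeriesY m K) (φ j)) * mapHom ψ g).coeff γ ≠ 0) :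
    ∃ ν : Fin m → ℤ, γ = zexpo ν := by
  rw [HahnSeries.coeff_mul] at h
  obtain ⟨⟨δ, ε⟩, hδε, -⟩ := Finset.exists_ne_zero_of_sum_ne_zero h
  obtain ⟨h1, h2, h3⟩ := Finset.mem_antidiagonal.1 hδε
  have h3 : δ + ε = γ := h3
  obtain ⟨η, -, hη⟩ := prod_heval_support φ Finset.univ h1
  have hη : δ = natExpo η := hη
  have h4 : g.coeff ε ≠ 0 := fun h0 => h2 (by
    change ψ (g.coeff ε) = 0
    rw [h0, map_zero])
  obtain ⟨ν, hν, -⟩ := hg.sub_mem ε h4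
  refine ⟨(fun j => (η j : ℤ)) + (ν + -fun j => (r j : ℤ)), ?_⟩
  rw [zexpo_add, zexpo_add, zexpo_neg, ← hν, ← h3, hη, natExpo, natExpo]
  abel

theorem zexpo_sub_mem_of_coeff_ne_zero {c : ℂ} (hg : HasLead (rootCone m) (-natExpo r) c g)
    {η : Fin m → ℕ} (h : g.coeff (-natExpo η) ≠ 0) :
    zexpo (fun j => (r j : ℤ) - (η j : ℤ)) ∈ rootCone m := by
  have h1 := hg.sub_mem _ h
  have h2 : -natExpo η - -natExpo r = zexpo (fun j => (r j : ℤ) - (η j : ℤ)) := by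
    rw [show (fun j => (r j : ℤ) - (η j : ℤ)) = (fun j => (r j : ℤ)) - fun j => (η j : ℤ) from rfl,
      zexpo_sub, natExpo, natExpo]
    abel
  rwa [h2] at h1

theorem sum_le_of_hasLead {c : ℂ} (hg : HasLead (rootCone m) (-natExpo r) c g)
    {η : Fin m → ℕ} (h : g.coeff (-natExpo η) ≠ 0) : ∑ j, η j ≤ ∑ j, r j := by
  have := sum_nonneg_of_mem_rootCone (zexpo_sub_mem_of_coeff_ne_zero hg h)
  rw [Finset.sum_sub_distrib, sub_nonneg] at this
  exact_mod_cast this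

/-- The exponent vectors with entries at most `N`. -/
def expoBox (m N : ℕ) : Finset (Fin m → ℕ) := Fintype.piFinset fun _ => Finset.range (N + 1)

theorem mem_expoBox {N : ℕ} {η : Fin m → ℕ} (h : ∑ j, η j ≤ N) : η ∈ expoBox m N :=
  Fintype.mem_piFinset.2 fun j => Finset.mem_range_succ_iff.2
    ((Finset.single_le_sum (f := η) (fun _ _ => Nat.zero_le _) (Finset.mem_univ j)).trans h)

/-- The constant term in `y` of `∏_{i,j} φ(y_j x_i) φ(y_j / x_i) g(y)` as a Laurent polynomial
in `x`, when `g` has no terms `y^{-η}` with `|η| > N`. -/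
def constantTerm (n : ℕ) (φ : PowerSeries ℂ) (g : SeriesY m ℂ) (N : ℕ) : LaurentAlg n :=
  ∑ η ∈ expoBox m N, g.coeff (-natExpo η) • ∏ j, PowerSeries.coeff (η j) (laurentKernel n φ)

theorem coeff_zero_eq_toRatX_constantTerm {c : ℂ}
    (hg : HasLead (rootCone m) (-natExpo r) c g) (φ : PowerSeries ℂ) :
    ((∏ j : Fin m, PowerSeries.heval (yVar j : SeriesY m (RatX n))
        ((laurentKernel n φ).map (toRatX (n := n) : LaurentAlg n →+* RatX n))) *
      mapHom (algebraMap ℂ (RatX n)) g).coeff 0 = toRatX (constantTerm n φ g (∑ j, r j)) := by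
  rw [coeff_zero_prod_heval_mul _ _ (expoBox m (∑ j, r j)), constantTerm, map_sum]
  · refine Finset.sum_congr rfl fun η _ => ?_
    rw [map_smul, map_prod, Algebra.smul_def, mul_comm]
    rfl
  · intro η h
    refine mem_expoBox (sum_le_of_hasLead hg fun h0 => h ?_)
    change algebraMap ℂ (RatX n) (g.coeff (-natExpo η)) = 0
    rw [h0, map_zero]

theorem constantTerm_mem_weylInvariants (φ : PowerSeries ℂ) (g : SeriesY m ℂ) (N : ℕ) :
    constantTerm n φ g N ∈ weylInvariants n :=
  Subalgebra.sum_mem _ fun _ _ => Subalgebra.smul_mem _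
    (Subalgebra.prod_mem _ fun _ _ => coeff_laurentKernel_mem φ _) _

theorem coeff_constantTerm (φ : PowerSeries ℂ) (g : SeriesY m ℂ) (N : ℕ) (μ : Fin n → ℤ) :
    (constantTerm n φ g N).coeff μ = ∑ η ∈ expoBox m N, g.coeff (-natExpo η) *
      (∏ j, PowerSeries.coeff (η j) (laurentKernel n φ)).coeff μ := by
  rw [constantTerm, AddMonoidAlgebra.coeff_sum, Finsupp.finsetSum_apply]
  rfl

theorem sum_le_of_coeff_constantTerm_ne_zero {c : ℂ}
    (hg : HasLead (rootCone m) (-natExpo r) c g) {φ : PowerSeries ℂ} {N : ℕ} {μ : Fin n → ℕ}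
    (h : (constantTerm n φ g N).coeff (fun i => (μ i : ℤ)) ≠ 0) : ∑ i, μ i ≤ ∑ j, r j := by
  rw [coeff_constantTerm] at h
  obtain ⟨η, -, hη⟩ := Finset.exists_ne_zero_of_sum_ne_zero h
  exact (sum_le_of_coeff_ne_zero (right_ne_zero_of_mul hη)).trans
    (sum_le_of_hasLead hg (left_ne_zero_of_mul hη))

/-- The rearrangements of a weakly increasing exponent vector `r` do not occur in a series in
`y^{-r} ℂ[[y_1/y_2, …, y_{m-1}/y_m, y_m]]`, except `r` itself. -/
theorem comp_perm_eq_of_coeff_ne_zero {c : ℂ} (hr : Monotone r)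
    (hg : HasLead (rootCone m) (-natExpo r) c g) (σ : Equiv.Perm (Fin m))
    (h : g.coeff (-natExpo (r ∘ σ)) ≠ 0) : r ∘ σ = r := by
  have h1 := zexpo_sub_mem_of_coeff_ne_zero hg h
  -- The partial sums of the increasing arrangement are the smallest ones.
  have h2 : zexpo (-fun j => (r j : ℤ) - ((r ∘ σ) j : ℤ)) ∈ rootCone m := by
    rw [zexpo_mem_rootCone]
    intro k
    have hanti : Antivary (fun i : Fin m => if i ≤ k then (1 : ℤ) else 0) fun i => (r i : ℤ) := by
      intro i j hij
      have hlt : i < j := by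
        by_contra hle
        have := hr (not_lt.1 hle)
        have hij' : (r i : ℤ) < (r j : ℤ) := hij
        omega
      dsimp only
      split_ifs with hj hi hi
      · exact le_rfl
      · exact absurd (hlt.le.trans hj) hi
      · exact zero_le_one
      · exact le_rfl
    have h3 := hanti.sum_mul_le_sum_mul_comp_perm (σ := σ)
    have h4 : ∀ F : Fin m → ℤ, ∑ i, (if i ≤ k then (1 : ℤ) else 0) * F i =
        ∑ i ∈ Finset.Iic k, F i := by
      intro F
      simp only [ite_mul, one_mul, zero_mul]
      rw [← Finset.sum_filter]
      refine Finset.sum_congr ?_ fun _ _ => rfl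
      ext i
      simp
    rw [h4, h4] at h3
    simp only [Pi.neg_apply, neg_sub, Function.comp_apply, Finset.sum_sub_distrib]
    exact sub_nonneg.2 h3
  have h5 := isPositiveCone_rootCone.nonneg _ h1
  have h6 := isPositiveCone_rootCone.nonneg _ h2
  rw [zexpo_neg] at h6
  have h7 := le_antisymm (neg_nonneg.1 h6) h5
  have h8 := zexpo_injective (h7.trans zexpo_zero.symm)
  funext j
  have := congrFun h8 j
  simp only [Pi.zero_apply] at this
  omega

/-- If the constant term vanished, so would its coefficients of top degree. They are the values of a
linear functional on the products of the row polynomials `h_k(y)`, and these span the symmetric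
polynomials; but the functional does not vanish on the symmetrization of the monomial `y^r`. -/
theorem constantTerm_ne_zero (hmn : m ≤ n) (hr : Monotone r)
    (hg : HasLead (rootCone m) (-natExpo r) 1 g) {φ : PowerSeries ℂ} {q t k : ℂ}
    (hφ : PowerSeries.rescale q φ * (1 - PowerSeries.C (k * t) * PowerSeries.X) =
      φ * (1 - PowerSeries.C k * PowerSeries.X))
    (hφ0 : PowerSeries.coeff 0 φ = 1) (hk : k ≠ 0)
    (hqt : ∀ a b : ℕ, 1 ≤ b → b ≤ m → q ^ a * t ^ b ≠ 1) :
    constantTerm n φ g (∑ j, r j) ≠ 0 := by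
  intro hC
  -- The functional of the top-degree coefficients of the constant term.
  let s : Finset (Fin m → ℕ) := (expoBox m (∑ j, r j)).filter fun η => ∑ j, η j = ∑ j, r j
  let l : MvPolynomial (Fin m) ℂ →ₗ[ℂ] ℂ := ∑ η ∈ s,
    g.coeff (-natExpo η) • MvPolynomial.lcoeff ℂ (Finsupp.equivFunOnFinite.symm η)
  have hl : ∀ P, l P = ∑ η ∈ s,
      g.coeff (-natExpo η) * P.coeff (Finsupp.equivFunOnFinite.symm η) := by
    intro P
    simp only [l, LinearMap.sum_apply, LinearMap.smul_apply, smul_eq_mul]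
    rfl
  -- The functional kills the products of the `h_k`: its values there are coefficients of the
  -- constant term.
  have hkill : ∀ ρ : Fin m → ℕ, l (∏ i, rowPoly m φ (ρ i)) = 0 := by
    intro ρ
    rw [hl]
    by_cases hρ : ∑ i, ρ i = ∑ j, r j
    · have h0 : (constantTerm n φ g (∑ j, r j)).coeff (fun i => (extendZero n ρ i : ℤ)) = 0 := by
        rw [hC]; rfl
      rw [coeff_constantTerm,
        ← Finset.sum_filter_of_ne (p := fun η : Fin m → ℕ => ∑ j, η j = ∑ j, r j)] at h0
      · rw [← h0]
        refine Finset.sum_congr rfl fun η hη => ?_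
        have h1 : ∑ j, η j = ∑ i, extendZero n ρ i := by
          rw [sum_extendZero hmn, hρ]
          exact (Finset.mem_filter.1 hη).2
        rw [coeff_prod_laurentKernel_eq hφ0 h1, prod_univ_eq_prod_castLE hmn
          (fun i => rowPoly m φ (extendZero n ρ i))]
        · simp only [extendZero_castLE]
        · intro i hi
          rw [extendZero_of_le ρ hi, rowPoly_zero hφ0]
      · intro η _ hne
        have h1 := sum_le_of_hasLead hg (left_ne_zero_of_mul hne)
        have h2 := sum_le_of_coeff_ne_zero (right_ne_zero_of_mul hne)
        rw [sum_extendZero hmn, hρ] at h2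
        exact le_antisymm h1 h2
    · refine Finset.sum_eq_zero fun η hη => ?_
      by_contra hne
      have h1 := sum_eq_of_coeff_rowPoly_ne_zero (right_ne_zero_of_mul hne)
      exact hρ (h1.symm.trans (Finset.mem_filter.1 hη).2)
  let mono : (Fin m → ℕ) → MvPolynomial (Fin m) ℂ := fun η =>
    MvPolynomial.monomial (Finsupp.equivFunOnFinite.symm η) 1
  have hsymm : (∑ σ : Equiv.Perm (Fin m), mono (r ∘ σ)).IsSymmetric := by
    intro τ
    have h1 : ∀ η : Fin m → ℕ, MvPolynomial.rename τ (mono η) = mono (η ∘ τ.symm) := by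
      intro η
      simp only [mono]
      rw [MvPolynomial.rename_monomial]
      congr 2
      ext j
      obtain ⟨i, rfl⟩ := τ.surjective j
      rw [Finsupp.mapDomain_apply τ.injective]
      simp
    rw [map_sum]
    simp only [h1]
    exact Fintype.sum_equiv (Equiv.mulRight τ.symm) _ _ fun σ => rfl
  -- Of the monomials in the orbit of `y^r`, only `y^r` itself contributes, with coefficient `1`, since
  -- the exponents of `g` are bounded below in the dominance order.
  have hvalue : l (∑ σ : Equiv.Perm (Fin m), mono (r ∘ σ)) =
      ((Finset.univ.filter fun σ : Equiv.Perm (Fin m) => r ∘ σ = r).card : ℂ) := by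
    have h1 : ∀ σ : Equiv.Perm (Fin m), l (mono (r ∘ σ)) = if r ∘ σ = r then 1 else 0 := by
      intro σ
      have hsum : ∑ j, (r ∘ σ) j = ∑ j, r j := Equiv.sum_comp σ r
      rw [hl, Finset.sum_eq_single (r ∘ σ)]
      · simp only [mono]
        rw [MvPolynomial.coeff_monomial, if_pos rfl, mul_one]
        by_cases hσ : r ∘ σ = r
        · rw [if_pos hσ, hσ, hg.coeff_eq]
        · rw [if_neg hσ]
          by_contra hne
          exact hσ (comp_perm_eq_of_coeff_ne_zero hr hg σ hne)
      · intro η _ hη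
        simp only [mono]
        rw [MvPolynomial.coeff_monomial, if_neg, mul_zero]
        exact fun h => hη (Finsupp.equivFunOnFinite.symm.injective h).symm
      · intro hn
        exact absurd (Finset.mem_filter.2 ⟨mem_expoBox hsum.le, hsum⟩) hn
    rw [map_sum, Finset.sum_congr rfl fun σ _ => h1 σ, Finset.sum_boole]
  rw [eq_zero_of_isSymmetric hφ hφ0 hk hqt hkill hsymm] at hvalue
  have h1 : (1 : Equiv.Perm (Fin m)) ∈
      Finset.univ.filter fun σ : Equiv.Perm (Fin m) => r ∘ σ = r :=
    Finset.mem_filter.2 ⟨Finset.mem_univ _, rfl⟩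
  exact Finset.card_ne_zero_of_mem h1 (Nat.cast_eq_zero.1 hvalue.symm)

end ConstantTerm

end Koornwinder

end

theorem mainTheorem9 (n m : ℕ) (hm : 0 < m) (hmn : m ≤ n)
    (p : Koornwinder.Params) (sq st β : ℂ)
    (ha : p.a ≠ 0) (hb : p.b ≠ 0) (hc : p.c ≠ 0) (hd : p.d ≠ 0)
    (hq : ‖(p.q : ℂ)‖ < 1)
    (hα : p.α ^ 2 = p.a * p.b * p.c * p.d / (p.q : ℂ))
    (hβ : p.t = (p.q : ℂ) ^ β) (hsq : sq ^ 2 = (p.q : ℂ)) (hst : st ^ 2 = p.t)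
    (lam : Fin m → ℕ) (hlam : Antitone lam)
    (e s : Fin m → ℂ)
    -- with indices from 1 to m: e_i = -λ_{m+1-i} + m + 1 - i - n β
    (he : ∀ i, e i = -(lam i.rev : ℂ) + ((m : ℂ) - ((i : ℕ) : ℂ)) - (n : ℂ) * β)
    -- with indices from 1 to m: s_i = (q/t)^{-m+i} q^{e_i}
    (hs : ∀ i, s i = ((p.q : ℂ) / p.t) ^ (-(m : ℤ) + ((i : ℕ) : ℤ) + 1) * (p.q : ℂ) ^ e i)
    (f : Koornwinder.SeriesY m ℂ)
    (hf : Koornwinder.IsEigenseries (p.hat (sq / st)) e s f)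
    (F : Koornwinder.SeriesY m (Koornwinder.RatX n))
    (hF : F = Koornwinder.kernelFunction n m (p.q : ℂ) sq st β *
      Koornwinder.weylDenominator m (Koornwinder.RatX n) * Koornwinder.extendScalars n f) :
    -- no fractional powers in y
    (∀ γ ∈ F.support, ∃ ν : Fin m → ℤ, γ = Koornwinder.expo fun i => (ν i : ℂ)) ∧
    -- the constant term in y is an eigenfunction
    Koornwinder.opX p (F.coeff 0) =
      (∑ i : Fin m, Koornwinder.bracket
        (p.α * p.t ^ (n - 1 - (i : ℕ)) * (p.q : ℂ) ^ lam i)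
        (p.α * p.t ^ (n - 1 - (i : ℕ)))) • F.coeff 0 ∧
    -- the constant term is proportional to the Koornwinder polynomial
    ((∀ μ : Fin n → ℕ, Antitone μ → μ ≠ Koornwinder.extendZero n lam →
        ∑ i, μ i ≤ ∑ i, lam i →
        Koornwinder.eigenvalue p μ ≠
          Koornwinder.eigenvalue p (Koornwinder.extendZero n lam)) →
      (∃! P, Koornwinder.IsKoornwinderPolynomial p (Koornwinder.extendZero n lam) P) ∧
      ∀ P, Koornwinder.IsKoornwinderPolynomial p (Koornwinder.extendZero n lam) P →
        ∃ κ : ℂ, F.coeff 0 = κ • Koornwinder.laurent P ∧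
          ((∀ k l : ℕ, 1 ≤ l → l ≤ m → (p.q : ℂ) ^ k * p.t ^ l ≠ 1) → κ ≠ 0)) := by
  have ht0 : p.t ≠ 0 := by rw [hβ]; exact Koornwinder.cpow_unit_ne_zero _ _
  have hst0 : st ≠ 0 := by rintro rfl; exact ht0 (by rw [← hst]; simp)
  have hsq0 : sq ≠ 0 := by rintro rfl; exact p.q.ne_zero (by rw [← hsq]; simp)
  have hα0 : p.α ≠ 0 := by
    intro h
    rw [h] at hα
    exact div_ne_zero (mul_ne_zero (mul_ne_zero (mul_ne_zero ha hb) hc) hd) p.q.ne_zero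
      (by rw [← hα]; simp)
  -- The part of the product free of `x` has the leading term `y^{-r}` with `r` the reversal of `λ`.
  have hlead := Koornwinder.hasLead_series hf he
  have hr : Monotone fun i : Fin m => lam i.rev := fun i j hij => hlam (Fin.rev_le_rev.2 hij)
  have hsum : ∑ i : Fin m, lam i.rev = ∑ i, lam i := Equiv.sum_comp Fin.revPerm lam
  have heig := Koornwinder.opX_constantTerm hm hmn ha hb hc hd hq hα hβ hsq hst lam e s he hs f hf
  rw [← hF] at heig
  rw [Koornwinder.kernelFunction_mul_eq hq] at hF
  have hφ0 := Koornwinder.constantCoeff_kernelSeries hq sq st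
  have hφ := Koornwinder.rescale_kernelSeries hq sq st
  have hkt : sq * st = sq * st⁻¹ * p.t := by
    rw [← hst]
    field_simp
  rw [hkt] at hφ
  have hC := Koornwinder.coeff_zero_eq_toRatX_constantTerm (n := n) hlead
    (Koornwinder.kernelSeries (p.q : ℂ) sq st)
  rw [← hF] at hC
  refine ⟨fun γ hγ => ?_, heig, fun hsep => ?_⟩
  · rw [hF] at hγ
    exact Koornwinder.exists_eq_zexpo_of_coeff_ne_zero hlead _ _ hγ
  · rw [← Koornwinder.eigenvalue_extendZero hmn, hC] at heig
    rw [← Koornwinder.sum_extendZero hmn lam] at hsep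
    refine ⟨Koornwinder.existsUnique_isKoornwinderPolynomial hα0 ht0 hα
      (Koornwinder.antitone_extendZero hlam) hsep, fun P hP => ?_⟩
    have hdeg : ∀ μ : Fin n → ℕ, Antitone μ → (Koornwinder.constantTerm n
        (Koornwinder.kernelSeries (p.q : ℂ) sq st)
        (Koornwinder.yMono (fun _ => (n : ℂ) * β) 1 * Koornwinder.weylDenominator m ℂ * f)
        (∑ i : Fin m, lam i.rev)).coeff (fun i => (μ i : ℤ)) ≠ 0 →
        ∑ i, μ i ≤ ∑ i, Koornwinder.extendZero n lam i := by
      intro μ _ hμ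
      rw [Koornwinder.sum_extendZero hmn, ← hsum]
      exact Koornwinder.sum_le_of_coeff_constantTerm_ne_zero hlead hμ
    -- The constant term is an invariant eigenfunction of degree at most `|λ|`.
    have hP' := Koornwinder.eq_smul_of_eigen hα0 ht0 hα hsep hP
      (Koornwinder.constantTerm_mem_weylInvariants _ _ _) hdeg heig
    generalize hκ : (Koornwinder.constantTerm n (Koornwinder.kernelSeries (p.q : ℂ) sq st)
        (Koornwinder.yMono (fun _ => (n : ℂ) * β) 1 * Koornwinder.weylDenominator m ℂ * f)
        (∑ i : Fin m, lam i.rev)).coeff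
          (fun i => (Koornwinder.extendZero n lam i : ℤ)) = κ at hP'
    refine ⟨κ, ?_, fun hqt hκ0 => ?_⟩
    · rw [hC, hP', map_smul, ← Koornwinder.laurent_eq]
    · rw [hκ0, zero_smul] at hP'
      exact Koornwinder.constantTerm_ne_zero hmn hr hlead hφ hφ0
        (mul_ne_zero hsq0 (inv_ne_zero hst0)) hqt hP'
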